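/- Let $n\ge 1$, let $\sigma$ be surface measure on the unit sphere $\mathbf S^{n-1}\subset\mathbb R^n$, and let $\alpha>1$. Let $\Omega\in L^1(\mathbf S^{n-1})$ be a complex-valued function such that $$\int_{\mathbf S^{n-1}}\Omega\,d\sigma=0\qquad\text{and}\qquad \sup_{\xi\in\mathbf S^{n-1}}\int_{\mathbf S^{n-1}}|\Omega(\theta)|\Big(\log\frac1{|\theta\cdot\xi|}\Big)^{1+\alpha}d\sigma(\theta)<\infty ,$$ the latter meaning $\Omega\in\mathcal G_\alpha(\mathbf S^{n-1})$. For $\varepsilon>0$ put $$T_\varepsilon f(x)=\int_{|y|>\varepsilon}\frac{\Omega(y/|y|)}{|y|^n}f(x-y)\,dy,$$ and let $\mathcal Tf=\{T_\varepsilon f\}_{\varepsilon>0}$. For a family $\mathcal F=\{F_t\}_{t>0}$ of functions on $\mathbb R^n$ define $$V_{2,j}(\mathcal F)(x)=\Big(\sup\sum_{l=1}^{N-1}|F_{t_{l+1}}(x)-F_{t_l}(x)|^2\Big)^{1/2}\quad(j\in\mathbb Z),\qquad S_2(\mathcal F)(x)=\Big(\sum_{j\in\mathbb Z}V_{2,j}(\mathcal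 F)(x)^2\Big)^{1/2},$$ where the supremum is over all $N\ge1$ and all $t_1<\dots<t_N$ in $[2^j,2^{j+1}]$. Then for every $p$ with $$\frac{3+\alpha}{1+\alpha}<p<\frac{3+\alpha}{2}$$ there is a constant $C<\infty$, which does not depend on $f$, such that for every $f\in L^p(\mathbb R^n)$: for almost every $x$ the integrals defining $T_\varepsilon f(x)$, $\varepsilon>0$, all converge absolutely; $S_2(\mathcal Tf)$ is measurable (with respect to Lebesgue measure); and $$\|S_2(\mathcal Tf)\|_{L^p(\mathbb R^n)}\le C\,\|f\|_{L^p(\mathbb R^n)} .$$ -/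

import Mathlib

open MeasureTheory
open scoped ENNReal NNReal

namespace RoughVariation

noncomputable section

/-- `ℝⁿ` with the Euclidean norm. -/
abbrev Space (n : ℕ) : Type := EuclideanSpace ℝ (Fin n)

/-- The unit sphere `S^{n-1}` of `ℝⁿ`. -/
abbrev USphere (n : ℕ) : Type := Metric.sphere (0 : Space n) 1

/-- Surface measure on `S^{n-1}`. -/
abbrev surf (n : ℕ) : Measure (USphere n) := (volume : Measure (Space n)).toSphere

/-- The Grafakos–Stefanov class `𝒢_α(S^{n-1})`:
`sup_ξ ∫ |Ω(θ)| (log (1 / |θ·ξ|))^{1+α} dσ(θ) < ∞`.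
The integrand is nonnegative because `|θ·ξ| ≤ 1`; the set where `θ·ξ = 0` is null for surface
measure, so the value of the logarithm there is irrelevant. -/
def grafakosStefanov (n : ℕ) (α : ℝ) : Set (USphere n → ℂ) :=
  {Ω | (⨆ ξ : USphere n, ∫⁻ θ : USphere n, ‖Ω θ‖ₑ *
      ENNReal.ofReal (Real.log (1 / |inner ℝ (θ : Space n) (ξ : Space n)|) ^ (1 + α))
        ∂(surf n)) < ∞}

/-- The direction `y' = y / |y|` of a nonzero vector. -/
def direction {n : ℕ} (y : Space n) (hy : y ≠ 0) : USphere n :=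
  ⟨‖y‖⁻¹ • y, by simp [norm_smul, hy]⟩

open Classical in
/-- The rough homogeneous kernel `Ω(y') / |y|ⁿ` (with value `0` at the origin). -/
def roughKernel {n : ℕ} (Ω : USphere n → ℂ) (y : Space n) : ℂ :=
  if hy : y ≠ 0 then Ω (direction y hy) / ((‖y‖ ^ n : ℝ) : ℂ) else 0

/-- The truncated singular integral `T_ε f(x) = ∫_{|y| > ε} Ω(y') / |y|ⁿ f(x - y) dy`. -/
def truncated {n : ℕ} (Ω : USphere n → ℂ) (f : Space n → ℂ) (ε : ℝ) (x : Space n) : ℂ :=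
  ∫ y in {y : Space n | ε < ‖y‖}, roughKernel Ω y * f (x - y)

/-- The `2`-variation over the interval `[2^j, 2^{j+1}]` of a family `a` of complex numbers:
`(sup ∑ |a_{t_{l+1}} - a_{t_l}|²)^{1/2}`, the supremum being over all finite increasing
sequences `t_0 < ⋯ < t_N` in `[2^j, 2^{j+1}]`. -/
def dyadicVariation (a : ℝ → ℂ) (j : ℤ) : ℝ≥0∞ :=
  (⨆ (N : ℕ) (t : ℕ → ℝ) (_ : StrictMonoOn t (Set.Iic N))
      (_ : ∀ l ≤ N, t l ∈ Set.Icc ((2 : ℝ) ^ j) ((2 : ℝ) ^ (j + 1))),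
    ∑ l ∈ Finset.range N, ‖a (t (l + 1)) - a (t l)‖ₑ ^ 2) ^ (1 / 2 : ℝ)

/-- The short `2`-variation `S_2(F)(x) = (∑_{j ∈ ℤ} V_{2,j}(F)(x)²)^{1/2}` of a family
`F = {F_t}_{t > 0}` of functions. -/
def shortVariation {n : ℕ} (F : ℝ → Space n → ℂ) (x : Space n) : ℝ≥0∞ :=
  (∑' j : ℤ, dyadicVariation (fun t => F t x) j ^ 2) ^ (1 / 2 : ℝ)

end

end RoughVariation

/-!
The operators `T_ε` are studied through their restrictions to annuli: on `[2 ^ j, 2 ^ (j + 1)]`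
the increments of `t ↦ T_t f` are, up to sign, those of `t ↦ κ_{j,t} * f`, where `κ_{j,t}` is the
kernel `K = Ω(y / |y|) / |y| ^ n` restricted to `2 ^ j < |y| ≤ t` (`annularVariation`). Two properties of `K`
are used (`KernelBounds`): the mass of an annulus is at most `A (t - s) / s`, and, with
`β = 1 + α`, the Fourier transform of `κ_{j,t}` is at most `A (1 + |j + r|) ^ (-β)` at the frequencies of
size `2 ^ r`. Both follow in polar coordinates: the mean value zero of `Ω` serves at low
frequencies, and at high ones a single integration by parts in the radius, averaged over the
sphere with the help of the Grafakos–Stefanov condition (`exists_kernelBounds`).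

A Littlewood–Paley decomposition is applied at every scale. With `ψ_i` the difference of the
averages over the balls of radius `2 ^ i` and `2 ^ (i + 1)`, the function `f` is the sum over `k`
of `ψ_{j - k} * f`, and the short variation is at most the sum over `k` of the square functions
`S_k f = (∑ j, V_{2,j}(κ_{j,t} * ψ_{j - k} * f) ^ 2) ^ (1 / 2)` (`localizedVariation`,
`annularVariation_le_liminf`). With `w = 1 + |k|` they satisfy three estimates.

* On `L²`, the square of the norm of `S_k` is `O(w ^ (-β))`
  (`exists_lintegral_localizedVariation_sq_le`). By `variationSq_le_grid` the variation is
  controlled by the values at about `w ^ β` equally spaced points, each of which contributes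
  `O(w ^ (-2 β))` by Plancherel's theorem, and by the total variations between neighbouring points,
  which are small because the annuli have little mass.
* The weak type `(1, 1)` norm is `O(w)` (`exists_weak_type_localizedVariation`), by the
  Calderón–Zygmund theorem: for a mean-zero function on a ball only about `|k|` scales do not
  benefit from the cancellation against `ψ_{j - k}` (`tsum_tailCoeff_le`).
* For `q > 2` the `q`-th power of the norm on `L^q` is `O(w ^ (q - 1))`
  (`exists_lintegral_localizedVariation_le`). The variation is the limit of linear square
  functions over finer and finer grids, whose transpose (`dualOp`) is again treated by the
  Calderón–Zygmund theorem, uniformly in the grid.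

`marcinkiewicz` keeps the height of the truncations free. With a suitable power of `w` in its
place, the estimates above give `‖S_k f‖_p ≤ C w ^ (-1 - η) ‖f‖_p` for some `η > 0` in the range
`(2 + β) / β < p < (2 + β) / 2`, and the sum over `k` converges
(`exists_lintegral_annularVariation_le`).

All of this concerns bounded functions of bounded support (`Tame`). For `f` in `L^p` the truncated
integrals converge absolutely almost everywhere (`ae_integrableOn_truncated`); at such points they
are limits of those of truncations of `f`, and Fatou's lemma extends the estimate. They also
depend continuously on `ε` there, whence the supremum defining the variation may be taken over a
countable set and is measurable.
-/

namespace RoughVariation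

noncomputable section

/-! ### Bounded functions of bounded support -/

section Tame

variable {n : ℕ} {E : Type*} [NormedAddCommGroup E]

/-- Bounded strongly measurable functions vanishing off a ball.  All operators are first studied
on this class, which is stable under truncations and on which every integral converges. -/
def Tame (f : Space n → E) : Prop :=
  StronglyMeasurable f ∧ (∃ M : ℝ, ∀ x, ‖f x‖ ≤ M) ∧ ∃ R : ℝ, ∀ x, R < ‖x‖ → f x = 0

theorem Tame.zero : Tame (0 : Space n → E) :=
  ⟨stronglyMeasurable_zero, ⟨0, by simp⟩, 0, by simp⟩

theorem Tame.add {f g : Space n → E} (hf : Tame f) (hg : Tame g) : Tame (f + g) := by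
  obtain ⟨mf, ⟨M, hM⟩, R, hR⟩ := hf
  obtain ⟨mg, ⟨M', hM'⟩, R', hR'⟩ := hg
  refine ⟨mf.add mg, ⟨M + M', fun x => (norm_add_le _ _).trans (add_le_add (hM x) (hM' x))⟩,
    max R R', fun x hx => ?_⟩
  simp [hR x (lt_of_le_of_lt (le_max_left _ _) hx), hR' x (lt_of_le_of_lt (le_max_right _ _) hx)]

theorem Tame.neg {f : Space n → E} (hf : Tame f) : Tame (-f) := by
  obtain ⟨mf, ⟨M, hM⟩, R, hR⟩ := hf
  exact ⟨mf.neg, ⟨M, fun x => by simpa using hM x⟩, R, fun x hx => by simp [hR x hx]⟩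

theorem Tame.sub {f g : Space n → E} (hf : Tame f) (hg : Tame g) : Tame (f - g) := by
  rw [sub_eq_add_neg]; exact hf.add hg.neg

theorem Tame.sum {ι : Type*} {f : ι → Space n → E} (s : Finset ι) (hf : ∀ i ∈ s, Tame (f i)) :
    Tame (∑ i ∈ s, f i) := by
  classical
  induction s using Finset.induction_on with
  | empty => simpa using Tame.zero
  | insert i s hi ih =>
    rw [Finset.sum_insert hi]
    exact (hf i (by simp)).add (ih fun j hj => hf j (by simp [hj]))

/-- A measurable function dominated by a tame one is tame. -/
theorem Tame.mono {F : Type*} [NormedAddCommGroup F] {f : Space n → E} {g : Space n → F} {c : ℝ}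
    (hf : Tame f) (hg : StronglyMeasurable g) (h : ∀ x, ‖g x‖ ≤ c * ‖f x‖) : Tame g := by
  obtain ⟨mf, ⟨M, hM⟩, R, hR⟩ := hf
  refine ⟨hg, ⟨|c| * M, fun x => (h x).trans ?_⟩, R, fun x hx => ?_⟩
  · calc c * ‖f x‖ ≤ |c| * ‖f x‖ := by gcongr; exact le_abs_self c
      _ ≤ |c| * M := by gcongr; exact hM x
  · have := h x
    rw [hR x hx] at this
    simpa using this

theorem Tame.indicator {f : Space n → E} (hf : Tame f) {s : Set (Space n)}
    (hs : MeasurableSet s) : Tame (s.indicator f) :=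
  hf.mono (c := 1) (hf.1.indicator hs) fun x => by
    rw [one_mul]; exact norm_indicator_le_norm_self f x

theorem Tame.integrable {f : Space n → E} (hf : Tame f) : Integrable f := by
  obtain ⟨mf, ⟨M, hM⟩, R, hR⟩ := hf
  have h : Integrable ((Metric.closedBall (0 : Space n) R).indicator fun _ => M) :=
    (integrable_indicator_iff measurableSet_closedBall).2
      (integrableOn_const measure_closedBall_lt_top.ne)
  refine h.mono' mf.aestronglyMeasurable (Filter.Eventually.of_forall fun x => ?_)
  by_cases hx : x ∈ Metric.closedBall (0 : Space n) R
  · rw [Set.indicator_of_mem hx]; exact hM x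
  · rw [Set.indicator_of_notMem hx, hR x (by simpa using hx), norm_zero]

theorem Tame.lintegral_rpow_lt_top {f : Space n → E} (hf : Tame f) {p : ℝ} (hp : 0 < p) :
    ∫⁻ x, ‖f x‖ₑ ^ p < ∞ := by
  obtain ⟨mf, ⟨M, hM⟩, R, hR⟩ := hf
  calc ∫⁻ x, ‖f x‖ₑ ^ p
      ≤ ∫⁻ x, (Metric.closedBall (0 : Space n) R).indicator (fun _ => ENNReal.ofReal M ^ p) x := by
        refine lintegral_mono fun x => ?_
        by_cases hx : x ∈ Metric.closedBall (0 : Space n) R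
        · rw [Set.indicator_of_mem hx, ← ofReal_norm]
          gcongr
          exact hM x
        · rw [Set.indicator_of_notMem hx, hR x (by simpa using hx)]; simp [hp]
    _ = ENNReal.ofReal M ^ p * volume (Metric.closedBall (0 : Space n) R) := by
        rw [lintegral_indicator measurableSet_closedBall]; simp
    _ < ∞ := ENNReal.mul_lt_top (ENNReal.rpow_lt_top_of_nonneg hp.le ENNReal.ofReal_ne_top)
        measure_closedBall_lt_top

end Tame

/-! ### Interpolation between weak-type estimates -/

section Marcinkiewicz

theorem lintegral_Ioo_rpow {s c : ℝ} (hs : 0 < s) (hc : 0 ≤ c) :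
    ∫⁻ t in Set.Ioo 0 c, ENNReal.ofReal (t ^ (s - 1)) = ENNReal.ofReal (c ^ s / s) := by
  rw [← ofReal_integral_eq_lintegral_ofReal]
  · rw [← integral_Ioc_eq_integral_Ioo, ← intervalIntegral.integral_of_le hc,
      integral_rpow (Or.inl (by linarith))]
    simp [hs.ne']
  · rw [← IntegrableOn, ← integrableOn_Ioc_iff_integrableOn_Ioo]
    exact (intervalIntegral.intervalIntegrable_rpow' (by linarith)).1
  · filter_upwards [ae_restrict_mem measurableSet_Ioo] with t ht
    exact Real.rpow_nonneg ht.1.le _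

theorem lintegral_Ici_rpow {s c : ℝ} (hs : 0 < s) (hc : 0 < c) :
    ∫⁻ t in Set.Ici c, ENNReal.ofReal (t ^ (-s - 1)) = ENNReal.ofReal (c ^ (-s) / s) := by
  rw [← ofReal_integral_eq_lintegral_ofReal]
  · rw [integral_Ici_eq_integral_Ioi, integral_Ioi_rpow_of_lt (by linarith) hc]
    congr 1
    rw [show -s - 1 + 1 = -s by ring, neg_div_neg_eq]
  · rw [← IntegrableOn, integrableOn_Ici_iff_integrableOn_Ioi]
    exact integrableOn_Ioi_rpow_of_lt (by linarith) hc
  · filter_upwards [ae_restrict_mem measurableSet_Ici] with t ht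
    exact Real.rpow_nonneg (hc.le.trans ht) _

/-- The layer cake bound for a single value; integrating it over `x` controls `∫⁻ T f ^ p` by the
distribution function of `T f`. -/
theorem rpow_le_lintegral_layer {p : ℝ} (hp : 0 < p) (G : ℝ≥0∞) :
    G ^ p ≤ ∫⁻ t in Set.Ioi (0 : ℝ), ENNReal.ofReal (p * t ^ (p - 1)) *
      {t : ℝ | ENNReal.ofReal t < G}.indicator 1 t := by
  have key : ∀ c : ℝ≥0, (c : ℝ≥0∞) ≤ G → (c : ℝ≥0∞) ^ p ≤
      ∫⁻ t in Set.Ioi (0 : ℝ), ENNReal.ofReal (p * t ^ (p - 1)) *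
        {t : ℝ | ENNReal.ofReal t < G}.indicator 1 t := by
    intro c hc
    calc (c : ℝ≥0∞) ^ p = ENNReal.ofReal p * ENNReal.ofReal ((c : ℝ) ^ p / p) := by
          rw [← ENNReal.ofReal_mul hp.le, mul_div_cancel₀ _ hp.ne',
            ← ENNReal.ofReal_rpow_of_nonneg c.coe_nonneg hp.le, ENNReal.ofReal_coe_nnreal]
      _ = ∫⁻ t in Set.Ioo 0 (c : ℝ), ENNReal.ofReal (p * t ^ (p - 1)) *
        {t : ℝ | ENNReal.ofReal t < G}.indicator 1 t := by
          rw [← lintegral_Ioo_rpow hp c.coe_nonneg, ← lintegral_const_mul' _ _ ENNReal.ofReal_ne_top]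
          refine setLIntegral_congr_fun measurableSet_Ioo fun t ht => ?_
          have : t ∈ {t : ℝ | ENNReal.ofReal t < G} := by
            refine lt_of_lt_of_le ?_ hc
            rw [← ENNReal.ofReal_coe_nnreal]
            exact (ENNReal.ofReal_lt_ofReal_iff (ht.1.trans ht.2)).2 ht.2
          simp only [Set.indicator_of_mem this, Pi.one_apply, mul_one]
          rw [ENNReal.ofReal_mul hp.le]
      _ ≤ _ := lintegral_mono_set Set.Ioo_subset_Ioi_self
  rcases eq_or_ne G ∞ with rfl | hG
  · rw [ENNReal.top_rpow_of_pos hp]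
    refine le_of_forall_lt fun b hb => ?_
    have hb' : b ^ p⁻¹ < ∞ := ENNReal.rpow_lt_top_of_nonneg (by positivity) hb.ne
    refine lt_of_lt_of_le ?_ (key ((b ^ p⁻¹).toNNReal + 1) le_top)
    have h1 : b = (b ^ p⁻¹) ^ p := by rw [← ENNReal.rpow_mul, inv_mul_cancel₀ hp.ne', ENNReal.rpow_one]
    conv_lhs => rw [h1]
    apply ENNReal.rpow_lt_rpow _ hp
    rw [ENNReal.coe_add, ENNReal.coe_toNNReal hb'.ne]
    exact ENNReal.lt_add_right hb'.ne (by simp)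
  · lift G to ℝ≥0 using hG
    exact key G le_rfl

variable {n : ℕ} {E : Type*} [NormedAddCommGroup E]

theorem measurable_enorm_rpow_indicator {f : Space n → E} (hf : StronglyMeasurable f) (q : ℝ)
    {s : Set (ℝ × Space n)} (hs : MeasurableSet s) :
    Measurable fun z : ℝ × Space n => s.indicator (fun z => ‖f z.2‖ₑ ^ q) z :=
  ((hf.enorm.comp measurable_snd).pow_const q).indicator hs

/-- The large parts of `f`, measured in an exponent `q` below `p` and integrated over all heights. -/
theorem lintegral_truncation_gt {f : Space n → E} (hf : StronglyMeasurable f) {p q a : ℝ}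
    (hq : 0 < q) (hqp : q < p) (ha : 0 < a) :
    ∫⁻ t in Set.Ioi (0 : ℝ), ENNReal.ofReal (t ^ (p - q - 1)) *
        ∫⁻ x, ‖{x | a * t < ‖f x‖}.indicator f x‖ₑ ^ q
      ≤ ENNReal.ofReal (a ^ (q - p) / (p - q)) * ∫⁻ x, ‖f x‖ₑ ^ p := by
  set s : Set (ℝ × Space n) := {z | a * z.1 < ‖f z.2‖} with hs_def
  have hs : MeasurableSet s :=
    measurableSet_lt (measurable_fst.const_mul a) (hf.norm.measurable.comp measurable_snd)
  have hpow : Measurable fun t : ℝ => ENNReal.ofReal (t ^ (p - q - 1)) :=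
    (measurable_id.pow_const _).ennreal_ofReal
  have h1 : ∀ (t : ℝ) (x : Space n), ‖{x | a * t < ‖f x‖}.indicator f x‖ₑ ^ q
      = s.indicator (fun z => ‖f z.2‖ₑ ^ q) (t, x) := by
    intro t x
    by_cases h : a * t < ‖f x‖ <;> simp [hs_def, h, Set.indicator, hq]
  simp_rw [h1]
  have h2 : ∀ t : ℝ, ENNReal.ofReal (t ^ (p - q - 1)) *
      ∫⁻ x, s.indicator (fun z => ‖f z.2‖ₑ ^ q) (t, x) = ∫⁻ x, ENNReal.ofReal (t ^ (p - q - 1)) *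
        s.indicator (fun z => ‖f z.2‖ₑ ^ q) (t, x) := fun t =>
    (lintegral_const_mul' _ _ ENNReal.ofReal_ne_top).symm
  simp_rw [h2]
  rw [lintegral_lintegral_swap ((hpow.comp measurable_fst).mul
    (measurable_enorm_rpow_indicator hf q hs)).aemeasurable,
    ← lintegral_const_mul' _ _ ENNReal.ofReal_ne_top]
  refine lintegral_mono fun x => ?_
  calc ∫⁻ t in Set.Ioi (0 : ℝ), ENNReal.ofReal (t ^ (p - q - 1)) *
        s.indicator (fun z => ‖f z.2‖ₑ ^ q) (t, x)
      = ∫⁻ t in Set.Ioi (0 : ℝ), (Set.Ioo 0 (‖f x‖ / a)).indicator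
        (fun t => ENNReal.ofReal (t ^ (p - q - 1)) * ‖f x‖ₑ ^ q) t := by
        refine setLIntegral_congr_fun measurableSet_Ioi fun t ht => ?_
        have ht' : 0 < t := ht
        by_cases h : a * t < ‖f x‖
        · have : t < ‖f x‖ / a := by rw [lt_div_iff₀ ha]; linarith
          simp [hs_def, h, Set.indicator, ht', this]
        · have : ¬ t < ‖f x‖ / a := by rw [lt_div_iff₀ ha]; linarith
          simp [hs_def, h, Set.indicator, this]
    _ = (∫⁻ t in Set.Ioo 0 (‖f x‖ / a), ENNReal.ofReal (t ^ (p - q - 1))) * ‖f x‖ₑ ^ q := by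
        rw [setLIntegral_indicator measurableSet_Ioo,
          Set.inter_eq_left.2 Set.Ioo_subset_Ioi_self, lintegral_mul_const'']
        exact hpow.aemeasurable
    _ ≤ ENNReal.ofReal (a ^ (q - p) / (p - q)) * ‖f x‖ₑ ^ p := by
        rw [lintegral_Ioo_rpow (by linarith) (by positivity), ← ofReal_norm,
          ENNReal.ofReal_rpow_of_nonneg (norm_nonneg _) hq.le,
          ENNReal.ofReal_rpow_of_nonneg (norm_nonneg _) (hq.trans hqp).le,
          ← ENNReal.ofReal_mul' (by positivity), ← ENNReal.ofReal_mul' (by positivity)]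
        refine ENNReal.ofReal_le_ofReal (le_of_eq ?_)
        rcases (norm_nonneg (f x)).eq_or_lt with h | h
        · rw [← h, Real.zero_rpow hq.ne', Real.zero_rpow (hq.trans hqp).ne']; simp
        · rw [Real.div_rpow h.le ha.le, show q - p = -(p - q) by ring, Real.rpow_neg ha.le,
            show p = (p - q) + q by ring, Real.rpow_add h]
          simp only [add_sub_cancel_right]
          ring

/-- The small parts of `f`, measured in an exponent `q` above `p` and integrated over all heights. -/
theorem lintegral_truncation_le {f : Space n → E} (hf : StronglyMeasurable f) {p q a : ℝ}
    (hp : 0 < p) (hpq : p < q) (ha : 0 < a) :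
    ∫⁻ t in Set.Ioi (0 : ℝ), ENNReal.ofReal (t ^ (p - q - 1)) *
        ∫⁻ x, ‖{x | a * t < ‖f x‖}ᶜ.indicator f x‖ₑ ^ q
      ≤ ENNReal.ofReal (a ^ (q - p) / (q - p)) * ∫⁻ x, ‖f x‖ₑ ^ p := by
  have hq : 0 < q := hp.trans hpq
  set s : Set (ℝ × Space n) := {z | a * z.1 < ‖f z.2‖}ᶜ with hs_def
  have hs : MeasurableSet s :=
    (measurableSet_lt (measurable_fst.const_mul a) (hf.norm.measurable.comp measurable_snd)).compl
  have hpow : Measurable fun t : ℝ => ENNReal.ofReal (t ^ (p - q - 1)) :=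
    (measurable_id.pow_const _).ennreal_ofReal
  have h1 : ∀ (t : ℝ) (x : Space n), ‖{x | a * t < ‖f x‖}ᶜ.indicator f x‖ₑ ^ q
      = s.indicator (fun z => ‖f z.2‖ₑ ^ q) (t, x) := by
    intro t x
    by_cases h : a * t < ‖f x‖ <;> simp [hs_def, h, Set.indicator, hq]
  simp_rw [h1]
  have h2 : ∀ t : ℝ, ENNReal.ofReal (t ^ (p - q - 1)) *
      ∫⁻ x, s.indicator (fun z => ‖f z.2‖ₑ ^ q) (t, x) = ∫⁻ x, ENNReal.ofReal (t ^ (p - q - 1)) *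
        s.indicator (fun z => ‖f z.2‖ₑ ^ q) (t, x) := fun t =>
    (lintegral_const_mul' _ _ ENNReal.ofReal_ne_top).symm
  simp_rw [h2]
  rw [lintegral_lintegral_swap ((hpow.comp measurable_fst).mul
    (measurable_enorm_rpow_indicator hf q hs)).aemeasurable,
    ← lintegral_const_mul' _ _ ENNReal.ofReal_ne_top]
  refine lintegral_mono fun x => ?_
  rcases (norm_nonneg (f x)).eq_or_lt with h0 | h0
  · have : ‖f x‖ₑ = 0 := by rw [← ofReal_norm, ← h0]; simp
    simp [Set.indicator, this, hq, hp]
  have hc : 0 < ‖f x‖ / a := by positivity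
  calc ∫⁻ t in Set.Ioi (0 : ℝ), ENNReal.ofReal (t ^ (p - q - 1)) *
        s.indicator (fun z => ‖f z.2‖ₑ ^ q) (t, x)
      = ∫⁻ t in Set.Ioi (0 : ℝ), (Set.Ici (‖f x‖ / a)).indicator
        (fun t => ENNReal.ofReal (t ^ (p - q - 1)) * ‖f x‖ₑ ^ q) t := by
        refine setLIntegral_congr_fun measurableSet_Ioi fun t ht => ?_
        by_cases h : a * t < ‖f x‖
        · have : ¬ ‖f x‖ / a ≤ t := by rw [not_le, lt_div_iff₀ ha]; linarith
          simp [hs_def, h, Set.indicator, this]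
        · have : ‖f x‖ / a ≤ t := by rw [div_le_iff₀ ha]; linarith
          simp [hs_def, h, Set.indicator, this]
    _ = (∫⁻ t in Set.Ici (‖f x‖ / a), ENNReal.ofReal (t ^ (-(q - p) - 1))) * ‖f x‖ₑ ^ q := by
        rw [setLIntegral_indicator measurableSet_Ici,
          Set.inter_eq_left.2 (Set.Ici_subset_Ioi.2 hc), lintegral_mul_const'']
        · simp only [neg_sub]
        · exact hpow.aemeasurable
    _ ≤ ENNReal.ofReal (a ^ (q - p) / (q - p)) * ‖f x‖ₑ ^ p := by
        rw [lintegral_Ici_rpow (by linarith) hc, ← ofReal_norm,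
          ENNReal.ofReal_rpow_of_nonneg (norm_nonneg _) hq.le,
          ENNReal.ofReal_rpow_of_nonneg (norm_nonneg _) hp.le,
          ← ENNReal.ofReal_mul' (by positivity), ← ENNReal.ofReal_mul' (by positivity)]
        refine ENNReal.ofReal_le_ofReal (le_of_eq ?_)
        rw [Real.div_rpow h0.le ha.le, Real.rpow_neg ha.le, div_inv_eq_mul,
          show ‖f x‖ ^ p = ‖f x‖ ^ (-(q - p)) * ‖f x‖ ^ q by rw [← Real.rpow_add h0]; congr 1; ring]
        ring

/-- **Marcinkiewicz interpolation**, with the height `a * t` of the truncations left free: the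
dependence of the bound on the two weak-type constants is then optimized by choosing `a`. -/
theorem marcinkiewicz {T : (Space n → E) → Space n → ℝ≥0∞}
    (hmeas : ∀ f, Tame f → Measurable (T f))
    (hadd : ∀ f g, Tame f → Tame g → ∀ x, T (f + g) x ≤ T f x + T g x)
    {p₀ p p₁ : ℝ} (hp₀ : 0 < p₀) (hp₀p : p₀ < p) (hpp₁ : p < p₁) {B₀ B₁ : ℝ≥0∞}
    (hB₀ : B₀ ≠ ∞) (hB₁ : B₁ ≠ ∞)
    (h₀ : ∀ f, Tame f → ∀ t : ℝ, 0 < t →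
      ENNReal.ofReal (t ^ p₀) * volume {x | ENNReal.ofReal t < T f x} ≤ B₀ * ∫⁻ x, ‖f x‖ₑ ^ p₀)
    (h₁ : ∀ f, Tame f → ∀ t : ℝ, 0 < t →
      ENNReal.ofReal (t ^ p₁) * volume {x | ENNReal.ofReal t < T f x} ≤ B₁ * ∫⁻ x, ‖f x‖ₑ ^ p₁)
    {a : ℝ} (ha : 0 < a) {f : Space n → E} (hf : Tame f) :
    ∫⁻ x, T f x ^ p ≤ (ENNReal.ofReal (p * 2 ^ p₀ / (p - p₀)) * B₀ * ENNReal.ofReal (a ^ (p₀ - p))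
      + ENNReal.ofReal (p * 2 ^ p₁ / (p₁ - p)) * B₁ * ENNReal.ofReal (a ^ (p₁ - p)))
        * ∫⁻ x, ‖f x‖ₑ ^ p := by
  have hp : 0 < p := hp₀.trans hp₀p
  have hp₁ : 0 < p₁ := hp.trans hpp₁
  have hset : ∀ t : ℝ, MeasurableSet {x | a * t < ‖f x‖} := fun t =>
    measurableSet_lt measurable_const hf.1.norm.measurable
  -- the distribution function at height `t`, split at height `a * t` of `f`
  have hdist : ∀ t : ℝ, 0 < t → ENNReal.ofReal (p * t ^ (p - 1)) *
      volume {x | ENNReal.ofReal t < T f x} ≤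
      ENNReal.ofReal (p * 2 ^ p₀) * B₀ * (ENNReal.ofReal (t ^ (p - p₀ - 1)) *
        ∫⁻ x, ‖{x | a * t < ‖f x‖}.indicator f x‖ₑ ^ p₀) +
      ENNReal.ofReal (p * 2 ^ p₁) * B₁ * (ENNReal.ofReal (t ^ (p - p₁ - 1)) *
        ∫⁻ x, ‖{x | a * t < ‖f x‖}ᶜ.indicator f x‖ₑ ^ p₁) := by
    intro t ht
    have piece : ∀ (g : Space n → E) (q : ℝ) (B : ℝ≥0∞), ENNReal.ofReal ((t / 2) ^ q) *
        volume {x | ENNReal.ofReal (t / 2) < T g x} ≤ B * ∫⁻ x, ‖g x‖ₑ ^ q →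
        ENNReal.ofReal (p * t ^ (p - 1)) * volume {x | ENNReal.ofReal (t / 2) < T g x} ≤
        ENNReal.ofReal (p * 2 ^ q) * B * (ENNReal.ofReal (t ^ (p - q - 1)) *
          ∫⁻ x, ‖g x‖ₑ ^ q) := by
      intro g q B h
      have e : p * t ^ (p - 1) = (p * 2 ^ q) * t ^ (p - q - 1) * (t / 2) ^ q := by
        rw [Real.div_rpow ht.le two_pos.le]
        have : t ^ (p - 1) = t ^ (p - q - 1) * t ^ q := by rw [← Real.rpow_add ht]; congr 1; ring
        rw [this]
        have : (2 : ℝ) ^ q ≠ 0 := (Real.rpow_pos_of_pos two_pos q).ne'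
        field_simp
      calc ENNReal.ofReal (p * t ^ (p - 1)) * volume {x | ENNReal.ofReal (t / 2) < T g x}
          = ENNReal.ofReal (p * 2 ^ q) * ENNReal.ofReal (t ^ (p - q - 1)) *
            (ENNReal.ofReal ((t / 2) ^ q) * volume {x | ENNReal.ofReal (t / 2) < T g x}) := by
            rw [e, ENNReal.ofReal_mul (by positivity), ENNReal.ofReal_mul (by positivity)]
            ring
        _ ≤ ENNReal.ofReal (p * 2 ^ q) * ENNReal.ofReal (t ^ (p - q - 1)) *
            (B * ∫⁻ x, ‖g x‖ₑ ^ q) := by gcongr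
        _ = _ := by ring
    have hsub : {x | ENNReal.ofReal t < T f x} ⊆
        {x | ENNReal.ofReal (t / 2) < T ({x | a * t < ‖f x‖}.indicator f) x} ∪
        {x | ENNReal.ofReal (t / 2) < T ({x | a * t < ‖f x‖}ᶜ.indicator f) x} := by
      intro x hx
      by_contra hcon
      simp only [Set.mem_union, Set.mem_ofPred_eq, not_or, not_lt] at hcon
      have h := hadd _ _ (hf.indicator (hset t)) (hf.indicator (hset t).compl) x
      rw [Set.indicator_self_add_compl] at h
      have h2 := h.trans (add_le_add hcon.1 hcon.2)
      rw [← ENNReal.ofReal_add (by positivity) (by positivity), add_halves] at h2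
      exact absurd hx (not_lt.2 h2)
    calc ENNReal.ofReal (p * t ^ (p - 1)) * volume {x | ENNReal.ofReal t < T f x}
        ≤ ENNReal.ofReal (p * t ^ (p - 1)) *
          (volume {x | ENNReal.ofReal (t / 2) < T ({x | a * t < ‖f x‖}.indicator f) x} +
          volume {x | ENNReal.ofReal (t / 2) < T ({x | a * t < ‖f x‖}ᶜ.indicator f) x}) := by
          gcongr
          exact (measure_mono hsub).trans (measure_union_le _ _)
      _ ≤ _ := by
          rw [mul_add]
          exact add_le_add (piece _ _ _ (h₀ _ (hf.indicator (hset t)) _ (by positivity)))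
            (piece _ _ _ (h₁ _ (hf.indicator (hset t).compl) _ (by positivity)))
  have hTm := hmeas f hf
  have hjoint : MeasurableSet {z : Space n × ℝ | ENNReal.ofReal z.2 < T f z.1} :=
    measurableSet_lt measurable_snd.ennreal_ofReal (hTm.comp measurable_fst)
  have hpm : Measurable fun t : ℝ => ENNReal.ofReal (p * t ^ (p - 1)) :=
    ((measurable_id.pow_const _).const_mul p).ennreal_ofReal
  have hmeas₁ : Measurable fun t : ℝ => ENNReal.ofReal (p * 2 ^ p₀) * B₀ *
      (ENNReal.ofReal (t ^ (p - p₀ - 1)) *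
        ∫⁻ x, ‖{x | a * t < ‖f x‖}.indicator f x‖ₑ ^ p₀) := by
    refine ((measurable_id.pow_const _).ennreal_ofReal.mul ?_).const_mul _
    have hs : MeasurableSet {z : ℝ × Space n | a * z.1 < ‖f z.2‖} :=
      measurableSet_lt (measurable_fst.const_mul a) (hf.1.norm.measurable.comp measurable_snd)
    convert! (measurable_enorm_rpow_indicator hf.1 p₀ hs).lintegral_prod_right' (ν := volume)
      using 4 with t x
    by_cases h : a * t < ‖f x‖ <;> simp [h, Set.indicator, hp₀]
  calc ∫⁻ x, T f x ^ p
      ≤ ∫⁻ x, ∫⁻ t in Set.Ioi (0 : ℝ), ENNReal.ofReal (p * t ^ (p - 1)) *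
        {z : Space n × ℝ | ENNReal.ofReal z.2 < T f z.1}.indicator 1 (x, t) :=
        lintegral_mono fun x => rpow_le_lintegral_layer hp (T f x)
    _ = ∫⁻ t in Set.Ioi (0 : ℝ), ENNReal.ofReal (p * t ^ (p - 1)) *
        volume {x | ENNReal.ofReal t < T f x} := by
        rw [lintegral_lintegral_swap ((hpm.comp measurable_snd).mul
          (measurable_one.indicator hjoint)).aemeasurable]
        refine lintegral_congr fun t => ?_
        rw [lintegral_const_mul' _ _ ENNReal.ofReal_ne_top]
        congr 1
        rw [← lintegral_indicator_one (measurableSet_lt measurable_const hTm)]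
        rfl
    _ ≤ ∫⁻ t in Set.Ioi (0 : ℝ), (ENNReal.ofReal (p * 2 ^ p₀) * B₀ *
        (ENNReal.ofReal (t ^ (p - p₀ - 1)) *
          ∫⁻ x, ‖{x | a * t < ‖f x‖}.indicator f x‖ₑ ^ p₀) +
        ENNReal.ofReal (p * 2 ^ p₁) * B₁ * (ENNReal.ofReal (t ^ (p - p₁ - 1)) *
          ∫⁻ x, ‖{x | a * t < ‖f x‖}ᶜ.indicator f x‖ₑ ^ p₁)) :=
        setLIntegral_mono' measurableSet_Ioi hdist
    _ ≤ ENNReal.ofReal (p * 2 ^ p₀) * B₀ *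
          (ENNReal.ofReal (a ^ (p₀ - p) / (p - p₀)) * ∫⁻ x, ‖f x‖ₑ ^ p) +
        ENNReal.ofReal (p * 2 ^ p₁) * B₁ *
          (ENNReal.ofReal (a ^ (p₁ - p) / (p₁ - p)) * ∫⁻ x, ‖f x‖ₑ ^ p) := by
        rw [lintegral_add_left hmeas₁,
          lintegral_const_mul' _ _ (ENNReal.mul_ne_top ENNReal.ofReal_ne_top hB₀),
          lintegral_const_mul' _ _ (ENNReal.mul_ne_top ENNReal.ofReal_ne_top hB₁)]
        gcongr
        · exact lintegral_truncation_gt hf.1 hp₀ hp₀p ha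
        · exact lintegral_truncation_le hf.1 hp hpp₁ ha
    _ = _ := by
        rw [div_eq_mul_inv (a ^ (p₀ - p)), div_eq_mul_inv (a ^ (p₁ - p)),
          div_eq_mul_inv (p * 2 ^ p₀), div_eq_mul_inv (p * 2 ^ p₁),
          ENNReal.ofReal_mul (p := a ^ (p₀ - p)) (by positivity),
          ENNReal.ofReal_mul (p := a ^ (p₁ - p)) (by positivity),
          ENNReal.ofReal_mul (p := p * 2 ^ p₀) (by positivity),
          ENNReal.ofReal_mul (p := p * 2 ^ p₁) (by positivity)]
        ring

end Marcinkiewicz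

/-! ### Dyadic cubes and the Calderón–Zygmund decomposition -/

section DyadicCubes

variable {n : ℕ}

/-- The half-open dyadic cube of side length `2 ^ m` with integer coordinates `v`. -/
def dyadicCube (m : ℤ) (v : Fin n → ℤ) : Set (Space n) :=
  {x | ∀ i, ⌊x i / 2 ^ m⌋ = v i}

/-- The integer coordinates of the dyadic cube of side length `2 ^ m` containing `x`. -/
def dyadicIndex (m : ℤ) (x : Space n) : Fin n → ℤ := fun i => ⌊x i / 2 ^ m⌋

/-- The corner of a dyadic cube with the smallest coordinates. -/
def dyadicCorner (m : ℤ) (v : Fin n → ℤ) : Space n := WithLp.toLp 2 fun i => v i * (2 : ℝ) ^ m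

theorem mem_dyadicCube {m : ℤ} {v : Fin n → ℤ} {x : Space n} :
    x ∈ dyadicCube m v ↔ dyadicIndex m x = v :=
  ⟨fun h => funext h, fun h i => congrFun h i⟩

theorem dyadicCube_eq_preimage (m : ℤ) (v : Fin n → ℤ) :
    dyadicCube m v = WithLp.ofLp ⁻¹'
      (Set.univ.pi fun i => Set.Ico (v i * (2 : ℝ) ^ m) ((v i + 1) * (2 : ℝ) ^ m)) := by
  have h2 : (0 : ℝ) < 2 ^ m := by positivity
  ext x
  simp only [dyadicCube, Set.mem_ofPred_eq, Set.mem_preimage, Set.mem_pi, Set.mem_univ,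
    true_implies, Set.mem_Ico, Int.floor_eq_iff]
  refine forall_congr' fun i => ?_
  rw [le_div_iff₀ h2, div_lt_iff₀ h2]

theorem measurableSet_dyadicCube (m : ℤ) (v : Fin n → ℤ) : MeasurableSet (dyadicCube m v) := by
  rw [dyadicCube_eq_preimage]
  exact (PiLp.volume_preserving_ofLp (Fin n)).measurable
    (MeasurableSet.univ_pi fun _ => measurableSet_Ico)

theorem volume_dyadicCube (m : ℤ) (v : Fin n → ℤ) :
    volume (dyadicCube m v) = ENNReal.ofReal (2 ^ m) ^ n := by
  rw [dyadicCube_eq_preimage, (PiLp.volume_preserving_ofLp (Fin n)).measure_preimage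
    (MeasurableSet.univ_pi fun _ => measurableSet_Ico).nullMeasurableSet, Real.volume_pi_Ico]
  simp [add_mul]

theorem volume_dyadicCube_ne_top (m : ℤ) (v : Fin n → ℤ) : volume (dyadicCube m v) ≠ ∞ := by
  rw [volume_dyadicCube]; exact ENNReal.pow_ne_top ENNReal.ofReal_ne_top

theorem volume_dyadicCube_ne_zero (m : ℤ) (v : Fin n → ℤ) : volume (dyadicCube m v) ≠ 0 := by
  rw [volume_dyadicCube]
  exact pow_ne_zero _ (ENNReal.ofReal_pos.2 (by positivity)).ne'

theorem dist_le_of_mem_dyadicCube {m : ℤ} {v : Fin n → ℤ} {x y : Space n}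
    (hx : x ∈ dyadicCube m v) (hy : y ∈ dyadicCube m v) : dist x y ≤ √n * 2 ^ m := by
  have h2 : (0 : ℝ) < 2 ^ m := by positivity
  rw [dyadicCube_eq_preimage] at hx hy
  rw [EuclideanSpace.dist_eq, Real.sqrt_le_left (by positivity), mul_pow,
    Real.sq_sqrt (Nat.cast_nonneg n)]
  calc ∑ i, dist (x i) (y i) ^ 2 ≤ ∑ _i : Fin n, ((2 : ℝ) ^ m) ^ 2 := by
        refine Finset.sum_le_sum fun i _ => ?_
        have hxi := hx i (Set.mem_univ i)
        have hyi := hy i (Set.mem_univ i)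
        rw [Set.mem_Ico, add_mul, one_mul] at hxi hyi
        gcongr
        rw [Real.dist_eq, abs_le]
        constructor <;> linarith [hxi.1, hxi.2, hyi.1, hyi.2]
    _ = n * ((2 : ℝ) ^ m) ^ 2 := by simp

theorem dyadicCorner_mem (m : ℤ) (v : Fin n → ℤ) : dyadicCorner m v ∈ dyadicCube m v := by
  intro i
  have h2 : (2 : ℝ) ^ m ≠ 0 := by positivity
  simp [dyadicCorner, mul_div_cancel_right₀ _ h2]

theorem dyadicCube_subset_closedBall (m : ℤ) {v : Fin n → ℤ} {x : Space n}
    (hx : x ∈ dyadicCube m v) : dyadicCube m v ⊆ Metric.closedBall x (√n * 2 ^ m) :=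
  fun _ hy => dist_le_of_mem_dyadicCube hy hx

theorem volume_closedBall_eq_mul_volume_dyadicCube (m : ℤ) (v : Fin n → ℤ) (x : Space n) {s : ℝ}
    (hs : 0 ≤ s) : volume (Metric.closedBall x (s * 2 ^ m)) =
      volume (Metric.closedBall (0 : Space n) s) * volume (dyadicCube m v) := by
  rw [mul_comm s, Measure.addHaar_closedBall_mul _ _ (by positivity) hs, volume_dyadicCube,
    ← ENNReal.ofReal_pow (by positivity), mul_comm]
  simp

theorem dyadicIndex_succ (m : ℤ) (x : Space n) :
    dyadicIndex (m + 1) x = fun i => dyadicIndex m x i / 2 := by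
  ext i
  have := Int.floor_div_natCast (x i / 2 ^ m) 2
  rw [dyadicIndex, dyadicIndex, zpow_add₀ two_ne_zero, zpow_one, ← div_div]
  exact_mod_cast this

theorem dyadicIndex_eq_of_le {m m' : ℤ} (h : m ≤ m') {x y : Space n}
    (hxy : dyadicIndex m x = dyadicIndex m y) : dyadicIndex m' x = dyadicIndex m' y := by
  induction m', h using Int.leInduction with
  | base => exact hxy
  | succ k _ ih => rw [dyadicIndex_succ, dyadicIndex_succ, ih]

end DyadicCubes

section Decomposition

variable {n : ℕ} {E : Type*} [NormedAddCommGroup E]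

/-- The average of `‖f‖` over the dyadic cube of generation `m` containing `x` exceeds `t`. -/
def LargeAverage (f : Space n → E) (t : ℝ) (x : Space n) (m : ℤ) : Prop :=
  ENNReal.ofReal t * volume (dyadicCube m (dyadicIndex m x)) <
    ∫⁻ y in dyadicCube m (dyadicIndex m x), ‖f y‖ₑ

theorem LargeAverage.zpow_lt (hn : 1 ≤ n) {f : Space n → E} (hf : Tame f) {t : ℝ} (ht : 0 < t)
    {x : Space n} {m : ℤ} (h : LargeAverage f t x m) :
    (2 : ℝ) ^ m ≤ max 1 ((∫⁻ y, ‖f y‖ₑ).toReal / t) := by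
  by_contra hcon
  rw [not_le, max_lt_iff] at hcon
  have hfin : ∫⁻ y, ‖f y‖ₑ ≠ ∞ := hf.integrable.2.ne
  have h1 : (2 : ℝ) ^ m ≤ ((2 : ℝ) ^ m) ^ n := le_self_pow₀ hcon.1.le (by omega)
  have h2 : ENNReal.ofReal t * ENNReal.ofReal (2 ^ m) ^ n < ∫⁻ y, ‖f y‖ₑ := by
    rw [← volume_dyadicCube m (dyadicIndex m x)]
    exact lt_of_lt_of_le h (setLIntegral_le_lintegral _ _)
  rw [← ENNReal.ofReal_pow (by positivity), ← ENNReal.ofReal_mul ht.le,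
    ENNReal.ofReal_lt_iff_lt_toReal (by positivity) hfin] at h2
  have h3 := (div_lt_iff₀ ht).1 hcon.2
  nlinarith

/-- The maximal dyadic cubes on which the average of `‖f‖` exceeds `t`. -/
def StoppingCube (f : Space n → E) (t : ℝ) : Type :=
  {q : ℤ × (Fin n → ℤ) // ∃ x, dyadicIndex q.1 x = q.2 ∧ IsGreatest {m | LargeAverage f t x m} q.1}

namespace StoppingCube

variable {f : Space n → E} {t : ℝ}

instance : Countable (StoppingCube f t) := inferInstanceAs (Countable (Subtype _))

/-- The underlying set of a stopping cube. -/
def toSet (q : StoppingCube f t) : Set (Space n) := dyadicCube q.1.1 q.1.2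

theorem isGreatest_of_mem {q : StoppingCube f t} {x : Space n} (hx : x ∈ q.toSet) :
    IsGreatest {m | LargeAverage f t x m} q.1.1 := by
  obtain ⟨⟨m, v⟩, y, hy, hg⟩ := q
  have hxy : dyadicIndex m x = dyadicIndex m y := by rw [hy]; exact mem_dyadicCube.1 hx
  constructor
  · have := hg.1
    simp only [Set.mem_ofPred_eq, LargeAverage] at this ⊢
    rwa [hxy]
  · intro m' hm'
    by_contra hcon
    refine hcon (hg.2 ?_)
    simp only [Set.mem_ofPred_eq, LargeAverage] at hm' ⊢
    rwa [← dyadicIndex_eq_of_le (not_le.1 hcon).le hxy]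

theorem pairwise_disjoint : Pairwise (Function.onFun Disjoint
    (toSet : StoppingCube f t → Set (Space n))) := by
  intro q q' hne
  refine Set.disjoint_left.2 fun x hx hx' => hne ?_
  have hm := (isGreatest_of_mem hx).unique (isGreatest_of_mem hx')
  have h1 := mem_dyadicCube.1 hx
  have h2 := mem_dyadicCube.1 hx'
  refine Subtype.ext (Prod.ext hm ?_)
  rw [← h1, ← h2, hm]

theorem measurableSet (q : StoppingCube f t) : MeasurableSet q.toSet :=
  measurableSet_dyadicCube _ _

theorem lt_lintegral (q : StoppingCube f t) :
    ENNReal.ofReal t * volume q.toSet < ∫⁻ y in q.toSet, ‖f y‖ₑ := by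
  have h := (isGreatest_of_mem (dyadicCorner_mem q.1.1 q.1.2 : _ ∈ q.toSet)).1
  simp only [Set.mem_ofPred_eq, LargeAverage, mem_dyadicCube.1 (dyadicCorner_mem q.1.1 q.1.2)] at h
  exact h

/-- The parent of a stopping cube is not a stopping cube, which bounds the average above. -/
theorem lintegral_le (q : StoppingCube f t) :
    ∫⁻ y in q.toSet, ‖f y‖ₑ ≤ ENNReal.ofReal (2 ^ n * t) * volume q.toSet := by
  set x := dyadicCorner q.1.1 q.1.2
  have hx : x ∈ q.toSet := dyadicCorner_mem q.1.1 q.1.2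
  have h : ¬ LargeAverage f t x (q.1.1 + 1) := fun hcon => by
    have := (isGreatest_of_mem hx).2 hcon
    omega
  rw [LargeAverage, not_lt] at h
  have hsub : q.toSet ⊆ dyadicCube (q.1.1 + 1) (dyadicIndex (q.1.1 + 1) x) := by
    intro y hy
    rw [mem_dyadicCube]
    exact dyadicIndex_eq_of_le (by omega) ((mem_dyadicCube.1 hy).trans (mem_dyadicCube.1 hx).symm)
  refine (lintegral_mono_set hsub).trans (h.trans (le_of_eq ?_))
  rw [toSet, volume_dyadicCube, volume_dyadicCube, zpow_add₀ two_ne_zero, zpow_one,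
    ENNReal.ofReal_mul (by positivity), ENNReal.ofReal_mul (by positivity), mul_pow,
    ENNReal.ofReal_pow (by positivity)]
  ring

theorem subset_closedBall (hn : 1 ≤ n) (hf : Tame f) (ht : 0 < t) :
    ∃ R : ℝ, ∀ q : StoppingCube f t, q.toSet ⊆ Metric.closedBall 0 R := by
  obtain ⟨R, hR⟩ := hf.2.2
  refine ⟨R + √n * max 1 ((∫⁻ y, ‖f y‖ₑ).toReal / t), fun q => ?_⟩
  have hpos : ∃ y ∈ q.toSet, ‖y‖ ≤ R := by
    by_contra hcon
    push Not at hcon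
    have h := q.lt_lintegral
    rw [setLIntegral_congr_fun (g := fun _ => 0) q.measurableSet
      fun y hy => by simp [hR y (hcon y hy)]] at h
    simp at h
  obtain ⟨y, hy, hyR⟩ := hpos
  intro z hz
  have hm := (isGreatest_of_mem hz).1.zpow_lt hn hf ht
  rw [mem_closedBall_zero_iff]
  calc ‖z‖ = ‖y + (z - y)‖ := by simp
    _ ≤ ‖y‖ + dist z y := by rw [dist_eq_norm]; exact norm_add_le _ _
    _ ≤ R + √n * 2 ^ q.1.1 := add_le_add hyR (dist_le_of_mem_dyadicCube hz hy)
    _ ≤ _ := by gcongr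

theorem exists_mem_of_largeAverage (hn : 1 ≤ n) (hf : Tame f) (ht : 0 < t) {x : Space n} {m : ℤ}
    (h : LargeAverage f t x m) : ∃ q : StoppingCube f t, x ∈ q.toSet := by
  obtain ⟨M, hM⟩ : ∃ M : ℤ, ∀ m, LargeAverage f t x m → m ≤ M := by
    obtain ⟨N, hN⟩ := pow_unbounded_of_one_lt (max 1 ((∫⁻ y, ‖f y‖ₑ).toReal / t)) one_lt_two
    refine ⟨N, fun m hm => ?_⟩
    have := (hm.zpow_lt hn hf ht).trans_lt hN
    rw [← zpow_natCast] at this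
    exact ((zpow_lt_zpow_iff_right₀ one_lt_two).1 this).le
  obtain ⟨u, hu, hu'⟩ := Int.exists_greatest_of_bdd ⟨M, hM⟩ ⟨m, h⟩
  exact ⟨⟨(u, dyadicIndex u x), x, rfl, hu, hu'⟩, mem_dyadicCube.2 rfl⟩

/-- Off the stopping cubes, `‖f‖ ≤ t` almost everywhere, by Lebesgue's differentiation theorem. -/
theorem ae_norm_le (hn : 1 ≤ n) (hf : Tame f) (ht : 0 < t) :
    ∀ᵐ x, (∀ q : StoppingCube f t, x ∉ q.toSet) → ‖f x‖ ≤ t := by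
  filter_upwards [IsUnifLocDoublingMeasure.ae_tendsto_average_norm_sub (μ := volume)
    hf.integrable.locallyIntegrable 1] with x hx hq
  have hsq : 0 < √(n : ℝ) := Real.sqrt_pos.2 (by exact_mod_cast hn)
  set δ : ℕ → ℝ := fun k => √n * 2 ^ (-(k : ℤ))
  have hδpos : ∀ k, 0 < δ k := fun k => by positivity
  have hδ : Filter.Tendsto δ Filter.atTop (nhdsWithin 0 (Set.Ioi 0)) := by
    refine tendsto_nhdsWithin_iff.2 ⟨?_, Filter.Eventually.of_forall hδpos⟩
    have : Filter.Tendsto (fun k : ℕ => √(n : ℝ) * (1 / 2 : ℝ) ^ k) Filter.atTop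
        (nhds (√n * 0)) :=
      (tendsto_pow_atTop_nhds_zero_of_lt_one (by norm_num) (by norm_num)).const_mul _
    rw [mul_zero] at this
    refine this.congr fun k => ?_
    simp [δ]
  have hlim := hx (fun _ => x) δ hδ (Filter.Eventually.of_forall fun k => by
    simpa using (hδpos k).le)
  set c : ℝ := volume.real (Metric.closedBall (0 : Space n) √n)
  have hbound : ∀ k : ℕ, ‖f x‖ ≤ t + c * ⨍ y in Metric.closedBall x (δ k), ‖f y - f x‖ := by
    intro k
    set Q := dyadicCube (-(k : ℤ)) (dyadicIndex (-(k : ℤ)) x)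
    have hxQ : x ∈ Q := mem_dyadicCube.2 rfl
    have hQpos : 0 < volume.real Q := ENNReal.toReal_pos (volume_dyadicCube_ne_zero _ _)
      (volume_dyadicCube_ne_top _ _)
    have hQm : MeasurableSet Q := measurableSet_dyadicCube _ _
    have hnot : ¬ LargeAverage f t x (-(k : ℤ)) := fun h => by
      obtain ⟨q, hxq⟩ := exists_mem_of_largeAverage hn hf ht h
      exact hq q hxq
    have hint : Integrable (fun y => ‖f y‖) := hf.integrable.norm
    have h1 : ∫ y in Q, ‖f y‖ ≤ t * volume.real Q := by
      rw [LargeAverage, not_lt] at hnot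
      rw [integral_norm_eq_lintegral_enorm hf.1.aestronglyMeasurable.restrict]
      refine ENNReal.toReal_le_of_le_ofReal (by positivity) (hnot.trans (le_of_eq ?_))
      rw [ENNReal.ofReal_mul ht.le, measureReal_def, ENNReal.ofReal_toReal
        (volume_dyadicCube_ne_top _ _)]
    have hloc : ∀ s : Set (Space n), volume s ≠ ∞ → IntegrableOn (fun y => ‖f y - f x‖) s :=
      fun s hs => (hf.integrable.integrableOn.sub (integrableOn_const hs)).norm
    have hB : volume (Metric.closedBall x (δ k)) ≠ ∞ := measure_closedBall_lt_top.ne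
    have hvol : volume.real (Metric.closedBall x (δ k)) = c * volume.real Q := by
      rw [measureReal_def, volume_closedBall_eq_mul_volume_dyadicCube _
        (dyadicIndex (-(k : ℤ)) x) x hsq.le, ENNReal.toReal_mul]
      rfl
    have h2 : ∫ y in Q, ‖f y - f x‖ ≤
        c * volume.real Q * ⨍ y in Metric.closedBall x (δ k), ‖f y - f x‖ := by
      rw [← hvol, setAverage_eq, smul_eq_mul, ← mul_assoc, mul_inv_cancel₀, one_mul]
      · exact setIntegral_mono_set (hloc _ hB) (Filter.Eventually.of_forall fun y => norm_nonneg _)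
          (dyadicCube_subset_closedBall _ hxQ).eventuallyLE
      · exact (ENNReal.toReal_pos (Metric.measure_closedBall_pos _ _ (hδpos k)).ne' hB).ne'
    have h3 : ‖f x‖ * volume.real Q ≤ ∫ y in Q, (‖f y‖ + ‖f y - f x‖) := by
      have : ‖f x‖ * volume.real Q = ∫ _y in Q, ‖f x‖ := by simp [mul_comm]
      rw [this]
      refine setIntegral_mono (integrableOn_const (volume_dyadicCube_ne_top _ _))
        (hint.integrableOn.add (hloc _ (volume_dyadicCube_ne_top _ _))) fun y => ?_
      have := norm_sub_le (f y) (f y - f x)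
      simpa using this
    rw [integral_add hint.integrableOn (hloc _ (volume_dyadicCube_ne_top _ _))] at h3
    have h4 : ‖f x‖ * volume.real Q ≤
        (t + c * ⨍ y in Metric.closedBall x (δ k), ‖f y - f x‖) * volume.real Q := by linarith
    exact le_of_mul_le_mul_right h4 hQpos
  have hlim' := (hlim.const_mul c).const_add t
  rw [mul_zero, add_zero] at hlim'
  exact ge_of_tendsto' hlim' hbound

end StoppingCube

end Decomposition

/-! ### The weak type `(1, 1)` criterion -/

section WeakType

variable {n : ℕ} {E : Type*} [NormedAddCommGroup E]

/-- Lower semicontinuity of an operator along dominated pointwise convergent sequences. -/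
def DominatedLSC (T : (Space n → E) → Space n → ℝ≥0∞) : Prop :=
  ∀ (f : Space n → E) (F : ℕ → Space n → E), Tame f → (∀ m, Tame (F m)) →
    (∀ m x, ‖F m x‖ ≤ ‖f x‖) →
    (∀ x, Filter.Tendsto (fun m => F m x) Filter.atTop (nhds (f x))) →
    ∀ x, T f x ≤ Filter.liminf (fun m => T (F m) x) Filter.atTop

theorem le_sum_of_subadditive {T : (Space n → E) → Space n → ℝ≥0∞} (hzero : ∀ x, T 0 x = 0)
    (hadd : ∀ f g, Tame f → Tame g → ∀ x, T (f + g) x ≤ T f x + T g x) {ι : Type*}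
    {f : ι → Space n → E} (s : Finset ι) (hf : ∀ i ∈ s, Tame (f i)) (x : Space n) :
    T (∑ i ∈ s, f i) x ≤ ∑ i ∈ s, T (f i) x := by
  classical
  induction s using Finset.induction_on with
  | empty => simp [hzero]
  | insert i s hi ih =>
    rw [Finset.sum_insert hi, Finset.sum_insert hi]
    refine (hadd _ _ (hf i (by simp)) (Tame.sum s fun j hj => hf j (by simp [hj])) x).trans ?_
    gcongr
    exact ih fun j hj => hf j (by simp [hj])

theorem sum_indicator_eq {ι : Type*} {Q : ι → Set (Space n)}
    (hQ : Pairwise (Function.onFun Disjoint Q)) (b : Space n → E) (s : Finset ι) (x : Space n)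
    {i : ι} (hi : x ∈ Q i) :
    (∑ j ∈ s, (Q j).indicator b) x = {j | j ∈ s}.indicator (fun _ => b x) i := by
  classical
  have hne : ∀ j, j ≠ i → (Q j).indicator b x = 0 := fun j hj =>
    Set.indicator_of_notMem (fun h => Set.disjoint_left.1 (hQ hj) h hi) _
  rw [Finset.sum_apply]
  by_cases his : i ∈ s
  · rw [Finset.sum_eq_single_of_mem i his fun j _ hj => hne j hj]
    simp [hi, his]
  · rw [Finset.sum_eq_zero fun j hj => hne j (fun h => his (h ▸ hj))]
    simp [his]

/-- Countable subadditivity over functions with disjoint supports. -/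
theorem le_tsum_of_disjoint {T : (Space n → E) → Space n → ℝ≥0∞} (hzero : ∀ x, T 0 x = 0)
    (hadd : ∀ f g, Tame f → Tame g → ∀ x, T (f + g) x ≤ T f x + T g x) (hlsc : DominatedLSC T)
    {ι : Type*} [Countable ι] {Q : ι → Set (Space n)} (hQm : ∀ i, MeasurableSet (Q i))
    (hQ : Pairwise (Function.onFun Disjoint Q)) {b : Space n → E} (hb : Tame b)
    (hb0 : ∀ x, (∀ i, x ∉ Q i) → b x = 0) (x : Space n) :
    T b x ≤ ∑' i, T ((Q i).indicator b) x := by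
  obtain ⟨e, he⟩ := exists_injective_nat ι
  have hfin : ∀ m : ℕ, {i | e i < m}.Finite := fun m =>
    (Set.finite_Iio m).preimage he.injOn
  set F : ℕ → Space n → E := fun m => ∑ i ∈ (hfin m).toFinset, (Q i).indicator b
  have hF : ∀ m, Tame (F m) := fun m => Tame.sum _ fun i _ => hb.indicator (hQm i)
  have hzeroF : ∀ m x, (∀ i, x ∉ Q i) → F m x = 0 := fun m x hx => by
    simp only [F, Finset.sum_apply]
    exact Finset.sum_eq_zero fun i _ => Set.indicator_of_notMem (hx i) _
  refine (hlsc b F hb hF (fun m x => ?_) (fun x => ?_) x).trans ?_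
  · by_cases hx : ∃ i, x ∈ Q i
    · obtain ⟨i, hi⟩ := hx
      simp only [F]
      rw [sum_indicator_eq hQ b _ x hi]
      exact norm_indicator_le_norm_self (fun _ => b x) i
    · push Not at hx
      rw [hzeroF m x hx]; simp
  · by_cases hx : ∃ i, x ∈ Q i
    · obtain ⟨i, hi⟩ := hx
      refine tendsto_const_nhds.congr' ?_
      filter_upwards [Filter.eventually_gt_atTop (e i)] with m hm
      simp only [F]
      rw [sum_indicator_eq hQ b _ x hi, Set.indicator_of_mem (by simpa using hm)]
    · push Not at hx
      rw [hb0 x hx]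
      simp only [hzeroF _ x hx]
      exact tendsto_const_nhds
  · refine Filter.liminf_le_of_le (by isBoundedDefault) fun c hc => ?_
    obtain ⟨m, hm⟩ := hc.exists
    refine hm.trans ((le_sum_of_subadditive hzero hadd _ (fun i _ => hb.indicator (hQm i)) x).trans
      (ENNReal.sum_le_tsum _))

namespace StoppingCube

variable {f : Space n → E} {t : ℝ}

theorem volume_ne_top (q : StoppingCube f t) : volume q.toSet ≠ ∞ := volume_dyadicCube_ne_top _ _

theorem volume_ne_zero (q : StoppingCube f t) : volume q.toSet ≠ 0 := volume_dyadicCube_ne_zero _ _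

end StoppingCube

variable [NormedSpace ℝ E]

namespace StoppingCube

variable {f : Space n → E} {t : ℝ}

/-- The mean of `f` over a stopping cube. -/
def mean (q : StoppingCube f t) : E := ⨍ y in q.toSet, f y

theorem enorm_mean_mul_le (q : StoppingCube f t) :
    ‖q.mean‖ₑ * volume q.toSet ≤ ∫⁻ y in q.toSet, ‖f y‖ₑ := by
  rw [mean, setAverage_eq, enorm_smul, measureReal_def]
  have h1 : ‖((volume q.toSet).toReal)⁻¹‖ₑ = (volume q.toSet)⁻¹ := by
    rw [← ofReal_norm, Real.norm_of_nonneg (by positivity), ENNReal.ofReal_inv_of_pos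
      (ENNReal.toReal_pos q.volume_ne_zero q.volume_ne_top), ENNReal.ofReal_toReal q.volume_ne_top]
  rw [h1, mul_right_comm, ENNReal.inv_mul_cancel q.volume_ne_zero q.volume_ne_top, one_mul]
  exact enorm_integral_le_lintegral_enorm _

theorem enorm_mean_le (q : StoppingCube f t) : ‖q.mean‖ₑ ≤ ENNReal.ofReal (2 ^ n * t) := by
  have h := q.enorm_mean_mul_le.trans q.lintegral_le
  exact (ENNReal.mul_le_mul_iff_left q.volume_ne_zero q.volume_ne_top).1 h

end StoppingCube

open Classical in
/-- The bad part of the Calderón–Zygmund decomposition of `f` at height `t`. -/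
def badPart (f : Space n → E) (t : ℝ) (x : Space n) : E :=
  if h : ∃ q : StoppingCube f t, x ∈ q.toSet then f x - h.choose.mean else 0

section BadPart

variable {f : Space n → E} {t : ℝ}

theorem badPart_of_mem {q : StoppingCube f t} {x : Space n} (hx : x ∈ q.toSet) :
    badPart f t x = f x - q.mean := by
  have h : ∃ q : StoppingCube f t, x ∈ q.toSet := ⟨q, hx⟩
  rw [badPart, dif_pos h]
  congr 2
  by_contra hne
  exact Set.disjoint_left.1 (StoppingCube.pairwise_disjoint hne) h.choose_spec hx

theorem badPart_of_notMem {x : Space n} (hx : ∀ q : StoppingCube f t, x ∉ q.toSet) :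
    badPart f t x = 0 := by
  rw [badPart, dif_neg (by simpa using hx)]

theorem indicator_badPart (q : StoppingCube f t) :
    q.toSet.indicator (badPart f t) = q.toSet.indicator fun x => f x - q.mean := by
  ext x
  by_cases hx : x ∈ q.toSet
  · simp [hx, badPart_of_mem hx]
  · simp [hx]

theorem stronglyMeasurable_badPart (hf : StronglyMeasurable f) :
    StronglyMeasurable (badPart f t) := by
  obtain ⟨e, he⟩ := exists_injective_nat (StoppingCube f t)
  have hfin : ∀ m : ℕ, {i | e i < m}.Finite := fun m => (Set.finite_Iio m).preimage he.injOn
  refine stronglyMeasurable_of_tendsto Filter.atTop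
    (f := fun m => ∑ i ∈ (hfin m).toFinset, i.toSet.indicator (badPart f t)) (fun m => ?_) ?_
  · refine Finset.stronglyMeasurable_sum _ fun q _ => ?_
    rw [indicator_badPart]
    exact (hf.sub stronglyMeasurable_const).indicator q.measurableSet
  · refine tendsto_pi_nhds.2 fun x => ?_
    by_cases hx : ∃ q : StoppingCube f t, x ∈ q.toSet
    · obtain ⟨i, hi⟩ := hx
      refine tendsto_const_nhds.congr' ?_
      filter_upwards [Filter.eventually_gt_atTop (e i)] with m hm
      rw [sum_indicator_eq StoppingCube.pairwise_disjoint _ _ x hi,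
        Set.indicator_of_mem (by simpa using hm)]
    · push Not at hx
      rw [badPart_of_notMem hx]
      refine tendsto_const_nhds.congr fun m => ?_
      rw [Finset.sum_apply]
      exact (Finset.sum_eq_zero fun i _ => Set.indicator_of_notMem (hx i) _).symm

theorem tame_badPart (hn : 1 ≤ n) (hf : Tame f) (ht : 0 < t) : Tame (badPart f t) := by
  obtain ⟨M, hM⟩ := hf.2.1
  obtain ⟨R, hR⟩ := StoppingCube.subset_closedBall hn hf ht
  have hM0 : 0 ≤ M := (norm_nonneg _).trans (hM 0)
  refine ⟨stronglyMeasurable_badPart hf.1, ⟨M + 2 ^ n * t, fun x => ?_⟩, R, fun x hx => ?_⟩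
  · by_cases hx : ∃ q : StoppingCube f t, x ∈ q.toSet
    · obtain ⟨q, hq⟩ := hx
      rw [badPart_of_mem hq]
      refine (norm_sub_le _ _).trans (add_le_add (hM x) ?_)
      have h := q.enorm_mean_le
      rw [← ofReal_norm] at h
      exact (ENNReal.ofReal_le_ofReal_iff (by positivity)).1 h
    · push Not at hx
      rw [badPart_of_notMem hx, norm_zero]
      positivity
  · refine badPart_of_notMem fun q hq => ?_
    have := hR q hq
    rw [mem_closedBall_zero_iff] at this
    linarith

theorem lintegral_indicator_badPart_le (q : StoppingCube f t) (hf : Tame f) :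
    ∫⁻ x, ‖q.toSet.indicator (badPart f t) x‖ₑ ≤ 2 * ∫⁻ x in q.toSet, ‖f x‖ₑ := by
  rw [indicator_badPart]
  simp_rw [enorm_indicator_eq_indicator_enorm]
  rw [lintegral_indicator q.measurableSet]
  calc ∫⁻ x in q.toSet, ‖f x - q.mean‖ₑ ≤ ∫⁻ x in q.toSet, (‖f x‖ₑ + ‖q.mean‖ₑ) :=
        lintegral_mono fun x => enorm_sub_le
    _ = (∫⁻ x in q.toSet, ‖f x‖ₑ) + ‖q.mean‖ₑ * volume q.toSet := by
        rw [lintegral_add_left hf.1.enorm]; simp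
    _ ≤ _ := by rw [two_mul]; exact add_le_add le_rfl q.enorm_mean_mul_le

theorem integral_indicator_badPart [CompleteSpace E] (q : StoppingCube f t) (hf : Tame f) :
    ∫ x, q.toSet.indicator (badPart f t) x = 0 := by
  rw [indicator_badPart, integral_indicator q.measurableSet,
    integral_sub hf.integrable.integrableOn (integrableOn_const q.volume_ne_top)]
  have h : volume.real q.toSet ≠ 0 := (ENNReal.toReal_pos q.volume_ne_zero q.volume_ne_top).ne'
  rw [setIntegral_const, StoppingCube.mean, setAverage_eq, smul_smul, mul_inv_cancel₀ h, one_smul,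
    sub_self]

theorem lintegral_goodPart_le :
    ∫⁻ x, ‖(f - badPart f t) x‖ₑ ≤ ∫⁻ x, ‖f x‖ₑ := by
  set U : Set (Space n) := ⋃ q : StoppingCube f t, q.toSet
  have hU : MeasurableSet U := MeasurableSet.iUnion fun q => q.measurableSet
  rw [← lintegral_add_compl _ hU, ← lintegral_add_compl (fun x => ‖f x‖ₑ) hU]
  gcongr ?_ + ?_
  · rw [lintegral_iUnion (fun q => q.measurableSet) StoppingCube.pairwise_disjoint,
      lintegral_iUnion (fun q => q.measurableSet) StoppingCube.pairwise_disjoint]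
    refine ENNReal.tsum_le_tsum fun q => ?_
    rw [setLIntegral_congr_fun (g := fun _ => ‖q.mean‖ₑ) q.measurableSet
      fun x hx => by simp [badPart_of_mem hx]]
    simpa using q.enorm_mean_mul_le
  · refine (setLIntegral_congr_fun hU.compl fun x hx => ?_).le
    simp only [U, Set.mem_compl_iff, Set.mem_iUnion, not_exists] at hx
    simp [badPart_of_notMem hx]

theorem ae_goodPart_le (hn : 1 ≤ n) (hf : Tame f) (ht : 0 < t) :
    ∀ᵐ x, ‖(f - badPart f t) x‖ₑ ≤ ENNReal.ofReal (2 ^ n * t) := by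
  filter_upwards [StoppingCube.ae_norm_le hn hf ht] with x hx
  by_cases h : ∃ q : StoppingCube f t, x ∈ q.toSet
  · obtain ⟨q, hq⟩ := h
    simpa [badPart_of_mem hq] using q.enorm_mean_le
  · push Not at h
    rw [Pi.sub_apply, badPart_of_notMem h, sub_zero, ← ofReal_norm]
    refine ENNReal.ofReal_le_ofReal ((hx h).trans ?_)
    have : (1 : ℝ) ≤ 2 ^ n := one_le_pow₀ one_le_two
    nlinarith

end BadPart

/-- **Calderón–Zygmund theorem**: a sublinear operator which is bounded on `L²` and maps mean-zero
functions on a ball to functions integrable off a dilated ball is of weak type `(1,1)`. -/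
theorem weak_type_one_one [CompleteSpace E] (hn : 1 ≤ n)
    {T : (Space n → E) → Space n → ℝ≥0∞} (hzero : ∀ x, T 0 x = 0)
    (hmeas : ∀ f, Tame f → Measurable (T f))
    (hadd : ∀ f g, Tame f → Tame g → ∀ x, T (f + g) x ≤ T f x + T g x) (hlsc : DominatedLSC T)
    {A H : ℝ≥0∞} {D : ℝ} (hD : 0 ≤ D)
    (h₂ : ∀ f, Tame f → ∫⁻ x, T f x ^ (2 : ℝ) ≤ A * ∫⁻ x, ‖f x‖ₑ ^ (2 : ℝ))
    (hH : ∀ b, Tame b → ∀ c r, 0 < r → (∀ x, x ∉ Metric.closedBall c r → b x = 0) →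
      ∫ x, b x = 0 → ∫⁻ x in (Metric.closedBall c (D * r))ᶜ, T b x ≤ H * ∫⁻ x, ‖b x‖ₑ)
    {f : Space n → E} (hf : Tame f) {t : ℝ} (ht : 0 < t) :
    ENNReal.ofReal t * volume {x | ENNReal.ofReal t < T f x} ≤
      (4 * 2 ^ n * A + volume (Metric.closedBall (0 : Space n) (D * √n)) + 4 * H) *
        ∫⁻ x, ‖f x‖ₑ := by
  have hsq : 0 < √(n : ℝ) := Real.sqrt_pos.2 (by exact_mod_cast hn)
  set b := badPart f t with hb_def
  have hb : Tame b := tame_badPart hn hf ht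
  have hg : Tame (f - b) := hf.sub hb
  set r : StoppingCube f t → ℝ := fun q => √n * 2 ^ q.1.1
  have hr : ∀ q, 0 < r q := fun q => by positivity
  set c : StoppingCube f t → Space n := fun q => dyadicCorner q.1.1 q.1.2
  set U : Set (Space n) := ⋃ q : StoppingCube f t, Metric.closedBall (c q) (D * r q)
  have hU : MeasurableSet U := MeasurableSet.iUnion fun q => measurableSet_closedBall
  have ht0 : ENNReal.ofReal t ≠ 0 := (ENNReal.ofReal_pos.2 ht).ne'
  have htt : ENNReal.ofReal t ≠ ∞ := ENNReal.ofReal_ne_top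
  have hsum : ∑' q : StoppingCube f t, ∫⁻ x in q.toSet, ‖f x‖ₑ ≤ ∫⁻ x, ‖f x‖ₑ := by
    rw [← lintegral_iUnion (fun q => q.measurableSet) StoppingCube.pairwise_disjoint]
    exact setLIntegral_le_lintegral _ _
  have hhalf : ENNReal.ofReal t = 2 * ENNReal.ofReal (t / 2) := by
    rw [← ENNReal.ofReal_ofNat, ← ENNReal.ofReal_mul (by norm_num)]
    congr 1; ring
  -- the good part is at most `2 ^ n * t`, and Chebyshev's inequality in `L²` applies
  have hgood : ENNReal.ofReal t * volume {x | ENNReal.ofReal (t / 2) < T (f - b) x} ≤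
      4 * 2 ^ n * A * ∫⁻ x, ‖f x‖ₑ := by
    have hc := mul_meas_ge_le_lintegral (μ := volume) ((hmeas _ hg).pow_const (2 : ℝ))
      (ENNReal.ofReal (t / 2) ^ (2 : ℝ))
    have h1 : ∫⁻ x, ‖(f - b) x‖ₑ ^ (2 : ℝ) ≤ ENNReal.ofReal (2 ^ n * t) * ∫⁻ x, ‖f x‖ₑ := by
      refine le_trans ?_ (mul_le_mul_right (lintegral_goodPart_le (f := f) (t := t)) _)
      rw [← lintegral_const_mul' _ _ ENNReal.ofReal_ne_top]
      refine lintegral_mono_ae ?_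
      filter_upwards [ae_goodPart_le hn hf ht] with x hx
      rw [ENNReal.rpow_two, sq]
      gcongr
    have h2 : ENNReal.ofReal t * (ENNReal.ofReal t *
        volume {x | ENNReal.ofReal (t / 2) < T (f - b) x}) ≤
        ENNReal.ofReal t * (4 * 2 ^ n * A * ∫⁻ x, ‖f x‖ₑ) := by
      calc ENNReal.ofReal t * (ENNReal.ofReal t *
          volume {x | ENNReal.ofReal (t / 2) < T (f - b) x})
          = 4 * (ENNReal.ofReal (t / 2) ^ (2 : ℝ) *
            volume {x | ENNReal.ofReal (t / 2) < T (f - b) x}) := by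
            rw [hhalf, ENNReal.rpow_two]; ring
        _ ≤ 4 * (ENNReal.ofReal (t / 2) ^ (2 : ℝ) * volume {x | ENNReal.ofReal (t / 2) ^ (2 : ℝ) ≤
              T (f - b) x ^ (2 : ℝ)}) := by
            gcongr with x
            intro hx
            exact ENNReal.rpow_le_rpow hx.le two_pos.le
        _ ≤ 4 * (A * (ENNReal.ofReal (2 ^ n * t) * ∫⁻ x, ‖f x‖ₑ)) := by
            refine mul_le_mul_right (hc.trans ((h₂ _ hg).trans ?_)) _
            gcongr
        _ = _ := by
            rw [ENNReal.ofReal_mul (by positivity), ENNReal.ofReal_pow two_pos.le,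
              ENNReal.ofReal_ofNat]
            ring
    exact (ENNReal.mul_le_mul_iff_right ht0 htt).1 h2
  have hUvol : ENNReal.ofReal t * volume U ≤
      volume (Metric.closedBall (0 : Space n) (D * √n)) * ∫⁻ x, ‖f x‖ₑ := by
    calc ENNReal.ofReal t * volume U
        ≤ ENNReal.ofReal t * ∑' q : StoppingCube f t,
          volume (Metric.closedBall (0 : Space n) (D * √n)) * volume q.toSet := by
          gcongr
          refine (measure_iUnion_le _).trans (ENNReal.tsum_le_tsum fun q => le_of_eq ?_)
          simp only [r]
          rw [← mul_assoc, volume_closedBall_eq_mul_volume_dyadicCube q.1.1 q.1.2 _ (by positivity)]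
          rfl
      _ = volume (Metric.closedBall (0 : Space n) (D * √n)) *
          ∑' q : StoppingCube f t, ENNReal.ofReal t * volume q.toSet := by
          rw [ENNReal.tsum_mul_left, ENNReal.tsum_mul_left]; ring
      _ ≤ _ := by
          gcongr
          exact (ENNReal.tsum_le_tsum fun q => q.lt_lintegral.le).trans hsum
  -- off the dilated cubes, the bad part is estimated cube by cube
  have hbad : ENNReal.ofReal t * volume ({x | ENNReal.ofReal (t / 2) < T b x} ∩ Uᶜ) ≤
      4 * H * ∫⁻ x, ‖f x‖ₑ := by
    have h1 : ENNReal.ofReal (t / 2) * volume ({x | ENNReal.ofReal (t / 2) < T b x} ∩ Uᶜ) ≤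
        ∫⁻ x in Uᶜ, T b x := by
      refine le_trans ?_ (mul_meas_ge_le_lintegral (hmeas _ hb) (ENNReal.ofReal (t / 2)))
      rw [Measure.restrict_apply (measurableSet_le measurable_const (hmeas _ hb))]
      gcongr with x
      exact fun hx => hx.le
    have h2 : ∫⁻ x in Uᶜ, T b x ≤ 2 * H * ∫⁻ x, ‖f x‖ₑ := by
      calc ∫⁻ x in Uᶜ, T b x ≤ ∫⁻ x in Uᶜ, ∑' q : StoppingCube f t, T (q.toSet.indicator b) x :=
            lintegral_mono fun x => le_tsum_of_disjoint hzero hadd hlsc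
              (fun q => q.measurableSet) StoppingCube.pairwise_disjoint hb
              (fun x hx => badPart_of_notMem hx) x
        _ = ∑' q : StoppingCube f t, ∫⁻ x in Uᶜ, T (q.toSet.indicator b) x :=
            lintegral_tsum fun q => (hmeas _ (hb.indicator q.measurableSet)).aemeasurable
        _ ≤ ∑' q : StoppingCube f t, 2 * H * ∫⁻ x in q.toSet, ‖f x‖ₑ := by
            refine ENNReal.tsum_le_tsum fun q => ?_
            have hsubU : Uᶜ ⊆ (Metric.closedBall (c q) (D * r q))ᶜ :=
              Set.compl_subset_compl.2 (Set.subset_iUnion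
                (fun q : StoppingCube f t => Metric.closedBall (c q) (D * r q)) q)
            refine (lintegral_mono_set hsubU).trans ((hH _ (hb.indicator q.measurableSet) (c q)
              (r q) (hr q) (fun x hx => ?_) (integral_indicator_badPart q hf)).trans ?_)
            · refine Set.indicator_of_notMem (fun hxq => hx ?_) _
              exact dyadicCube_subset_closedBall _ (dyadicCorner_mem q.1.1 q.1.2) hxq
            · calc H * ∫⁻ x, ‖q.toSet.indicator b x‖ₑ
                  ≤ H * (2 * ∫⁻ x in q.toSet, ‖f x‖ₑ) := by
                    gcongr
                    exact lintegral_indicator_badPart_le q hf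
                _ = _ := by ring
        _ ≤ _ := by rw [ENNReal.tsum_mul_left]; gcongr
    calc ENNReal.ofReal t * volume ({x | ENNReal.ofReal (t / 2) < T b x} ∩ Uᶜ)
        = 2 * (ENNReal.ofReal (t / 2) *
          volume ({x | ENNReal.ofReal (t / 2) < T b x} ∩ Uᶜ)) := by rw [hhalf]; ring
      _ ≤ 2 * (2 * H * ∫⁻ x, ‖f x‖ₑ) := mul_le_mul_right (h1.trans h2) _
      _ = _ := by ring
  have hsub : {x | ENNReal.ofReal t < T f x} ⊆ {x | ENNReal.ofReal (t / 2) < T (f - b) x} ∪ U ∪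
      ({x | ENNReal.ofReal (t / 2) < T b x} ∩ Uᶜ) := by
    intro x hx
    by_contra hcon
    simp only [Set.mem_union, Set.mem_inter_iff, Set.mem_compl_iff, Set.mem_ofPred_eq, not_or,
      not_and', not_lt] at hcon
    obtain ⟨⟨h1, h2⟩, h3⟩ := hcon
    have h4 := hadd _ _ hg hb x
    rw [sub_add_cancel] at h4
    have h5 := h4.trans (add_le_add h1 (h3 h2))
    rw [← ENNReal.ofReal_add (by positivity) (by positivity), add_halves] at h5
    exact absurd hx (not_lt.2 h5)
  calc ENNReal.ofReal t * volume {x | ENNReal.ofReal t < T f x}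
      ≤ ENNReal.ofReal t * (volume {x | ENNReal.ofReal (t / 2) < T (f - b) x} + volume U +
        volume ({x | ENNReal.ofReal (t / 2) < T b x} ∩ Uᶜ)) := by
        gcongr
        refine (measure_mono hsub).trans ((measure_union_le _ _).trans ?_)
        gcongr
        exact measure_union_le _ _
    _ ≤ _ := by
        rw [mul_add, mul_add, add_mul, add_mul]
        exact add_le_add (add_le_add hgood hUvol) hbad

end WeakType

/-! ### Convolutions of integrable kernels with tame functions -/

section Conv

open Filter Topology FourierTransform

variable {n : ℕ}

/-- The convolution `κ * h`. -/
def cv (κ h : Space n → ℂ) (x : Space n) : ℂ := ∫ y, κ y * h (x - y)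

/-- The convolution of two nonnegative functions. -/
def lcv (u v : Space n → ℝ≥0∞) (x : Space n) : ℝ≥0∞ := ∫⁻ y, u y * v (x - y)

/-- Integrable kernels of bounded support. -/
structure IsKernel (κ : Space n → ℂ) : Prop where
  stronglyMeasurable : StronglyMeasurable κ
  integrable : Integrable κ
  support : ∃ R : ℝ, ∀ x, R < ‖x‖ → κ x = 0

theorem Tame.isKernel {κ : Space n → ℂ} (h : Tame κ) : IsKernel κ := ⟨h.1, h.integrable, h.2.2⟩

theorem measurable_lcv {u v : Space n → ℝ≥0∞} (hu : Measurable u) (hv : Measurable v) :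
    Measurable (lcv u v) := by
  have h : Measurable fun z : Space n × Space n => u z.2 * v (z.1 - z.2) :=
    (hu.comp measurable_snd).mul (hv.comp (measurable_fst.sub measurable_snd))
  exact h.lintegral_prod_right'

theorem lintegral_lcv {u v : Space n → ℝ≥0∞} (hu : Measurable u) (hv : Measurable v) :
    ∫⁻ x, lcv u v x = (∫⁻ y, u y) * ∫⁻ y, v y := by
  have h : Measurable fun z : Space n × Space n => u z.2 * v (z.1 - z.2) :=
    (hu.comp measurable_snd).mul (hv.comp (measurable_fst.sub measurable_snd))
  unfold lcv
  rw [lintegral_lintegral_swap h.aemeasurable]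
  have : ∀ y, ∫⁻ x, u y * v (x - y) = u y * ∫⁻ x, v x := fun y => by
    rw [lintegral_const_mul _ (by fun_prop),
      lintegral_sub_right_eq_self v y]
  simp_rw [this]
  rw [lintegral_mul_const _ hu]

/-- Cauchy–Schwarz with respect to the measure of density `u`. -/
theorem lcv_sq_le {u v : Space n → ℝ≥0∞} (hu : Measurable u) (hv : Measurable v) (x : Space n) :
    lcv u v x ^ (2 : ℝ) ≤ (∫⁻ y, u y) * lcv u (fun y => v y ^ (2 : ℝ)) x := by
  have hvx : Measurable fun y => v (x - y) := hv.comp (measurable_const.sub measurable_id)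
  have h := ENNReal.lintegral_mul_le_Lp_mul_Lq volume Real.HolderConjugate.two_two
    (f := fun y => u y ^ (1 / 2 : ℝ)) (g := fun y => u y ^ (1 / 2 : ℝ) * v (x - y))
    (hu.pow_const _).aemeasurable ((hu.pow_const _).mul hvx).aemeasurable
  have e1 : ∀ y, u y ^ (1 / 2 : ℝ) * (u y ^ (1 / 2 : ℝ) * v (x - y)) = u y * v (x - y) := fun y => by
    rw [← mul_assoc, ← ENNReal.rpow_add_of_nonneg _ _ (by norm_num) (by norm_num)]
    norm_num
  have e2 : ∀ y, (u y ^ (1 / 2 : ℝ)) ^ (2 : ℝ) = u y := fun y => by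
    rw [← ENNReal.rpow_mul]; norm_num
  simp only [Pi.mul_apply, e1, ENNReal.mul_rpow_of_nonneg _ _ two_pos.le, e2] at h
  have h2 := ENNReal.rpow_le_rpow h two_pos.le
  rw [ENNReal.mul_rpow_of_nonneg _ _ two_pos.le, ← ENNReal.rpow_mul, ← ENNReal.rpow_mul] at h2
  norm_num at h2
  unfold lcv
  simpa using h2

/-- Young's inequality `L¹ * L² ⊆ L²`. -/
theorem lintegral_lcv_sq_le {u v : Space n → ℝ≥0∞} (hu : Measurable u) (hv : Measurable v) :
    ∫⁻ x, lcv u v x ^ (2 : ℝ) ≤ (∫⁻ y, u y) ^ 2 * ∫⁻ y, v y ^ (2 : ℝ) := by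
  calc ∫⁻ x, lcv u v x ^ (2 : ℝ)
      ≤ ∫⁻ x, (∫⁻ y, u y) * lcv u (fun y => v y ^ (2 : ℝ)) x := lintegral_mono fun x => lcv_sq_le hu hv x
    _ = _ := by
        rw [lintegral_const_mul _ (measurable_lcv hu (hv.pow_const _)),
          lintegral_lcv hu (hv.pow_const _)]
        ring

theorem enorm_cv_le (κ h : Space n → ℂ) (x : Space n) :
    ‖cv κ h x‖ₑ ≤ lcv (fun y => ‖κ y‖ₑ) (fun y => ‖h y‖ₑ) x := by
  refine (enorm_integral_le_lintegral_enorm _).trans (le_of_eq ?_)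
  simp only [enorm_mul, lcv]

theorem IsKernel.integrable_mul {κ h : Space n → ℂ} (hκ : IsKernel κ) (hh : Tame h) (x : Space n) :
    Integrable fun y => κ y * h (x - y) := by
  obtain ⟨M, hM⟩ := hh.2.1
  refine hκ.integrable.mul_bdd (c := M) ?_ (Eventually.of_forall fun y => hM _)
  exact (hh.1.comp_measurable (measurable_const.sub measurable_id)).aestronglyMeasurable

theorem IsKernel.tame_cv {κ h : Space n → ℂ} (hκ : IsKernel κ) (hh : Tame h) : Tame (cv κ h) := by
  obtain ⟨M, hM⟩ := hh.2.1
  obtain ⟨R, hR⟩ := hh.2.2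
  obtain ⟨R', hR'⟩ := hκ.support
  refine ⟨?_, ⟨∫ y, ‖κ y‖ * M, fun x => ?_⟩, R + R', fun x hx => ?_⟩
  · have : StronglyMeasurable fun z : Space n × Space n => κ z.2 * h (z.1 - z.2) :=
      (hκ.stronglyMeasurable.comp_measurable measurable_snd).mul
        (hh.1.comp_measurable (measurable_fst.sub measurable_snd))
    exact this.integral_prod_right'
  · refine norm_integral_le_of_norm_le (hκ.integrable.norm.mul_const M)
      (Eventually.of_forall fun y => ?_)
    rw [norm_mul]
    gcongr
    exact hM _
  · refine integral_eq_zero_of_ae (Eventually.of_forall fun y => ?_)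
    by_cases hy : R' < ‖y‖
    · simp [hR' y hy]
    · have : R < ‖x - y‖ := by
        have := norm_sub_norm_le x y
        linarith
      simp [hR _ this]

theorem cv_add {κ f g : Space n → ℂ} (hκ : IsKernel κ) (hf : Tame f) (hg : Tame g) (x : Space n) :
    cv κ (f + g) x = cv κ f x + cv κ g x := by
  unfold cv
  rw [← integral_add (hκ.integrable_mul hf x) (hκ.integrable_mul hg x)]
  simp [mul_add]

theorem cv_zero (κ : Space n → ℂ) : cv κ 0 = 0 := by ext x; simp [cv]

theorem cv_sub_left {κ κ' f : Space n → ℂ} (hκ : IsKernel κ) (hκ' : IsKernel κ') (hf : Tame f)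
    (x : Space n) : cv (κ - κ') f x = cv κ f x - cv κ' f x := by
  unfold cv
  rw [← integral_sub (hκ.integrable_mul hf x) (hκ'.integrable_mul hf x)]
  simp [sub_mul]

theorem cv_sum {κ : Space n → ℂ} (hκ : IsKernel κ) {ι : Type*} (s : Finset ι)
    {f : ι → Space n → ℂ} (hf : ∀ i ∈ s, Tame (f i)) (x : Space n) :
    cv κ (∑ i ∈ s, f i) x = ∑ i ∈ s, cv κ (f i) x := by
  unfold cv
  rw [← integral_finsetSum _ fun i hi => hκ.integrable_mul (hf i hi) x]
  simp [Finset.mul_sum]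

theorem tendsto_cv {κ : Space n → ℂ} (hκ : IsKernel κ) {F : ℕ → Space n → ℂ} {f : Space n → ℂ}
    {M : ℝ} (hF : ∀ m, StronglyMeasurable (F m)) (hM : ∀ m x, ‖F m x‖ ≤ M)
    (hlim : ∀ᵐ x, Tendsto (fun m => F m x) atTop (𝓝 (f x))) (x : Space n) :
    Tendsto (fun m => cv κ (F m) x) atTop (𝓝 (cv κ f x)) := by
  refine tendsto_integral_of_dominated_convergence (fun y => ‖κ y‖ * M) (fun m => ?_)
    (hκ.integrable.norm.mul_const M) (fun m => Eventually.of_forall fun y => ?_) ?_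
  · exact hκ.integrable.1.mul
      ((hF m).comp_measurable (measurable_const.sub measurable_id)).aestronglyMeasurable
  · rw [norm_mul]; gcongr; exact hM _ _
  · have := (quasiMeasurePreserving_sub_left volume x).ae hlim
    filter_upwards [this] with y hy
    exact hy.const_mul _

/-- Transposition of a convolution operator. -/
theorem integral_cv_mul {κ f g : Space n → ℂ} (hκ : IsKernel κ) (hf : Tame f) (hg : Tame g) :
    ∫ x, cv κ f x * g x = ∫ x, f x * cv (fun y => κ (-y)) g x := by
  have hint : Integrable (fun z : Space n × Space n => κ z.2 * f (z.1 - z.2) * g z.1)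
      (volume.prod volume) := by
    obtain ⟨M, hM⟩ := hf.2.1
    have h1 : Integrable (fun z : Space n × Space n => g z.1 * κ z.2) (volume.prod volume) :=
      hg.integrable.mul_prod hκ.integrable
    have hm : StronglyMeasurable fun z : Space n × Space n => f (z.1 - z.2) :=
      hf.1.comp_measurable (measurable_fst.sub measurable_snd)
    have h2 := h1.mul_bdd (c := M) hm.aestronglyMeasurable (Eventually.of_forall fun z => hM _)
    refine h2.congr (Eventually.of_forall fun z => ?_)
    simp only; ring
  have h1 : ∫ x, cv κ f x * g x = ∫ x, ∫ y, κ y * f (x - y) * g x := by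
    simp only [cv, ← integral_mul_const]
  rw [h1, integral_integral_swap hint]
  have h2 : ∀ y, ∫ x, κ y * f (x - y) * g x = ∫ x, κ y * f x * g (x + y) := fun y => by
    rw [← integral_add_right_eq_self (fun x => κ y * f (x - y) * g x) y]
    simp
  simp_rw [h2]
  have hint2 : Integrable (fun z : Space n × Space n => κ z.1 * f z.2 * g (z.2 + z.1))
      (volume.prod volume) := by
    obtain ⟨M, hM⟩ := hg.2.1
    have hm : StronglyMeasurable fun z : Space n × Space n => g (z.2 + z.1) :=
      hg.1.comp_measurable (measurable_snd.add measurable_fst)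
    exact (hκ.integrable.mul_prod hf.integrable).mul_bdd (c := M) hm.aestronglyMeasurable
      (Eventually.of_forall fun z => hM _)
  rw [integral_integral_swap hint2]
  refine integral_congr_ae (Eventually.of_forall fun x => ?_)
  simp only [cv, ← integral_const_mul]
  rw [← integral_neg_eq_self]
  refine integral_congr_ae (Eventually.of_forall fun y => ?_)
  simp only [sub_eq_add_neg]
  ring

theorem IsKernel.reflect {κ : Space n → ℂ} (hκ : IsKernel κ) : IsKernel fun y => κ (-y) := by
  obtain ⟨R, hR⟩ := hκ.support
  exact ⟨hκ.stronglyMeasurable.comp_measurable measurable_neg, hκ.integrable.comp_neg, R,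
    fun x hx => hR _ (by rwa [norm_neg])⟩

/-! ### Plancherel's theorem for tame functions -/

theorem Tame.memLp_two {f : Space n → ℂ} (hf : Tame f) : MemLp f 2 volume := by
  refine ⟨hf.1.aestronglyMeasurable, ?_⟩
  have h := hf.lintegral_rpow_lt_top two_pos
  rw [eLpNorm_eq_lintegral_rpow_enorm_toReal two_ne_zero ENNReal.ofNat_ne_top]
  exact ENNReal.rpow_lt_top_of_nonneg (by positivity) (by simpa using h.ne)

theorem continuous_fourier {f : Space n → ℂ} (hf : Integrable f) : Continuous (𝓕 f) :=
  VectorFourier.fourierIntegral_continuous Real.continuous_fourierChar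
    (innerSL ℝ).continuous₂ hf

/-- The Fourier transform on `L²` is given by the Fourier integral, since both agree as tempered
distributions. -/
theorem Tame.fourier_ae_eq {f : Space n → ℂ} (hf : Tame f) :
    ((𝓕 (hf.memLp_two.toLp f) : Lp (α := Space n) ℂ 2 volume) : Space n → ℂ) =ᵐ[volume] 𝓕 f := by
  have hcont : Continuous (𝓕 f) := continuous_fourier hf.integrable
  refine ae_eq_of_integral_contDiff_smul_eq ((Lp.memLp _).locallyIntegrable one_le_two)
    hcont.locallyIntegrable fun g hg hgc => ?_
  have hgc' : HasCompactSupport (fun x => (g x : ℂ)) := hgc.comp_left (g := Complex.ofReal) rfl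
  set G : SchwartzMap (Space n) ℂ := hgc'.toSchwartzMap (by
    exact Complex.ofRealCLM.contDiff.comp hg) with hG
  have hGapp : ∀ x, G x = g x := fun x => rfl
  have h1 := congrArg (fun u => u G) (Lp.fourier_toTemperedDistribution_eq (hf.memLp_two.toLp f))
  simp only [TemperedDistribution.fourier_apply, Lp.toTemperedDistribution_apply] at h1
  have h2 : ∀ x, g x • ((𝓕 (hf.memLp_two.toLp f) : Lp (α := Space n) ℂ 2 volume) : Space n → ℂ) x
      = G x • ((𝓕 (hf.memLp_two.toLp f) : Lp (α := Space n) ℂ 2 volume) : Space n → ℂ) x := fun x => by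
    rw [hGapp]; simp
  simp_rw [h2]
  rw [← h1]
  have h3 : ∫ x, (𝓕 G) x • (hf.memLp_two.toLp f) x = ∫ x, (𝓕 (G : Space n → ℂ)) x • f x := by
    refine integral_congr_ae ?_
    filter_upwards [hf.memLp_two.coeFn_toLp] with x hx
    rw [hx, SchwartzMap.fourier_coe]
  rw [h3]
  have h4 := VectorFourier.integral_fourierIntegral_smul_eq_flip (μ := (volume : Measure (Space n)))
    (ν := (volume : Measure (Space n))) (L := innerₗ (Space n)) (f := (G : Space n → ℂ)) (g := f)
    Real.continuous_fourierChar (innerSL ℝ).continuous₂ G.integrable hf.integrable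
  rw [flip_innerₗ] at h4
  refine h4.trans (integral_congr_ae (Eventually.of_forall fun x => ?_))
  rfl

/-- **Plancherel's theorem**. -/
theorem Tame.lintegral_fourier_sq {f : Space n → ℂ} (hf : Tame f) :
    ∫⁻ ξ, ‖𝓕 f ξ‖ₑ ^ (2 : ℝ) = ∫⁻ x, ‖f x‖ₑ ^ (2 : ℝ) := by
  have h := congrArg (fun r => ENNReal.ofReal r) (Lp.norm_fourier_eq (hf.memLp_two.toLp f))
  simp only [ofReal_norm] at h
  rw [Lp.enorm_def, Lp.enorm_def, eLpNorm_congr_ae hf.fourier_ae_eq,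
    eLpNorm_congr_ae hf.memLp_two.coeFn_toLp,
    eLpNorm_eq_lintegral_rpow_enorm_toReal two_ne_zero ENNReal.ofNat_ne_top,
    eLpNorm_eq_lintegral_rpow_enorm_toReal two_ne_zero ENNReal.ofNat_ne_top] at h
  simp only [ENNReal.toReal_ofNat] at h
  exact ENNReal.rpow_left_injective (by norm_num) h

theorem fourier_cv {κ h : Space n → ℂ} (hκ : IsKernel κ) (hh : Tame h) (ξ : Space n) :
    𝓕 (cv κ h) ξ = 𝓕 κ ξ * 𝓕 h ξ :=
  Real.fourier_mul_convolution_eq hκ.integrable hh.integrable ξ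

theorem lintegral_cv_sq {κ h : Space n → ℂ} (hκ : IsKernel κ) (hh : Tame h) :
    ∫⁻ x, ‖cv κ h x‖ₑ ^ (2 : ℝ) = ∫⁻ ξ, ‖𝓕 κ ξ‖ₑ ^ (2 : ℝ) * ‖𝓕 h ξ‖ₑ ^ (2 : ℝ) := by
  rw [← (hκ.tame_cv hh).lintegral_fourier_sq]
  refine lintegral_congr fun ξ => ?_
  rw [fourier_cv hκ hh, enorm_mul, ENNReal.mul_rpow_of_nonneg _ _ two_pos.le]

/-- A family of convolution operators whose multipliers are square summable, uniformly in the
frequency, is bounded from `L²` to `L²(ℓ²)`. -/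
theorem tsum_lintegral_cv_sq_le {ι : Type*} [Countable ι] {κ : ι → Space n → ℂ}
    (hκ : ∀ i, IsKernel (κ i)) {h : Space n → ℂ} (hh : Tame h) {A : ℝ≥0∞}
    (hA : ∀ᵐ ξ, ∑' i, ‖𝓕 (κ i) ξ‖ₑ ^ (2 : ℝ) ≤ A) :
    ∑' i, ∫⁻ x, ‖cv (κ i) h x‖ₑ ^ (2 : ℝ) ≤ A * ∫⁻ x, ‖h x‖ₑ ^ (2 : ℝ) := by
  have hm : ∀ g : Space n → ℂ, Integrable g → Measurable fun ξ => ‖𝓕 g ξ‖ₑ ^ (2 : ℝ) :=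
    fun g hg => (continuous_fourier hg).measurable.enorm.pow_const _
  simp_rw [lintegral_cv_sq (hκ _) hh]
  have hmm : ∀ i, AEMeasurable (fun ξ => ‖𝓕 (κ i) ξ‖ₑ ^ (2 : ℝ) * ‖𝓕 h ξ‖ₑ ^ (2 : ℝ)) volume :=
    fun i => ((hm _ (hκ i).integrable).mul (hm _ hh.integrable)).aemeasurable
  rw [← lintegral_tsum hmm, ← hh.lintegral_fourier_sq, ← lintegral_const_mul _ (hm _ hh.integrable)]
  refine lintegral_mono_ae ?_
  filter_upwards [hA] with ξ hξ
  rw [ENNReal.tsum_mul_right]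
  gcongr

end Conv

/-! ### Differences of ball averages as a Littlewood–Paley family -/

section BallAverage

open Filter Topology FourierTransform

variable {n : ℕ}

/-- The kernel of the averaging operator over balls of radius `2 ^ i`. -/
def phi (i : ℤ) : Space n → ℂ :=
  (Metric.closedBall (0 : Space n) (2 ^ i)).indicator
    fun _ => (((volume.real (Metric.closedBall (0 : Space n) (2 ^ i)))⁻¹ : ℝ) : ℂ)

/-- The difference of two consecutive ball averages.  It plays the role of a Littlewood–Paley
projection to the frequencies of size `2 ^ (-i)`; only the decay of its Fourier transform at `0` and
at `∞`, and the `L¹` modulus of continuity, matter. -/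
def psi (i : ℤ) : Space n → ℂ := phi i - phi (i + 1)

theorem volume_real_closedBall_pos (i : ℤ) :
    0 < volume.real (Metric.closedBall (0 : Space n) (2 ^ i)) :=
  ENNReal.toReal_pos (Metric.measure_closedBall_pos _ _ (by positivity)).ne'
    measure_closedBall_lt_top.ne

theorem tame_phi (i : ℤ) : Tame (phi i : Space n → ℂ) := by
  refine ⟨stronglyMeasurable_const.indicator measurableSet_closedBall,
    ⟨_, fun x => norm_indicator_le_norm_self _ x⟩, 2 ^ i, fun x hx => ?_⟩
  exact Set.indicator_of_notMem (by simpa using hx) _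

theorem tame_psi (i : ℤ) : Tame (psi i : Space n → ℂ) := (tame_phi i).sub (tame_phi (i + 1))

theorem phi_neg (i : ℤ) (x : Space n) : phi i (-x) = phi i x := by
  simp [phi, Set.indicator]

theorem psi_neg (i : ℤ) (x : Space n) : psi i (-x) = psi i x := by
  simp [psi, phi_neg]

theorem psi_eq_zero {i : ℤ} {x : Space n} (hx : 2 ^ (i + 1) < ‖x‖) : psi i x = 0 := by
  have h : (2 : ℝ) ^ i ≤ 2 ^ (i + 1) := zpow_le_zpow_right₀ one_le_two (by omega)
  rw [psi, Pi.sub_apply, phi, phi, Set.indicator_of_notMem, Set.indicator_of_notMem, sub_zero]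
  · simpa using hx
  · simpa using h.trans_lt hx

theorem integral_phi (i : ℤ) : ∫ x : Space n, phi i x = 1 := by
  have h := volume_real_closedBall_pos (n := n) i
  simp_rw [phi]
  rw [integral_indicator measurableSet_closedBall, setIntegral_const, Complex.real_smul,
    ← Complex.ofReal_mul, mul_inv_cancel₀ h.ne', Complex.ofReal_one]

theorem lintegral_phi (i : ℤ) : ∫⁻ x : Space n, ‖phi i x‖ₑ = 1 := by
  have h := volume_real_closedBall_pos (n := n) i
  simp_rw [phi, enorm_indicator_eq_indicator_enorm]
  rw [lintegral_indicator measurableSet_closedBall, lintegral_const, Measure.restrict_apply_univ,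
    ← ofReal_norm, Complex.norm_real, Real.norm_of_nonneg (by positivity),
    ENNReal.ofReal_inv_of_pos h, measureReal_def, ENNReal.ofReal_toReal
      measure_closedBall_lt_top.ne, ENNReal.inv_mul_cancel _ measure_closedBall_lt_top.ne]
  exact (Metric.measure_closedBall_pos _ _ (by positivity)).ne'

theorem lintegral_psi_le (i : ℤ) : ∫⁻ x : Space n, ‖psi i x‖ₑ ≤ 2 := by
  calc ∫⁻ x : Space n, ‖psi i x‖ₑ ≤ ∫⁻ x : Space n, (‖phi i x‖ₑ + ‖phi (i + 1) x‖ₑ) :=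
        lintegral_mono fun x => enorm_sub_le
    _ = 2 := by
        rw [lintegral_add_left (tame_phi i).1.enorm, lintegral_phi, lintegral_phi, one_add_one_eq_two]

theorem one_add_pow_sub_one_le (n : ℕ) {u : ℝ} (h0 : 0 ≤ u) (h1 : u ≤ 1) :
    (1 + u) ^ n - 1 ≤ (2 ^ n - 1) * u := by
  induction n with
  | zero => simp
  | succ n ih =>
    have h2 : (1 : ℝ) ≤ 2 ^ n := one_le_pow₀ one_le_two
    have h3 : (2 ^ n - 1) * u * u ≤ (2 ^ n - 1) * u * 1 := by gcongr
    rw [pow_succ, pow_succ]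
    nlinarith

theorem measure_closedBall_sdiff_le (i : ℤ) (x y : Space n) :
    volume (Metric.closedBall x (2 ^ i) \ Metric.closedBall y (2 ^ i)) ≤
      ENNReal.ofReal (2 ^ n * (dist x y / 2 ^ i)) *
        volume (Metric.closedBall (0 : Space n) (2 ^ i)) := by
  have hR : (0 : ℝ) < 2 ^ i := by positivity
  set δ := dist x y
  rcases le_or_gt δ (2 ^ i) with h | h
  · have hsub : Metric.closedBall x (2 ^ i) \ Metric.closedBall y (2 ^ i) ⊆
        Metric.closedBall y (2 ^ i + δ) \ Metric.closedBall y (2 ^ i) :=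
      Set.sdiff_subset_sdiff_left (Metric.closedBall_subset_closedBall' le_rfl)
    refine (measure_mono hsub).trans ?_
    rw [measure_sdiff (Metric.closedBall_subset_closedBall (by simp [δ]))
      measurableSet_closedBall.nullMeasurableSet measure_closedBall_lt_top.ne,
      Measure.addHaar_closedBall _ _ (by positivity), Measure.addHaar_closedBall _ _ hR.le,
      Measure.addHaar_closedBall _ _ hR.le, ← ENNReal.sub_mul fun _ _ => measure_ball_lt_top.ne,
      ← mul_assoc, ← ENNReal.ofReal_mul (by positivity), ← ENNReal.ofReal_sub _ (by positivity)]
    gcongr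
    have h2 := one_add_pow_sub_one_le n (u := δ / 2 ^ i) (by positivity) ((div_le_one hR).2 h)
    have h3 : (2 ^ i + δ) ^ n = (1 + δ / 2 ^ i) ^ n * (2 ^ i) ^ n := by
      rw [← mul_pow]; congr 1; field_simp
    have h4 : (0 : ℝ) < (2 ^ i) ^ n := by positivity
    have h5 : 0 ≤ δ / 2 ^ i := by positivity
    rw [finrank_euclideanSpace_fin, h3]
    nlinarith
  · refine (measure_mono Set.sdiff_subset).trans ?_
    rw [Measure.addHaar_closedBall_center]
    conv_lhs => rw [← one_mul (volume _)]
    gcongr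
    rw [ENNReal.one_le_ofReal]
    have h2 : (1 : ℝ) ≤ 2 ^ n := one_le_pow₀ one_le_two
    have h3 : 1 ≤ δ / 2 ^ i := (one_le_div hR).2 h.le
    nlinarith

/-- The `L¹` modulus of continuity of the ball averages. -/
theorem lintegral_phi_sub_le (i : ℤ) (y z : Space n) :
    ∫⁻ x, ‖phi i (x - y) - phi i (x - z)‖ₑ ≤ ENNReal.ofReal (2 ^ (n + 1) * (dist y z / 2 ^ i)) := by
  have hv := volume_real_closedBall_pos (n := n) i
  set v := volume.real (Metric.closedBall (0 : Space n) (2 ^ i))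
  have hv' : volume (Metric.closedBall (0 : Space n) (2 ^ i)) = ENNReal.ofReal v := by
    rw [show v = volume.real _ from rfl, measureReal_def,
      ENNReal.ofReal_toReal measure_closedBall_lt_top.ne]
  set S : Set (Space n) := Metric.closedBall y (2 ^ i) \ Metric.closedBall z (2 ^ i)
  set S' : Set (Space n) := Metric.closedBall z (2 ^ i) \ Metric.closedBall y (2 ^ i)
  have hS : MeasurableSet S := measurableSet_closedBall.diff measurableSet_closedBall
  have hS' : MeasurableSet S' := measurableSet_closedBall.diff measurableSet_closedBall
  have hmem : ∀ x w : Space n, phi i (x - w) =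
      (Metric.closedBall w (2 ^ i)).indicator (fun _ => ((v⁻¹ : ℝ) : ℂ)) x := by
    intro x w
    simp [phi, Set.indicator, dist_eq_norm, v]
  have hle : ∀ x, ‖phi i (x - y) - phi i (x - z)‖ₑ ≤
      S.indicator (fun _ => ENNReal.ofReal v⁻¹) x + S'.indicator (fun _ => ENNReal.ofReal v⁻¹) x := by
    intro x
    have hc : ‖((v⁻¹ : ℝ) : ℂ)‖ₑ = ENNReal.ofReal v⁻¹ := by
      rw [← ofReal_norm, Complex.norm_real, Real.norm_of_nonneg (by positivity)]
    rw [hmem, hmem]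
    by_cases h1 : x ∈ Metric.closedBall y (2 ^ i) <;> by_cases h2 : x ∈ Metric.closedBall z (2 ^ i)
    · simp only [Set.indicator_of_mem h1, Set.indicator_of_mem h2, sub_self, enorm_zero, zero_le]
    · have h3 : x ∈ S := ⟨h1, h2⟩
      simp only [Set.indicator_of_mem h1, Set.indicator_of_notMem h2, sub_zero,
        Set.indicator_of_mem h3, hc]
      exact le_self_add
    · have h3 : x ∈ S' := ⟨h2, h1⟩
      simp only [Set.indicator_of_notMem h1, Set.indicator_of_mem h2, zero_sub, enorm_neg,
        Set.indicator_of_mem h3, hc]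
      exact le_add_self
    · simp only [Set.indicator_of_notMem h1, Set.indicator_of_notMem h2, sub_self, enorm_zero,
        zero_le]
  calc ∫⁻ x, ‖phi i (x - y) - phi i (x - z)‖ₑ
      ≤ ∫⁻ x, (S.indicator (fun _ => ENNReal.ofReal v⁻¹) x +
        S'.indicator (fun _ => ENNReal.ofReal v⁻¹) x) := lintegral_mono hle
    _ = ENNReal.ofReal v⁻¹ * volume S + ENNReal.ofReal v⁻¹ * volume S' := by
        rw [lintegral_add_left (measurable_const.indicator hS), lintegral_indicator hS,
          lintegral_indicator hS']
        simp
    _ ≤ ENNReal.ofReal v⁻¹ * (ENNReal.ofReal (2 ^ n * (dist y z / 2 ^ i)) * ENNReal.ofReal v) +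
        ENNReal.ofReal v⁻¹ * (ENNReal.ofReal (2 ^ n * (dist y z / 2 ^ i)) * ENNReal.ofReal v) := by
        rw [← hv']
        gcongr
        · exact measure_closedBall_sdiff_le i y z
        · rw [dist_comm]; exact measure_closedBall_sdiff_le i z y
    _ = _ := by
        rw [← ENNReal.ofReal_mul (by positivity), ← ENNReal.ofReal_mul (by positivity),
          ← ENNReal.ofReal_add (by positivity) (by positivity)]
        congr 1
        field_simp
        ring

theorem lintegral_psi_sub_le (i : ℤ) (y z : Space n) :
    ∫⁻ x, ‖psi i (x - y) - psi i (x - z)‖ₑ ≤ ENNReal.ofReal (2 ^ (n + 2) * (dist y z / 2 ^ i)) := by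
  have hm : ∀ (k : ℤ) (w : Space n), StronglyMeasurable fun x => phi k (x - w) := fun k w =>
    (tame_phi k).1.comp_measurable (measurable_id.sub_const w)
  calc ∫⁻ x, ‖psi i (x - y) - psi i (x - z)‖ₑ
      ≤ ∫⁻ x, (‖phi i (x - y) - phi i (x - z)‖ₑ + ‖phi (i + 1) (x - y) - phi (i + 1) (x - z)‖ₑ) := by
        refine lintegral_mono fun x => ?_
        have : psi i (x - y) - psi i (x - z) = (phi i (x - y) - phi i (x - z)) -
          (phi (i + 1) (x - y) - phi (i + 1) (x - z)) := by simp only [psi, Pi.sub_apply]; ring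
        rw [this]
        exact enorm_sub_le
    _ ≤ ENNReal.ofReal (2 ^ (n + 1) * (dist y z / 2 ^ i)) +
        ENNReal.ofReal (2 ^ (n + 1) * (dist y z / 2 ^ (i + 1))) := by
        rw [lintegral_add_left (f := fun x => ‖phi i (x - y) - phi i (x - z)‖ₑ)
          ((hm _ _).sub (hm _ _)).enorm]
        exact add_le_add (lintegral_phi_sub_le _ _ _) (lintegral_phi_sub_le _ _ _)
    _ ≤ _ := by
        rw [← ENNReal.ofReal_add (by positivity) (by positivity)]
        refine ENNReal.ofReal_le_ofReal ?_
        have h : dist y z / (2 : ℝ) ^ (i + 1) ≤ dist y z / 2 ^ i := by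
          gcongr
          · exact one_le_two
          · omega
        rw [pow_succ 2 (n + 1)]
        have : (0 : ℝ) < 2 ^ (n + 1) := by positivity
        nlinarith

/-- Cancellation: a mean-zero function living at a scale `r` smaller than `2 ^ i` has a small
convolution with `psi i`. -/
theorem lintegral_cv_psi_le (i : ℤ) {b : Space n → ℂ} (hb : Tame b) {c : Space n} {r : ℝ}
    (hsupp : ∀ x, x ∉ Metric.closedBall c r → b x = 0) (hmean : ∫ x, b x = 0) :
    ∫⁻ x, ‖cv (psi i) b x‖ₑ ≤ ENNReal.ofReal (2 ^ (n + 2) * min 1 (r / 2 ^ i)) * ∫⁻ x, ‖b x‖ₑ := by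
  have h1 : ∫⁻ x, ‖cv (psi i) b x‖ₑ ≤ 2 * ∫⁻ x, ‖b x‖ₑ := by
    refine (lintegral_mono fun x => enorm_cv_le _ _ x).trans ?_
    rw [lintegral_lcv (tame_psi i).1.enorm hb.1.enorm]
    gcongr
    exact lintegral_psi_le i
  have hjm : Measurable fun z : Space n × Space n =>
      ‖psi i (z.1 - z.2) - psi i (z.1 - c)‖ₑ * ‖b z.2‖ₑ := by
    have e1 : StronglyMeasurable fun z : Space n × Space n => psi i (z.1 - z.2) :=
      (tame_psi i).1.comp_measurable (measurable_fst.sub measurable_snd)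
    have e2 : StronglyMeasurable fun z : Space n × Space n => psi i (z.1 - c) :=
      (tame_psi i).1.comp_measurable (measurable_fst.sub_const c)
    exact (e1.sub e2).enorm.mul (hb.1.enorm.comp measurable_snd)
  have h2 : ∫⁻ x, ‖cv (psi i) b x‖ₑ ≤ ENNReal.ofReal (2 ^ (n + 2) * (r / 2 ^ i)) * ∫⁻ x, ‖b x‖ₑ := by
    calc ∫⁻ x, ‖cv (psi i) b x‖ₑ
        ≤ ∫⁻ x, ∫⁻ y, ‖psi i (x - y) - psi i (x - c)‖ₑ * ‖b y‖ₑ := by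
          refine lintegral_mono fun x => ?_
          have e1 : cv (psi i) b x = ∫ y, psi i (x - y) * b y := by
            rw [cv, ← integral_sub_left_eq_self _ _ x]
            simp
          have hint : Integrable fun y => psi i (x - y) * b y := by
            have := (tame_psi i).isKernel.integrable_mul hb x
            have h3 := this.comp_sub_left x
            simpa using h3
          have e2 : cv (psi i) b x = ∫ y, (psi i (x - y) - psi i (x - c)) * b y := by
            simp only [sub_mul]
            rw [integral_sub hint (hb.integrable.const_mul _), integral_const_mul, hmean, mul_zero,
              sub_zero, e1]
          rw [e2]
          refine (enorm_integral_le_lintegral_enorm _).trans (le_of_eq ?_)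
          simp only [enorm_mul]
      _ = ∫⁻ y, (∫⁻ x, ‖psi i (x - y) - psi i (x - c)‖ₑ) * ‖b y‖ₑ := by
          rw [lintegral_lintegral_swap hjm.aemeasurable]
          refine lintegral_congr fun y => ?_
          rw [lintegral_mul_const' _ _ enorm_ne_top]
      _ ≤ ∫⁻ y, ENNReal.ofReal (2 ^ (n + 2) * (r / 2 ^ i)) * ‖b y‖ₑ := by
          refine lintegral_mono fun y => ?_
          by_cases hy : y ∈ Metric.closedBall c r
          · refine mul_le_mul_left ((lintegral_psi_sub_le i y c).trans ?_) _
            refine ENNReal.ofReal_le_ofReal ?_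
            gcongr
            exact hy
          · simp [hsupp y hy]
      _ = _ := lintegral_const_mul' _ _ ENNReal.ofReal_ne_top
  rcases min_cases 1 (r / (2 : ℝ) ^ i) with ⟨h, _⟩ | ⟨h, _⟩
  · rw [h]
    refine h1.trans ?_
    gcongr
    rw [← ENNReal.ofReal_ofNat]
    refine ENNReal.ofReal_le_ofReal ?_
    have : (1 : ℝ) ≤ 2 ^ n := one_le_pow₀ one_le_two
    rw [pow_add]
    linarith
  · rw [h]; exact h2

theorem norm_cexp_sub_one_le (t : ℝ) : ‖Complex.exp ((t : ℂ) * Complex.I) - 1‖ ≤ |t| := by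
  rw [mul_comm]
  exact Real.norm_exp_I_mul_ofReal_sub_one_le

theorem integral_norm_phi (i : ℤ) : ∫ x : Space n, ‖phi i x‖ = 1 := by
  rw [integral_norm_eq_lintegral_enorm (tame_phi i).1.aestronglyMeasurable, lintegral_phi,
    ENNReal.toReal_one]

theorem norm_fourier_phi_sub_one_le (i : ℤ) (ξ : Space n) :
    ‖𝓕 (phi i : Space n → ℂ) ξ - 1‖ ≤ 2 * Real.pi * (2 ^ i * ‖ξ‖) := by
  have hint := (tame_phi (n := n) i).integrable
  have h1 : Integrable fun v : Space n =>
      Complex.exp ((↑(-2 * Real.pi * inner ℝ v ξ) * Complex.I)) • phi i v := by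
    have := (Real.fourierIntegral_convergent_iff (f := (phi i : Space n → ℂ)) ξ).2 hint
    refine this.congr (Eventually.of_forall fun v => ?_)
    simp only [Circle.smul_def, Real.fourierChar_apply, mul_neg, neg_mul]
  rw [Real.fourier_eq', ← integral_phi (n := n) i, ← integral_sub h1 hint]
  calc ‖∫ v : Space n, (Complex.exp ((↑(-2 * Real.pi * inner ℝ v ξ) * Complex.I)) • phi i v -
        phi i v)‖ ≤ ∫ v : Space n, 2 * Real.pi * (2 ^ i * ‖ξ‖) * ‖phi i v‖ := by
        refine norm_integral_le_of_norm_le (hint.norm.const_mul _) (Eventually.of_forall fun v => ?_)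
        rw [smul_eq_mul, ← sub_one_mul, norm_mul]
        by_cases hv : v ∈ Metric.closedBall (0 : Space n) (2 ^ i)
        · gcongr
          refine (norm_cexp_sub_one_le _).trans ?_
          rw [abs_mul, abs_mul, abs_neg, abs_two, abs_of_pos Real.pi_pos]
          gcongr
          refine (abs_real_inner_le_norm v ξ).trans ?_
          gcongr
          simpa using hv
        · simp [phi, Set.indicator_of_notMem hv]
    _ = _ := by rw [integral_const_mul, integral_norm_phi, mul_one]

/-- The decay of the Fourier transform follows from the `L¹` modulus of continuity, by translating
by half a period. -/
theorem norm_fourier_phi_le (i : ℤ) {ξ : Space n} (hξ : ξ ≠ 0) :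
    ‖𝓕 (phi i : Space n → ℂ) ξ‖ ≤ 2 ^ n / (2 ^ i * ‖ξ‖) := by
  have hξ' : 0 < ‖ξ‖ := norm_pos_iff.2 hξ
  set y : Space n := (1 / (2 * ‖ξ‖ ^ 2)) • ξ with hy
  have hinner : inner ℝ y ξ = (1 / 2 : ℝ) := by
    rw [hy, real_inner_smul_left, real_inner_self_eq_norm_sq]
    field_simp
  have hynorm : ‖y‖ = 1 / (2 * ‖ξ‖) := by
    rw [hy, norm_smul, Real.norm_of_nonneg (by positivity)]
    field_simp
  have hint : Integrable (phi i : Space n → ℂ) := (tame_phi i).integrable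
  have hint' : Integrable fun x : Space n => phi i (x - y) := hint.comp_sub_right y
  have hconv : ∀ f : Space n → ℂ, Integrable f → Integrable fun v : Space n =>
      Complex.exp ((↑(-2 * Real.pi * inner ℝ v ξ) * Complex.I)) • f v := fun f hf => by
    have := (Real.fourierIntegral_convergent_iff (f := f) ξ).2 hf
    refine this.congr (Eventually.of_forall fun v => ?_)
    simp only [Circle.smul_def, Real.fourierChar_apply, mul_neg, neg_mul]
  have htrans : ∫ v : Space n, Complex.exp ((↑(-2 * Real.pi * inner ℝ v ξ) * Complex.I)) •
      phi i (v - y) = -𝓕 (phi i : Space n → ℂ) ξ := by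
    rw [Real.fourier_eq', ← integral_neg,
      ← integral_add_right_eq_self (fun v : Space n =>
        Complex.exp ((↑(-2 * Real.pi * inner ℝ v ξ) * Complex.I)) • phi i (v - y)) y]
    refine integral_congr_ae (Eventually.of_forall fun v => ?_)
    simp only [add_sub_cancel_right, inner_add_left, hinner, smul_eq_mul]
    have : Complex.exp (↑(-2 * Real.pi * (inner ℝ v ξ + 1 / 2)) * Complex.I) =
        Complex.exp ((↑(-2 * Real.pi * inner ℝ v ξ) * Complex.I)) * Complex.exp (-(Real.pi * Complex.I)) := by
      rw [← Complex.exp_add]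
      congr 1
      push_cast
      ring
    rw [this, Complex.exp_neg, Complex.exp_pi_mul_I]
    ring
  have h2 : 2 * ‖𝓕 (phi i : Space n → ℂ) ξ‖ ≤ 2 ^ (n + 1) * (‖y‖ / 2 ^ i) := by
    have e : (2 : ℂ) * 𝓕 (phi i : Space n → ℂ) ξ = ∫ v : Space n,
        Complex.exp ((↑(-2 * Real.pi * inner ℝ v ξ) * Complex.I)) • (phi i (v - 0) - phi i (v - y)) := by
      simp only [smul_sub, sub_zero]
      rw [integral_sub (hconv _ hint) (hconv _ hint'), htrans, Real.fourier_eq']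
      ring
    have e2 : 2 * ‖𝓕 (phi i : Space n → ℂ) ξ‖ = ‖(2 : ℂ) * 𝓕 (phi i : Space n → ℂ) ξ‖ := by
      rw [norm_mul]; simp
    rw [e2, e]
    refine (norm_integral_le_lintegral_norm _).trans ?_
    refine ENNReal.toReal_le_of_le_ofReal (by positivity) ?_
    have h3 := lintegral_phi_sub_le (n := n) i 0 y
    rw [dist_zero_left] at h3
    refine le_trans (lintegral_mono fun v => ?_) h3
    rw [ofReal_norm, enorm_smul]
    have : ‖Complex.exp ((↑(-2 * Real.pi * inner ℝ v ξ) * Complex.I))‖ₑ = 1 := by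
      rw [← ofReal_norm, Complex.norm_exp_ofReal_mul_I, ENNReal.ofReal_one]
    rw [this, one_mul]
  rw [hynorm] at h2
  have h4 : (2 : ℝ) ^ (n + 1) * (1 / (2 * ‖ξ‖) / 2 ^ i) = 2 ^ n / (2 ^ i * ‖ξ‖) := by
    field_simp
    ring
  rw [h4] at h2
  have := norm_nonneg (𝓕 (phi i : Space n → ℂ) ξ)
  linarith

/-- At the frequencies of size `2 ^ r`, the transform of `ψ_i` is `O(2 ^ (-|i + r|))`: small
frequencies by the cancellation between the two averages, large ones by the decay of each. -/
theorem norm_fourier_psi_le (i r : ℤ) {ξ : Space n} (h₁ : 2 ^ r ≤ ‖ξ‖) (h₂ : ‖ξ‖ < 2 ^ (r + 1)) :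
    ‖𝓕 (psi i : Space n → ℂ) ξ‖ ≤ 48 * 2 ^ n * (1 / 2) ^ (i + r).natAbs := by
  have hr : (0 : ℝ) < 2 ^ r := by positivity
  have hξ : ξ ≠ 0 := norm_pos_iff.1 (hr.trans_le h₁)
  have hsub : 𝓕 (psi i : Space n → ℂ) ξ = 𝓕 (phi i : Space n → ℂ) ξ - 𝓕 (phi (i + 1)) ξ := by
    have hconv := fun k : ℤ => (Real.fourierIntegral_convergent_iff (f := (phi k : Space n → ℂ)) ξ).2
      (tame_phi k).integrable
    rw [Real.fourier_eq, Real.fourier_eq, Real.fourier_eq, ← integral_sub (hconv i) (hconv (i + 1))]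
    simp only [psi, Pi.sub_apply, smul_sub]
  have h2n : (1 : ℝ) ≤ 2 ^ n := one_le_pow₀ one_le_two
  have hi1 : (2 : ℝ) ^ (i + 1) = 2 * 2 ^ i := by rw [zpow_add₀ two_ne_zero, zpow_one]; ring
  have hr1 : (2 : ℝ) ^ (r + 1) = 2 * 2 ^ r := by rw [zpow_add₀ two_ne_zero, zpow_one]; ring
  have hir : (2 : ℝ) ^ i * 2 ^ r = 2 ^ (i + r) := by rw [zpow_add₀ two_ne_zero]
  have hi : (0 : ℝ) < 2 ^ i := by positivity
  rcases le_total 0 (i + r) with h | h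
  · obtain ⟨m, hm⟩ := Int.eq_ofNat_of_zero_le h
    have e1 := norm_fourier_phi_le (n := n) i hξ
    have e2 := norm_fourier_phi_le (n := n) (i + 1) hξ
    have e3 : (2 : ℝ) ^ n / (2 ^ i * ‖ξ‖) ≤ 2 ^ n / 2 ^ (i + r) := by
      rw [← hir]; gcongr
    have e4 : (2 : ℝ) ^ n / (2 ^ (i + 1) * ‖ξ‖) ≤ 2 ^ n / 2 ^ (i + r) := by
      rw [← hir, hi1]; gcongr
      nlinarith
    have e5 : (2 : ℝ) ^ n / 2 ^ (i + r) = 2 ^ n * (1 / 2) ^ m := by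
      rw [hm, zpow_natCast, one_div, inv_pow]
      rfl
    rw [hsub, hm]
    refine (norm_sub_le _ _).trans ?_
    rw [Int.natAbs_natCast]
    have : (0 : ℝ) ≤ 2 ^ n * (1 / 2) ^ m := by positivity
    rw [e5] at e3 e4
    linarith
  · obtain ⟨m, hm⟩ := Int.eq_ofNat_of_zero_le (neg_nonneg.2 h)
    have hm' : i + r = -(m : ℤ) := by omega
    have e1 := norm_fourier_phi_sub_one_le (n := n) i ξ
    have e2 := norm_fourier_phi_sub_one_le (n := n) (i + 1) ξ
    have e3 : (2 : ℝ) ^ i * ‖ξ‖ ≤ 2 * 2 ^ (i + r) := by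
      rw [← hir]; nlinarith
    have e5 : (2 : ℝ) ^ (i + r) = (1 / 2) ^ m := by
      rw [hm', zpow_neg, zpow_natCast, one_div, inv_pow]
    have e6 : ‖𝓕 (psi i : Space n → ℂ) ξ‖ ≤
        2 * Real.pi * (2 ^ i * ‖ξ‖) + 2 * Real.pi * (2 ^ (i + 1) * ‖ξ‖) := by
      rw [hsub, ← sub_sub_sub_cancel_right _ _ 1]
      exact (norm_sub_le _ _).trans (add_le_add e1 e2)
    rw [hi1] at e6
    rw [hm', Int.natAbs_neg, Int.natAbs_natCast]
    have hpi := Real.pi_lt_four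
    have hpi0 := Real.pi_pos
    rw [e5] at e3
    have hm0 : (0 : ℝ) ≤ (1 / 2) ^ m := by positivity
    calc ‖𝓕 (psi i : Space n → ℂ) ξ‖ ≤ 6 * Real.pi * (2 ^ i * ‖ξ‖) := by linarith
      _ ≤ 6 * 4 * (2 * (1 / 2) ^ m) := by gcongr
      _ = 48 * 1 * (1 / 2) ^ m := by ring
      _ ≤ _ := by gcongr

theorem cv_phi_eq_average (i : ℤ) (f : Space n → ℂ) (x : Space n) :
    cv (phi i) f x = ⨍ y in Metric.closedBall x (2 ^ i), f y := by
  have h1 : cv (phi i) f x = ∫ y, phi i (x - y) * f y := by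
    rw [cv, ← integral_sub_left_eq_self _ _ x]
    simp
  have h2 : ∀ y, phi i (x - y) * f y = (Metric.closedBall x (2 ^ i)).indicator (fun y =>
      (((volume.real (Metric.closedBall (0 : Space n) (2 ^ i)))⁻¹ : ℝ) : ℂ) * f y) y := by
    intro y
    simp [phi, Set.indicator, dist_eq_norm, norm_sub_rev]
  rw [h1]
  simp_rw [h2]
  rw [integral_indicator measurableSet_closedBall, integral_const_mul, setAverage_eq,
    Complex.real_smul, measureReal_def, measureReal_def,
    Measure.addHaar_closedBall_center volume x]

theorem ae_tendsto_cv_phi {f : Space n → ℂ} (hf : Tame f) (j : ℤ) :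
    ∀ᵐ x, Tendsto (fun m : ℕ => cv (phi (j - m)) f x) atTop (𝓝 (f x)) := by
  filter_upwards [IsUnifLocDoublingMeasure.ae_tendsto_average (μ := volume)
    hf.integrable.locallyIntegrable 1] with x hx
  simp_rw [cv_phi_eq_average]
  refine hx (fun _ => x) (fun m : ℕ => (2 : ℝ) ^ (j - m)) (tendsto_nhdsWithin_iff.2
    ⟨?_, Eventually.of_forall fun m => ?_⟩) (Eventually.of_forall fun m => ?_)
  · have : Tendsto (fun m : ℕ => (2 : ℝ) ^ j * (1 / 2 : ℝ) ^ m) atTop (𝓝 (2 ^ j * 0)) :=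
      (tendsto_pow_atTop_nhds_zero_of_lt_one (by norm_num) (by norm_num)).const_mul _
    rw [mul_zero] at this
    refine this.congr fun m => ?_
    rw [zpow_sub₀ two_ne_zero, zpow_natCast]
    simp [div_eq_mul_inv]
  · exact Set.mem_Ioi.2 (by positivity)
  · rw [Metric.mem_closedBall, dist_self]; positivity

theorem norm_cv_phi_le {f : Space n → ℂ} {M : ℝ} (hM : ∀ x, ‖f x‖ ≤ M) (i : ℤ)
    (x : Space n) : ‖cv (phi i) f x‖ ≤ M := by
  calc ‖cv (phi i) f x‖ ≤ ∫ y : Space n, ‖phi i y‖ * M := by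
        refine norm_integral_le_of_norm_le ((tame_phi i).integrable.norm.mul_const M)
          (Eventually.of_forall fun y => ?_)
        rw [norm_mul]
        gcongr
        exact hM _
    _ = M := by rw [integral_mul_const, integral_norm_phi, one_mul]

/-- Averages over large balls vanish in the limit, the volume of the balls tending to infinity. -/
theorem tendsto_cv_phi_zero (hn : 1 ≤ n) {f : Space n → ℂ} (hf : Tame f) (j : ℤ) (x : Space n) :
    Tendsto (fun m : ℕ => cv (phi (j + m)) f x) atTop (𝓝 0) := by
  set V := volume.real (Metric.ball (0 : Space n) 1)
  have hV : 0 < V := ENNReal.toReal_pos (Metric.measure_ball_pos _ _ one_pos).ne'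
    measure_ball_lt_top.ne
  have hvol : ∀ m : ℕ, volume.real (Metric.closedBall (0 : Space n) (2 ^ (j + m))) =
      (2 ^ (j + m)) ^ n * V := fun m => by
    rw [measureReal_def, Measure.addHaar_closedBall _ _ (by positivity), ENNReal.toReal_mul,
      ENNReal.toReal_ofReal (by positivity), finrank_euclideanSpace_fin]
    rfl
  have hbound : ∀ m : ℕ, ‖cv (phi (j + m)) f x‖ ≤
      ((2 ^ j) ^ n * V)⁻¹ * (∫ y, ‖f y‖) * (1 / 2) ^ m := by
    intro m
    have h1 : ∀ y : Space n, ‖phi (j + m) y‖ ≤ ((2 ^ (j + m)) ^ n * V)⁻¹ := by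
      intro y
      refine (norm_indicator_le_norm_self _ y).trans ?_
      rw [hvol, Complex.norm_real, Real.norm_of_nonneg (by positivity)]
    have h2 : ((2 : ℝ) ^ (j + m)) ^ n ≥ (2 ^ j) ^ n * 2 ^ m := by
      rw [zpow_add₀ two_ne_zero, mul_pow, zpow_natCast]
      gcongr
      exact le_self_pow₀ (one_le_pow₀ one_le_two) (by omega)
    calc ‖cv (phi (j + m)) f x‖ ≤ ∫ y, ((2 ^ (j + m)) ^ n * V)⁻¹ * ‖f (x - y)‖ := by
          refine norm_integral_le_of_norm_le ((hf.integrable.comp_sub_left x).norm.const_mul _)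
            (Eventually.of_forall fun y => ?_)
          rw [norm_mul]
          gcongr
          exact h1 y
      _ = ((2 ^ (j + m)) ^ n * V)⁻¹ * ∫ y, ‖f y‖ := by
          rw [integral_const_mul, integral_sub_left_eq_self (fun y => ‖f y‖) volume x]
      _ ≤ ((2 ^ j) ^ n * 2 ^ m * V)⁻¹ * ∫ y, ‖f y‖ := by
          gcongr
      _ = _ := by
          rw [one_div, inv_pow, mul_inv, mul_inv, mul_inv]; ring
  refine squeeze_zero_norm hbound ?_
  have := (tendsto_pow_atTop_nhds_zero_of_lt_one (r := (1 / 2 : ℝ)) (by norm_num)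
    (by norm_num)).const_mul (((2 ^ j) ^ n * V)⁻¹ * (∫ y, ‖f y‖))
  rwa [mul_zero] at this

theorem sum_psi (j : ℤ) (m : ℕ) : ∑ k ∈ Finset.Ico (-m : ℤ) m, (psi (j - k) : Space n → ℂ) =
    phi (j - m + 1) - phi (j + m + 1) := by
  induction m with
  | zero => simp
  | succ m ih =>
    have h1 : Finset.Ico (-((m + 1 : ℕ) : ℤ)) ((m + 1 : ℕ) : ℤ) =
        insert (-(m : ℤ) - 1) (insert (m : ℤ) (Finset.Ico (-m : ℤ) m)) := by
      ext k
      simp only [Finset.mem_Ico, Finset.mem_insert]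
      omega
    rw [h1, Finset.sum_insert, Finset.sum_insert, ih]
    · rw [psi, psi, show j - (-(m : ℤ) - 1) = j + m + 1 by ring,
        show j - ((m + 1 : ℕ) : ℤ) + 1 = j - m by push_cast; ring,
        show j + ((m + 1 : ℕ) : ℤ) + 1 = j + m + 1 + 1 by push_cast; ring]
      abel
    · simp
    · simp only [Finset.mem_insert, Finset.mem_Ico]; omega

end BallAverage

/-! ### The `2`-variation over a dyadic interval -/

section Variation

open Filter Topology

/-- The square of `dyadicVariation`. -/
def variationSq (a : ℝ → ℂ) (j : ℤ) : ℝ≥0∞ :=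
  ⨆ (N : ℕ) (t : ℕ → ℝ) (_ : StrictMonoOn t (Set.Iic N))
    (_ : ∀ l ≤ N, t l ∈ Set.Icc ((2 : ℝ) ^ j) ((2 : ℝ) ^ (j + 1))),
    ∑ l ∈ Finset.range N, ‖a (t (l + 1)) - a (t l)‖ₑ ^ 2

theorem dyadicVariation_eq (a : ℝ → ℂ) (j : ℤ) :
    dyadicVariation a j = variationSq a j ^ (1 / 2 : ℝ) := rfl

theorem rpow_half_sq (x : ℝ≥0∞) : (x ^ (1 / 2 : ℝ)) ^ 2 = x := by
  rw [← ENNReal.rpow_natCast, ← ENNReal.rpow_mul]; norm_num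

theorem sq_rpow_half (x : ℝ≥0∞) : (x ^ 2) ^ (1 / 2 : ℝ) = x := by
  rw [← ENNReal.rpow_natCast, ← ENNReal.rpow_mul]; norm_num

theorem rpow_half_le_iff {x y : ℝ≥0∞} : x ^ (1 / 2 : ℝ) ≤ y ↔ x ≤ y ^ 2 := by
  constructor
  · intro h
    rw [← rpow_half_sq x]
    gcongr
  · intro h
    rw [← sq_rpow_half y]
    gcongr

theorem dyadicVariation_sq (a : ℝ → ℂ) (j : ℤ) : dyadicVariation a j ^ 2 = variationSq a j :=
  rpow_half_sq _

theorem add_sq_le_ennreal (a b : ℝ≥0∞) : (a + b) ^ 2 ≤ 2 * (a ^ 2 + b ^ 2) := by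
  have h := ENNReal.rpow_add_le_mul_rpow_add_rpow a b one_le_two
  norm_num at h
  exact h

theorem sum_sq_le_sum_sq {ι : Type*} (s : Finset ι) (u : ι → ℝ≥0∞) :
    ∑ i ∈ s, u i ^ 2 ≤ (∑ i ∈ s, u i) ^ 2 := by
  rw [sq, Finset.sum_mul]
  refine Finset.sum_le_sum fun i hi => ?_
  rw [sq]
  exact mul_le_mul_right (Finset.single_le_sum_of_canonicallyOrdered hi) _

theorem variationSq_le_iff {a : ℝ → ℂ} {j : ℤ} {B : ℝ≥0∞} : variationSq a j ≤ B ↔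
    ∀ (N : ℕ) (t : ℕ → ℝ), StrictMonoOn t (Set.Iic N) →
      (∀ l ≤ N, t l ∈ Set.Icc ((2 : ℝ) ^ j) ((2 : ℝ) ^ (j + 1))) →
      ∑ l ∈ Finset.range N, ‖a (t (l + 1)) - a (t l)‖ₑ ^ 2 ≤ B := by
  simp only [variationSq, iSup_le_iff]

theorem le_variationSq {a : ℝ → ℂ} {j : ℤ} {N : ℕ} {t : ℕ → ℝ} (ht : StrictMonoOn t (Set.Iic N))
    (htI : ∀ l ≤ N, t l ∈ Set.Icc ((2 : ℝ) ^ j) ((2 : ℝ) ^ (j + 1))) :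
    ∑ l ∈ Finset.range N, ‖a (t (l + 1)) - a (t l)‖ₑ ^ 2 ≤ variationSq a j :=
  variationSq_le_iff.1 le_rfl N t ht htI

theorem variationSq_mono {a b : ℝ → ℂ} {j : ℤ}
    (h : ∀ s ∈ Set.Icc ((2 : ℝ) ^ j) ((2 : ℝ) ^ (j + 1)),
      ∀ t ∈ Set.Icc ((2 : ℝ) ^ j) ((2 : ℝ) ^ (j + 1)), s ≤ t →
        ‖a t - a s‖ₑ ≤ ‖b t - b s‖ₑ) : variationSq a j ≤ variationSq b j := by
  refine variationSq_le_iff.2 fun N t ht htI => le_trans ?_ (le_variationSq ht htI)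
  refine Finset.sum_le_sum fun l hl => ?_
  rw [Finset.mem_range] at hl
  gcongr
  exact h _ (htI l hl.le) _ (htI (l + 1) hl) (ht hl.le hl (Nat.lt_succ_self l)).le

theorem variationSq_zero (j : ℤ) : variationSq (fun _ => 0) j = 0 := by
  refine le_antisymm (variationSq_le_iff.2 fun N t _ _ => ?_) zero_le
  simp

theorem dyadicVariation_zero (j : ℤ) : dyadicVariation (fun _ => 0) j = 0 := by
  rw [dyadicVariation_eq, variationSq_zero]; simp

theorem dyadicVariation_add_le (a b : ℝ → ℂ) (j : ℤ) :
    dyadicVariation (fun t => a t + b t) j ≤ dyadicVariation a j + dyadicVariation b j := by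
  rw [dyadicVariation_eq, rpow_half_le_iff]
  refine variationSq_le_iff.2 fun N t ht htI => rpow_half_le_iff.1 ?_
  have h := ENNReal.Lp_add_le (Finset.range N) (fun l => ‖a (t (l + 1)) - a (t l)‖ₑ)
    (fun l => ‖b (t (l + 1)) - b (t l)‖ₑ) one_le_two
  simp only [ENNReal.rpow_two] at h
  refine le_trans ?_ (h.trans (add_le_add ?_ ?_))
  · gcongr with l
    refine le_trans (le_of_eq ?_) (enorm_add_le _ _)
    congr 1; ring
  · exact ENNReal.rpow_le_rpow (le_variationSq ht htI) (by norm_num)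
  · exact ENNReal.rpow_le_rpow (le_variationSq ht htI) (by norm_num)

theorem dyadicVariation_sum_le {ι : Type*} (s : Finset ι) (a : ι → ℝ → ℂ) (j : ℤ) :
    dyadicVariation (fun t => ∑ i ∈ s, a i t) j ≤ ∑ i ∈ s, dyadicVariation (a i) j := by
  classical
  induction s using Finset.induction_on with
  | empty => simp [dyadicVariation_zero]
  | insert i s hi ih =>
    simp only [Finset.sum_insert hi]
    exact (dyadicVariation_add_le _ _ j).trans (add_le_add le_rfl ih)

theorem variationSq_le_liminf {a : ℝ → ℂ} {A : ℕ → ℝ → ℂ} {j : ℤ}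
    (h : ∀ t ∈ Set.Icc ((2 : ℝ) ^ j) ((2 : ℝ) ^ (j + 1)),
      Tendsto (fun m => A m t) atTop (𝓝 (a t))) :
    variationSq a j ≤ liminf (fun m => variationSq (A m) j) atTop := by
  refine variationSq_le_iff.2 fun N t ht htI => ?_
  have hlim : Tendsto (fun m => ∑ l ∈ Finset.range N, ‖A m (t (l + 1)) - A m (t l)‖ₑ ^ 2) atTop
      (𝓝 (∑ l ∈ Finset.range N, ‖a (t (l + 1)) - a (t l)‖ₑ ^ 2)) := by
    refine tendsto_finsetSum _ fun l hl => ?_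
    rw [Finset.mem_range] at hl
    exact ((ENNReal.continuous_pow 2).tendsto _).comp
      (((h _ (htI (l + 1) hl)).sub (h _ (htI l hl.le))).enorm)
  rw [← hlim.liminf_eq]
  exact liminf_le_liminf (Eventually.of_forall fun m => le_variationSq ht htI)

theorem rpow_liminf {ι : Type*} {u : ι → ℝ≥0∞} {F : Filter ι} {s : ℝ} (hs : 0 < s) :
    (liminf u F) ^ s = liminf (fun m => u m ^ s) F :=
  (ENNReal.orderIsoRpow s hs).liminf_apply

theorem dyadicVariation_le_liminf {a : ℝ → ℂ} {A : ℕ → ℝ → ℂ} {j : ℤ}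
    (h : ∀ t ∈ Set.Icc ((2 : ℝ) ^ j) ((2 : ℝ) ^ (j + 1)),
      Tendsto (fun m => A m t) atTop (𝓝 (a t))) :
    dyadicVariation a j ≤ liminf (fun m => dyadicVariation (A m) j) atTop := by
  simp only [dyadicVariation_eq]
  rw [← rpow_liminf one_half_pos]
  exact ENNReal.rpow_le_rpow (variationSq_le_liminf h) (by norm_num)

theorem sum_measure_Ioc_le (m : Measure ℝ) {N : ℕ} {t : ℕ → ℝ} (ht : StrictMonoOn t (Set.Iic N))
    {S : Finset ℕ} (hS : ∀ l ∈ S, l < N) {A : Set ℝ}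
    (hA : ∀ l ∈ S, Set.Ioc (t l) (t (l + 1)) ⊆ A) :
    ∑ l ∈ S, m (Set.Ioc (t l) (t (l + 1))) ≤ m A := by
  rw [← measure_biUnion_finset]
  · exact measure_mono (Set.iUnion₂_subset hA)
  · intro l hl l' hl' hne
    have key : ∀ l ∈ S, ∀ l' ∈ S, l < l' →
        Disjoint (Set.Ioc (t l) (t (l + 1))) (Set.Ioc (t l') (t (l' + 1))) := by
      intro l hl l' hl' hlt
      have h1 : t (l + 1) ≤ t l' := ht.monotoneOn (hS l hl) (hS l' hl').le hlt
      exact Set.disjoint_left.2 fun x hx hx' => by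
        have := hx.2; have := hx'.1; linarith
    rcases lt_or_gt_of_ne hne with h | h
    · exact key l hl l' hl' h
    · exact (key l' hl' l hl h).symm
  · exact fun l _ => measurableSet_Ioc

/-- The `2`-variation is at most the total variation. -/
theorem variationSq_le_measure_sq {a : ℝ → ℂ} {j : ℤ} {m : Measure ℝ}
    (h : ∀ s ∈ Set.Icc ((2 : ℝ) ^ j) ((2 : ℝ) ^ (j + 1)),
      ∀ t ∈ Set.Icc ((2 : ℝ) ^ j) ((2 : ℝ) ^ (j + 1)), s ≤ t →
        ‖a t - a s‖ₑ ≤ m (Set.Ioc s t)) :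
    variationSq a j ≤ m (Set.Ioc (2 ^ j) (2 ^ (j + 1))) ^ 2 := by
  refine variationSq_le_iff.2 fun N t ht htI => ?_
  have h1 : ∀ l ∈ Finset.range N, ‖a (t (l + 1)) - a (t l)‖ₑ ≤ m (Set.Ioc (t l) (t (l + 1))) := by
    intro l hl
    rw [Finset.mem_range] at hl
    exact h _ (htI l hl.le) _ (htI (l + 1) hl) (ht hl.le hl (Nat.lt_succ_self l)).le
  calc ∑ l ∈ Finset.range N, ‖a (t (l + 1)) - a (t l)‖ₑ ^ 2
      ≤ (∑ l ∈ Finset.range N, ‖a (t (l + 1)) - a (t l)‖ₑ) ^ 2 :=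
        sum_sq_le_sum_sq _ _
    _ ≤ (∑ l ∈ Finset.range N, m (Set.Ioc (t l) (t (l + 1)))) ^ 2 := by
        gcongr with l hl; exact h1 l hl
    _ ≤ _ := by
        gcongr
        refine sum_measure_Ioc_le m ht (fun l hl => Finset.mem_range.1 hl) fun l hl => ?_
        rw [Finset.mem_range] at hl
        exact Set.Ioc_subset_Ioc (htI l hl.le).1 (htI (l + 1) hl).2

/-- The `l`-th point of the partition of `[2 ^ j, 2 ^ (j + 1)]` into `L` intervals of equal
length. -/
def gridPoint (j : ℤ) (L l : ℕ) : ℝ := 2 ^ j * (1 + l / L)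

/-- The index of the grid interval containing `t`. -/
def gridIndex (j : ℤ) (L : ℕ) (t : ℝ) : ℕ := ⌊(t / 2 ^ j - 1) * L⌋₊

theorem gridPoint_mono (j : ℤ) (L : ℕ) : Monotone (gridPoint j L) := fun l l' h => by
  unfold gridPoint
  gcongr

theorem gridPoint_mem {j : ℤ} {L l : ℕ} (hL : 1 ≤ L) (hl : l ≤ L) :
    gridPoint j L l ∈ Set.Icc ((2 : ℝ) ^ j) ((2 : ℝ) ^ (j + 1)) := by
  have h2 : (0 : ℝ) < 2 ^ j := by positivity
  have hL' : (0 : ℝ) < L := by exact_mod_cast hL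
  have h3 : (l : ℝ) / L ≤ 1 := (div_le_one hL').2 (by exact_mod_cast hl)
  have h4 : (0 : ℝ) ≤ l / L := by positivity
  rw [zpow_add₀ two_ne_zero, zpow_one]
  constructor <;> unfold gridPoint <;> nlinarith

theorem gridIndex_mono (j : ℤ) (L : ℕ) : Monotone (gridIndex j L) := fun t t' h => by
  unfold gridIndex
  gcongr

theorem gridIndex_le {j : ℤ} {L : ℕ} {t : ℝ} (ht : t ≤ 2 ^ (j + 1)) : gridIndex j L t ≤ L := by
  have h2 : (0 : ℝ) < 2 ^ j := by positivity
  rw [zpow_add₀ two_ne_zero, zpow_one] at ht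
  refine Nat.floor_le_of_le ?_
  have : t / 2 ^ j ≤ 2 := by rw [div_le_iff₀ h2]; linarith
  have hL : (0 : ℝ) ≤ L := Nat.cast_nonneg L
  nlinarith

theorem gridPoint_gridIndex_le {j : ℤ} {L : ℕ} (hL : 1 ≤ L) {t : ℝ} (ht : 2 ^ j ≤ t) :
    gridPoint j L (gridIndex j L t) ≤ t := by
  have h2 : (0 : ℝ) < 2 ^ j := by positivity
  have hL' : (0 : ℝ) < L := by exact_mod_cast hL
  have h3 : 1 ≤ t / 2 ^ j := (one_le_div h2).2 ht
  have h4 : (gridIndex j L t : ℝ) ≤ (t / 2 ^ j - 1) * L := Nat.floor_le (by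
    have : 0 ≤ t / 2 ^ j - 1 := by linarith
    positivity)
  have h5 : (gridIndex j L t : ℝ) / L ≤ t / 2 ^ j - 1 := (div_le_iff₀ hL').2 h4
  calc gridPoint j L (gridIndex j L t) ≤ 2 ^ j * (1 + (t / 2 ^ j - 1)) := by
        unfold gridPoint; gcongr
    _ = t := by field_simp; ring

theorem lt_gridPoint_succ {j : ℤ} {L : ℕ} (hL : 1 ≤ L) (t : ℝ) :
    t < gridPoint j L (gridIndex j L t + 1) := by
  have h2 : (0 : ℝ) < 2 ^ j := by positivity
  have hL' : (0 : ℝ) < L := by exact_mod_cast hL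
  have h4 : (t / 2 ^ j - 1) * L < (gridIndex j L t + 1 : ℕ) := by
    push_cast; exact Nat.lt_floor_add_one _
  have h5 : t / 2 ^ j - 1 < ((gridIndex j L t + 1 : ℕ) : ℝ) / L := (lt_div_iff₀ hL').2 h4
  calc t = 2 ^ j * (1 + (t / 2 ^ j - 1)) := by field_simp; ring
    _ < _ := by unfold gridPoint; gcongr

theorem sum_comp_le_of_injOn {S : Finset ℕ} {u : ℕ → ℕ} (hu : Set.InjOn u S) {L : ℕ}
    (hL : ∀ l ∈ S, u l ≤ L) (w : ℕ → ℝ≥0∞) :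
    ∑ l ∈ S, w (u l) ≤ ∑ i ∈ Finset.range (L + 1), w i := by
  classical
  rw [← Finset.sum_image hu]
  refine Finset.sum_le_sum_of_subset fun i hi => ?_
  obtain ⟨l, hl, rfl⟩ := Finset.mem_image.1 hi
  exact Finset.mem_range.2 (Nat.lt_succ_of_le (hL l hl))

/-- Bound for the `2`-variation by the values on a grid and the total variations between the grid
points.  An increment either stays within one grid interval, or it is controlled by the values at
the two grid points preceding its ends, and then every grid point is used at most twice. -/
theorem variationSq_le_grid {a : ℝ → ℂ} {j : ℤ} {m : Measure ℝ}
    (h : ∀ s ∈ Set.Icc ((2 : ℝ) ^ j) ((2 : ℝ) ^ (j + 1)),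
      ∀ t ∈ Set.Icc ((2 : ℝ) ^ j) ((2 : ℝ) ^ (j + 1)), s ≤ t →
        ‖a t - a s‖ₑ ≤ m (Set.Ioc s t)) {L : ℕ} (hL : 1 ≤ L) :
    variationSq a j ≤ 9 * ∑ i ∈ Finset.range (L + 1), (‖a (gridPoint j L i)‖ₑ ^ 2 +
      m (Set.Ioc (gridPoint j L i) (gridPoint j L (i + 1))) ^ 2) := by
  classical
  refine variationSq_le_iff.2 fun N t ht htI => ?_
  set w : ℕ → ℝ≥0∞ := fun i => ‖a (gridPoint j L i)‖ₑ ^ 2 +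
      m (Set.Ioc (gridPoint j L i) (gridPoint j L (i + 1))) ^ 2 with hw
  set u : ℕ → ℕ := fun l => gridIndex j L (t l) with hu
  have huL : ∀ l ≤ N, u l ≤ L := fun l hl => gridIndex_le (htI l hl).2
  have humono : ∀ l l', l ≤ l' → l' ≤ N → u l ≤ u l' := fun l l' hll' hl' =>
    gridIndex_mono j L (ht.monotoneOn (hll'.trans hl') hl' hll')
  have hΔ : ∀ l < N, ‖a (t (l + 1)) - a (t l)‖ₑ ≤ m (Set.Ioc (t l) (t (l + 1))) := fun l hl =>
    h _ (htI l hl.le) _ (htI (l + 1) hl) (ht hl.le hl (Nat.lt_succ_self l)).le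
  -- the value at a point is controlled by the grid interval containing it
  have hval : ∀ l ≤ N, ‖a (t l)‖ₑ ^ 2 ≤ 2 * w (u l) := by
    intro l hl
    have hle := gridPoint_gridIndex_le hL (htI l hl).1
    have h1 : ‖a (t l)‖ₑ ≤ ‖a (gridPoint j L (u l))‖ₑ +
        m (Set.Ioc (gridPoint j L (u l)) (gridPoint j L (u l + 1))) := by
      have h2 := h _ (gridPoint_mem hL (huL l hl)) _ (htI l hl) hle
      have h3 : m (Set.Ioc (gridPoint j L (u l)) (t l)) ≤
          m (Set.Ioc (gridPoint j L (u l)) (gridPoint j L (u l + 1))) :=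
        measure_mono (Set.Ioc_subset_Ioc_right (lt_gridPoint_succ hL _).le)
      calc ‖a (t l)‖ₑ = ‖a (gridPoint j L (u l)) + (a (t l) - a (gridPoint j L (u l)))‖ₑ := by
            rw [add_sub_cancel]
        _ ≤ _ := (enorm_add_le _ _).trans (add_le_add le_rfl (h2.trans h3))
    calc ‖a (t l)‖ₑ ^ 2 ≤ _ := by gcongr
      _ ≤ _ := add_sq_le_ennreal _ _
  set S := (Finset.range N).filter fun l => u l = u (l + 1) with hS
  set S' := (Finset.range N).filter fun l => ¬ u l = u (l + 1) with hS'
  have hsame : ∑ l ∈ S, ‖a (t (l + 1)) - a (t l)‖ₑ ^ 2 ≤ ∑ i ∈ Finset.range (L + 1), w i := by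
    have hSN : ∀ l ∈ S, l < N := fun l hl => Finset.mem_range.1 (Finset.mem_filter.1 hl).1
    rw [← Finset.sum_fiberwise_of_maps_to (g := u) (t := Finset.range (L + 1)) fun l hl =>
      Finset.mem_range.2 (Nat.lt_succ_of_le (huL l (hSN l hl).le))]
    refine Finset.sum_le_sum fun i _ => ?_
    calc ∑ l ∈ S with u l = i, ‖a (t (l + 1)) - a (t l)‖ₑ ^ 2
        ≤ (∑ l ∈ S with u l = i, ‖a (t (l + 1)) - a (t l)‖ₑ) ^ 2 :=
          sum_sq_le_sum_sq _ _
      _ ≤ (∑ l ∈ S with u l = i, m (Set.Ioc (t l) (t (l + 1)))) ^ 2 := by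
          gcongr with l hl
          exact hΔ l (hSN l (Finset.mem_filter.1 hl).1)
      _ ≤ m (Set.Ioc (gridPoint j L i) (gridPoint j L (i + 1))) ^ 2 := by
          gcongr
          refine sum_measure_Ioc_le m ht (fun l hl => hSN l (Finset.mem_filter.1 hl).1)
            fun l hl => ?_
          obtain ⟨hlS, hli⟩ := Finset.mem_filter.1 hl
          have hlN := hSN l hlS
          have h1 := gridPoint_gridIndex_le hL (htI l hlN.le).1
          have h2 := (lt_gridPoint_succ (j := j) hL (t (l + 1))).le
          have h3 : gridIndex j L (t (l + 1)) = i := (Finset.mem_filter.1 hlS).2.symm.trans hli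
          have h4 : gridIndex j L (t l) = i := hli
          rw [h3] at h2
          rw [h4] at h1
          exact Set.Ioc_subset_Ioc h1 h2
      _ ≤ w i := le_add_self
  have hS'N : ∀ l ∈ S', l < N := fun l hl => Finset.mem_range.1 (Finset.mem_filter.1 hl).1
  have hlt : ∀ l ∈ S', u l < u (l + 1) := fun l hl =>
    lt_of_le_of_ne (humono _ _ (Nat.le_succ l) (hS'N l hl)) (Finset.mem_filter.1 hl).2
  have hinj : Set.InjOn u S' := by
    have key : ∀ l ∈ S', ∀ l' ∈ S', l < l' → u l < u l' := fun l hl l' hl' hll' =>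
      (hlt l hl).trans_le (humono _ _ hll' (hS'N l' hl').le)
    intro l hl l' hl' he
    by_contra hne
    rcases lt_or_gt_of_ne hne with h | h
    · exact (key l hl l' hl' h).ne he
    · exact (key l' hl' l hl h).ne he.symm
  have hinj' : Set.InjOn (fun l => u (l + 1)) S' := by
    have key : ∀ l ∈ S', ∀ l' ∈ S', l < l' → u (l + 1) < u (l' + 1) := fun l hl l' hl' hll' =>
      (humono _ _ hll' (hS'N l' hl').le).trans_lt (hlt l' hl')
    intro l hl l' hl' he
    by_contra hne
    rcases lt_or_gt_of_ne hne with h | h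
    · exact (key l hl l' hl' h).ne he
    · exact (key l' hl' l hl h).ne he.symm
  have hcross : ∑ l ∈ S', ‖a (t (l + 1)) - a (t l)‖ₑ ^ 2 ≤
      8 * ∑ i ∈ Finset.range (L + 1), w i := by
    calc ∑ l ∈ S', ‖a (t (l + 1)) - a (t l)‖ₑ ^ 2
        ≤ ∑ l ∈ S', (4 * w (u (l + 1)) + 4 * w (u l)) := by
          refine Finset.sum_le_sum fun l hl => ?_
          have hlN := hS'N l hl
          calc ‖a (t (l + 1)) - a (t l)‖ₑ ^ 2 ≤ (‖a (t (l + 1))‖ₑ + ‖a (t l)‖ₑ) ^ 2 := by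
                gcongr; exact enorm_sub_le
            _ ≤ 2 * (‖a (t (l + 1))‖ₑ ^ 2 + ‖a (t l)‖ₑ ^ 2) := add_sq_le_ennreal _ _
            _ ≤ 2 * (2 * w (u (l + 1)) + 2 * w (u l)) := by
                gcongr
                · exact hval (l + 1) hlN
                · exact hval l hlN.le
            _ = _ := by ring
      _ = 4 * ∑ l ∈ S', w (u (l + 1)) + 4 * ∑ l ∈ S', w (u l) := by
          rw [Finset.sum_add_distrib, Finset.mul_sum, Finset.mul_sum]
      _ ≤ 4 * ∑ i ∈ Finset.range (L + 1), w i + 4 * ∑ i ∈ Finset.range (L + 1), w i := by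
          gcongr
          · exact sum_comp_le_of_injOn hinj' (fun l hl => huL (l + 1) (hS'N l hl)) w
          · exact sum_comp_le_of_injOn hinj (fun l hl => huL l (hS'N l hl).le) w
      _ = _ := by ring
  calc ∑ l ∈ Finset.range N, ‖a (t (l + 1)) - a (t l)‖ₑ ^ 2
      = ∑ l ∈ S, ‖a (t (l + 1)) - a (t l)‖ₑ ^ 2 + ∑ l ∈ S', ‖a (t (l + 1)) - a (t l)‖ₑ ^ 2 :=
        (Finset.sum_filter_add_sum_filter_not _ _ _).symm
    _ ≤ ∑ i ∈ Finset.range (L + 1), w i + 8 * ∑ i ∈ Finset.range (L + 1), w i :=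
        add_le_add hsame hcross
    _ = _ := by ring

theorem tendsto_gridPoint_gridIndex {j : ℤ} {t : ℝ} (ht : 2 ^ j ≤ t) :
    Tendsto (fun L => gridPoint j L (gridIndex j L t)) atTop (𝓝 t) := by
  have h1 : Tendsto (fun L : ℕ => t - 2 ^ j * (1 / (L : ℝ))) atTop (𝓝 t) := by
    have := (tendsto_one_div_atTop_nhds_zero_nat (𝕜 := ℝ)).const_mul ((2 : ℝ) ^ j)
    simpa using this.const_sub t
  refine tendsto_of_tendsto_of_tendsto_of_le_of_le' h1 tendsto_const_nhds ?_ ?_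
  · filter_upwards [eventually_ge_atTop 1] with L hL
    have h := lt_gridPoint_succ (j := j) hL t
    have hL' : (0 : ℝ) < L := by exact_mod_cast hL
    have e : gridPoint j L (gridIndex j L t + 1) =
        gridPoint j L (gridIndex j L t) + 2 ^ j * (1 / (L : ℝ)) := by
      unfold gridPoint; push_cast; field_simp; ring
    linarith
  · filter_upwards [eventually_ge_atTop 1] with L hL
    exact gridPoint_gridIndex_le hL ht

/-- Partitions may be taken inside fine grids. -/
theorem eventually_strictMonoOn_grid {j : ℤ} {N : ℕ} {t : ℕ → ℝ} (ht : StrictMonoOn t (Set.Iic N))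
    (htI : ∀ l ≤ N, t l ∈ Set.Icc ((2 : ℝ) ^ j) ((2 : ℝ) ^ (j + 1))) :
    ∀ᶠ L in atTop, StrictMonoOn (fun l => gridPoint j L (gridIndex j L (t l))) (Set.Iic N) := by
  have h : ∀ l ∈ Finset.range (N + 1), ∀ l' ∈ Finset.range (N + 1), l < l' → ∀ᶠ L in atTop,
      gridPoint j L (gridIndex j L (t l)) < gridPoint j L (gridIndex j L (t l')) := by
    intro l hl l' hl' hll'
    rw [Finset.mem_range, Nat.lt_succ_iff] at hl hl'
    exact (tendsto_gridPoint_gridIndex (htI l hl).1).eventually_lt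
      (tendsto_gridPoint_gridIndex (htI l' hl').1) (ht hl hl' hll')
  have h2 : ∀ᶠ L in atTop, ∀ l ∈ Finset.range (N + 1), ∀ l' ∈ Finset.range (N + 1), l < l' →
      gridPoint j L (gridIndex j L (t l)) < gridPoint j L (gridIndex j L (t l')) := by
    rw [Finset.eventually_all]
    intro l hl
    rw [Finset.eventually_all]
    intro l' hl'
    rw [eventually_imp_distrib_left]
    exact h l hl l' hl'
  filter_upwards [h2] with L hL l hl l' hl' hll'
  exact hL l (Finset.mem_range.2 (Nat.lt_succ_of_le hl)) l'
    (Finset.mem_range.2 (Nat.lt_succ_of_le hl')) hll'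

theorem tendsto_sum_grid {a : ℝ → ℂ} {j : ℤ}
    (ha : ContinuousOn a (Set.Icc ((2 : ℝ) ^ j) ((2 : ℝ) ^ (j + 1)))) {N : ℕ} {t : ℕ → ℝ}
    (htI : ∀ l ≤ N, t l ∈ Set.Icc ((2 : ℝ) ^ j) ((2 : ℝ) ^ (j + 1))) :
    Tendsto (fun L => ∑ l ∈ Finset.range N, ‖a (gridPoint j L (gridIndex j L (t (l + 1)))) -
      a (gridPoint j L (gridIndex j L (t l)))‖ₑ ^ 2) atTop
      (𝓝 (∑ l ∈ Finset.range N, ‖a (t (l + 1)) - a (t l)‖ₑ ^ 2)) := by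
  have h : ∀ l ≤ N, Tendsto (fun L => a (gridPoint j L (gridIndex j L (t l)))) atTop
      (𝓝 (a (t l))) := fun l hl => by
    refine (ha (t l) (htI l hl)).tendsto.comp (tendsto_nhdsWithin_iff.2
      ⟨tendsto_gridPoint_gridIndex (htI l hl).1, ?_⟩)
    filter_upwards [eventually_ge_atTop 1] with L hL
    exact gridPoint_mem hL (gridIndex_le (htI l hl).2)
  refine tendsto_finsetSum _ fun l hl => ?_
  rw [Finset.mem_range] at hl
  exact ((ENNReal.continuous_pow 2).tendsto _).comp (((h _ hl).sub (h _ hl.le)).enorm)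

/-- For a continuous family the supremum may be restricted to grid points, hence to countably many
partitions; this is the source of measurability. -/
theorem variationSq_eq_iSup_grid {a : ℝ → ℂ} {j : ℤ}
    (ha : ContinuousOn a (Set.Icc ((2 : ℝ) ^ j) ((2 : ℝ) ^ (j + 1)))) :
    variationSq a j = ⨆ (N : ℕ) (L : ℕ) (k : ℕ →₀ ℕ)
      (_ : StrictMonoOn (fun l => gridPoint j L (k l)) (Set.Iic N) ∧
        ∀ l ≤ N, gridPoint j L (k l) ∈ Set.Icc ((2 : ℝ) ^ j) ((2 : ℝ) ^ (j + 1))),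
      ∑ l ∈ Finset.range N, ‖a (gridPoint j L (k (l + 1))) - a (gridPoint j L (k l))‖ₑ ^ 2 := by
  classical
  refine le_antisymm (variationSq_le_iff.2 fun N t ht htI => ?_) ?_
  · refine le_of_tendsto (tendsto_sum_grid ha htI) ?_
    filter_upwards [eventually_strictMonoOn_grid ht htI, eventually_ge_atTop 1] with L hL hL1
    obtain ⟨k, hk⟩ : ∃ k : ℕ →₀ ℕ, ∀ l ≤ N, k l = gridIndex j L (t l) := by
      refine ⟨Finsupp.onFinset (Finset.range (N + 1))
        (fun l => if l ≤ N then gridIndex j L (t l) else 0) (fun l hl => ?_), fun l hl => ?_⟩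
      · by_contra hcon
        rw [Finset.mem_range, not_lt] at hcon
        exact hl (if_neg (by omega))
      · simp [hl]
    have h1 : StrictMonoOn (fun l => gridPoint j L (k l)) (Set.Iic N) := by
      intro l hl l' hl' hll'
      have h2 := hL hl hl' hll'
      simp only [hk l hl, hk l' hl']
      exact h2
    have h2 : ∀ l ≤ N, gridPoint j L (k l) ∈ Set.Icc ((2 : ℝ) ^ j) ((2 : ℝ) ^ (j + 1)) := by
      intro l hl
      rw [hk l hl]
      exact gridPoint_mem hL1 (gridIndex_le (htI l hl).2)
    have h3 : ∑ l ∈ Finset.range N, ‖a (gridPoint j L (gridIndex j L (t (l + 1)))) -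
        a (gridPoint j L (gridIndex j L (t l)))‖ₑ ^ 2 =
        ∑ l ∈ Finset.range N, ‖a (gridPoint j L (k (l + 1))) - a (gridPoint j L (k l))‖ₑ ^ 2 := by
      refine Finset.sum_congr rfl fun l hl => ?_
      rw [Finset.mem_range] at hl
      rw [hk l hl.le, hk (l + 1) hl]
    rw [h3]
    refine le_iSup_of_le N (le_iSup_of_le L (le_iSup_of_le k ?_))
    exact le_iSup_of_le (f := fun _ : StrictMonoOn (fun l => gridPoint j L (k l)) (Set.Iic N) ∧
        ∀ l ≤ N, gridPoint j L (k l) ∈ Set.Icc ((2 : ℝ) ^ j) ((2 : ℝ) ^ (j + 1)) =>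
      ∑ l ∈ Finset.range N, ‖a (gridPoint j L (k (l + 1))) - a (gridPoint j L (k l))‖ₑ ^ 2)
      ⟨h1, h2⟩ le_rfl
  · exact iSup_le fun N => iSup_le fun L => iSup_le fun k => iSup_le fun h =>
      le_variationSq (t := fun l => gridPoint j L (k l)) h.1 h.2

theorem measurable_variationSq {α : Type*} [MeasurableSpace α] {F : ℝ → α → ℂ} {j : ℤ}
    (hF : ∀ t ∈ Set.Icc ((2 : ℝ) ^ j) ((2 : ℝ) ^ (j + 1)), Measurable (F t))
    (hc : ∀ x, ContinuousOn (fun t => F t x) (Set.Icc ((2 : ℝ) ^ j) ((2 : ℝ) ^ (j + 1)))) :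
    Measurable fun x => variationSq (fun t => F t x) j := by
  simp_rw [variationSq_eq_iSup_grid (hc _)]
  refine .iSup fun N => .iSup fun L => .iSup fun k => .iSup fun h => ?_
  refine Finset.measurable_sum _ fun l hl => ?_
  rw [Finset.mem_range] at hl
  exact ((hF _ (h.2 (l + 1) hl)).sub (hF _ (h.2 l hl.le))).enorm.pow_const 2

/-- The `2`-variation is at most the limit of the total variations along grids. -/
theorem variationSq_le_liminf_grid {a : ℝ → ℂ} {j : ℤ}
    (ha : ContinuousOn a (Set.Icc ((2 : ℝ) ^ j) ((2 : ℝ) ^ (j + 1)))) :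
    variationSq a j ≤ liminf (fun L : ℕ => (L : ℝ≥0∞) * ∑ i ∈ Finset.range L,
      ‖a (gridPoint j L (i + 1)) - a (gridPoint j L i)‖ₑ ^ 2) atTop := by
  refine variationSq_le_iff.2 fun N t ht htI => ?_
  rw [← (tendsto_sum_grid ha htI).liminf_eq]
  refine liminf_le_liminf ?_
  filter_upwards with L
  set d : ℕ → ℝ≥0∞ := fun i => ‖a (gridPoint j L (i + 1)) - a (gridPoint j L i)‖ₑ
  have hu : ∀ l ≤ N, gridIndex j L (t l) ≤ L := fun l hl => gridIndex_le (htI l hl).2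
  have hmono : ∀ l < N, gridIndex j L (t l) ≤ gridIndex j L (t (l + 1)) := fun l hl =>
    gridIndex_mono j L (ht hl.le hl (Nat.lt_succ_self l)).le
  have htel : ∀ k k', k ≤ k' → ‖a (gridPoint j L k') - a (gridPoint j L k)‖ₑ ≤
      ∑ i ∈ Finset.Ico k k', d i := by
    intro k k' hkk'
    induction k', hkk' using Nat.le_induction with
    | base => simp
    | succ k' hk ih =>
      rw [Finset.sum_Ico_succ_top hk]
      calc _ = ‖(a (gridPoint j L k') - a (gridPoint j L k)) +
            (a (gridPoint j L (k' + 1)) - a (gridPoint j L k'))‖ₑ := by congr 1; ring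
        _ ≤ _ := (enorm_add_le _ _).trans (add_le_add ih le_rfl)
  have hsum : ∀ M ≤ N, ∑ l ∈ Finset.range M, ‖a (gridPoint j L (gridIndex j L (t (l + 1)))) -
      a (gridPoint j L (gridIndex j L (t l)))‖ₑ ≤
      ∑ i ∈ Finset.Ico (gridIndex j L (t 0)) (gridIndex j L (t M)), d i := by
    intro M hM
    induction M with
    | zero => simp
    | succ M ih =>
      have h0 : gridIndex j L (t 0) ≤ gridIndex j L (t M) :=
        gridIndex_mono j L (ht.monotoneOn (Nat.zero_le N) (by exact Nat.le_of_succ_le hM)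
          (Nat.zero_le M))
      rw [Finset.sum_range_succ, ← Finset.sum_Ico_consecutive _ h0 (hmono M hM)]
      exact add_le_add (ih (Nat.le_of_succ_le hM)) (htel _ _ (hmono M hM))
  calc ∑ l ∈ Finset.range N, ‖a (gridPoint j L (gridIndex j L (t (l + 1)))) -
        a (gridPoint j L (gridIndex j L (t l)))‖ₑ ^ 2
      ≤ (∑ l ∈ Finset.range N, ‖a (gridPoint j L (gridIndex j L (t (l + 1)))) -
        a (gridPoint j L (gridIndex j L (t l)))‖ₑ) ^ 2 :=
        sum_sq_le_sum_sq _ _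
    _ ≤ (∑ i ∈ Finset.range L, d i) ^ 2 := by
        gcongr
        refine (hsum N le_rfl).trans (Finset.sum_le_sum_of_subset fun i hi => ?_)
        rw [Finset.mem_Ico] at hi
        exact Finset.mem_range.2 (hi.2.trans_le (hu N le_rfl))
    _ ≤ _ := by
        have h := ENNReal.inner_le_Lp_mul_Lq (Finset.range L) (fun _ => 1) d
          Real.HolderConjugate.two_two
        simp only [one_mul, Finset.sum_const, Finset.card_range, nsmul_eq_mul, ENNReal.rpow_two,
          one_pow, mul_one] at h
        calc (∑ i ∈ Finset.range L, d i) ^ 2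
            ≤ ((L : ℝ≥0∞) ^ (1 / 2 : ℝ) * (∑ i ∈ Finset.range L, d i ^ 2) ^ (1 / 2 : ℝ)) ^ 2 := by
              gcongr
          _ = _ := by rw [mul_pow, rpow_half_sq, rpow_half_sq]

end Variation

/-! ### Polar coordinates and the rough kernel -/

section Polar

open Filter Topology FourierTransform Pointwise

variable {n : ℕ}

theorem measurable_roughKernel {Ω : USphere n → ℂ} (hΩ : Measurable Ω) :
    Measurable (roughKernel Ω) := by
  classical
  have hd : Measurable fun y : {y : Space n | y ≠ 0} => direction y.1 y.2 :=
    Measurable.subtype_mk ((measurable_norm.comp measurable_subtype_coe).inv.smul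
      measurable_subtype_coe)
  have h1 : Measurable fun y : {y : Space n | y ≠ 0} =>
      Ω (direction y.1 y.2) / ((‖y.1‖ ^ n : ℝ) : ℂ) :=
    (hΩ.comp hd).div (Complex.measurable_ofReal.comp
      ((measurable_norm.comp measurable_subtype_coe).pow_const n))
  have hs : MeasurableSet {y : Space n | y ≠ 0} := (measurableSet_singleton (0 : Space n)).compl
  have h2 := Measurable.dite (s := {y : Space n | y ≠ 0}) h1
    (g := fun _ => (0 : ℂ)) measurable_const hs
  exact h2

theorem roughKernel_smul (Ω : USphere n → ℂ) (θ : USphere n) {r : ℝ} (hr : 0 < r) :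
    roughKernel Ω (r • (θ : Space n)) = Ω θ / ((r ^ n : ℝ) : ℂ) := by
  have hθ : ‖(θ : Space n)‖ = 1 := norm_eq_of_mem_sphere θ
  have hne : r • (θ : Space n) ≠ 0 := by
    rw [smul_ne_zero_iff]
    refine ⟨hr.ne', fun h => ?_⟩
    rw [h, norm_zero] at hθ
    exact zero_ne_one hθ
  have hnorm : ‖r • (θ : Space n)‖ = r := by rw [norm_smul, hθ, mul_one, Real.norm_of_nonneg hr.le]
  have hdir : direction (r • (θ : Space n)) hne = θ := by
    ext1
    change ‖r • (θ : Space n)‖⁻¹ • r • (θ : Space n) = θ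
    rw [hnorm, smul_smul, inv_mul_cancel₀ hr.ne', one_smul]
  rw [roughKernel, dif_pos hne, hdir, hnorm]

/-- Polar coordinates. -/
theorem lintegral_polar (hn : 1 ≤ n) {g : Space n → ℝ≥0∞} (hg : Measurable g) :
    ∫⁻ y, g y = ∫⁻ θ : USphere n, (∫⁻ r in Set.Ioi (0 : ℝ),
      ENNReal.ofReal (r ^ (n - 1)) * g (r • (θ : Space n))) ∂(surf n) := by
  have : Nonempty (Fin n) := ⟨⟨0, hn⟩⟩
  have h0 : ∫⁻ y, g y = ∫⁻ y : ({(0 : Space n)}ᶜ : Set (Space n)), g y.1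
      ∂((volume : Measure (Space n)).comap (↑)) := by
    rw [lintegral_subtype_comap (measurableSet_singleton _).compl, restrict_compl_singleton]
  have hmp := (volume : Measure (Space n)).measurePreserving_homeomorphUnitSphereProd
  have hemb := (homeomorphUnitSphereProd (Space n)).measurableEmbedding
  set G : USphere n × Set.Ioi (0 : ℝ) → ℝ≥0∞ := fun z => g (z.2.1 • (z.1 : Space n)) with hG
  have hGm : Measurable G := hg.comp ((measurable_subtype_coe.comp measurable_snd).smul
    (measurable_subtype_coe.comp measurable_fst))
  have h1 : ∀ y : ({(0 : Space n)}ᶜ : Set (Space n)),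
      G (homeomorphUnitSphereProd (Space n) y) = g y.1 := by
    intro y
    have := (homeomorphUnitSphereProd (Space n)).symm_apply_apply y
    simp only [hG]
    congr 1
    exact congrArg Subtype.val this
  rw [h0, ← lintegral_congr h1, hmp.lintegral_comp_emb hemb, lintegral_prod _ hGm.aemeasurable]
  refine lintegral_congr fun θ => ?_
  have hd : Module.finrank ℝ (Space n) = n := by simp
  rw [hd, Measure.volumeIoiPow, lintegral_withDensity_eq_lintegral_mul]
  · rw [← lintegral_subtype_comap measurableSet_Ioi
      (fun r => ENNReal.ofReal (r ^ (n - 1)) * g (r • (θ : Space n)))]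
    rfl
  · exact (measurable_subtype_coe.pow_const _).ennreal_ofReal
  · exact hGm.comp (measurable_const.prodMk measurable_id)

theorem integral_polar (hn : 1 ≤ n) {g : Space n → ℂ} (hg : Integrable g) :
    ∫ y, g y = ∫ θ : USphere n, (∫ r in Set.Ioi (0 : ℝ),
      (r ^ (n - 1)) • g (r • (θ : Space n))) ∂(surf n) := by
  have : Nonempty (Fin n) := ⟨⟨0, hn⟩⟩
  have h0 : ∫ y, g y = ∫ y : ({(0 : Space n)}ᶜ : Set (Space n)), g y.1
      ∂((volume : Measure (Space n)).comap (↑)) := by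
    rw [integral_subtype_comap (measurableSet_singleton _).compl, restrict_compl_singleton]
  have hmp := (volume : Measure (Space n)).measurePreserving_homeomorphUnitSphereProd
  have hemb := (homeomorphUnitSphereProd (Space n)).measurableEmbedding
  set G : USphere n × Set.Ioi (0 : ℝ) → ℂ := fun z => g (z.2.1 • (z.1 : Space n)) with hG
  have h1 : ∀ y : ({(0 : Space n)}ᶜ : Set (Space n)),
      G (homeomorphUnitSphereProd (Space n) y) = g y.1 := by
    intro y
    have := (homeomorphUnitSphereProd (Space n)).symm_apply_apply y
    simp only [hG]
    congr 1
    exact congrArg Subtype.val this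
  have hGint : Integrable G (((volume : Measure (Space n)).toSphere).prod
      (Measure.volumeIoiPow (Module.finrank ℝ (Space n) - 1))) := by
    rw [← hmp.integrable_comp_emb hemb]
    have h2 : IntegrableOn g ({(0 : Space n)}ᶜ) := hg.integrableOn
    rw [integrableOn_iff_comap_subtypeVal (measurableSet_singleton _).compl] at h2
    refine h2.congr (Eventually.of_forall fun y => (h1 y).symm)
  rw [h0, ← integral_congr_ae (Eventually.of_forall h1), hmp.integral_comp hemb,
    integral_prod _ hGint]
  refine integral_congr_ae (Eventually.of_forall fun θ => ?_)
  have hd : Module.finrank ℝ (Space n) = n := by simp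
  simp only [hd, Measure.volumeIoiPow, ENNReal.ofReal]
  rw [integral_withDensity_eq_integral_smul]
  · have h3 := integral_subtype_comap (μ := volume) (s := Set.Ioi (0 : ℝ)) measurableSet_Ioi
      (fun r : ℝ => (r ^ (n - 1)).toNNReal • g (r • (θ : Space n)))
    refine Eq.trans h3 (setIntegral_congr_fun measurableSet_Ioi fun r hr => ?_)
    simp only [NNReal.smul_def]
    rw [Real.coe_toNNReal _ (pow_nonneg (Set.mem_Ioi.1 hr).le _)]
  · exact (measurable_subtype_coe.pow_const _).real_toNNReal

theorem roughKernel_ae_eq (hn : 1 ≤ n) {Ω Ω' : USphere n → ℂ} (h : Ω =ᵐ[surf n] Ω') :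
    roughKernel Ω =ᵐ[volume] roughKernel Ω' := by
  obtain ⟨N, hN, hNm, hN0⟩ := exists_measurable_superset_of_null (ae_iff.1 h)
  have hm : Measurable fun y => ‖roughKernel (N.indicator fun _ => (1 : ℂ)) y‖ₑ :=
    (measurable_roughKernel (measurable_const.indicator hNm)).enorm
  have h0 : ∫⁻ y, ‖roughKernel (N.indicator fun _ => (1 : ℂ)) y‖ₑ = 0 := by
    rw [lintegral_polar hn hm]
    refine lintegral_eq_zero_of_ae_eq_zero ?_
    filter_upwards [measure_eq_zero_iff_ae_notMem.1 hN0] with θ hθ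
    refine (setLIntegral_congr_fun measurableSet_Ioi fun r hr => ?_).trans lintegral_zero
    simp only [roughKernel_smul _ _ (Set.mem_Ioi.1 hr), Set.indicator_of_notMem hθ]
    simp
  rw [lintegral_eq_zero_iff hm] at h0
  filter_upwards [h0] with y hy
  by_cases hy0 : y = 0
  · simp [roughKernel, hy0]
  · have hy' : ‖y‖ ^ n ≠ 0 := pow_ne_zero _ (norm_ne_zero_iff.2 hy0)
    have : direction y hy0 ∉ N := fun hmem => by
      simp [roughKernel, hy0, hmem] at hy
    have h1 : Ω (direction y hy0) = Ω' (direction y hy0) := by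
      by_contra hne
      exact this (hN hne)
    simp [roughKernel, hy0, h1]

theorem surf_hyperplane (ξ : USphere n) :
    surf n {θ : USphere n | inner ℝ (θ : Space n) (ξ : Space n) = 0} = 0 := by
  have hm : MeasurableSet {θ : USphere n | inner ℝ (θ : Space n) (ξ : Space n) = (0 : ℝ)} :=
    (measurable_subtype_coe.inner measurable_const) (measurableSet_singleton (0 : ℝ))
  have hsub : Set.Ioo (0 : ℝ) 1 •
      ((↑) '' {θ : USphere n | inner ℝ (θ : Space n) (ξ : Space n) = (0 : ℝ)}) ⊆
      ((ℝ ∙ (ξ : Space n))ᗮ : Set (Space n)) := by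
    rintro _ ⟨r, -, _, ⟨θ, hθ, rfl⟩, rfl⟩
    have hθ' : inner ℝ (θ : Space n) (ξ : Space n) = (0 : ℝ) := hθ
    simp only [SetLike.mem_coe, Submodule.mem_orthogonal_singleton_iff_inner_left]
    change inner ℝ (r • (θ : Space n)) (ξ : Space n) = 0
    rw [inner_smul_left, hθ', mul_zero]
  have hne : (ℝ ∙ (ξ : Space n))ᗮ ≠ ⊤ := by
    intro h
    have h1 : (ξ : Space n) ∈ (ℝ ∙ (ξ : Space n))ᗮ := by rw [h]; trivial
    rw [Submodule.mem_orthogonal_singleton_iff_inner_left, real_inner_self_eq_norm_sq,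
      norm_eq_of_mem_sphere ξ] at h1
    norm_num at h1
  rw [Measure.toSphere_apply' _ hm, measure_mono_null hsub (Measure.addHaar_submodule _ _ hne),
    mul_zero]

end Polar

/-! ### Size and Fourier decay of the truncated kernels -/

section KernelBounds

open Filter Topology FourierTransform

variable {n : ℕ}

/-- The restriction of `K` to the annulus `s < ‖y‖ ≤ t`. -/
def annulus (K : Space n → ℂ) (s t : ℝ) : Space n → ℂ := {y | s < ‖y‖ ∧ ‖y‖ ≤ t}.indicator K

theorem measurableSet_annulus (s t : ℝ) : MeasurableSet {y : Space n | s < ‖y‖ ∧ ‖y‖ ≤ t} :=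
  (measurableSet_lt measurable_const measurable_norm).inter
    (measurableSet_le measurable_norm measurable_const)

/-- What the estimates for the short variation use of the kernel: the mass of annuli and the
decay of the Fourier transform of the truncations to `2 ^ j < ‖y‖ ≤ t`. -/
structure KernelBounds (K : Space n → ℂ) (A β : ℝ) : Prop where
  stronglyMeasurable : StronglyMeasurable K
  nonneg : 0 ≤ A
  mass : ∀ s t, 0 < s → ∫⁻ y, ‖annulus K s t y‖ₑ ≤ ENNReal.ofReal (A * ((t - s) / s))
  fourier : ∀ (j r : ℤ) (t : ℝ) (ξ : Space n), 2 ^ j ≤ t → t ≤ 2 ^ (j + 1) → 2 ^ r ≤ ‖ξ‖ →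
    ‖ξ‖ < 2 ^ (r + 1) → ‖𝓕 (annulus K (2 ^ j) t) ξ‖ ≤ A * (1 + |((j + r : ℤ) : ℝ)|) ^ (-β)

theorem KernelBounds.isKernel {K : Space n → ℂ} {A β : ℝ} (hK : KernelBounds K A β) {s : ℝ}
    (hs : 0 < s) (t : ℝ) : IsKernel (annulus K s t) := by
  refine ⟨hK.stronglyMeasurable.indicator (measurableSet_annulus s t), ⟨?_, ?_⟩, t, fun x hx => ?_⟩
  · exact (hK.stronglyMeasurable.indicator (measurableSet_annulus s t)).aestronglyMeasurable
  · exact (hK.mass s t hs).trans_lt ENNReal.ofReal_lt_top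
  · exact Set.indicator_of_notMem (fun h => absurd h.2 (not_le.2 hx)) _

theorem radial_enorm_roughKernel (hn : 1 ≤ n) (Ω : USphere n → ℂ) (θ : USphere n) {r : ℝ}
    (hr : 0 < r) : ENNReal.ofReal (r ^ (n - 1)) * ‖roughKernel Ω (r • (θ : Space n))‖ₑ =
      ‖Ω θ‖ₑ * ENNReal.ofReal r⁻¹ := by
  rw [roughKernel_smul Ω θ hr, div_eq_mul_inv, enorm_mul, mul_left_comm]
  congr 1
  rw [← Complex.ofReal_inv, ← ofReal_norm, Complex.norm_real,
    Real.norm_of_nonneg (by positivity),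
    ← ENNReal.ofReal_mul (by positivity)]
  congr 1
  obtain ⟨m, rfl⟩ := Nat.exists_eq_add_of_le hn
  rw [Nat.add_sub_cancel_left, pow_add]
  field_simp

theorem lintegral_annulus_le (hn : 1 ≤ n) {Ω : USphere n → ℂ} (hΩ : Measurable Ω) {s : ℝ}
    (hs : 0 < s) (t : ℝ) : ∫⁻ y, ‖annulus (roughKernel Ω) s t y‖ₑ ≤
      (∫⁻ θ, ‖Ω θ‖ₑ ∂(surf n)) * ENNReal.ofReal ((t - s) / s) := by
  have hm : Measurable fun y : Space n => ‖annulus (roughKernel Ω) s t y‖ₑ :=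
    ((measurable_roughKernel hΩ).indicator (measurableSet_annulus s t)).enorm
  rw [lintegral_polar hn hm,
    ← lintegral_mul_const _ hΩ.enorm]
  refine lintegral_mono fun θ => ?_
  have h1 : ∀ r ∈ Set.Ioi (0 : ℝ), ENNReal.ofReal (r ^ (n - 1)) *
      ‖annulus (roughKernel Ω) s t (r • (θ : Space n))‖ₑ ≤
      (Set.Ioc s t).indicator (fun _ => ‖Ω θ‖ₑ * ENNReal.ofReal s⁻¹) r := by
    intro r hr
    have hr' : 0 < r := hr
    have hnorm : ‖r • (θ : Space n)‖ = r := by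
      rw [norm_smul, norm_eq_of_mem_sphere θ, mul_one, Real.norm_of_nonneg hr'.le]
    by_cases h : s < r ∧ r ≤ t
    · rw [Set.indicator_of_mem (show r ∈ Set.Ioc s t from h), annulus, Set.indicator_of_mem
        (show r • (θ : Space n) ∈ {y : Space n | s < ‖y‖ ∧ ‖y‖ ≤ t} by
          simpa only [Set.mem_ofPred_eq, hnorm] using h), radial_enorm_roughKernel hn Ω θ hr']
      gcongr
      exact h.1.le
    · rw [annulus, Set.indicator_of_notMem
        (show r • (θ : Space n) ∉ {y : Space n | s < ‖y‖ ∧ ‖y‖ ≤ t} by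
          simpa only [Set.mem_ofPred_eq, hnorm] using h)]
      simp
  calc _ ≤ ∫⁻ r in Set.Ioi (0 : ℝ),
        (Set.Ioc s t).indicator (fun _ => ‖Ω θ‖ₑ * ENNReal.ofReal s⁻¹) r :=
        setLIntegral_mono' measurableSet_Ioi h1
    _ ≤ ∫⁻ r, (Set.Ioc s t).indicator (fun _ => ‖Ω θ‖ₑ * ENNReal.ofReal s⁻¹) r :=
        setLIntegral_le_lintegral _ _
    _ = _ := by
        rw [lintegral_indicator measurableSet_Ioc, setLIntegral_const, Real.volume_Ioc, mul_assoc,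
          ← ENNReal.ofReal_mul (by positivity)]
        congr 2
        field_simp

/-- The oscillatory integral `∫_a^t e^{-2πirs} dr / r`. -/
def osc (a t s : ℝ) : ℂ :=
  ∫ r in a..t, ((r⁻¹ : ℝ) : ℂ) * Complex.exp (((-2 * Real.pi * (r * s) : ℝ) : ℂ) * Complex.I)

/-- In polar coordinates the multiplier of a truncated kernel becomes an average of `osc`. -/
theorem fourier_annulus (hn : 1 ≤ n) {Ω : USphere n → ℂ} {a t : ℝ} (ha : 0 < a) (hat : a ≤ t)
    (hint : Integrable (annulus (roughKernel Ω) a t)) (ξ : Space n) :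
    𝓕 (annulus (roughKernel Ω) a t) ξ =
      ∫ θ : USphere n, Ω θ * osc a t (inner ℝ (θ : Space n) ξ) ∂(surf n) := by
  have hg : Integrable fun v : Space n => Complex.exp (((-2 * Real.pi * inner ℝ v ξ : ℝ) : ℂ) *
      Complex.I) * annulus (roughKernel Ω) a t v := by
    refine hint.bdd_mul (c := 1) ?_ (Eventually.of_forall fun v => (Complex.norm_exp_ofReal_mul_I _).le)
    have : Continuous fun v : Space n =>
        Complex.exp (((-2 * Real.pi * inner ℝ v ξ : ℝ) : ℂ) * Complex.I) := by fun_prop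
    exact this.aestronglyMeasurable
  rw [Real.fourier_eq']
  simp only [smul_eq_mul]
  rw [integral_polar hn hg]
  refine integral_congr_ae (Eventually.of_forall fun θ => ?_)
  simp only [osc]
  rw [intervalIntegral.integral_of_le hat, ← integral_const_mul,
    ← integral_indicator measurableSet_Ioi, ← integral_indicator measurableSet_Ioc]
  refine integral_congr_ae (Eventually.of_forall fun r => ?_)
  by_cases hr : 0 < r
  swap
  · rw [Set.indicator_of_notMem (show r ∉ Set.Ioi (0 : ℝ) from hr), Set.indicator_of_notMem
      (fun h => hr (ha.trans h.1))]
  have hnorm : ‖r • (θ : Space n)‖ = r := by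
    rw [norm_smul, norm_eq_of_mem_sphere θ, mul_one, Real.norm_of_nonneg hr.le]
  rw [Set.indicator_of_mem (show r ∈ Set.Ioi (0 : ℝ) from hr)]
  by_cases h : a < r ∧ r ≤ t
  · rw [Set.indicator_of_mem (show r ∈ Set.Ioc a t from h), annulus, Set.indicator_of_mem
        (show r • (θ : Space n) ∈ {y : Space n | a < ‖y‖ ∧ ‖y‖ ≤ t} by
          simpa only [Set.mem_ofPred_eq, hnorm] using h), roughKernel_smul Ω θ hr, inner_smul_left]
    obtain ⟨m, rfl⟩ := Nat.exists_eq_add_of_le hn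
    have hr0 : (r : ℂ) ≠ 0 := Complex.ofReal_ne_zero.2 hr.ne'
    rw [Nat.add_sub_cancel_left, pow_add, Complex.real_smul]
    push_cast
    simp only [conj_trivial]
    field_simp
  · rw [annulus, Set.indicator_of_notMem
        (show r • (θ : Space n) ∉ {y : Space n | a < ‖y‖ ∧ ‖y‖ ≤ t} by
          simpa only [Set.mem_ofPred_eq, hnorm] using h), Set.indicator_of_notMem
        (show r ∉ Set.Ioc a t from h)]
    simp

theorem norm_osc_le {a t : ℝ} (ha : 0 < a) (hat : a ≤ t) (s : ℝ) : ‖osc a t s‖ ≤ (t - a) / a := by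
  have h := intervalIntegral.norm_integral_le_of_norm_le_const (a := a) (b := t) (C := a⁻¹)
    (f := fun r => ((r⁻¹ : ℝ) : ℂ) * Complex.exp (((-2 * Real.pi * (r * s) : ℝ) : ℂ) * Complex.I))
    (fun r hr => by
      rw [Set.uIoc_of_le hat] at hr
      rw [norm_mul, Complex.norm_exp_ofReal_mul_I, mul_one, Complex.norm_real,
        Real.norm_of_nonneg (inv_nonneg.2 (ha.trans hr.1).le)]
      exact inv_anti₀ ha hr.1.le)
  rw [abs_of_nonneg (sub_nonneg.2 hat)] at h
  refine h.trans (le_of_eq ?_)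
  field_simp

theorem continuousOn_osc_integrand {a t : ℝ} (ha : 0 < a) (hat : a ≤ t) (s : ℝ) :
    ContinuousOn (fun r : ℝ => ((r⁻¹ : ℝ) : ℂ) *
      Complex.exp (((-2 * Real.pi * (r * s) : ℝ) : ℂ) * Complex.I)) (Set.uIcc a t) := by
  rw [Set.uIcc_of_le hat]
  refine ContinuousOn.mul ?_ (by fun_prop)
  exact Complex.continuous_ofReal.comp_continuousOn
    (continuousOn_inv₀.mono fun r hr => (ha.trans_le hr.1).ne')

theorem norm_osc_sub_le {a t : ℝ} (ha : 0 < a) (hat : a ≤ t) (s s' : ℝ) :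
    ‖osc a t s - osc a t s'‖ ≤ 2 * Real.pi * |s - s'| * (t - a) := by
  unfold osc
  rw [← intervalIntegral.integral_sub (continuousOn_osc_integrand ha hat s).intervalIntegrable
    (continuousOn_osc_integrand ha hat s').intervalIntegrable]
  have h := intervalIntegral.norm_integral_le_of_norm_le_const (a := a) (b := t)
    (C := 2 * Real.pi * |s - s'|)
    (f := fun r => ((r⁻¹ : ℝ) : ℂ) * Complex.exp (((-2 * Real.pi * (r * s) : ℝ) : ℂ) * Complex.I) -
      ((r⁻¹ : ℝ) : ℂ) * Complex.exp (((-2 * Real.pi * (r * s') : ℝ) : ℂ) * Complex.I))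
    (fun r hr => by
      rw [Set.uIoc_of_le hat] at hr
      have hr0 : 0 < r := ha.trans hr.1
      have e : Complex.exp (((-2 * Real.pi * (r * s) : ℝ) : ℂ) * Complex.I) =
          Complex.exp (((-2 * Real.pi * (r * s') : ℝ) : ℂ) * Complex.I) *
          Complex.exp (((-2 * Real.pi * (r * (s - s')) : ℝ) : ℂ) * Complex.I) := by
        rw [← Complex.exp_add]
        congr 1
        push_cast
        ring
      rw [← mul_sub, e, ← mul_sub_one, norm_mul, norm_mul, Complex.norm_exp_ofReal_mul_I, one_mul,
        Complex.norm_real, Real.norm_of_nonneg (inv_nonneg.2 hr0.le)]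
      calc r⁻¹ * _ ≤ r⁻¹ * |-2 * Real.pi * (r * (s - s'))| := by
            gcongr; exact norm_cexp_sub_one_le _
        _ = _ := by
            rw [abs_mul, abs_mul, abs_mul, abs_of_pos hr0, abs_of_pos Real.pi_pos]
            norm_num
            field_simp)
  rwa [abs_of_nonneg (sub_nonneg.2 hat)] at h

theorem continuous_osc {a t : ℝ} (ha : 0 < a) (hat : a ≤ t) : Continuous (osc a t) := by
  refine (LipschitzWith.of_dist_le_mul (K := (2 * Real.pi * (t - a)).toNNReal)
    fun s s' => ?_).continuous
  rw [Real.coe_toNNReal _ (mul_nonneg Real.two_pi_pos.le (sub_nonneg.2 hat)), dist_eq_norm,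
    Real.dist_eq]
  refine (norm_osc_sub_le ha hat s s').trans (le_of_eq (by ring))

/-- The decay of the oscillatory integral, from one integration by parts. -/
theorem abs_mul_norm_osc_le {a t : ℝ} (ha : 0 < a) (hat : a ≤ t) (s : ℝ) :
    |s| * ‖osc a t s‖ ≤ a⁻¹ := by
  have ht : 0 < t := ha.trans_le hat
  set e : ℝ → ℂ := fun r => Complex.exp (((-2 * Real.pi * (r * s) : ℝ) : ℂ) * Complex.I) with he
  set c : ℂ := ((-2 * Real.pi * s : ℝ) : ℂ) * Complex.I with hc
  have hec : Continuous e := by simp only [he]; fun_prop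
  have hde : ∀ r, HasDerivAt e (e r * c) r := by
    intro r
    have h1 : HasDerivAt (fun r : ℝ => ((-2 * Real.pi * (r * s) : ℝ) : ℂ) * Complex.I) c r := by
      have h2 : HasDerivAt (fun r : ℝ => -2 * Real.pi * (r * s)) (-2 * Real.pi * s) r := by
        have := ((hasDerivAt_id r).mul_const s).const_mul (-2 * Real.pi)
        simpa using this
      exact (h2.ofReal_comp).mul_const Complex.I
    exact h1.cexp
  have hinv : ∀ r, 0 < r → HasDerivAt (fun r : ℝ => ((r⁻¹ : ℝ) : ℂ)) ((-(r ^ 2)⁻¹ : ℝ) : ℂ) r :=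
    fun r hr => (hasDerivAt_inv hr.ne').ofReal_comp
  have hcont1 : ContinuousOn (fun r : ℝ => ((-(r ^ 2)⁻¹ : ℝ) : ℂ)) (Set.uIcc a t) := by
    rw [Set.uIcc_of_le hat]
    refine Complex.continuous_ofReal.comp_continuousOn (ContinuousOn.neg ?_)
    exact ContinuousOn.inv₀ (by fun_prop) fun r hr => (pow_pos (ha.trans_le hr.1) 2).ne'
  have hib := intervalIntegral.integral_mul_deriv_eq_deriv_mul (a := a) (b := t)
    (u := fun r : ℝ => ((r⁻¹ : ℝ) : ℂ)) (v := e) (u' := fun r => ((-(r ^ 2)⁻¹ : ℝ) : ℂ))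
    (v' := fun r => e r * c)
    (fun r hr => hinv r (by rw [Set.uIcc_of_le hat] at hr; exact ha.trans_le hr.1))
    (fun r _ => hde r) hcont1.intervalIntegrable
    ((hec.mul continuous_const).intervalIntegrable _ _)
  have hosc : (∫ r in a..t, ((r⁻¹ : ℝ) : ℂ) * (e r * c)) = osc a t s * c := by
    unfold osc
    rw [← intervalIntegral.integral_mul_const]
    simp only [he, mul_assoc]
  have hrem : ‖∫ r in a..t, ((-(r ^ 2)⁻¹ : ℝ) : ℂ) * e r‖ ≤ a⁻¹ - t⁻¹ := by
    have h1 : ∫ r in a..t, (r ^ 2)⁻¹ = a⁻¹ - t⁻¹ := by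
      have h2 := intervalIntegral.integral_eq_sub_of_hasDerivAt (a := a) (b := t)
        (f := fun r : ℝ => -r⁻¹) (f' := fun r => (r ^ 2)⁻¹)
        (fun r hr => by
          rw [Set.uIcc_of_le hat] at hr
          have h3 := (hasDerivAt_inv (ha.trans_le hr.1).ne').neg
          rw [neg_neg] at h3
          exact h3) (by
          refine ContinuousOn.intervalIntegrable ?_
          rw [Set.uIcc_of_le hat]
          exact ContinuousOn.inv₀ (by fun_prop) fun r hr => (pow_pos (ha.trans_le hr.1) 2).ne')
      rw [h2]; ring
    rw [← h1]
    refine intervalIntegral.norm_integral_le_of_norm_le hat ?_ ?_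
    · filter_upwards with r hr
      rw [norm_mul, Complex.norm_exp_ofReal_mul_I, mul_one, Complex.norm_real, norm_neg,
        Real.norm_of_nonneg (by positivity)]
    · refine ContinuousOn.intervalIntegrable ?_
      rw [Set.uIcc_of_le hat]
      exact ContinuousOn.inv₀ (by fun_prop) fun r hr => (pow_pos (ha.trans_le hr.1) 2).ne'
  have hb : ∀ r, 0 < r → ‖((r⁻¹ : ℝ) : ℂ) * e r‖ = r⁻¹ := fun r hr => by
    rw [norm_mul, Complex.norm_exp_ofReal_mul_I, mul_one, Complex.norm_real,
      Real.norm_of_nonneg (inv_nonneg.2 hr.le)]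
  have hmain : ‖osc a t s * c‖ ≤ 2 * a⁻¹ := by
    rw [← hosc, hib]
    calc _ ≤ ‖((t⁻¹ : ℝ) : ℂ) * e t‖ + ‖((a⁻¹ : ℝ) : ℂ) * e a‖ + (a⁻¹ - t⁻¹) :=
          (norm_sub_le _ _).trans (add_le_add (norm_sub_le _ _) hrem)
      _ = 2 * a⁻¹ := by rw [hb t ht, hb a ha]; ring
  have hcn : ‖c‖ = 2 * Real.pi * |s| := by
    rw [hc, norm_mul, Complex.norm_I, mul_one, Complex.norm_real, Real.norm_eq_abs, abs_mul,
      abs_mul, abs_of_pos Real.pi_pos]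
    norm_num
  rw [norm_mul, hcn] at hmain
  have h3 : 0 ≤ |s| * ‖osc a t s‖ := by positivity
  nlinarith [Real.pi_gt_three]

theorem rpow_le_mul_exp {β c : ℝ} (hβ : 0 < β) (hc : 0 < c) {y : ℝ} (hy : 0 ≤ y) :
    y ^ β ≤ (β / c) ^ β * Real.exp (c * y) := by
  have h1 : y ≤ (β / c) * Real.exp (c * y / β) := by
    have h2 := Real.add_one_le_exp (c * y / β)
    calc y = (β / c) * (c * y / β) := by field_simp
      _ ≤ _ := by gcongr; linarith
  calc y ^ β ≤ ((β / c) * Real.exp (c * y / β)) ^ β := by gcongr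
    _ = _ := by
      rw [Real.mul_rpow (by positivity) (Real.exp_pos _).le, ← Real.exp_mul]
      congr 2
      field_simp

/-- The source of the logarithmic decay: `min 1 (1 / (u c))` is at most a constant multiple of
`(1 + log u) ^ (-β) (1 + log (1 / c) ^ β)`.  If `c √u ≥ 1` it is at most `u ^ (-1 / 2)`, and otherwise
`log u ≤ 2 log (1 / c)`. -/
theorem min_decay_le {β u c x : ℝ} (hβ : 0 < β) (hu : 1 ≤ u) (hc : 0 < c) (hc1 : c ≤ 1)
    (h1 : x ≤ 1) (h2 : u * c * x ≤ 1) :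
    x ≤ (1 + Real.log u) ^ (-β) * ((3 ^ β + (2 * β) ^ β * Real.exp (1 / 2)) *
      (1 + Real.log (1 / c) ^ β)) := by
  have hu0 : 0 < u := by linarith
  have hlu : 0 ≤ Real.log u := Real.log_nonneg hu
  have hL : 0 ≤ Real.log (1 / c) := Real.log_nonneg ((one_le_div hc).2 hc1)
  have hLβ : 0 ≤ Real.log (1 / c) ^ β := by positivity
  have hpos : 0 < (1 + Real.log u) ^ β := by positivity
  rw [Real.rpow_neg (by positivity), ← div_eq_inv_mul, le_div_iff₀ hpos]
  by_cases hx : x ≤ 0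
  · refine (mul_nonpos_of_nonpos_of_nonneg hx hpos.le).trans (by positivity)
  push Not at hx
  by_cases hcase : 1 ≤ c * Real.sqrt u
  · have hs : 0 < Real.sqrt u := Real.sqrt_pos.2 hu0
    have h3 : x * Real.sqrt u ≤ 1 := by
      have h4 : u = Real.sqrt u * Real.sqrt u := (Real.mul_self_sqrt hu0.le).symm
      have h5 : Real.sqrt u * (c * Real.sqrt u) * x ≤ 1 := by
        calc _ = (Real.sqrt u * Real.sqrt u) * c * x := by ring
          _ ≤ 1 := by rw [← h4]; exact h2
      have h6 : Real.sqrt u * x ≤ Real.sqrt u * (c * Real.sqrt u) * x := by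
        have : Real.sqrt u ≤ Real.sqrt u * (c * Real.sqrt u) := le_mul_of_one_le_right hs.le hcase
        gcongr
      linarith
    have h7 := rpow_le_mul_exp hβ (c := 1 / 2) (by norm_num) (y := 1 + Real.log u) (by positivity)
    have h8 : Real.exp (1 / 2 * (1 + Real.log u)) = Real.exp (1 / 2) * Real.sqrt u := by
      rw [mul_add, Real.exp_add, mul_one, Real.sqrt_eq_rpow, Real.rpow_def_of_pos hu0]
      congr 2
      ring
    rw [h8] at h7
    calc x * (1 + Real.log u) ^ β
        ≤ x * ((β / (1 / 2)) ^ β * (Real.exp (1 / 2) * Real.sqrt u)) := by gcongr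
      _ = (2 * β) ^ β * Real.exp (1 / 2) * (x * Real.sqrt u) := by
          rw [show β / (1 / 2) = 2 * β by ring]; ring
      _ ≤ (2 * β) ^ β * Real.exp (1 / 2) * 1 := by gcongr
      _ ≤ _ := by
          have h9 : (0 : ℝ) ≤ 3 ^ β := by positivity
          have h10 : (0 : ℝ) ≤ (2 * β) ^ β * Real.exp (1 / 2) := by positivity
          nlinarith [mul_nonneg h9 hLβ, mul_nonneg h10 hLβ]
  · push Not at hcase
    have h3 : Real.log u ≤ 2 * Real.log (1 / c) := by
      have h4 : Real.sqrt u ≤ 1 / c := by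
        rw [le_div_iff₀ hc]; linarith
      have h5 := Real.log_le_log (Real.sqrt_pos.2 hu0) h4
      rw [Real.log_sqrt hu0.le] at h5
      linarith
    have h6 : (1 + Real.log u) ^ β ≤ 3 ^ β * (1 + Real.log (1 / c) ^ β) := by
      have h3β : (0 : ℝ) < 3 ^ β := by positivity
      rcases le_total (Real.log (1 / c)) 1 with h | h
      · calc (1 + Real.log u) ^ β ≤ 3 ^ β := by gcongr; linarith
          _ ≤ _ := by nlinarith
      · calc (1 + Real.log u) ^ β ≤ (3 * Real.log (1 / c)) ^ β := by gcongr; linarith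
          _ = 3 ^ β * Real.log (1 / c) ^ β := Real.mul_rpow (by norm_num) hL
          _ ≤ _ := by nlinarith
    calc x * (1 + Real.log u) ^ β ≤ 1 * (3 ^ β * (1 + Real.log (1 / c) ^ β)) := by gcongr
      _ ≤ _ := by
          rw [one_mul]
          gcongr
          exact le_add_of_nonneg_right (by positivity)

theorem two_zpow_eq_exp (m : ℤ) : (2 : ℝ) ^ m = Real.exp (Real.log 2 * m) := by
  rw [← Real.rpow_intCast, Real.rpow_def_of_pos two_pos]

theorem one_add_log_rpow_neg_le {β u : ℝ} (hβ : 0 < β) {m : ℤ} (hm : 0 ≤ m) (hu : 2 ^ m ≤ u) :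
    (1 + Real.log u) ^ (-β) ≤ 2 ^ β * (1 + |(m : ℝ)|) ^ (-β) := by
  have hm' : (0 : ℝ) ≤ m := by exact_mod_cast hm
  have h1 : Real.log 2 * m ≤ Real.log u := by
    rw [← Real.log_exp (Real.log 2 * m), ← two_zpow_eq_exp]
    exact Real.log_le_log (by positivity) hu
  have h2 := Real.log_two_gt_d9
  have h3 : (1 + |(m : ℝ)|) / 2 ≤ 1 + Real.log u := by
    rw [abs_of_nonneg hm']
    nlinarith
  calc (1 + Real.log u) ^ (-β) ≤ ((1 + |(m : ℝ)|) / 2) ^ (-β) :=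
        Real.rpow_le_rpow_of_nonpos (by positivity) h3 (by linarith)
    _ = _ := by
        rw [Real.div_rpow (by positivity) (by norm_num), Real.rpow_neg two_pos.le, div_inv_eq_mul,
          mul_comm]

theorem two_zpow_le_rpow_neg {β : ℝ} (hβ : 0 < β) {m : ℤ} (hm : m ≤ 0) :
    (2 : ℝ) ^ m ≤ 2 * (β / Real.log 2) ^ β * (1 + |(m : ℝ)|) ^ (-β) := by
  have hm' : (m : ℝ) ≤ 0 := by exact_mod_cast hm
  have h0 : 0 < Real.log 2 := Real.log_pos (by norm_num)
  have h1 := rpow_le_mul_exp hβ h0 (y := 1 + |(m : ℝ)|) (by positivity)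
  have h2 : Real.exp (Real.log 2 * (1 + |(m : ℝ)|)) = 2 * (2 ^ m)⁻¹ := by
    rw [mul_add, Real.exp_add, mul_one, Real.exp_log two_pos, two_zpow_eq_exp, ← Real.exp_neg,
      abs_of_nonpos hm']
    congr 2
    ring
  rw [h2] at h1
  have h3 : (0 : ℝ) < 2 ^ m := by positivity
  rw [Real.rpow_neg (by positivity), ← div_eq_mul_inv, le_div_iff₀ (by positivity)]
  calc (2 : ℝ) ^ m * (1 + |(m : ℝ)|) ^ β
      ≤ 2 ^ m * ((β / Real.log 2) ^ β * (2 * (2 ^ m)⁻¹)) := by gcongr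
    _ = _ := by field_simp

/-- Low frequencies: the cancellation of `Ω`. -/
theorem norm_fourier_annulus_le_low (hn : 1 ≤ n) {Ω : USphere n → ℂ}
    (hΩ_int : Integrable Ω (surf n)) (hΩ_mean : ∫ θ, Ω θ ∂(surf n) = 0)
    {a t : ℝ} (ha : 0 < a) (hat : a ≤ t) (hta : t ≤ 2 * a)
    (hint : Integrable (annulus (roughKernel Ω) a t)) (ξ : Space n) :
    ‖𝓕 (annulus (roughKernel Ω) a t) ξ‖ ≤
      2 * Real.pi * (∫ θ, ‖Ω θ‖ ∂(surf n)) * (a * ‖ξ‖) := by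
  have hosc : Continuous fun θ : USphere n => osc a t (inner ℝ (θ : Space n) ξ) :=
    (continuous_osc ha hat).comp (continuous_subtype_val.inner continuous_const)
  have hint' : Integrable (fun θ : USphere n => Ω θ * osc a t (inner ℝ (θ : Space n) ξ))
      (surf n) :=
    hΩ_int.mul_bdd (c := (t - a) / a) hosc.aestronglyMeasurable
      (Eventually.of_forall fun θ => norm_osc_le ha hat _)
  have h1 : 𝓕 (annulus (roughKernel Ω) a t) ξ = ∫ θ : USphere n, Ω θ *
      (osc a t (inner ℝ (θ : Space n) ξ) - osc a t 0) ∂(surf n) := by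
    rw [fourier_annulus hn ha hat hint ξ]
    simp only [mul_sub]
    rw [integral_sub hint' (hΩ_int.mul_const _), integral_mul_const, hΩ_mean, zero_mul, sub_zero]
  rw [h1]
  refine (norm_integral_le_of_norm_le (hΩ_int.norm.mul_const (2 * Real.pi * (a * ‖ξ‖)))
    (Eventually.of_forall fun θ => ?_)).trans (le_of_eq ?_)
  · rw [norm_mul]
    gcongr
    refine (norm_osc_sub_le ha hat _ _).trans ?_
    have h2 : |inner ℝ (θ : Space n) ξ| ≤ ‖ξ‖ := by
      have := abs_real_inner_le_norm (θ : Space n) ξ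
      rwa [norm_eq_of_mem_sphere θ, one_mul] at this
    rw [sub_zero]
    calc 2 * Real.pi * |inner ℝ (θ : Space n) ξ| * (t - a) ≤ 2 * Real.pi * ‖ξ‖ * a := by
          gcongr; linarith
      _ = _ := by ring
  · rw [integral_mul_const]; ring

/-- High frequencies: the logarithmic condition on `Ω`. -/
theorem enorm_fourier_annulus_le_high (hn : 1 ≤ n) {Ω : USphere n → ℂ} (hΩ : Measurable Ω)
    {β : ℝ} (hβ : 0 < β)
    {a t : ℝ} (ha : 0 < a) (hat : a ≤ t) (hta : t ≤ 2 * a)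
    (hint : Integrable (annulus (roughKernel Ω) a t)) {ξ : Space n} (hu : 1 ≤ a * ‖ξ‖) :
    ‖𝓕 (annulus (roughKernel Ω) a t) ξ‖ₑ ≤
      ENNReal.ofReal ((1 + Real.log (a * ‖ξ‖)) ^ (-β) *
        (3 ^ β + (2 * β) ^ β * Real.exp (1 / 2))) *
      ((∫⁻ θ, ‖Ω θ‖ₑ ∂(surf n)) + ⨆ ξ : USphere n, ∫⁻ θ : USphere n, ‖Ω θ‖ₑ *
        ENNReal.ofReal (Real.log (1 / |inner ℝ (θ : Space n) (ξ : Space n)|) ^ β) ∂(surf n)) := by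
  have hξ : 0 < ‖ξ‖ := by
    rcases (norm_nonneg ξ).eq_or_lt with h | h
    · rw [← h, mul_zero] at hu; linarith
    · exact h
  set ξ' : USphere n := direction ξ (norm_pos_iff.1 hξ) with hξ'
  have hinner : ∀ θ : USphere n, inner ℝ (θ : Space n) ξ =
      ‖ξ‖ * inner ℝ (θ : Space n) (ξ' : Space n) := by
    intro θ
    change _ = ‖ξ‖ * inner ℝ (θ : Space n) (‖ξ‖⁻¹ • ξ)
    rw [inner_smul_right, ← mul_assoc, mul_inv_cancel₀ hξ.ne', one_mul]
  set D : ℝ := (1 + Real.log (a * ‖ξ‖)) ^ (-β) * (3 ^ β + (2 * β) ^ β * Real.exp (1 / 2)) with hD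
  have hD0 : 0 ≤ D := by
    have := Real.log_nonneg hu
    positivity
  have hpt : ∀ᵐ θ ∂(surf n), ‖Ω θ * osc a t (inner ℝ (θ : Space n) ξ)‖ₑ ≤
      ENNReal.ofReal D * (‖Ω θ‖ₑ + ‖Ω θ‖ₑ *
        ENNReal.ofReal (Real.log (1 / |inner ℝ (θ : Space n) (ξ' : Space n)|) ^ β)) := by
    filter_upwards [measure_eq_zero_iff_ae_notMem.1 (surf_hyperplane ξ')] with θ hθ
    have hc0 : 0 < |inner ℝ (θ : Space n) (ξ' : Space n)| := abs_pos.2 hθ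
    have hc1 : |inner ℝ (θ : Space n) (ξ' : Space n)| ≤ 1 := by
      have := abs_real_inner_le_norm (θ : Space n) ξ'
      rwa [norm_eq_of_mem_sphere θ, norm_eq_of_mem_sphere ξ', one_mul] at this
    have h1 : ‖osc a t (inner ℝ (θ : Space n) ξ)‖ ≤ 1 :=
      (norm_osc_le ha hat _).trans (by rw [div_le_one ha]; linarith)
    have h2 : a * ‖ξ‖ * |inner ℝ (θ : Space n) (ξ' : Space n)| *
        ‖osc a t (inner ℝ (θ : Space n) ξ)‖ ≤ 1 := by
      have h3 := abs_mul_norm_osc_le ha hat (inner ℝ (θ : Space n) ξ)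
      rw [hinner θ, abs_mul, abs_of_pos hξ, ← hinner θ] at h3
      calc _ = a * (‖ξ‖ * |inner ℝ (θ : Space n) (ξ' : Space n)| *
            ‖osc a t (inner ℝ (θ : Space n) ξ)‖) := by ring
        _ ≤ a * a⁻¹ := by gcongr
        _ = 1 := mul_inv_cancel₀ ha.ne'
    have h4 := min_decay_le hβ hu hc0 hc1 h1 h2
    rw [← mul_assoc] at h4
    have hl : 0 ≤ Real.log (1 / |inner ℝ (θ : Space n) (ξ' : Space n)|) ^ β :=
      Real.rpow_nonneg (Real.log_nonneg ((one_le_div hc0).2 hc1)) _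
    calc ‖Ω θ * osc a t (inner ℝ (θ : Space n) ξ)‖ₑ
        = ‖Ω θ‖ₑ * ENNReal.ofReal ‖osc a t (inner ℝ (θ : Space n) ξ)‖ := by
          rw [enorm_mul, ofReal_norm]
      _ ≤ ‖Ω θ‖ₑ * ENNReal.ofReal (D *
            (1 + Real.log (1 / |inner ℝ (θ : Space n) (ξ' : Space n)|) ^ β)) := by gcongr
      _ = _ := by
          rw [ENNReal.ofReal_mul hD0, ENNReal.ofReal_add zero_le_one hl, ENNReal.ofReal_one]
          ring
  rw [fourier_annulus hn ha hat hint ξ]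
  calc _ ≤ ∫⁻ θ, ‖Ω θ * osc a t (inner ℝ (θ : Space n) ξ)‖ₑ ∂(surf n) :=
        enorm_integral_le_lintegral_enorm _
    _ ≤ ∫⁻ θ, ENNReal.ofReal D * (‖Ω θ‖ₑ + ‖Ω θ‖ₑ *
        ENNReal.ofReal (Real.log (1 / |inner ℝ (θ : Space n) (ξ' : Space n)|) ^ β)) ∂(surf n) :=
        lintegral_mono_ae hpt
    _ = ENNReal.ofReal D * ((∫⁻ θ, ‖Ω θ‖ₑ ∂(surf n)) + ∫⁻ θ : USphere n, ‖Ω θ‖ₑ *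
        ENNReal.ofReal (Real.log (1 / |inner ℝ (θ : Space n) (ξ' : Space n)|) ^ β) ∂(surf n)) := by
        rw [lintegral_const_mul' _ _ ENNReal.ofReal_ne_top, lintegral_add_left hΩ.enorm]
    _ ≤ _ := by
        gcongr
        exact le_iSup (fun ξ : USphere n => ∫⁻ θ : USphere n, ‖Ω θ‖ₑ *
          ENNReal.ofReal (Real.log (1 / |inner ℝ (θ : Space n) (ξ : Space n)|) ^ β) ∂(surf n)) ξ'

/-- The hypotheses on `Ω` give the decay of order `1 + α` of the multipliers, the mean value zero
being used at low and the logarithmic condition at high frequencies. -/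
theorem exists_kernelBounds (hn : 1 ≤ n) {α : ℝ} (hα : 1 < α) {Ω : USphere n → ℂ}
    (hΩm : Measurable Ω) (hΩ_int : Integrable Ω (surf n)) (hΩ_mean : ∫ θ, Ω θ ∂(surf n) = 0)
    (hΩ : Ω ∈ grafakosStefanov n α) : ∃ A, KernelBounds (roughKernel Ω) A (1 + α) := by
  set β := 1 + α with hβdef
  have hβ : 0 < β := by linarith
  set M := ∫ θ, ‖Ω θ‖ ∂(surf n) with hM
  have hM0 : 0 ≤ M := integral_nonneg fun _ => norm_nonneg _
  have hMe : ∫⁻ θ, ‖Ω θ‖ₑ ∂(surf n) = ENNReal.ofReal M :=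
    (ofReal_integral_norm_eq_lintegral_enorm hΩ_int).symm
  have hG : (⨆ ξ : USphere n, ∫⁻ θ : USphere n, ‖Ω θ‖ₑ *
      ENNReal.ofReal (Real.log (1 / |inner ℝ (θ : Space n) (ξ : Space n)|) ^ β) ∂(surf n)) < ∞ := hΩ
  set G := (⨆ ξ : USphere n, ∫⁻ θ : USphere n, ‖Ω θ‖ₑ *
      ENNReal.ofReal (Real.log (1 / |inner ℝ (θ : Space n) (ξ : Space n)|) ^ β) ∂(surf n)) with hGdef
  set C₁ : ℝ := 3 ^ β + (2 * β) ^ β * Real.exp (1 / 2) with hC₁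
  have hC₁0 : 0 ≤ C₁ := by positivity
  set A₁ := C₁ * (M + G.toReal) * 2 ^ β with hA₁
  have hA₁0 : 0 ≤ A₁ := by positivity
  set A₂ := 2 * Real.pi * M * (2 * (2 * (β / Real.log 2) ^ β)) with hA₂
  have hl2 : 0 < Real.log 2 := Real.log_pos (by norm_num)
  have hA₂0 : 0 ≤ A₂ := by have := Real.pi_pos; positivity
  have hmass : ∀ s t, 0 < s → ∫⁻ y, ‖annulus (roughKernel Ω) s t y‖ₑ ≤
      ENNReal.ofReal (M * ((t - s) / s)) := fun s t hs => by
    rw [ENNReal.ofReal_mul hM0, ← hMe]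
    exact lintegral_annulus_le hn hΩm hs t
  have hsm := (measurable_roughKernel hΩm).stronglyMeasurable
  refine ⟨M + A₁ + A₂, hsm, by positivity, fun s t hs => ?_, fun j r t ξ h1 h2 h3 h4 => ?_⟩
  · rcases le_total s t with hst | hst
    · refine (hmass s t hs).trans (ENNReal.ofReal_le_ofReal ?_)
      have : 0 ≤ (t - s) / s := div_nonneg (sub_nonneg.2 hst) hs.le
      gcongr
      linarith
    · refine (hmass s t hs).trans ?_
      rw [ENNReal.ofReal_of_nonpos]
      · exact zero_le
      · exact mul_nonpos_of_nonneg_of_nonpos hM0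
          (div_nonpos_of_nonpos_of_nonneg (sub_nonpos.2 hst) hs.le)
  · have ha : (0 : ℝ) < 2 ^ j := by positivity
    have hta : t ≤ 2 * 2 ^ j := by
      rw [zpow_add₀ two_ne_zero, zpow_one] at h2; linarith
    have hint : Integrable (annulus (roughKernel Ω) (2 ^ j) t) :=
      ⟨(hsm.indicator (measurableSet_annulus _ _)).aestronglyMeasurable,
        (hmass _ t ha).trans_lt ENNReal.ofReal_lt_top⟩
    have hw : 0 ≤ (1 + |((j + r : ℤ) : ℝ)|) ^ (-β) := by positivity
    have hu1 : (2 : ℝ) ^ (j + r) ≤ 2 ^ j * ‖ξ‖ := by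
      rw [zpow_add₀ two_ne_zero]; gcongr
    have hu2 : 2 ^ j * ‖ξ‖ ≤ 2 * (2 : ℝ) ^ (j + r) := by
      rw [zpow_add₀ two_ne_zero]
      rw [zpow_add₀ two_ne_zero, zpow_one] at h4
      calc (2 : ℝ) ^ j * ‖ξ‖ ≤ 2 ^ j * (2 ^ r * 2) := by gcongr
        _ = _ := by ring
    rcases le_total 0 (j + r) with hm | hm
    · have hu : 1 ≤ 2 ^ j * ‖ξ‖ := (one_le_zpow₀ one_le_two hm).trans hu1
      have h5 := enorm_fourier_annulus_le_high hn hΩm hβ ha h1 hta hint hu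
      rw [hMe, ← hGdef, ← ENNReal.ofReal_toReal hG.ne, ← ENNReal.ofReal_add hM0
        ENNReal.toReal_nonneg, ← ENNReal.ofReal_mul (by
          have := Real.log_nonneg hu; positivity), ← ofReal_norm,
        ENNReal.ofReal_le_ofReal_iff (by have := Real.log_nonneg hu; positivity)] at h5
      have h6 := one_add_log_rpow_neg_le hβ hm hu1
      calc _ ≤ _ := h5
        _ ≤ (2 ^ β * (1 + |((j + r : ℤ) : ℝ)|) ^ (-β)) * C₁ * (M + G.toReal) := by gcongr
        _ = A₁ * (1 + |((j + r : ℤ) : ℝ)|) ^ (-β) := by rw [hA₁]; ring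
        _ ≤ _ := by gcongr; linarith
    · have h5 := norm_fourier_annulus_le_low hn hΩ_int hΩ_mean ha h1 hta hint ξ
      have h6 := two_zpow_le_rpow_neg hβ hm
      calc _ ≤ _ := h5
        _ ≤ 2 * Real.pi * M * (2 * (2 * (β / Real.log 2) ^ β *
            (1 + |((j + r : ℤ) : ℝ)|) ^ (-β))) := by
            have := Real.pi_pos
            refine mul_le_mul_of_nonneg_left (hu2.trans ?_) (by positivity)
            gcongr
        _ = A₂ * (1 + |((j + r : ℤ) : ℝ)|) ^ (-β) := by rw [hA₂]; ring
        _ ≤ _ := by gcongr; linarith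

/-- Young's inequality, up to the constants. -/
theorem le_rpow_mul_add {p : ℝ} (hp : 1 < p) {a ρ : ℝ} (ha : 0 ≤ a) (hρ : 0 < ρ) :
    a ≤ a ^ p * ρ + ρ ^ (-(1 / (p - 1))) := by
  have hp1 : 0 < p - 1 := by linarith
  rcases le_total a (ρ ^ (-(1 / (p - 1)))) with h | h
  · have : 0 ≤ a ^ p * ρ := by positivity
    linarith
  · have hc : 0 < ρ ^ (-(1 / (p - 1))) := by positivity
    have ha0 : 0 < a := hc.trans_le h
    have h1 : ρ⁻¹ ≤ a ^ (p - 1) := by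
      calc ρ⁻¹ = (ρ ^ (-(1 / (p - 1)))) ^ (p - 1) := by
            rw [← Real.rpow_mul hρ.le, neg_mul, one_div_mul_cancel hp1.ne', Real.rpow_neg_one]
        _ ≤ _ := by gcongr
    have h2 : a ^ p = a * a ^ (p - 1) := by
      rw [Real.rpow_sub_one ha0.ne']; field_simp
    have h3 : a ≤ a ^ p * ρ := by
      rw [h2]
      calc a = a * (ρ⁻¹ * ρ) := by rw [inv_mul_cancel₀ hρ.ne', mul_one]
        _ ≤ a * (a ^ (p - 1) * ρ) := by gcongr
        _ = _ := by ring
    linarith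

theorem lintegral_roughKernel_mul_radial (hn : 1 ≤ n) {Ω : USphere n → ℂ} (hΩ : Measurable Ω)
    {g : ℝ → ℝ≥0∞} (hg : Measurable g) :
    ∫⁻ y, ‖roughKernel Ω y‖ₑ * g ‖y‖ =
      (∫⁻ θ, ‖Ω θ‖ₑ ∂(surf n)) * ∫⁻ r in Set.Ioi (0 : ℝ), ENNReal.ofReal r⁻¹ * g r := by
  have hm : Measurable fun y : Space n => ‖roughKernel Ω y‖ₑ * g ‖y‖ :=
    (measurable_roughKernel hΩ).enorm.mul (hg.comp measurable_norm)
  rw [lintegral_polar hn hm, ← lintegral_mul_const _ hΩ.enorm]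
  refine lintegral_congr fun θ => ?_
  rw [← lintegral_const_mul' _ _ enorm_ne_top]
  refine setLIntegral_congr_fun measurableSet_Ioi fun r hr => ?_
  have hr' : 0 < r := hr
  have hnorm : ‖r • (θ : Space n)‖ = r := by
    rw [norm_smul, norm_eq_of_mem_sphere θ, mul_one, Real.norm_of_nonneg hr'.le]
  simp only [hnorm]
  rw [← mul_assoc, radial_enorm_roughKernel hn Ω θ hr', mul_assoc]

/-- Young's inequality bounds `|f(x - y)|` by `|y| |f(x - y)| ^ p + |y| ^ (-1 / (p - 1))`.  The second
term is integrable against the kernel on `|y| > ε`.  For the first one, `x` ranges over a ball of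
radius `R`, so that for fixed `z = x - y` the radius `|y|` ranges over an interval of length `2 R`,
in which the density `|y| |K(y)|` has mass at most `2 R ‖Ω‖₁`. -/
theorem lintegral_ball_truncated_lt_top (hn : 1 ≤ n) {Ω : USphere n → ℂ} (hΩ : Measurable Ω)
    (hΩ_int : Integrable Ω (surf n)) {p : ℝ} (hp : 1 < p) {f : Space n → ℂ} (hf : Measurable f)
    (hfp : ∫⁻ x, ‖f x‖ₑ ^ p < ∞) {ε R : ℝ} (hε : 0 < ε) :
    ∫⁻ x in Metric.ball 0 R, (∫⁻ y in {y : Space n | ε < ‖y‖},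
      ‖roughKernel Ω y‖ₑ * ‖f (x - y)‖ₑ) < ∞ := by
  set γ := 1 / (p - 1) with hγ
  have hγ0 : 0 < γ := one_div_pos.2 (by linarith)
  set M := ∫⁻ θ, ‖Ω θ‖ₑ ∂(surf n) with hM
  have hMtop : M < ∞ := hΩ_int.2
  set k : Space n → ℝ≥0∞ := fun y => ‖roughKernel Ω y‖ₑ with hk
  have hkm : Measurable k := (measurable_roughKernel hΩ).enorm
  set F : Space n → ℝ≥0∞ := fun x => ‖f x‖ₑ ^ p with hF
  have hFm : Measurable F := hf.enorm.pow_const p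
  set B : Set (Space n) := Metric.ball 0 R with hB
  have hBm : MeasurableSet B := measurableSet_ball
  set g : ℝ → ℝ≥0∞ := (Set.Ioi ε).indicator fun r => ENNReal.ofReal (r ^ (-γ)) with hg
  have hgm : Measurable g :=
    ((measurable_id.pow_const (-γ)).ennreal_ofReal).indicator measurableSet_Ioi
  have hpt : ∀ x, (∫⁻ y in {y : Space n | ε < ‖y‖}, ‖roughKernel Ω y‖ₑ * ‖f (x - y)‖ₑ) ≤
      (∫⁻ y, k y * ENNReal.ofReal ‖y‖ * F (x - y)) + ∫⁻ y, k y * g ‖y‖ := by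
    intro x
    have hms : MeasurableSet {y : Space n | ε < ‖y‖} :=
      measurableSet_lt measurable_const measurable_norm
    have hm2 : Measurable fun y => k y * g ‖y‖ := hkm.mul (hgm.comp measurable_norm)
    rw [← lintegral_add_right _ hm2]
    refine (setLIntegral_mono' hms fun y hy => ?_).trans (setLIntegral_le_lintegral _ _)
    have hy' : ε < ‖y‖ := hy
    have hy0 : 0 < ‖y‖ := hε.trans hy'
    have h1 := ENNReal.ofReal_le_ofReal (le_rpow_mul_add hp (norm_nonneg (f (x - y))) hy0)
    rw [ofReal_norm, ENNReal.ofReal_add (by positivity) (by positivity),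
      ENNReal.ofReal_mul (by positivity), ← ENNReal.ofReal_rpow_of_nonneg (norm_nonneg _)
      (by linarith), ofReal_norm] at h1
    have h2 : g ‖y‖ = ENNReal.ofReal (‖y‖ ^ (-γ)) :=
      Set.indicator_of_mem (show ‖y‖ ∈ Set.Ioi ε from hy') _
    calc ‖roughKernel Ω y‖ₑ * ‖f (x - y)‖ₑ
        ≤ k y * (F (x - y) * ENNReal.ofReal ‖y‖ + g ‖y‖) := by
          rw [h2]; exact mul_le_mul_right h1 _
      _ = _ := by ring
  have htail : (∫⁻ y, k y * g ‖y‖) < ∞ := by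
    rw [lintegral_roughKernel_mul_radial hn hΩ hgm]
    refine ENNReal.mul_lt_top hMtop ?_
    have h1 : IntegrableOn (fun r : ℝ => r ^ (-1 - γ)) (Set.Ioi ε) :=
      integrableOn_Ioi_rpow_of_lt (by linarith) hε
    refine lt_of_le_of_lt ?_ h1.2
    rw [← lintegral_indicator measurableSet_Ioi, ← lintegral_indicator measurableSet_Ioi]
    refine lintegral_mono fun r => ?_
    by_cases hr : ε < r
    · have hr0 : 0 < r := hε.trans hr
      rw [Set.indicator_of_mem (show r ∈ Set.Ioi (0 : ℝ) from hr0), Set.indicator_of_mem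
        (show r ∈ Set.Ioi ε from hr), hg, Set.indicator_of_mem (show r ∈ Set.Ioi ε from hr),
        ← ENNReal.ofReal_mul (by positivity), Real.enorm_of_nonneg (by positivity)]
      refine ENNReal.ofReal_le_ofReal (le_of_eq ?_)
      beta_reduce
      rw [sub_eq_add_neg, Real.rpow_add hr0, Real.rpow_neg_one]
    · rw [hg]
      have h2 : (Set.Ioi ε).indicator (fun r : ℝ => ENNReal.ofReal (r ^ (-γ))) r = 0 :=
        Set.indicator_of_notMem (show r ∉ Set.Ioi ε from hr) _
      have h3 : (Set.Ioi (0 : ℝ)).indicator (fun r => ENNReal.ofReal r⁻¹ *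
          (Set.Ioi ε).indicator (fun r : ℝ => ENNReal.ofReal (r ^ (-γ))) r) r = 0 := by
        rw [Set.indicator_apply_eq_zero]
        intro _
        rw [h2, mul_zero]
      rw [h3]
      exact zero_le
  have hinner : ∀ z, (∫⁻ y, B.indicator 1 (z + y) * (k y * ENNReal.ofReal ‖y‖)) ≤
      M * ENNReal.ofReal (2 * R) := by
    intro z
    set G : ℝ → ℝ≥0∞ := fun r => ENNReal.ofReal r * (Set.Ioo (‖z‖ - R) (‖z‖ + R)).indicator 1 r
      with hG
    have hGm : Measurable G :=
      ENNReal.measurable_ofReal.mul (measurable_one.indicator measurableSet_Ioo)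
    calc (∫⁻ y, B.indicator 1 (z + y) * (k y * ENNReal.ofReal ‖y‖)) ≤ ∫⁻ y, k y * G ‖y‖ := by
          refine lintegral_mono fun y => ?_
          by_cases hy : z + y ∈ B
          · have h1 : ‖z + y‖ < R := by simpa [hB] using hy
            have h2 : ‖z‖ - ‖y‖ ≤ ‖z + y‖ := by
              simpa using norm_sub_norm_le z (-y)
            have h3 : ‖y‖ - ‖z‖ ≤ ‖z + y‖ := by
              have := norm_sub_norm_le y (-z)
              rwa [norm_neg, sub_neg_eq_add, add_comm y z] at this
            have h4 : ‖y‖ ∈ Set.Ioo (‖z‖ - R) (‖z‖ + R) := ⟨by linarith, by linarith⟩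
            simp only [hG, Set.indicator_of_mem hy, Set.indicator_of_mem h4, Pi.one_apply, one_mul,
              mul_one, le_refl]
          · simp [Set.indicator_of_notMem hy]
      _ = M * ∫⁻ r in Set.Ioi (0 : ℝ), ENNReal.ofReal r⁻¹ * G r :=
          lintegral_roughKernel_mul_radial hn hΩ hGm
      _ ≤ M * ∫⁻ r, (Set.Ioo (‖z‖ - R) (‖z‖ + R)).indicator 1 r := by
          refine mul_le_mul_right ((setLIntegral_mono' measurableSet_Ioi fun r hr => ?_).trans
            (setLIntegral_le_lintegral _ _)) _
          have hr' : 0 < r := hr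
          simp only [hG]
          rw [← mul_assoc, ← ENNReal.ofReal_mul (by positivity), inv_mul_cancel₀ hr'.ne',
            ENNReal.ofReal_one, one_mul]
      _ = _ := by
          rw [lintegral_indicator_one measurableSet_Ioo, Real.volume_Ioo]
          congr 2
          ring
  have hmain : (∫⁻ x in B, (∫⁻ y, k y * ENNReal.ofReal ‖y‖ * F (x - y))) < ∞ := by
    have hm1 : Measurable fun z : Space n × Space n =>
        B.indicator (1 : Space n → ℝ≥0∞) z.1 * (k z.2 * ENNReal.ofReal ‖z.2‖ * F (z.1 - z.2)) :=
      ((measurable_one.indicator hBm).comp measurable_fst).mul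
        (((hkm.comp measurable_snd).mul (measurable_norm.comp measurable_snd).ennreal_ofReal).mul
          (hFm.comp (measurable_fst.sub measurable_snd)))
    have hm2 : Measurable fun z : Space n × Space n =>
        B.indicator (1 : Space n → ℝ≥0∞) (z.1 + z.2) * (k z.2 * ENNReal.ofReal ‖z.2‖ * F z.1) :=
      ((measurable_one.indicator hBm).comp (measurable_fst.add measurable_snd)).mul
        (((hkm.comp measurable_snd).mul (measurable_norm.comp measurable_snd).ennreal_ofReal).mul
          (hFm.comp measurable_fst))
    calc (∫⁻ x in B, (∫⁻ y, k y * ENNReal.ofReal ‖y‖ * F (x - y)))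
        = ∫⁻ x, ∫⁻ y, B.indicator 1 x * (k y * ENNReal.ofReal ‖y‖ * F (x - y)) := by
          rw [← lintegral_indicator hBm]
          refine lintegral_congr fun x => ?_
          by_cases hx : x ∈ B
          · simp [Set.indicator_of_mem hx]
          · simp [Set.indicator_of_notMem hx]
      _ = ∫⁻ y, ∫⁻ x, B.indicator 1 x * (k y * ENNReal.ofReal ‖y‖ * F (x - y)) :=
          lintegral_lintegral_swap hm1.aemeasurable
      _ = ∫⁻ y, ∫⁻ z, B.indicator 1 (z + y) * (k y * ENNReal.ofReal ‖y‖ * F z) := by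
          refine lintegral_congr fun y => ?_
          rw [← lintegral_add_right_eq_self _ y]
          simp only [add_sub_cancel_right]
      _ = ∫⁻ z, ∫⁻ y, B.indicator 1 (z + y) * (k y * ENNReal.ofReal ‖y‖ * F z) :=
          (lintegral_lintegral_swap hm2.aemeasurable).symm
      _ ≤ ∫⁻ z, M * ENNReal.ofReal (2 * R) * F z := by
          refine lintegral_mono fun z => ?_
          have hm3 : Measurable fun y => B.indicator (1 : Space n → ℝ≥0∞) (z + y) *
              (k y * ENNReal.ofReal ‖y‖) :=
            ((measurable_one.indicator hBm).comp (measurable_const.add measurable_id)).mul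
              (hkm.mul measurable_norm.ennreal_ofReal)
          calc _ = ∫⁻ y, B.indicator 1 (z + y) * (k y * ENNReal.ofReal ‖y‖) * F z := by
                simp only [mul_assoc]
            _ = (∫⁻ y, B.indicator 1 (z + y) * (k y * ENNReal.ofReal ‖y‖)) * F z :=
                lintegral_mul_const _ hm3
            _ ≤ _ := by gcongr; exact hinner z
      _ = M * ENNReal.ofReal (2 * R) * ∫⁻ z, F z := lintegral_const_mul _ hFm
      _ < ∞ := ENNReal.mul_lt_top (ENNReal.mul_lt_top hMtop ENNReal.ofReal_lt_top) hfp
  calc _ ≤ ∫⁻ x in B, ((∫⁻ y, k y * ENNReal.ofReal ‖y‖ * F (x - y)) + ∫⁻ y, k y * g ‖y‖) :=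
        lintegral_mono fun x => hpt x
    _ = (∫⁻ x in B, (∫⁻ y, k y * ENNReal.ofReal ‖y‖ * F (x - y))) +
        ∫⁻ _ in B, (∫⁻ y, k y * g ‖y‖) := lintegral_add_right _ measurable_const
    _ < ∞ := by
        refine ENNReal.add_lt_top.2 ⟨hmain, ?_⟩
        rw [setLIntegral_const]
        exact ENNReal.mul_lt_top htail measure_ball_lt_top

/-- The truncated integrals converge absolutely at almost every point. -/
theorem ae_integrableOn_truncated (hn : 1 ≤ n) {Ω : USphere n → ℂ} (hΩ : Measurable Ω)
    (hΩ_int : Integrable Ω (surf n)) {p : ℝ} (hp : 1 < p) {f : Space n → ℂ} (hf : Measurable f)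
    (hfp : ∫⁻ x, ‖f x‖ₑ ^ p < ∞) : ∀ᵐ x : Space n, ∀ ε : ℝ, 0 < ε →
      IntegrableOn (fun y => roughKernel Ω y * f (x - y)) {y : Space n | ε < ‖y‖} := by
  have hK := measurable_roughKernel hΩ
  have h1 : ∀ m R : ℕ, ∀ᵐ x : Space n, x ∈ Metric.ball (0 : Space n) (R : ℝ) →
      ∫⁻ y in {y : Space n | 1 / ((m : ℝ) + 1) < ‖y‖}, ‖roughKernel Ω y‖ₑ * ‖f (x - y)‖ₑ < ∞ := by
    intro m R
    have hm : Measurable fun x : Space n => ∫⁻ y in {y : Space n | 1 / ((m : ℝ) + 1) < ‖y‖},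
        ‖roughKernel Ω y‖ₑ * ‖f (x - y)‖ₑ := by
      have : Measurable fun z : Space n × Space n => ‖roughKernel Ω z.2‖ₑ * ‖f (z.1 - z.2)‖ₑ :=
        (hK.comp measurable_snd).enorm.mul (hf.comp (measurable_fst.sub measurable_snd)).enorm
      exact this.lintegral_prod_right'
    rw [← ae_restrict_iff' measurableSet_ball]
    exact ae_lt_top hm (lintegral_ball_truncated_lt_top hn hΩ hΩ_int hp hf hfp
      Nat.one_div_pos_of_nat).ne
  have h2 := ae_all_iff.2 fun m => ae_all_iff.2 fun R => h1 m R
  filter_upwards [h2] with x hx ε hε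
  obtain ⟨m, hm⟩ := exists_nat_one_div_lt hε
  obtain ⟨R, hR⟩ := exists_nat_gt ‖x‖
  have h3 := hx m R (by simpa using hR)
  have h4 : IntegrableOn (fun y => roughKernel Ω y * f (x - y))
      {y : Space n | 1 / ((m : ℝ) + 1) < ‖y‖} := by
    refine ⟨(hK.mul (hf.comp (measurable_const.sub measurable_id))).aestronglyMeasurable, ?_⟩
    simp only [HasFiniteIntegral, enorm_mul]
    exact h3
  exact h4.mono_set fun y hy => hm.trans hy

end KernelBounds

/-! ### The frequency localized short variation -/

section Localized

open Filter Topology FourierTransform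

variable {n : ℕ} {K : Space n → ℂ} {A β : ℝ}

theorem annulus_add {a s t : ℝ} (has : a ≤ s) (hst : s ≤ t) (K : Space n → ℂ) :
    annulus K a s + annulus K s t = annulus K a t := by
  ext y
  simp only [Pi.add_apply, annulus, Set.indicator_apply, Set.mem_ofPred_eq]
  by_cases h1 : ‖y‖ ≤ s
  · have h2 : ¬ s < ‖y‖ := not_lt.2 h1
    simp [h1, h2, h1.trans hst]
  · have h2 : s < ‖y‖ := not_le.1 h1
    simp [h1, h2, has.trans_lt h2]

theorem cv_annulus_sub (hK : KernelBounds K A β) {h : Space n → ℂ} (hh : Tame h) {a s t : ℝ}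
    (ha : 0 < a) (has : a ≤ s) (hst : s ≤ t) (x : Space n) :
    cv (annulus K a t) h x - cv (annulus K a s) h x = cv (annulus K s t) h x := by
  rw [← cv_sub_left (hK.isKernel ha t) (hK.isKernel ha s) hh, ← annulus_add has hst K,
    add_sub_cancel_left]

/-- The distribution of `‖y‖` under the density `|K(y) h(x - y)|`. -/
def shellMeasure (K h : Space n → ℂ) (x : Space n) : Measure ℝ :=
  (volume.withDensity fun y => ‖K y‖ₑ * ‖h (x - y)‖ₑ).map norm

theorem shellMeasure_Ioc (K h : Space n → ℂ) (x : Space n) (s t : ℝ) :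
    shellMeasure K h x (Set.Ioc s t) =
      lcv (fun y => ‖annulus K s t y‖ₑ) (fun y => ‖h y‖ₑ) x := by
  have hm : MeasurableSet (norm ⁻¹' Set.Ioc s t : Set (Space n)) := measurable_norm measurableSet_Ioc
  rw [shellMeasure, Measure.map_apply measurable_norm measurableSet_Ioc, withDensity_apply _ hm,
    ← lintegral_indicator hm]
  refine lintegral_congr fun y => ?_
  by_cases hy : s < ‖y‖ ∧ ‖y‖ ≤ t
  · have e : annulus K s t y = K y :=
      Set.indicator_of_mem (show y ∈ {y : Space n | s < ‖y‖ ∧ ‖y‖ ≤ t} from hy) K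
    simp only [e]
    exact Set.indicator_of_mem (show y ∈ norm ⁻¹' Set.Ioc s t from hy) _
  · have e : annulus K s t y = 0 :=
      Set.indicator_of_notMem (show y ∉ {y : Space n | s < ‖y‖ ∧ ‖y‖ ≤ t} from hy) K
    simp only [e, enorm_zero, zero_mul]
    exact Set.indicator_of_notMem (show y ∉ norm ⁻¹' Set.Ioc s t from hy) _

theorem enorm_cv_annulus_sub_le (hK : KernelBounds K A β) {h : Space n → ℂ} (hh : Tame h)
    {a s t : ℝ} (ha : 0 < a) (has : a ≤ s) (hst : s ≤ t) (x : Space n) :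
    ‖cv (annulus K a t) h x - cv (annulus K a s) h x‖ₑ ≤ shellMeasure K h x (Set.Ioc s t) := by
  rw [cv_annulus_sub hK hh ha has hst, shellMeasure_Ioc]
  exact enorm_cv_le _ _ _

theorem measurable_enorm_annulus (hK : KernelBounds K A β) (s t : ℝ) :
    Measurable fun y => ‖annulus K s t y‖ₑ :=
  ((hK.stronglyMeasurable.indicator (measurableSet_annulus s t)).measurable).enorm

theorem continuousOn_cv_annulus (hK : KernelBounds K A β) {h : Space n → ℂ} (hh : Tame h)
    {a b : ℝ} (ha : 0 < a) (x : Space n) :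
    ContinuousOn (fun t => cv (annulus K a t) h x) (Set.Icc a b) := by
  obtain ⟨M, hM⟩ := hh.2.1
  have hM0 : 0 ≤ M := (norm_nonneg _).trans (hM 0)
  have hA := hK.nonneg
  have key : ∀ s ∈ Set.Icc a b, ∀ t ∈ Set.Icc a b, s ≤ t →
      ‖cv (annulus K a t) h x - cv (annulus K a s) h x‖ₑ ≤
        ENNReal.ofReal (M * A / a) * ENNReal.ofReal (t - s) := by
    intro s hs t ht hst
    refine (enorm_cv_annulus_sub_le hK hh ha hs.1 hst x).trans ?_
    rw [shellMeasure_Ioc, lcv]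
    calc ∫⁻ y, ‖annulus K s t y‖ₑ * ‖h (x - y)‖ₑ
        ≤ ∫⁻ y, ‖annulus K s t y‖ₑ * ENNReal.ofReal M := by
          refine lintegral_mono fun y => mul_le_mul_right ?_ _
          rw [← ofReal_norm]
          exact ENNReal.ofReal_le_ofReal (hM _)
      _ = (∫⁻ y, ‖annulus K s t y‖ₑ) * ENNReal.ofReal M :=
          lintegral_mul_const _ (measurable_enorm_annulus hK s t)
      _ ≤ ENNReal.ofReal (A * ((t - s) / s)) * ENNReal.ofReal M :=
          mul_le_mul_left (hK.mass s t (ha.trans_le hs.1)) _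
      _ ≤ _ := by
          have h1 : 0 ≤ t - s := sub_nonneg.2 hst
          have h2 : 0 < s := ha.trans_le hs.1
          rw [← ENNReal.ofReal_mul (by positivity), ← ENNReal.ofReal_mul (by positivity)]
          refine ENNReal.ofReal_le_ofReal ?_
          calc A * ((t - s) / s) * M ≤ A * ((t - s) / a) * M := by gcongr; exact hs.1
            _ = _ := by ring
  have hlip : LipschitzOnWith (M * A / a).toNNReal (fun t => cv (annulus K a t) h x)
      (Set.Icc a b) := by
    intro t ht s hs
    simp only [edist_eq_enorm_sub]
    change _ ≤ ENNReal.ofReal (M * A / a) * _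
    rcases le_total s t with hst | hst
    · rw [Real.enorm_of_nonneg (sub_nonneg.2 hst)]
      exact key s hs t ht hst
    · rw [← neg_sub, enorm_neg, ← neg_sub s t, enorm_neg, Real.enorm_of_nonneg (sub_nonneg.2 hst)]
      exact key t ht s hs hst
  exact hlip.continuousOn

/-- The family `t ↦ (K 1_{2 ^ j < |y| ≤ t}) * ψ_{j - k} * f`. -/
def localized (K : Space n → ℂ) (k j : ℤ) (f : Space n → ℂ) (t : ℝ) : Space n → ℂ :=
  cv (annulus K (2 ^ j) t) (cv (psi (j - k)) f)

/-- The square of `localizedVariation`. -/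
def localizedSq (K : Space n → ℂ) (k : ℤ) (f : Space n → ℂ) (x : Space n) : ℝ≥0∞ :=
  ∑' j : ℤ, variationSq (fun t => localized K k j f t x) j

/-- The part of the short variation of the truncated singular integrals in which the frequencies
are comparable to `2 ^ k` times the inverse scale. -/
def localizedVariation (K : Space n → ℂ) (k : ℤ) (f : Space n → ℂ) (x : Space n) : ℝ≥0∞ :=
  localizedSq K k f x ^ (1 / 2 : ℝ)

theorem localizedVariation_sq (K : Space n → ℂ) (k : ℤ) (f : Space n → ℂ) (x : Space n) :
    localizedVariation K k f x ^ (2 : ℝ) = localizedSq K k f x := by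
  rw [ENNReal.rpow_two, localizedVariation, rpow_half_sq]

theorem tame_cv_psi {f : Space n → ℂ} (hf : Tame f) (i : ℤ) : Tame (cv (psi i) f) :=
  (tame_psi i).isKernel.tame_cv hf

theorem norm_cv_psi_le {f : Space n → ℂ} {M : ℝ} (hM : ∀ x, ‖f x‖ ≤ M) (i : ℤ) (x : Space n) :
    ‖cv (psi i) f x‖ ≤ 2 * M := by
  have hM0 : 0 ≤ M := (norm_nonneg _).trans (hM 0)
  have h3 : ‖cv (psi i) f x‖ₑ ≤ ENNReal.ofReal (2 * M) := by
    calc ‖cv (psi i) f x‖ₑ ≤ ∫⁻ z, ‖(psi i z : ℂ)‖ₑ * ‖f (x - z)‖ₑ := enorm_cv_le _ _ _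
      _ ≤ ∫⁻ z, ‖(psi i z : ℂ)‖ₑ * ENNReal.ofReal M := by
          refine lintegral_mono fun z => mul_le_mul_right ?_ _
          rw [← ofReal_norm]
          exact ENNReal.ofReal_le_ofReal (hM _)
      _ = (∫⁻ z : Space n, ‖psi i z‖ₑ) * ENNReal.ofReal M :=
          lintegral_mul_const _ (tame_psi i).1.measurable.enorm
      _ ≤ 2 * ENNReal.ofReal M := mul_le_mul_left (lintegral_psi_le i) _
      _ = _ := by rw [ENNReal.ofReal_mul two_pos.le]; norm_num
  rw [← ofReal_norm] at h3
  exact (ENNReal.ofReal_le_ofReal_iff (by positivity)).1 h3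

theorem measurable_variationSq_cv (hK : KernelBounds K A β) {h : Space n → ℂ} (hh : Tame h)
    (j : ℤ) : Measurable fun x => variationSq (fun t => cv (annulus K (2 ^ j) t) h x) j :=
  measurable_variationSq (fun t _ => ((hK.isKernel (by positivity) t).tame_cv hh).1.measurable)
    fun x => continuousOn_cv_annulus hK hh (by positivity) x

theorem measurable_localizedSq (hK : KernelBounds K A β) (k : ℤ) {f : Space n → ℂ} (hf : Tame f) :
    Measurable (localizedSq K k f) :=
  .tsum fun j => measurable_variationSq_cv hK (tame_cv_psi hf (j - k)) j

theorem measurable_localizedVariation (hK : KernelBounds K A β) (k : ℤ) {f : Space n → ℂ}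
    (hf : Tame f) : Measurable (localizedVariation K k f) :=
  (measurable_localizedSq hK k hf).pow_const _

theorem localized_zero (K : Space n → ℂ) (k j : ℤ) (t : ℝ) : localized K k j 0 t = 0 := by
  rw [localized, cv_zero, cv_zero]

theorem localizedVariation_zero (K : Space n → ℂ) (k : ℤ) (x : Space n) :
    localizedVariation K k 0 x = 0 := by
  simp [localizedVariation, localizedSq, localized_zero, variationSq_zero]

theorem localized_add (hK : KernelBounds K A β) (k j : ℤ) {f g : Space n → ℂ} (hf : Tame f)
    (hg : Tame g) (t : ℝ) (x : Space n) :
    localized K k j (f + g) t x = localized K k j f t x + localized K k j g t x := by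
  have h : cv (psi (j - k)) (f + g) = cv (psi (j - k)) f + cv (psi (j - k)) g := by
    ext y; exact cv_add (tame_psi _).isKernel hf hg y
  rw [localized, h, cv_add (hK.isKernel (by positivity) t) (tame_cv_psi hf _) (tame_cv_psi hg _)]
  rfl

/-- The triangle inequality in `ℓ²`. -/
theorem tsum_sq_rpow_half_add_le {ι : Type*} (u v : ι → ℝ≥0∞) :
    (∑' i, (u i + v i) ^ 2) ^ (1 / 2 : ℝ) ≤
      (∑' i, u i ^ 2) ^ (1 / 2 : ℝ) + (∑' i, v i ^ 2) ^ (1 / 2 : ℝ) := by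
  rw [rpow_half_le_iff, ENNReal.tsum_eq_iSup_sum]
  refine iSup_le fun s => rpow_half_le_iff.1 ?_
  have h := ENNReal.Lp_add_le s u v one_le_two
  simp only [ENNReal.rpow_two] at h
  refine h.trans (add_le_add ?_ ?_) <;>
  exact ENNReal.rpow_le_rpow (ENNReal.sum_le_tsum _) (by norm_num)

theorem localizedVariation_eq (K : Space n → ℂ) (k : ℤ) (f : Space n → ℂ) (x : Space n) :
    localizedVariation K k f x =
      (∑' j, dyadicVariation (fun t => localized K k j f t x) j ^ 2) ^ (1 / 2 : ℝ) := by
  simp only [localizedVariation, localizedSq, dyadicVariation_sq]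

theorem localizedVariation_add_le (hK : KernelBounds K A β) (k : ℤ) {f g : Space n → ℂ}
    (hf : Tame f) (hg : Tame g) (x : Space n) :
    localizedVariation K k (f + g) x ≤ localizedVariation K k f x + localizedVariation K k g x := by
  simp only [localizedVariation_eq, localized_add hK _ _ hf hg]
  refine le_trans ?_ (tsum_sq_rpow_half_add_le _ _)
  refine ENNReal.rpow_le_rpow (ENNReal.tsum_le_tsum fun j => ?_) (by norm_num)
  gcongr
  exact dyadicVariation_add_le _ _ j

theorem tsum_liminf_le {ι : Type*} (u : ℕ → ι → ℝ≥0∞) :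
    ∑' i, liminf (fun m => u m i) atTop ≤ liminf (fun m => ∑' i, u m i) atTop := by
  let _ : MeasurableSpace ι := ⊤
  simp only [← lintegral_count]
  exact lintegral_liminf_le fun m => measurable_from_top

theorem dominatedLSC_localizedVariation (hK : KernelBounds K A β) (k : ℤ) :
    DominatedLSC (localizedVariation K k) := by
  intro f F hf hF hdom hlim x
  obtain ⟨M, hM⟩ := hf.2.1
  have h1 : ∀ (i : ℤ) (y : Space n), Tendsto (fun m => cv (psi i) (F m) y) atTop
      (𝓝 (cv (psi i) f y)) := fun i y =>
    tendsto_cv (tame_psi i).isKernel (fun m => (hF m).1) (fun m y => (hdom m y).trans (hM y))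
      (Eventually.of_forall hlim) y
  unfold localizedVariation
  rw [← rpow_liminf one_half_pos]
  refine ENNReal.rpow_le_rpow (le_trans (ENNReal.tsum_le_tsum fun j => ?_) (tsum_liminf_le _))
    (by norm_num)
  refine variationSq_le_liminf fun t _ => ?_
  exact tendsto_cv (hK.isKernel (by positivity) t) (fun m => (tame_cv_psi (hF m) _).1)
    (fun m y => norm_cv_psi_le (fun z => (hdom m z).trans (hM z)) _ y)
    (Eventually.of_forall fun y => h1 _ y) x

end Localized

/-! ### The `L²` estimate with decay -/

section LTwo

open Filter Topology FourierTransform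

variable {n : ℕ} {K : Space n → ℂ} {A β : ℝ}

/-- The weight `1 + |k|`. -/
def wt (k : ℤ) : ℝ := 1 + |(k : ℝ)|

theorem one_le_wt (k : ℤ) : 1 ≤ wt k := le_add_of_nonneg_right (abs_nonneg _)

theorem wt_pos (k : ℤ) : 0 < wt k := one_pos.trans_le (one_le_wt k)

theorem wt_le_mul (k m : ℤ) : wt k ≤ wt m * wt (m - k) := by
  have h : |(k : ℝ)| ≤ |(m : ℝ)| + |((m - k : ℤ) : ℝ)| := by
    have := abs_sub (m : ℝ) ((m - k : ℤ) : ℝ)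
    push_cast at this ⊢
    rwa [sub_sub_cancel] at this
  have h1 := abs_nonneg (m : ℝ)
  have h2 := abs_nonneg ((m - k : ℤ) : ℝ)
  unfold wt
  nlinarith

theorem abs_eq_natAbs (l : ℤ) : |(l : ℝ)| = (l.natAbs : ℝ) := by
  rw [Nat.cast_natAbs, Int.cast_abs]

theorem summable_half_pow_natAbs : Summable fun l : ℤ => (1 / 2 : ℝ) ^ l.natAbs := by
  rw [summable_int_iff_summable_nat_and_neg]
  simp only [Int.natAbs_neg, Int.natAbs_natCast, and_self]
  exact summable_geometric_two

theorem tsum_half_pow_natAbs_ne_top :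
    ∑' l : ℤ, ENNReal.ofReal ((1 / 2 : ℝ) ^ l.natAbs) ≠ ∞ :=
  summable_half_pow_natAbs.tsum_ofReal_ne_top

/-- The constant coming from summing over the frequencies. -/
def decaySum (β : ℝ) : ℝ≥0∞ := ∑' l : ℤ, ENNReal.ofReal (wt l ^ (2 * β) * (1 / 4) ^ l.natAbs)

theorem decaySum_ne_top (hβ : 0 < β) : decaySum β ≠ ∞ := by
  have h0 : 0 < Real.log 2 := Real.log_pos (by norm_num)
  set c := (2 * β / Real.log 2) ^ (2 * β) * 2 with hc
  have hc0 : 0 ≤ c := by positivity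
  refine ne_top_of_le_ne_top (ENNReal.mul_ne_top (ENNReal.ofReal_ne_top (r := c))
    tsum_half_pow_natAbs_ne_top) ?_
  rw [← ENNReal.tsum_mul_left]
  refine ENNReal.tsum_le_tsum fun l => ?_
  rw [← ENNReal.ofReal_mul hc0]
  refine ENNReal.ofReal_le_ofReal ?_
  have h1 := rpow_le_mul_exp (β := 2 * β) (by positivity) h0 (wt_pos l).le
  have h2 : Real.exp (Real.log 2 * wt l) = 2 * 2 ^ l.natAbs := by
    rw [wt, abs_eq_natAbs, mul_add, mul_one, Real.exp_add, Real.exp_log two_pos, mul_comm (Real.log 2),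
      Real.exp_nat_mul, Real.exp_log two_pos]
  rw [h2] at h1
  calc wt l ^ (2 * β) * (1 / 4) ^ l.natAbs
      ≤ (2 * β / Real.log 2) ^ (2 * β) * (2 * 2 ^ l.natAbs) * (1 / 4) ^ l.natAbs := by gcongr
    _ = c * (2 * (1 / 4)) ^ l.natAbs := by rw [hc, mul_pow]; ring
    _ = _ := by norm_num

/-- The square of the constant in `norm_fourier_psi_le`. -/
def psiConst (n : ℕ) : ℝ := (48 * 2 ^ n) ^ 2

theorem enorm_rpow_two_le {z : ℂ} {b : ℝ} (h : ‖z‖ ≤ b) : ‖z‖ₑ ^ (2 : ℝ) ≤ ENNReal.ofReal (b ^ 2) := by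
  rw [← ofReal_norm, ENNReal.rpow_two, ← ENNReal.ofReal_pow (norm_nonneg _)]
  gcongr

/-- At the frequencies of size `2 ^ r`, the truncated kernel of scale `2 ^ j` contributes
`(1 + |j + r|) ^ (-β)` and `ψ_{j - k}` contributes `2 ^ (-|j + r - k|)`, so that only `j + r` near `k`
matters. -/
theorem tsum_fourier_mul_psi_le (hK : KernelBounds K A β) (hβ : 0 < β) (k : ℤ) {t : ℤ → ℝ}
    (ht : ∀ j, t j ∈ Set.Icc ((2 : ℝ) ^ j) (2 ^ (j + 1))) {ξ : Space n} (hξ : ξ ≠ 0) :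
    ∑' j : ℤ, ‖𝓕 (annulus K (2 ^ j) (t j)) ξ‖ₑ ^ (2 : ℝ) *
      ‖𝓕 (psi (j - k) : Space n → ℂ) ξ‖ₑ ^ (2 : ℝ) ≤
      ENNReal.ofReal (A ^ 2 * psiConst n * wt k ^ (-(2 * β))) * decaySum β := by
  obtain ⟨r, hr1, hr2⟩ := exists_mem_Ico_zpow (norm_pos_iff.2 hξ) (one_lt_two (α := ℝ))
  have hA := hK.nonneg
  have hpt : ∀ j : ℤ, ‖𝓕 (annulus K (2 ^ j) (t j)) ξ‖ₑ ^ (2 : ℝ) *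
      ‖𝓕 (psi (j - k) : Space n → ℂ) ξ‖ₑ ^ (2 : ℝ) ≤
      ENNReal.ofReal (A ^ 2 * psiConst n * wt k ^ (-(2 * β))) *
        ENNReal.ofReal (wt (j + (r - k)) ^ (2 * β) * (1 / 4) ^ (j + (r - k)).natAbs) := by
    intro j
    have h1 := enorm_rpow_two_le (hK.fourier j r (t j) ξ (ht j).1 (ht j).2 hr1 hr2)
    have h2 := enorm_rpow_two_le (norm_fourier_psi_le (j - k) r hr1 hr2)
    have hψ : 0 ≤ psiConst n := by unfold psiConst; positivity
    have hw0 := wt_pos (j + (r - k))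
    have hwk := wt_pos k
    have hwm := wt_pos (j + r)
    have h3 : (1 + |((j + r : ℤ) : ℝ)|) = wt (j + r) := rfl
    rw [h3] at h1
    refine (mul_le_mul' h1 h2).trans ?_
    rw [← ENNReal.ofReal_mul (by positivity), ← ENNReal.ofReal_mul (by positivity)]
    refine ENNReal.ofReal_le_ofReal ?_
    have h4 : (wt (j + r) ^ (-β)) ^ 2 ≤ wt k ^ (-(2 * β)) * wt (j + (r - k)) ^ (2 * β) := by
      have e : (wt (j + r) ^ (-β)) ^ 2 = (wt (j + r) ^ (2 * β))⁻¹ := by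
        rw [← Real.rpow_natCast, ← Real.rpow_mul hwm.le, ← Real.rpow_neg hwm.le]
        congr 1
        push_cast
        ring
      have h5 := wt_le_mul k (j + r)
      rw [show j + r - k = j + (r - k) by ring] at h5
      have h6 : wt k ^ (2 * β) ≤ wt (j + r) ^ (2 * β) * wt (j + (r - k)) ^ (2 * β) := by
        rw [← Real.mul_rpow hwm.le hw0.le]
        gcongr
      rw [e, Real.rpow_neg hwk.le, ← div_eq_inv_mul, le_div_iff₀ (by positivity),
        inv_mul_le_iff₀ (by positivity)]
      exact h6
    rw [show j - k + r = j + (r - k) by ring]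
    calc (A * wt (j + r) ^ (-β)) ^ 2 * (48 * 2 ^ n * (1 / 2) ^ (j + (r - k)).natAbs) ^ 2
        = A ^ 2 * psiConst n * (wt (j + r) ^ (-β)) ^ 2 * ((1 / 2) ^ 2) ^ (j + (r - k)).natAbs := by
          rw [psiConst, ← pow_mul (1 / 2 : ℝ), mul_comm 2, pow_mul]; ring
      _ ≤ A ^ 2 * psiConst n * (wt k ^ (-(2 * β)) * wt (j + (r - k)) ^ (2 * β)) *
            ((1 / 2) ^ 2) ^ (j + (r - k)).natAbs := by gcongr
      _ = _ := by norm_num; ring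
  refine (ENNReal.tsum_le_tsum hpt).trans ?_
  rw [ENNReal.tsum_mul_left]
  gcongr
  exact ((Equiv.addRight (r - k)).tsum_eq fun l : ℤ =>
    ENNReal.ofReal (wt l ^ (2 * β) * (1 / 4) ^ l.natAbs)).le

theorem tsum_fourier_psi_le (hβ : 0 < β) (k : ℤ) {ξ : Space n} (hξ : ξ ≠ 0) :
    ∑' j : ℤ, ‖𝓕 (psi (j - k) : Space n → ℂ) ξ‖ₑ ^ (2 : ℝ) ≤
      ENNReal.ofReal (psiConst n) * decaySum β := by
  obtain ⟨r, hr1, hr2⟩ := exists_mem_Ico_zpow (norm_pos_iff.2 hξ) (one_lt_two (α := ℝ))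
  have hpt : ∀ j : ℤ, ‖𝓕 (psi (j - k) : Space n → ℂ) ξ‖ₑ ^ (2 : ℝ) ≤
      ENNReal.ofReal (psiConst n) *
        ENNReal.ofReal (wt (j + (r - k)) ^ (2 * β) * (1 / 4) ^ (j + (r - k)).natAbs) := by
    intro j
    have hψ : 0 ≤ psiConst n := by unfold psiConst; positivity
    have h1 : 1 ≤ wt (j + (r - k)) ^ (2 * β) := Real.one_le_rpow (one_le_wt _) (by positivity)
    refine (enorm_rpow_two_le (norm_fourier_psi_le (j - k) r hr1 hr2)).trans ?_
    rw [← ENNReal.ofReal_mul hψ]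
    refine ENNReal.ofReal_le_ofReal ?_
    rw [show j - k + r = j + (r - k) by ring]
    calc (48 * 2 ^ n * (1 / 2 : ℝ) ^ (j + (r - k)).natAbs) ^ 2
        = psiConst n * (1 * ((1 / 2) ^ 2) ^ (j + (r - k)).natAbs) := by
          rw [psiConst, ← pow_mul (1 / 2 : ℝ), mul_comm 2, pow_mul]; ring
      _ ≤ psiConst n * (wt (j + (r - k)) ^ (2 * β) * ((1 / 2) ^ 2) ^ (j + (r - k)).natAbs) := by
          gcongr
      _ = _ := by norm_num
  refine (ENNReal.tsum_le_tsum hpt).trans ?_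
  rw [ENNReal.tsum_mul_left]
  gcongr
  exact ((Equiv.addRight (r - k)).tsum_eq fun l : ℤ =>
    ENNReal.ofReal (wt l ^ (2 * β) * (1 / 4) ^ l.natAbs)).le

theorem ae_ne_zero (hn : 1 ≤ n) : ∀ᵐ ξ : Space n, ξ ≠ 0 := by
  have : Nonempty (Fin n) := ⟨⟨0, hn⟩⟩
  exact Measure.ae_ne volume 0

theorem tsum_lintegral_cv_cv_sq_le {ι : Type*} [Countable ι] {κ ψ : ι → Space n → ℂ}
    (hκ : ∀ i, IsKernel (κ i)) (hψ : ∀ i, IsKernel (ψ i)) {h : Space n → ℂ} (hh : Tame h)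
    {B : ℝ≥0∞} (hB : ∀ᵐ ξ, ∑' i, ‖𝓕 (κ i) ξ‖ₑ ^ (2 : ℝ) * ‖𝓕 (ψ i) ξ‖ₑ ^ (2 : ℝ) ≤ B) :
    ∑' i, ∫⁻ x, ‖cv (κ i) (cv (ψ i) h) x‖ₑ ^ (2 : ℝ) ≤ B * ∫⁻ x, ‖h x‖ₑ ^ (2 : ℝ) := by
  have hm : ∀ g : Space n → ℂ, Integrable g → Measurable fun ξ => ‖𝓕 g ξ‖ₑ ^ (2 : ℝ) :=
    fun g hg => (continuous_fourier hg).measurable.enorm.pow_const _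
  have he : ∀ i, ∫⁻ x, ‖cv (κ i) (cv (ψ i) h) x‖ₑ ^ (2 : ℝ) =
      ∫⁻ ξ, ‖𝓕 (κ i) ξ‖ₑ ^ (2 : ℝ) * ‖𝓕 (ψ i) ξ‖ₑ ^ (2 : ℝ) * ‖𝓕 h ξ‖ₑ ^ (2 : ℝ) := by
    intro i
    rw [lintegral_cv_sq (hκ i) ((hψ i).tame_cv hh)]
    refine lintegral_congr fun ξ => ?_
    rw [fourier_cv (hψ i) hh, enorm_mul, ENNReal.mul_rpow_of_nonneg _ _ two_pos.le, mul_assoc]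
  have hmm : ∀ i, AEMeasurable (fun ξ => ‖𝓕 (κ i) ξ‖ₑ ^ (2 : ℝ) * ‖𝓕 (ψ i) ξ‖ₑ ^ (2 : ℝ) *
      ‖𝓕 h ξ‖ₑ ^ (2 : ℝ)) volume := fun i =>
    (((hm _ (hκ i).integrable).mul (hm _ (hψ i).integrable)).mul (hm _ hh.integrable)).aemeasurable
  simp_rw [he]
  rw [← lintegral_tsum hmm, ← hh.lintegral_fourier_sq,
    ← lintegral_const_mul _ (hm _ hh.integrable)]
  refine lintegral_mono_ae ?_
  filter_upwards [hB] with ξ hξ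
  rw [ENNReal.tsum_mul_right]
  gcongr

theorem tsum_lintegral_cv_psi_sq_le (hn : 1 ≤ n) (hβ : 0 < β) (k : ℤ) {f : Space n → ℂ}
    (hf : Tame f) : ∑' j : ℤ, ∫⁻ x, ‖cv (psi (j - k)) f x‖ₑ ^ (2 : ℝ) ≤
      ENNReal.ofReal (psiConst n) * decaySum β * ∫⁻ x, ‖f x‖ₑ ^ (2 : ℝ) := by
  refine tsum_lintegral_cv_sq_le (fun j => (tame_psi (j - k)).isKernel) hf ?_
  filter_upwards [ae_ne_zero hn] with ξ hξ
  exact tsum_fourier_psi_le hβ k hξ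

theorem lintegral_annulus_grid_le (hK : KernelBounds K A β) (j : ℤ) {L : ℕ} (hL : 1 ≤ L) (l : ℕ) :
    ∫⁻ y, ‖annulus K (gridPoint j L l) (gridPoint j L (l + 1)) y‖ₑ ≤ ENNReal.ofReal (A / L) := by
  have h2 : (0 : ℝ) < 2 ^ j := by positivity
  have hL' : (0 : ℝ) < L := by exact_mod_cast hL
  have h3 : (2 : ℝ) ^ j ≤ gridPoint j L l := by
    unfold gridPoint
    exact le_mul_of_one_le_right h2.le (le_add_of_nonneg_right (by positivity))
  have h4 : 0 < gridPoint j L l := h2.trans_le h3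
  have hA := hK.nonneg
  refine (hK.mass _ _ h4).trans (ENNReal.ofReal_le_ofReal ?_)
  have h5 : gridPoint j L (l + 1) - gridPoint j L l = 2 ^ j / L := by
    unfold gridPoint; push_cast; field_simp; ring
  rw [h5, ← mul_div_assoc, div_le_iff₀ h4]
  calc A * (2 ^ j / L) = A / L * 2 ^ j := by ring
    _ ≤ _ := by gcongr

/-- The `L²` bound for a grid of `L` cells. -/
theorem lintegral_localizedSq_le_grid (hn : 1 ≤ n) (hK : KernelBounds K A β) (hβ : 0 < β) (k : ℤ)
    {L : ℕ} (hL : 1 ≤ L) {f : Space n → ℂ} (hf : Tame f) :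
    ∫⁻ x, localizedSq K k f x ≤ 9 * (((L : ℝ≥0∞) + 1) *
      (ENNReal.ofReal (A ^ 2 * psiConst n * wt k ^ (-(2 * β))) * decaySum β +
        ENNReal.ofReal (A / L) ^ 2 * (ENNReal.ofReal (psiConst n) * decaySum β))) *
      ∫⁻ x, ‖f x‖ₑ ^ (2 : ℝ) := by
  set h : ℤ → Space n → ℂ := fun j => cv (psi (j - k)) f with hh
  have ht : ∀ j, Tame (h j) := fun j => tame_cv_psi hf _
  set P : ℤ → ℕ → ℝ≥0∞ := fun j i =>
    ∫⁻ x, ‖cv (annulus K (2 ^ j) (gridPoint j L i)) (h j) x‖ₑ ^ (2 : ℝ) with hP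
  set Q : ℤ → ℝ≥0∞ := fun j => ∫⁻ x, ‖h j x‖ₑ ^ (2 : ℝ) with hQ
  have hvar : ∀ j, ∫⁻ x, variationSq (fun t => localized K k j f t x) j ≤
      9 * ∑ i ∈ Finset.range (L + 1), (P j i + ENNReal.ofReal (A / L) ^ 2 * Q j) := by
    intro j
    have h2 : (0 : ℝ) < 2 ^ j := by positivity
    have hm1 : ∀ i, Measurable fun x => ‖cv (annulus K (2 ^ j) (gridPoint j L i)) (h j) x‖ₑ ^
        (2 : ℝ) := fun i => ((hK.isKernel h2 _).tame_cv (ht j)).1.measurable.enorm.pow_const _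
    have hm2 : ∀ i, Measurable (lcv
        (fun y => ‖annulus K (gridPoint j L i) (gridPoint j L (i + 1)) y‖ₑ) fun y => ‖h j y‖ₑ) := fun i =>
      measurable_lcv (measurable_enorm_annulus hK _ _) (ht j).1.measurable.enorm
    calc ∫⁻ x, variationSq (fun t => localized K k j f t x) j
        ≤ ∫⁻ x, 9 * ∑ i ∈ Finset.range (L + 1),
          (‖cv (annulus K (2 ^ j) (gridPoint j L i)) (h j) x‖ₑ ^ (2 : ℝ) +
          lcv (fun y => ‖annulus K (gridPoint j L i) (gridPoint j L (i + 1)) y‖ₑ)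
            (fun y => ‖h j y‖ₑ) x ^ (2 : ℝ)) := by
          refine lintegral_mono fun x => ?_
          have := variationSq_le_grid (a := fun t => localized K k j f t x) (j := j)
            (m := shellMeasure K (h j) x)
            (fun s hs t ht' hst => enorm_cv_annulus_sub_le hK (ht j) h2 hs.1 hst x) hL
          simp only [shellMeasure_Ioc] at this
          simp only [ENNReal.rpow_two]
          exact this
      _ = 9 * ∑ i ∈ Finset.range (L + 1), (P j i +
          ∫⁻ x, lcv (fun y => ‖annulus K (gridPoint j L i) (gridPoint j L (i + 1)) y‖ₑ)
            (fun y => ‖h j y‖ₑ) x ^ (2 : ℝ)) := by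
          rw [lintegral_const_mul' _ _ (by norm_num), lintegral_finsetSum]
          · simp_rw [lintegral_add_left (hm1 _)]
            rfl
          · exact fun i _ => (hm1 i).add ((hm2 i).pow_const _)
      _ ≤ _ := by
          gcongr with i _
          refine (lintegral_lcv_sq_le (measurable_enorm_annulus hK _ _)
            (ht j).1.measurable.enorm).trans ?_
          gcongr
          exact lintegral_annulus_grid_le hK j hL i
  have hPsum : ∀ i ∈ Finset.range (L + 1), ∑' j, P j i ≤
      ENNReal.ofReal (A ^ 2 * psiConst n * wt k ^ (-(2 * β))) * decaySum β *
        ∫⁻ x, ‖f x‖ₑ ^ (2 : ℝ) := by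
    intro i hi
    rw [Finset.mem_range, Nat.lt_succ_iff] at hi
    refine tsum_lintegral_cv_cv_sq_le (fun j => hK.isKernel (by positivity) _)
      (fun j => (tame_psi (j - k)).isKernel) hf ?_
    filter_upwards [ae_ne_zero hn] with ξ hξ
    exact tsum_fourier_mul_psi_le hK hβ k (fun j => gridPoint_mem hL hi) hξ
  have hQsum : ∑' j, Q j ≤ ENNReal.ofReal (psiConst n) * decaySum β * ∫⁻ x, ‖f x‖ₑ ^ (2 : ℝ) :=
    tsum_lintegral_cv_psi_sq_le hn hβ k hf
  calc ∫⁻ x, localizedSq K k f x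
      = ∑' j, ∫⁻ x, variationSq (fun t => localized K k j f t x) j :=
        lintegral_tsum fun j => (measurable_variationSq_cv hK (ht j) j).aemeasurable
    _ ≤ ∑' j, 9 * ∑ i ∈ Finset.range (L + 1), (P j i + ENNReal.ofReal (A / L) ^ 2 * Q j) :=
        ENNReal.tsum_le_tsum hvar
    _ = 9 * ∑ i ∈ Finset.range (L + 1), ((∑' j, P j i) +
          ENNReal.ofReal (A / L) ^ 2 * ∑' j, Q j) := by
        rw [ENNReal.tsum_mul_left, Summable.tsum_finsetSum fun _ _ => ENNReal.summable]
        simp_rw [ENNReal.tsum_add, ENNReal.tsum_mul_left]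
    _ ≤ 9 * ∑ i ∈ Finset.range (L + 1),
          (ENNReal.ofReal (A ^ 2 * psiConst n * wt k ^ (-(2 * β))) * decaySum β *
            (∫⁻ x, ‖f x‖ₑ ^ (2 : ℝ)) + ENNReal.ofReal (A / L) ^ 2 *
            (ENNReal.ofReal (psiConst n) * decaySum β * ∫⁻ x, ‖f x‖ₑ ^ (2 : ℝ))) := by
        refine mul_le_mul_right (Finset.sum_le_sum fun i hi => ?_) _
        exact add_le_add (hPsum i hi) (mul_le_mul_right hQsum _)
    _ = _ := by
        rw [Finset.sum_const, Finset.card_range, nsmul_eq_mul]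
        push_cast
        ring

/-- The `L²` estimate: grids of about `(1 + |k|) ^ β` cells balance the decay of the multipliers
against the total variation inside a cell. -/
theorem exists_lintegral_localizedVariation_sq_le (hn : 1 ≤ n) (hK : KernelBounds K A β)
    (hβ : 0 < β) : ∃ C : ℝ≥0∞, C ≠ ∞ ∧ ∀ (k : ℤ) (f : Space n → ℂ), Tame f →
      ∫⁻ x, localizedVariation K k f x ^ (2 : ℝ) ≤
        C * ENNReal.ofReal (wt k ^ (-β)) * ∫⁻ x, ‖f x‖ₑ ^ (2 : ℝ) := by
  have hA := hK.nonneg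
  have hψ : 0 ≤ psiConst n := by unfold psiConst; positivity
  refine ⟨54 * (ENNReal.ofReal (A ^ 2 * psiConst n) * decaySum β),
    ENNReal.mul_ne_top (by norm_num) (ENNReal.mul_ne_top ENNReal.ofReal_ne_top
      (decaySum_ne_top hβ)), fun k f hf => ?_⟩
  simp only [localizedVariation_sq]
  have hw := wt_pos k
  have hwβ : 1 ≤ wt k ^ β := Real.one_le_rpow (one_le_wt k) hβ.le
  set L := ⌈wt k ^ β⌉₊ with hLdef
  have hL : 1 ≤ L := Nat.one_le_ceil_iff.2 (by positivity)
  have hL' : (0 : ℝ) < L := by exact_mod_cast hL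
  have hL1 : wt k ^ β ≤ L := Nat.le_ceil _
  have hL2 : (L : ℝ) < wt k ^ β + 1 := Nat.ceil_lt_add_one (by positivity)
  have hneg : wt k ^ (-(2 * β)) = (wt k ^ (-β)) ^ 2 := by
    rw [← Real.rpow_natCast, ← Real.rpow_mul hw.le]; congr 1; push_cast; ring
  refine (lintegral_localizedSq_le_grid hn hK hβ k hL hf).trans (mul_le_mul_left ?_ _)
  have h1 : ENNReal.ofReal (A / L) ^ 2 ≤ ENNReal.ofReal (A ^ 2 * wt k ^ (-(2 * β))) := by
    rw [← ENNReal.ofReal_pow (by positivity)]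
    refine ENNReal.ofReal_le_ofReal ?_
    rw [hneg, ← mul_pow, Real.rpow_neg hw.le, ← div_eq_mul_inv]
    gcongr
  have h2 : (L : ℝ≥0∞) + 1 ≤ ENNReal.ofReal (3 * wt k ^ β) := by
    rw [← ENNReal.ofReal_natCast, ← ENNReal.ofReal_one, ← ENNReal.ofReal_add hL'.le one_pos.le]
    refine ENNReal.ofReal_le_ofReal (by linarith)
  calc 9 * (((L : ℝ≥0∞) + 1) *
      (ENNReal.ofReal (A ^ 2 * psiConst n * wt k ^ (-(2 * β))) * decaySum β +
        ENNReal.ofReal (A / L) ^ 2 * (ENNReal.ofReal (psiConst n) * decaySum β)))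
      ≤ 9 * (ENNReal.ofReal (3 * wt k ^ β) *
      (ENNReal.ofReal (A ^ 2 * psiConst n * wt k ^ (-(2 * β))) * decaySum β +
        ENNReal.ofReal (A ^ 2 * wt k ^ (-(2 * β))) *
          (ENNReal.ofReal (psiConst n) * decaySum β))) := by
        refine mul_le_mul_right (mul_le_mul' h2 (add_le_add le_rfl (mul_le_mul_left h1 _))) _
    _ = 54 * (ENNReal.ofReal (A ^ 2 * psiConst n) * decaySum β) *
        (ENNReal.ofReal (wt k ^ β) * ENNReal.ofReal (wt k ^ (-(2 * β)))) := by
        rw [ENNReal.ofReal_mul (q := wt k ^ (-(2 * β))) (by positivity),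
          ENNReal.ofReal_mul (q := wt k ^ (-(2 * β))) (by positivity),
          ENNReal.ofReal_mul (p := 3) (by norm_num), ENNReal.ofReal_mul (p := A ^ 2) (by positivity)]
        norm_num
        ring
    _ = _ := by
        rw [← ENNReal.ofReal_mul (by positivity), ← Real.rpow_add hw]
        congr 3
        ring

end LTwo

/-! ### The weak type `(1, 1)` estimate -/

section WeakType

open Filter Topology

variable {n : ℕ} {K : Space n → ℂ} {A β : ℝ}

/-- The size of the contribution of the scale `2 ^ j` far from a mean zero function supported in a
ball of radius `r`: nothing if both kernels are short, and otherwise the cancellation gain of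
`ψ_{j - k}`. -/
def tailCoeff (k : ℤ) (r : ℝ) (j : ℤ) : ℝ≥0∞ :=
  if (2 : ℝ) ^ (j + 1) + 2 ^ (j - k + 1) ≤ 4 * r then 0
  else ENNReal.ofReal (min 1 (r / 2 ^ (j - k)))

/-- The constant in the summation over the scales. -/
def tailSum : ℝ≥0∞ := (∑' l : ℤ, ENNReal.ofReal ((1 / 2 : ℝ) ^ l.natAbs)) + 1

theorem tailSum_ne_top : tailSum ≠ ∞ :=
  ENNReal.add_ne_top.2 ⟨tsum_half_pow_natAbs_ne_top, ENNReal.one_ne_top⟩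

/-- Only about `|k|` scales contribute without any geometric decay. -/
theorem tsum_tailCoeff_le (k : ℤ) {r : ℝ} (hr : 0 < r) :
    ∑' j, tailCoeff k r j ≤ tailSum * ENNReal.ofReal (wt k) := by
  obtain ⟨i₀, h1, h2⟩ := exists_mem_Ico_zpow hr (one_lt_two (α := ℝ))
  have hpt : ∀ j, tailCoeff k r j ≤
      ENNReal.ofReal ((1 / 2 : ℝ) ^ (j + (-k - (i₀ + 1))).natAbs) +
        (Set.Icc (i₀ + 1) (i₀ + k)).indicator 1 j := by
    intro j
    unfold tailCoeff
    split_ifs with hcase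
    · exact zero_le
    push Not at hcase
    rcases le_or_gt (i₀ + 1) (j - k) with hi | hi
    · refine le_trans (ENNReal.ofReal_le_ofReal ((min_le_right _ _).trans ?_)) le_self_add
      obtain ⟨m, hm⟩ := Int.eq_ofNat_of_zero_le (sub_nonneg.2 hi)
      have e1 : j + (-k - (i₀ + 1)) = m := by omega
      have e2 : j - k = (i₀ + 1) + m := by omega
      rw [e1, Int.natAbs_natCast, e2, zpow_add₀ two_ne_zero, zpow_natCast, div_le_iff₀ (by positivity)]
      calc r ≤ 2 ^ (i₀ + 1) * ((1 / 2) ^ m * 2 ^ m) := by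
            rw [← mul_pow]; norm_num; exact h2.le
        _ = _ := by ring
    · have h3 : (2 : ℝ) ^ (j - k + 1) ≤ 2 * r := by
        rw [zpow_add₀ two_ne_zero, zpow_one]
        have : (2 : ℝ) ^ (j - k) ≤ 2 ^ i₀ := zpow_le_zpow_right₀ one_le_two (by omega)
        linarith
      have h4 : (2 : ℝ) ^ i₀ < 2 ^ j := by
        rw [zpow_add₀ two_ne_zero j, zpow_one] at hcase
        linarith
      have h5 : i₀ < j := (zpow_lt_zpow_iff_right₀ one_lt_two).1 h4
      have h6 : j ∈ Set.Icc (i₀ + 1) (i₀ + k) := ⟨by omega, by omega⟩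
      rw [Set.indicator_of_mem h6, Pi.one_apply]
      refine le_trans ?_ le_add_self
      rw [← ENNReal.ofReal_one]
      exact ENNReal.ofReal_le_ofReal (min_le_left _ _)
  refine (ENNReal.tsum_le_tsum hpt).trans ?_
  rw [ENNReal.tsum_add]
  have e1 : ∑' j : ℤ, ENNReal.ofReal ((1 / 2 : ℝ) ^ (j + (-k - (i₀ + 1))).natAbs) =
      ∑' l : ℤ, ENNReal.ofReal ((1 / 2 : ℝ) ^ l.natAbs) :=
    (Equiv.addRight (-k - (i₀ + 1))).tsum_eq fun l : ℤ =>
      ENNReal.ofReal ((1 / 2 : ℝ) ^ l.natAbs)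
  have e2 : ∑' j : ℤ, (Set.Icc (i₀ + 1) (i₀ + k)).indicator (1 : ℤ → ℝ≥0∞) j ≤
      ENNReal.ofReal (wt k) := by
    rw [tsum_eq_sum (s := Finset.Icc (i₀ + 1) (i₀ + k)) fun j hj =>
      Set.indicator_of_notMem (by simpa using hj) _]
    calc _ ≤ ∑ _ ∈ Finset.Icc (i₀ + 1) (i₀ + k), (1 : ℝ≥0∞) :=
          Finset.sum_le_sum fun j _ => Set.indicator_le_self' (by simp) j
      _ = (k.toNat : ℝ≥0∞) := by
          rw [Finset.sum_const, Int.card_Icc, nsmul_eq_mul, mul_one]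
          congr 2
          ring
      _ ≤ _ := by
          rw [← ENNReal.ofReal_natCast]
          refine ENNReal.ofReal_le_ofReal ?_
          have h7 : (k.toNat : ℤ) ≤ |k| := by
            rw [Int.toNat_eq_max]
            exact max_le (le_abs_self k) (abs_nonneg k)
          have h8 : ((k.toNat : ℤ) : ℝ) ≤ |(k : ℝ)| := by exact_mod_cast h7
          unfold wt
          push_cast at h8
          linarith
  have hw : 1 ≤ ENNReal.ofReal (wt k) := by
    rw [← ENNReal.ofReal_one]; exact ENNReal.ofReal_le_ofReal (one_le_wt k)
  rw [e1, tailSum, add_mul, one_mul]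
  exact add_le_add (le_mul_of_one_le_right zero_le hw) e2

theorem cv_psi_eq_zero (i : ℤ) {b : Space n → ℂ} {c : Space n} {r : ℝ}
    (hsupp : ∀ x, x ∉ Metric.closedBall c r → b x = 0) {x : Space n}
    (hx : x ∉ Metric.closedBall c (r + 2 ^ (i + 1))) : cv (psi i) b x = 0 := by
  unfold cv
  refine (integral_congr_ae (Eventually.of_forall fun y => ?_)).trans (integral_zero _ _)
  by_cases hy : 2 ^ (i + 1) < ‖y‖
  · simp only [psi_eq_zero hy, zero_mul]
  · have : x - y ∉ Metric.closedBall c r := by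
      intro hxy
      apply hx
      rw [mem_closedBall_iff_norm] at hxy ⊢
      calc ‖x - c‖ = ‖(x - y - c) + y‖ := by congr 1; abel
        _ ≤ r + 2 ^ (i + 1) := (norm_add_le _ _).trans (add_le_add hxy (not_lt.1 hy))
    simp only [hsupp _ this, mul_zero]

/-- Off the dilated ball, the convolution with a kernel of scale `2 ^ j` is controlled by
`tailCoeff`. -/
theorem lintegral_compl_lcv_le {κ : Space n → ℂ} (hκ : IsKernel κ) (k j : ℤ)
    (hκsupp : ∀ y, 2 ^ (j + 1) < ‖y‖ → κ y = 0) {b : Space n → ℂ} (hb : Tame b) {c : Space n}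
    {r : ℝ} (hsupp : ∀ x, x ∉ Metric.closedBall c r → b x = 0) (hmean : ∫ x, b x = 0) :
    ∫⁻ x in (Metric.closedBall c (5 * r))ᶜ,
      lcv (fun y => ‖κ y‖ₑ) (fun y => ‖cv (psi (j - k)) b y‖ₑ) x ≤
      (∫⁻ y, ‖κ y‖ₑ) * (ENNReal.ofReal (2 ^ (n + 2)) * tailCoeff k r j * ∫⁻ x, ‖b x‖ₑ) := by
  unfold tailCoeff
  split_ifs with hcase
  · rw [mul_zero, zero_mul, mul_zero, nonpos_iff_eq_zero]
    refine (setLIntegral_congr_fun measurableSet_closedBall.compl fun x hx => ?_).trans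
      lintegral_zero
    unfold lcv
    refine (lintegral_congr fun y => ?_).trans lintegral_zero
    by_cases hy : 2 ^ (j + 1) < ‖y‖
    · simp only [hκsupp y hy, enorm_zero, zero_mul]
    · have : x - y ∉ Metric.closedBall c (r + 2 ^ (j - k + 1)) := by
        intro hxy
        apply hx
        rw [mem_closedBall_iff_norm] at hxy ⊢
        calc ‖x - c‖ = ‖(x - y - c) + y‖ := by congr 1; abel
          _ ≤ (r + 2 ^ (j - k + 1)) + 2 ^ (j + 1) :=
            (norm_add_le _ _).trans (add_le_add hxy (not_lt.1 hy))
          _ ≤ 5 * r := by linarith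
      simp only [cv_psi_eq_zero _ hsupp this, enorm_zero, mul_zero]
  · refine (setLIntegral_le_lintegral _ _).trans ?_
    rw [lintegral_lcv hκ.stronglyMeasurable.measurable.enorm
      (tame_cv_psi hb _).1.measurable.enorm]
    refine mul_le_mul_right ((lintegral_cv_psi_le (j - k) hb hsupp hmean).trans ?_) _
    rw [ENNReal.ofReal_mul (by positivity)]

theorem tsum_sq_le_sq_tsum {ι : Type*} (u : ι → ℝ≥0∞) : ∑' i, u i ^ 2 ≤ (∑' i, u i) ^ 2 := by
  rw [ENNReal.tsum_eq_iSup_sum]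
  refine iSup_le fun s => (sum_sq_le_sum_sq s u).trans ?_
  gcongr
  exact ENNReal.sum_le_tsum s

theorem localizedVariation_le_tsum (hK : KernelBounds K A β) (k : ℤ) {f : Space n → ℂ}
    (hf : Tame f) (x : Space n) : localizedVariation K k f x ≤
      ∑' j : ℤ, lcv (fun y => ‖annulus K (2 ^ j) (2 ^ (j + 1)) y‖ₑ)
        (fun y => ‖cv (psi (j - k)) f y‖ₑ) x := by
  unfold localizedVariation
  rw [rpow_half_le_iff]
  refine le_trans (ENNReal.tsum_le_tsum fun j => ?_) (tsum_sq_le_sq_tsum _)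
  rw [← shellMeasure_Ioc]
  exact variationSq_le_measure_sq fun s hs t _ hst =>
    enorm_cv_annulus_sub_le hK (tame_cv_psi hf _) (by positivity) hs.1 hst x

theorem lintegral_annulus_dyadic_le (hK : KernelBounds K A β) (j : ℤ) :
    ∫⁻ y, ‖annulus K (2 ^ j) (2 ^ (j + 1)) y‖ₑ ≤ ENNReal.ofReal A := by
  have h2 : (0 : ℝ) < 2 ^ j := by positivity
  refine (hK.mass _ _ h2).trans (ENNReal.ofReal_le_ofReal (le_of_eq ?_))
  rw [zpow_add₀ two_ne_zero, zpow_one]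
  field_simp
  ring

/-- The integral Hörmander condition for `localizedVariation`, with linear growth in `|k|`. -/
theorem lintegral_compl_localizedVariation_le (hK : KernelBounds K A β) (k : ℤ)
    {b : Space n → ℂ} (hb : Tame b) {c : Space n} {r : ℝ} (hr : 0 < r)
    (hsupp : ∀ x, x ∉ Metric.closedBall c r → b x = 0) (hmean : ∫ x, b x = 0) :
    ∫⁻ x in (Metric.closedBall c (5 * r))ᶜ, localizedVariation K k b x ≤
      ENNReal.ofReal A * ENNReal.ofReal (2 ^ (n + 2)) * tailSum * ENNReal.ofReal (wt k) *
        ∫⁻ x, ‖b x‖ₑ := by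
  calc ∫⁻ x in (Metric.closedBall c (5 * r))ᶜ, localizedVariation K k b x
      ≤ ∫⁻ x in (Metric.closedBall c (5 * r))ᶜ, ∑' j : ℤ,
          lcv (fun y => ‖annulus K (2 ^ j) (2 ^ (j + 1)) y‖ₑ)
            (fun y => ‖cv (psi (j - k)) b y‖ₑ) x :=
        lintegral_mono fun x => localizedVariation_le_tsum hK k hb x
    _ = ∑' j : ℤ, ∫⁻ x in (Metric.closedBall c (5 * r))ᶜ,
          lcv (fun y => ‖annulus K (2 ^ j) (2 ^ (j + 1)) y‖ₑ)
            (fun y => ‖cv (psi (j - k)) b y‖ₑ) x :=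
        lintegral_tsum fun j => (measurable_lcv (measurable_enorm_annulus hK _ _)
          (tame_cv_psi hb _).1.measurable.enorm).aemeasurable
    _ ≤ ∑' j : ℤ, ENNReal.ofReal A *
          (ENNReal.ofReal (2 ^ (n + 2)) * tailCoeff k r j * ∫⁻ x, ‖b x‖ₑ) := by
        refine ENNReal.tsum_le_tsum fun j => ?_
        refine (lintegral_compl_lcv_le (hK.isKernel (by positivity) _) k j (fun y hy => ?_) hb
          hsupp hmean).trans (mul_le_mul_left (lintegral_annulus_dyadic_le hK j) _)
        exact Set.indicator_of_notMem (s := {y : Space n | (2 : ℝ) ^ j < ‖y‖ ∧ ‖y‖ ≤ 2 ^ (j + 1)})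
          (fun h => absurd h.2 (not_le.2 hy)) K
    _ = ENNReal.ofReal A * ENNReal.ofReal (2 ^ (n + 2)) * (∑' j, tailCoeff k r j) *
          ∫⁻ x, ‖b x‖ₑ := by
        rw [ENNReal.tsum_mul_left, ENNReal.tsum_mul_right, ENNReal.tsum_mul_left]
        ring
    _ ≤ ENNReal.ofReal A * ENNReal.ofReal (2 ^ (n + 2)) *
          (tailSum * ENNReal.ofReal (wt k)) * ∫⁻ x, ‖b x‖ₑ := by
        gcongr
        exact tsum_tailCoeff_le k hr
    _ = _ := by ring

theorem ofReal_wt_rpow_neg_le_one (k : ℤ) {s : ℝ} (hs : 0 ≤ s) :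
    ENNReal.ofReal (wt k ^ (-s)) ≤ 1 := by
  rw [← ENNReal.ofReal_one]
  refine ENNReal.ofReal_le_ofReal ?_
  exact Real.rpow_le_one_of_one_le_of_nonpos (one_le_wt k) (by linarith)

theorem one_le_ofReal_wt (k : ℤ) : 1 ≤ ENNReal.ofReal (wt k) := by
  rw [← ENNReal.ofReal_one]
  exact ENNReal.ofReal_le_ofReal (one_le_wt k)

theorem exists_weak_type_localizedVariation (hn : 1 ≤ n) (hK : KernelBounds K A β) (hβ : 0 < β) :
    ∃ C : ℝ≥0∞, C ≠ ∞ ∧ ∀ (k : ℤ) (f : Space n → ℂ), Tame f → ∀ t : ℝ, 0 < t →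
      ENNReal.ofReal t * volume {x | ENNReal.ofReal t < localizedVariation K k f x} ≤
        C * ENNReal.ofReal (wt k) * ∫⁻ x, ‖f x‖ₑ := by
  obtain ⟨C₂, hC₂, h₂⟩ := exists_lintegral_localizedVariation_sq_le hn hK hβ
  set H₀ : ℝ≥0∞ := ENNReal.ofReal A * ENNReal.ofReal (2 ^ (n + 2)) * tailSum with hH₀
  have hH₀t : H₀ ≠ ∞ := ENNReal.mul_ne_top (ENNReal.mul_ne_top ENNReal.ofReal_ne_top
    ENNReal.ofReal_ne_top) tailSum_ne_top
  set V := volume (Metric.closedBall (0 : Space n) (5 * Real.sqrt n)) with hV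
  refine ⟨4 * 2 ^ n * C₂ + V + 4 * H₀, ?_, fun k f hf t ht => ?_⟩
  · refine ENNReal.add_ne_top.2 ⟨ENNReal.add_ne_top.2 ⟨ENNReal.mul_ne_top
      (ENNReal.mul_ne_top (by norm_num) (ENNReal.pow_ne_top (by norm_num))) hC₂,
      measure_closedBall_lt_top.ne⟩, ENNReal.mul_ne_top (by norm_num) hH₀t⟩
  · refine (weak_type_one_one hn (localizedVariation_zero K k)
      (fun f hf => measurable_localizedVariation hK k hf)
      (fun f g hf hg => localizedVariation_add_le hK k hf hg)
      (dominatedLSC_localizedVariation hK k) (A := C₂) (H := H₀ * ENNReal.ofReal (wt k))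
      (D := 5) (by norm_num) (fun f hf => ?_) (fun b hb c r hr hsupp hmean => ?_) hf ht).trans ?_
    · refine (h₂ k f hf).trans (mul_le_mul_left ?_ _)
      exact mul_le_of_le_one_right zero_le (ofReal_wt_rpow_neg_le_one k hβ.le)
    · exact lintegral_compl_localizedVariation_le hK k hb hr hsupp hmean
    · refine mul_le_mul_left ?_ _
      have hw := one_le_ofReal_wt k
      rw [add_mul, add_mul]
      refine add_le_add (add_le_add (le_mul_of_one_le_right zero_le hw)
        (le_mul_of_one_le_right zero_le hw)) (le_of_eq (by ring))

end WeakType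

/-! ### The dual square function operator -/

section Dual

open Filter Topology FourierTransform

variable {n : ℕ} {K : Space n → ℂ} {A β : ℝ} {ι : Type*} [Fintype ι]

theorem enorm_rpow_two_eq_sum (v : EuclideanSpace ℂ ι) :
    ‖v‖ₑ ^ (2 : ℝ) = ∑ i, ‖v i‖ₑ ^ (2 : ℝ) := by
  simp only [ENNReal.rpow_two, ← ofReal_norm]
  rw [← ENNReal.ofReal_pow (norm_nonneg _), EuclideanSpace.norm_sq_eq,
    ENNReal.ofReal_sum_of_nonneg fun i _ => by positivity]
  simp only [ENNReal.ofReal_pow (norm_nonneg _)]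

theorem Tame.coord {g : Space n → EuclideanSpace ℂ ι} (hg : Tame g) (i : ι) :
    Tame fun x => g x i := by
  refine hg.mono (c := 1) ?_ fun x => ?_
  · exact (EuclideanSpace.proj i : EuclideanSpace ℂ ι →L[ℂ] ℂ).continuous.comp_stronglyMeasurable
      hg.1
  · rw [one_mul]; exact PiLp.norm_apply_le (g x) i

/-- The Cauchy-Schwarz inequality for finite sums. -/
theorem sum_mul_sq_le (a b : ι → ℝ≥0∞) :
    (∑ i, a i * b i) ^ (2 : ℝ) ≤ (∑ i, a i ^ (2 : ℝ)) * ∑ i, b i ^ (2 : ℝ) := by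
  have h := ENNReal.inner_le_Lp_mul_Lq Finset.univ a b Real.HolderConjugate.two_two
  calc (∑ i, a i * b i) ^ (2 : ℝ) ≤ ((∑ i, a i ^ (2 : ℝ)) ^ (1 / 2 : ℝ) *
        (∑ i, b i ^ (2 : ℝ)) ^ (1 / 2 : ℝ)) ^ (2 : ℝ) := by gcongr
    _ = _ := by
        rw [ENNReal.mul_rpow_of_nonneg _ _ two_pos.le, ← ENNReal.rpow_mul, ← ENNReal.rpow_mul]
        norm_num

theorem fourier_sum {f : ι → Space n → ℂ} (hf : ∀ i, Integrable (f i)) (ξ : Space n) :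
    𝓕 (∑ i, f i) ξ = ∑ i, 𝓕 (f i) ξ := by
  simp only [Real.fourier_eq, Finset.sum_apply, Finset.smul_sum]
  exact integral_finsetSum _ fun i _ => (Real.fourierIntegral_convergent_iff ξ).2 (hf i)

/-- The operator `g ↦ ∑ i, κ i * ψ_{m i} * g i` on vector valued functions. -/
def dualOp (κ : ι → Space n → ℂ) (m : ι → ℤ) (g : Space n → EuclideanSpace ℂ ι) : Space n → ℂ :=
  ∑ i, cv (κ i) (cv (psi (m i)) fun z => g z i)

theorem tame_dualOp_term {κ : ι → Space n → ℂ} (hκ : ∀ i, IsKernel (κ i)) (m : ι → ℤ)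
    {g : Space n → EuclideanSpace ℂ ι} (hg : Tame g) (i : ι) :
    Tame (cv (κ i) (cv (psi (m i)) fun z => g z i)) :=
  (hκ i).tame_cv (tame_cv_psi (hg.coord i) _)

theorem tame_dualOp {κ : ι → Space n → ℂ} (hκ : ∀ i, IsKernel (κ i)) (m : ι → ℤ)
    {g : Space n → EuclideanSpace ℂ ι} (hg : Tame g) : Tame (dualOp κ m g) :=
  Tame.sum _ fun i _ => tame_dualOp_term hκ m hg i

theorem dualOp_zero (κ : ι → Space n → ℂ) (m : ι → ℤ) : dualOp κ m 0 = 0 := by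
  have h : ∀ i, (fun z : Space n => (0 : Space n → EuclideanSpace ℂ ι) z i) = 0 := fun i => rfl
  simp only [dualOp, h, cv_zero, Finset.sum_const_zero]

theorem dualOp_add {κ : ι → Space n → ℂ} (hκ : ∀ i, IsKernel (κ i)) (m : ι → ℤ)
    {g h : Space n → EuclideanSpace ℂ ι} (hg : Tame g) (hh : Tame h) :
    dualOp κ m (g + h) = dualOp κ m g + dualOp κ m h := by
  ext x
  simp only [dualOp, Pi.add_apply, Finset.sum_apply]
  rw [← Finset.sum_add_distrib]
  refine Finset.sum_congr rfl fun i _ => ?_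
  have e : cv (psi (m i)) (fun z => (g z + h z) i) =
      cv (psi (m i)) (fun z => g z i) + cv (psi (m i)) fun z => h z i := by
    ext y
    exact cv_add (tame_psi _).isKernel (hg.coord i) (hh.coord i) y
  rw [e, cv_add (hκ i) (tame_cv_psi (hg.coord i) _) (tame_cv_psi (hh.coord i) _)]

/-- Dominated convergence, in the form in which the Calderón–Zygmund theorem asks for it. -/
theorem dominatedLSC_dualOp {κ : ι → Space n → ℂ} (hκ : ∀ i, IsKernel (κ i)) (m : ι → ℤ) :
    DominatedLSC fun g x => ‖dualOp κ m g x‖ₑ := by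
  intro g G hg hG hdom hlim x
  obtain ⟨M, hM⟩ := hg.2.1
  have hb : ∀ (i : ι) (l : ℕ) (y : Space n), ‖G l y i‖ ≤ M := fun i l y =>
    (PiLp.norm_apply_le (G l y) i).trans ((hdom l y).trans (hM y))
  have h1 : ∀ (i : ι) (y : Space n), Tendsto (fun l => cv (psi (m i)) (fun z => G l z i) y) atTop
      (𝓝 (cv (psi (m i)) (fun z => g z i) y)) := fun i y =>
    tendsto_cv (tame_psi _).isKernel (fun l => ((hG l).coord i).1) (hb i)
      (Eventually.of_forall fun z =>
        ((EuclideanSpace.proj i : EuclideanSpace ℂ ι →L[ℂ] ℂ).continuous.tendsto _).comp (hlim z)) y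
  have h2 : Tendsto (fun l => dualOp κ m (G l) x) atTop (𝓝 (dualOp κ m g x)) := by
    simp only [dualOp, Finset.sum_apply]
    refine tendsto_finsetSum _ fun i _ => ?_
    exact tendsto_cv (hκ i) (fun l => (tame_cv_psi ((hG l).coord i) _).1)
      (fun l y => norm_cv_psi_le (hb i l) _ y) (Eventually.of_forall (h1 i)) x
  exact h2.enorm.liminf_eq.ge

/-- The `L²` bound, by Plancherel's theorem and the Cauchy-Schwarz inequality in the index. -/
theorem lintegral_dualOp_sq_le {κ : ι → Space n → ℂ} (hκ : ∀ i, IsKernel (κ i)) (m : ι → ℤ)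
    {B : ℝ≥0∞} (hB : ∀ᵐ ξ, ∑ i, ‖𝓕 (κ i) ξ‖ₑ ^ (2 : ℝ) *
      ‖𝓕 (psi (m i) : Space n → ℂ) ξ‖ₑ ^ (2 : ℝ) ≤ B)
    {g : Space n → EuclideanSpace ℂ ι} (hg : Tame g) :
    ∫⁻ x, ‖dualOp κ m g x‖ₑ ^ (2 : ℝ) ≤ B * ∫⁻ x, ‖g x‖ₑ ^ (2 : ℝ) := by
  have hm : ∀ i, Measurable fun ξ => ‖𝓕 (fun z => g z i) ξ‖ₑ ^ (2 : ℝ) := fun i =>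
    (continuous_fourier (hg.coord i).integrable).measurable.enorm.pow_const _
  calc ∫⁻ x, ‖dualOp κ m g x‖ₑ ^ (2 : ℝ) = ∫⁻ ξ, ‖𝓕 (dualOp κ m g) ξ‖ₑ ^ (2 : ℝ) :=
        (tame_dualOp hκ m hg).lintegral_fourier_sq.symm
    _ ≤ ∫⁻ ξ, B * ∑ i, ‖𝓕 (fun z => g z i) ξ‖ₑ ^ (2 : ℝ) := by
        refine lintegral_mono_ae ?_
        filter_upwards [hB] with ξ hξ
        have e : 𝓕 (dualOp κ m g) ξ =
            ∑ i, 𝓕 (κ i) ξ * 𝓕 (psi (m i) : Space n → ℂ) ξ * 𝓕 (fun z => g z i) ξ := by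
          rw [dualOp, fourier_sum fun i => (tame_dualOp_term hκ m hg i).integrable]
          refine Finset.sum_congr rfl fun i _ => ?_
          rw [fourier_cv (hκ i) (tame_cv_psi (hg.coord i) _),
            fourier_cv (tame_psi _).isKernel (hg.coord i), mul_assoc]
        calc ‖𝓕 (dualOp κ m g) ξ‖ₑ ^ (2 : ℝ)
            ≤ (∑ i, (‖𝓕 (κ i) ξ‖ₑ * ‖𝓕 (psi (m i) : Space n → ℂ) ξ‖ₑ) *
              ‖𝓕 (fun z => g z i) ξ‖ₑ) ^ (2 : ℝ) := by
              rw [e]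
              gcongr
              refine (enorm_sum_le _ _).trans (le_of_eq ?_)
              simp only [enorm_mul]
          _ ≤ _ := sum_mul_sq_le _ _
          _ ≤ _ := by
              gcongr
              simpa only [ENNReal.mul_rpow_of_nonneg _ _ two_pos.le] using hξ
    _ = B * ∑ i, ∫⁻ ξ, ‖𝓕 (fun z => g z i) ξ‖ₑ ^ (2 : ℝ) := by
        rw [lintegral_const_mul _ (Finset.measurable_sum _ fun i _ => hm i),
          lintegral_finsetSum _ fun i _ => hm i]
    _ = B * ∫⁻ x, ‖g x‖ₑ ^ (2 : ℝ) := by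
        simp only [enorm_rpow_two_eq_sum]
        rw [lintegral_finsetSum _ fun i _ => (hg.coord i).1.measurable.enorm.pow_const _]
        congr 1
        exact Finset.sum_congr rfl fun i _ => (hg.coord i).lintegral_fourier_sq

theorem lintegral_compl_dualOp_le {κ : ι → Space n → ℂ} (hκ : ∀ i, IsKernel (κ i)) (k : ℤ)
    (j : ι → ℤ) (hκsupp : ∀ i y, 2 ^ (j i + 1) < ‖y‖ → κ i y = 0)
    {b : Space n → EuclideanSpace ℂ ι} (hb : Tame b) {c : Space n} {r : ℝ}
    (hsupp : ∀ x, x ∉ Metric.closedBall c r → b x = 0) (hmean : ∫ x, b x = 0) :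
    ∫⁻ x in (Metric.closedBall c (5 * r))ᶜ, ‖dualOp κ (fun i => j i - k) b x‖ₑ ≤
      ∑ i, (∫⁻ y, ‖κ i y‖ₑ) *
        (ENNReal.ofReal (2 ^ (n + 2)) * tailCoeff k r (j i) * ∫⁻ x, ‖b x i‖ₑ) := by
  have hm : ∀ i, Measurable (lcv (fun y => ‖κ i y‖ₑ)
      fun y => ‖cv (psi (j i - k)) (fun z => b z i) y‖ₑ) := fun i =>
    measurable_lcv (hκ i).stronglyMeasurable.measurable.enorm
      (tame_cv_psi (hb.coord i) _).1.measurable.enorm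
  calc ∫⁻ x in (Metric.closedBall c (5 * r))ᶜ, ‖dualOp κ (fun i => j i - k) b x‖ₑ
      ≤ ∫⁻ x in (Metric.closedBall c (5 * r))ᶜ, ∑ i, lcv (fun y => ‖κ i y‖ₑ)
          (fun y => ‖cv (psi (j i - k)) (fun z => b z i) y‖ₑ) x := by
        refine lintegral_mono fun x => ?_
        rw [dualOp, Finset.sum_apply]
        exact (enorm_sum_le _ _).trans (Finset.sum_le_sum fun i _ => enorm_cv_le _ _ _)
    _ = ∑ i, ∫⁻ x in (Metric.closedBall c (5 * r))ᶜ, lcv (fun y => ‖κ i y‖ₑ)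
          (fun y => ‖cv (psi (j i - k)) (fun z => b z i) y‖ₑ) x :=
        lintegral_finsetSum _ fun i _ => hm i
    _ ≤ _ := by
        refine Finset.sum_le_sum fun i _ => ?_
        refine lintegral_compl_lcv_le (hκ i) k (j i) (hκsupp i) (hb.coord i)
          (fun x hx => by rw [hsupp x hx]; rfl) ?_
        have := (EuclideanSpace.proj i : EuclideanSpace ℂ ι →L[ℂ] ℂ).integral_comp_comm
          hb.integrable
        rw [hmean, map_zero] at this
        exact this

/-- The reflected kernel of the `l`-th cell of the grid with `L` cells at the scale `2 ^ j`,
normalized so that the square function over the cells is bounded uniformly in `L`. -/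
def cellKernel (K : Space n → ℂ) (J : Finset ℤ) (L : ℕ) (i : J × Fin L) (y : Space n) : ℂ :=
  (Real.sqrt L : ℂ) * annulus K (gridPoint i.1 L i.2) (gridPoint i.1 L (i.2 + 1)) (-y)

theorem gridPoint_pos (j : ℤ) (L l : ℕ) : 0 < gridPoint j L l := by
  unfold gridPoint; positivity

theorem isKernel_cellKernel (hK : KernelBounds K A β) (J : Finset ℤ) (L : ℕ) (i : J × Fin L) :
    IsKernel (cellKernel K J L i) := by
  have h := (hK.isKernel (gridPoint_pos i.1 L i.2) (gridPoint i.1 L (i.2 + 1))).reflect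
  refine ⟨stronglyMeasurable_const.mul h.1, h.2.const_mul _, ?_⟩
  obtain ⟨R, hR⟩ := h.support
  exact ⟨R, fun x hx => by rw [cellKernel, hR x hx, mul_zero]⟩

theorem lintegral_cellKernel_le (hK : KernelBounds K A β) (J : Finset ℤ) {L : ℕ} (hL : 1 ≤ L)
    (i : J × Fin L) : ∫⁻ y, ‖cellKernel K J L i y‖ₑ ≤ ENNReal.ofReal (A / Real.sqrt L) := by
  have hL' : (0 : ℝ) < L := by exact_mod_cast hL
  have hs : 0 < Real.sqrt L := Real.sqrt_pos.2 hL'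
  simp only [cellKernel, enorm_mul]
  rw [lintegral_const_mul' _ _ enorm_ne_top,
    lintegral_neg_eq_self (f := fun y : Space n => ‖annulus K (gridPoint i.1 L i.2)
      (gridPoint i.1 L (i.2 + 1)) y‖ₑ), ← ofReal_norm, Complex.norm_real,
    Real.norm_of_nonneg hs.le]
  refine (mul_le_mul_right (lintegral_annulus_grid_le hK i.1 hL i.2) _).trans (le_of_eq ?_)
  rw [← ENNReal.ofReal_mul hs.le]
  congr 1
  rw [eq_div_iff hs.ne']
  calc Real.sqrt L * (A / L) * Real.sqrt L = Real.sqrt L * Real.sqrt L * (A / L) := by ring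
    _ = A := by rw [Real.mul_self_sqrt hL'.le]; field_simp

theorem cellKernel_eq_zero (K : Space n → ℂ) (J : Finset ℤ) {L : ℕ} (hL : 1 ≤ L) (i : J × Fin L)
    {y : Space n} (hy : (2 : ℝ) ^ ((i.1 : ℤ) + 1) < ‖y‖) : cellKernel K J L i y = 0 := by
  have h := (gridPoint_mem (j := i.1) hL (l := i.2 + 1) i.2.2).2
  have : annulus K (gridPoint i.1 L i.2) (gridPoint i.1 L (i.2 + 1)) (-y) = 0 := by
    refine Set.indicator_of_notMem (s := {y : Space n | gridPoint i.1 L i.2 < ‖y‖ ∧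
      ‖y‖ ≤ gridPoint i.1 L (i.2 + 1)}) (fun hmem => ?_) K
    have h3 := hmem.2
    rw [norm_neg] at h3
    linarith
  rw [cellKernel, this, mul_zero]

theorem enorm_fourier_le (f : Space n → ℂ) (ξ : Space n) : ‖𝓕 f ξ‖ₑ ≤ ∫⁻ x, ‖f x‖ₑ := by
  rw [Real.fourier_eq]
  refine (enorm_integral_le_lintegral_enorm _).trans (le_of_eq (lintegral_congr fun x => ?_))
  rw [← ofReal_norm, Circle.norm_smul, ofReal_norm]

/-- Each of the `L` cells of a scale has a multiplier of size `O(L ^ (-1 / 2))`, so the sum over the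
cells is bounded uniformly in `L`. -/
theorem sum_fourier_cellKernel_le (hK : KernelBounds K A β) (hβ : 0 < β) (k : ℤ) (J : Finset ℤ)
    {L : ℕ} (hL : 1 ≤ L) {ξ : Space n} (hξ : ξ ≠ 0) :
    ∑ i : J × Fin L, ‖𝓕 (cellKernel K J L i) ξ‖ₑ ^ (2 : ℝ) *
      ‖𝓕 (psi (i.1 - k) : Space n → ℂ) ξ‖ₑ ^ (2 : ℝ) ≤
      ENNReal.ofReal (A ^ 2) * (ENNReal.ofReal (psiConst n) * decaySum β) := by
  have hL' : (0 : ℝ) < L := by exact_mod_cast hL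
  have hA := hK.nonneg
  have h1 : ∀ i, ‖𝓕 (cellKernel K J L i) ξ‖ₑ ^ (2 : ℝ) ≤ ENNReal.ofReal (A ^ 2 / L) := by
    intro i
    have h2 := (enorm_fourier_le (cellKernel K J L i) ξ).trans (lintegral_cellKernel_le hK J hL i)
    calc ‖𝓕 (cellKernel K J L i) ξ‖ₑ ^ (2 : ℝ) ≤ ENNReal.ofReal (A / Real.sqrt L) ^ (2 : ℝ) := by
          gcongr
      _ = _ := by
          rw [ENNReal.rpow_two, ← ENNReal.ofReal_pow (by positivity), div_pow,
            Real.sq_sqrt hL'.le]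
  calc _ ≤ ∑ i : J × Fin L, ENNReal.ofReal (A ^ 2 / L) *
        ‖𝓕 (psi (i.1 - k) : Space n → ℂ) ξ‖ₑ ^ (2 : ℝ) :=
        Finset.sum_le_sum fun i _ => mul_le_mul_left (h1 i) _
    _ = ENNReal.ofReal (A ^ 2) * ∑ j : J, ‖𝓕 (psi ((j : ℤ) - k) : Space n → ℂ) ξ‖ₑ ^ (2 : ℝ) := by
        rw [Fintype.sum_prod_type, Finset.mul_sum]
        refine Finset.sum_congr rfl fun j _ => ?_
        simp only [Finset.sum_const, Finset.card_univ, Fintype.card_fin, nsmul_eq_mul]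
        rw [← mul_assoc, ← ENNReal.ofReal_natCast, ← ENNReal.ofReal_mul hL'.le]
        congr 2
        field_simp
    _ ≤ ENNReal.ofReal (A ^ 2) * ∑' j : ℤ, ‖𝓕 (psi (j - k) : Space n → ℂ) ξ‖ₑ ^ (2 : ℝ) := by
        gcongr
        rw [Finset.sum_coe_sort J fun j => ‖𝓕 (psi (j - k) : Space n → ℂ) ξ‖ₑ ^ (2 : ℝ)]
        exact ENNReal.sum_le_tsum _
    _ ≤ _ := by
        gcongr
        exact tsum_fourier_psi_le hβ k hξ

theorem sum_enorm_le_sqrt_mul {L : ℕ} (a : Fin L → ℝ≥0∞) {B : ℝ≥0∞}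
    (h : ∑ l, a l ^ (2 : ℝ) ≤ B ^ (2 : ℝ)) : ∑ l, a l ≤ ENNReal.ofReal (Real.sqrt L) * B := by
  have h1 := sum_mul_sq_le (fun _ : Fin L => 1) a
  simp only [one_mul, ENNReal.one_rpow, Finset.sum_const, Finset.card_univ, Fintype.card_fin,
    nsmul_eq_mul, mul_one] at h1
  have h2 : (∑ l, a l) ^ (2 : ℝ) ≤ (ENNReal.ofReal (Real.sqrt L) * B) ^ (2 : ℝ) := by
    refine h1.trans ?_
    rw [ENNReal.mul_rpow_of_nonneg _ _ two_pos.le, ENNReal.rpow_two (ENNReal.ofReal _),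
      ← ENNReal.ofReal_pow (Real.sqrt_nonneg _), Real.sq_sqrt (Nat.cast_nonneg L),
      ENNReal.ofReal_natCast]
    gcongr
  exact (ENNReal.rpow_le_rpow_iff two_pos).1 h2

/-- The integral Hörmander condition for the dual operator, uniformly over the grids: the factor
`√L` lost by the Cauchy-Schwarz inequality over the cells is regained from the mass of the cells. -/
theorem lintegral_compl_dualOp_cell_le (hK : KernelBounds K A β) (k : ℤ) (J : Finset ℤ)
    {L : ℕ} (hL : 1 ≤ L) {b : Space n → EuclideanSpace ℂ (J × Fin L)} (hb : Tame b) {c : Space n}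
    {r : ℝ} (hr : 0 < r) (hsupp : ∀ x, x ∉ Metric.closedBall c r → b x = 0)
    (hmean : ∫ x, b x = 0) :
    ∫⁻ x in (Metric.closedBall c (5 * r))ᶜ,
      ‖dualOp (cellKernel K J L) (fun i => (i.1 : ℤ) - k) b x‖ₑ ≤
      ENNReal.ofReal A * ENNReal.ofReal (2 ^ (n + 2)) * tailSum * ENNReal.ofReal (wt k) *
        ∫⁻ x, ‖b x‖ₑ := by
  have hL' : (0 : ℝ) < L := by exact_mod_cast hL
  have hs : 0 < Real.sqrt L := Real.sqrt_pos.2 hL'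
  have hA := hK.nonneg
  have hsum : ∀ j : J, ∑ l : Fin L, ∫⁻ x, ‖b x (j, l)‖ₑ ≤
      ENNReal.ofReal (Real.sqrt L) * ∫⁻ x, ‖b x‖ₑ := by
    intro j
    rw [← lintegral_finsetSum _ fun l _ => (hb.coord (j, l)).1.measurable.enorm,
      ← lintegral_const_mul _ hb.1.enorm]
    refine lintegral_mono fun x => sum_enorm_le_sqrt_mul _ ?_
    rw [enorm_rpow_two_eq_sum, Fintype.sum_prod_type]
    exact Finset.single_le_sum_of_canonicallyOrdered
      (f := fun j : J => ∑ l : Fin L, ‖b x (j, l)‖ₑ ^ (2 : ℝ)) (Finset.mem_univ j)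
  refine (lintegral_compl_dualOp_le (isKernel_cellKernel hK J L) k (fun i => (i.1 : ℤ))
    (fun i y hy => cellKernel_eq_zero K J hL i hy) hb hsupp hmean).trans ?_
  calc _ ≤ ∑ i : J × Fin L, ENNReal.ofReal (A / Real.sqrt L) *
        (ENNReal.ofReal (2 ^ (n + 2)) * tailCoeff k r i.1 * ∫⁻ x, ‖b x i‖ₑ) :=
        Finset.sum_le_sum fun i _ => mul_le_mul_left (lintegral_cellKernel_le hK J hL i) _
    _ = ∑ j : J, ENNReal.ofReal (A / Real.sqrt L) * (ENNReal.ofReal (2 ^ (n + 2)) *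
          tailCoeff k r j * ∑ l : Fin L, ∫⁻ x, ‖b x (j, l)‖ₑ) := by
        rw [Fintype.sum_prod_type]
        simp only [Finset.mul_sum]
    _ ≤ ∑ j : J, ENNReal.ofReal (A / Real.sqrt L) * (ENNReal.ofReal (2 ^ (n + 2)) *
          tailCoeff k r j * (ENNReal.ofReal (Real.sqrt L) * ∫⁻ x, ‖b x‖ₑ)) := by
        gcongr with j
        exact hsum j
    _ = ENNReal.ofReal A * ENNReal.ofReal (2 ^ (n + 2)) * (∑ j : J, tailCoeff k r j) *
          ∫⁻ x, ‖b x‖ₑ := by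
        have e : ENNReal.ofReal A = ENNReal.ofReal (A / Real.sqrt L) *
            ENNReal.ofReal (Real.sqrt L) := by
          rw [← ENNReal.ofReal_mul (by positivity), div_mul_cancel₀ _ hs.ne']
        rw [e, Finset.mul_sum, Finset.sum_mul]
        refine Finset.sum_congr rfl fun j _ => ?_
        ring
    _ ≤ ENNReal.ofReal A * ENNReal.ofReal (2 ^ (n + 2)) *
          (tailSum * ENNReal.ofReal (wt k)) * ∫⁻ x, ‖b x‖ₑ := by
        gcongr
        rw [Finset.sum_coe_sort J fun j => tailCoeff k r j]
        exact (ENNReal.sum_le_tsum J).trans (tsum_tailCoeff_le k hr)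
    _ = _ := by ring

theorem rpow_mul_measure_le {T : Space n → ℝ≥0∞} (hT : Measurable T) {p t : ℝ} (hp : 0 < p)
    (ht : 0 < t) : ENNReal.ofReal (t ^ p) * volume {x | ENNReal.ofReal t < T x} ≤
      ∫⁻ x, T x ^ p := by
  refine le_trans (mul_le_mul_right (measure_mono fun x hx => ?_) _)
    (mul_meas_ge_le_lintegral (hT.pow_const p) _)
  have hx' : ENNReal.ofReal t < T x := hx
  change ENNReal.ofReal (t ^ p) ≤ T x ^ p
  rw [← ENNReal.ofReal_rpow_of_pos ht]
  gcongr

/-- Strong type estimates for the dual operator below the exponent `2`, uniformly over the grids. -/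
theorem exists_lintegral_dualOp_le (hn : 1 ≤ n) (hK : KernelBounds K A β) (hβ : 0 < β) {q : ℝ}
    (hq : 1 < q) (hq2 : q < 2) : ∃ C : ℝ≥0∞, C ≠ ∞ ∧ ∀ (k : ℤ) (J : Finset ℤ) (L : ℕ), 1 ≤ L →
      ∀ g : Space n → EuclideanSpace ℂ (J × Fin L), Tame g →
        ∫⁻ x, ‖dualOp (cellKernel K J L) (fun i => (i.1 : ℤ) - k) g x‖ₑ ^ q ≤
          C * ENNReal.ofReal (wt k) * ∫⁻ x, ‖g x‖ₑ ^ q := by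
  set C₂ : ℝ≥0∞ := ENNReal.ofReal (A ^ 2) * (ENNReal.ofReal (psiConst n) * decaySum β) with hC₂
  have hC₂t : C₂ ≠ ∞ := ENNReal.mul_ne_top ENNReal.ofReal_ne_top
    (ENNReal.mul_ne_top ENNReal.ofReal_ne_top (decaySum_ne_top hβ))
  set H₀ : ℝ≥0∞ := ENNReal.ofReal A * ENNReal.ofReal (2 ^ (n + 2)) * tailSum with hH₀
  have hH₀t : H₀ ≠ ∞ := ENNReal.mul_ne_top (ENNReal.mul_ne_top ENNReal.ofReal_ne_top
    ENNReal.ofReal_ne_top) tailSum_ne_top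
  set V := volume (Metric.closedBall (0 : Space n) (5 * Real.sqrt n)) with hV
  set C₁ : ℝ≥0∞ := 4 * 2 ^ n * C₂ + V + 4 * H₀ with hC₁
  have hC₁t : C₁ ≠ ∞ := by
    refine ENNReal.add_ne_top.2 ⟨ENNReal.add_ne_top.2 ⟨ENNReal.mul_ne_top
      (ENNReal.mul_ne_top (by norm_num) (ENNReal.pow_ne_top (by norm_num))) hC₂t,
      measure_closedBall_lt_top.ne⟩, ENNReal.mul_ne_top (by norm_num) hH₀t⟩
  refine ⟨ENNReal.ofReal (q * 2 ^ (1 : ℝ) / (q - 1)) * C₁ +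
    ENNReal.ofReal (q * 2 ^ (2 : ℝ) / (2 - q)) * C₂, ?_, fun k J L hL g hg => ?_⟩
  · exact ENNReal.add_ne_top.2 ⟨ENNReal.mul_ne_top ENNReal.ofReal_ne_top hC₁t,
      ENNReal.mul_ne_top ENNReal.ofReal_ne_top hC₂t⟩
  set T : (Space n → EuclideanSpace ℂ (J × Fin L)) → Space n → ℝ≥0∞ := fun g x =>
    ‖dualOp (cellKernel K J L) (fun i => (i.1 : ℤ) - k) g x‖ₑ with hT
  have hκ := isKernel_cellKernel hK J L
  have hw := one_le_ofReal_wt k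
  have hmeas : ∀ f, Tame f → Measurable (T f) := fun f hf =>
    (tame_dualOp hκ _ hf).1.measurable.enorm
  have hadd : ∀ f g, Tame f → Tame g → ∀ x, T (f + g) x ≤ T f x + T g x := by
    intro f g hf hg x
    simp only [hT, dualOp_add hκ _ hf hg, Pi.add_apply]
    exact enorm_add_le _ _
  have h₂ : ∀ f, Tame f → ∫⁻ x, T f x ^ (2 : ℝ) ≤ C₂ * ∫⁻ x, ‖f x‖ₑ ^ (2 : ℝ) := by
    intro f hf
    refine lintegral_dualOp_sq_le hκ _ ?_ hf
    filter_upwards [ae_ne_zero hn] with ξ hξ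
    exact sum_fourier_cellKernel_le hK hβ k J hL hξ
  have h₁ : ∀ f, Tame f → ∀ t, 0 < t →
      ENNReal.ofReal (t ^ (1 : ℝ)) * volume {x | ENNReal.ofReal t < T f x} ≤
        C₁ * ENNReal.ofReal (wt k) * ∫⁻ x, ‖f x‖ₑ ^ (1 : ℝ) := by
    intro f hf t ht
    simp only [Real.rpow_one, ENNReal.rpow_one]
    refine (weak_type_one_one hn (T := T) (fun x => by simp [hT, dualOp_zero]) hmeas hadd
      (dominatedLSC_dualOp hκ _) (A := C₂) (H := H₀ * ENNReal.ofReal (wt k)) (D := 5)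
      (by norm_num) h₂ (fun b hb c r hr hsupp hmean => ?_) hf ht).trans ?_
    · exact lintegral_compl_dualOp_cell_le hK k J hL hb hr hsupp hmean
    · refine mul_le_mul_left ?_ _
      rw [hC₁, add_mul, add_mul]
      refine add_le_add (add_le_add (le_mul_of_one_le_right zero_le hw)
        (le_mul_of_one_le_right zero_le hw)) (le_of_eq (by ring))
  have h₂' : ∀ f, Tame f → ∀ t, 0 < t →
      ENNReal.ofReal (t ^ (2 : ℝ)) * volume {x | ENNReal.ofReal t < T f x} ≤
        C₂ * ∫⁻ x, ‖f x‖ₑ ^ (2 : ℝ) := fun f hf t ht =>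
    (rpow_mul_measure_le (hmeas f hf) two_pos ht).trans (h₂ f hf)
  refine (marcinkiewicz hmeas hadd one_pos hq hq2 (ENNReal.mul_ne_top hC₁t ENNReal.ofReal_ne_top)
    hC₂t h₁ h₂' one_pos hg).trans (mul_le_mul_left ?_ _)
  simp only [Real.one_rpow, ENNReal.ofReal_one, mul_one]
  refine le_trans (add_le_add (mul_assoc _ _ _).ge (le_mul_of_one_le_right zero_le hw))
    (add_mul _ _ _).ge

end Dual

/-! ### Duality and the estimates above the exponent `2` -/

section Duality

open Filter Topology

variable {n : ℕ} {K : Space n → ℂ} {A β : ℝ} {ι : Type*} [Fintype ι]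

theorem cv_comm {κ ψ h : Space n → ℂ} (hκ : IsKernel κ) (hψ : IsKernel ψ) (hh : Tame h)
    (x : Space n) : cv κ (cv ψ h) x = cv ψ (cv κ h) x := by
  obtain ⟨M, hM⟩ := hh.2.1
  have hint : Integrable (Function.uncurry fun y z => κ y * (ψ z * h (x - y - z)))
      (volume.prod volume) := by
    have h1 : Integrable (fun w : Space n × Space n => κ w.1 * ψ w.2) (volume.prod volume) :=
      hκ.integrable.mul_prod hψ.integrable
    have hm : StronglyMeasurable fun w : Space n × Space n => h (x - w.1 - w.2) :=
      hh.1.comp_measurable ((measurable_const.sub measurable_fst).sub measurable_snd)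
    refine (h1.mul_bdd (c := M) hm.aestronglyMeasurable
      (Eventually.of_forall fun w => hM _)).congr (Eventually.of_forall fun w => ?_)
    simp only [Function.uncurry, mul_assoc]
  calc cv κ (cv ψ h) x = ∫ y, ∫ z, κ y * (ψ z * h (x - y - z)) := by
        simp only [cv, integral_const_mul]
    _ = ∫ z, ∫ y, κ y * (ψ z * h (x - y - z)) := integral_integral_swap hint
    _ = cv ψ (cv κ h) x := by
        simp only [cv, ← integral_const_mul]
        refine integral_congr_ae (Eventually.of_forall fun z => integral_congr_ae
          (Eventually.of_forall fun y => ?_))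
        simp only []
        rw [sub_right_comm]
        ring

/-- The vector of the functions `κ̃ i * ψ_{m i} * f`, with `κ̃` the reflection of `κ`. -/
def squareVec (κ : ι → Space n → ℂ) (m : ι → ℤ) (f : Space n → ℂ) (x : Space n) :
    EuclideanSpace ℂ ι :=
  WithLp.toLp 2 fun i => cv (fun y => κ i (-y)) (cv (psi (m i)) f) x

theorem norm_toLp_le_sum (v : ι → ℂ) : ‖(WithLp.toLp 2 v : EuclideanSpace ℂ ι)‖ ≤ ∑ i, ‖v i‖ := by
  rw [EuclideanSpace.norm_eq, Real.sqrt_le_left (Finset.sum_nonneg fun i _ => norm_nonneg _), sq,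
    Finset.sum_mul]
  refine Finset.sum_le_sum fun i hi => ?_
  rw [sq]
  exact mul_le_mul_of_nonneg_left (Finset.single_le_sum (f := fun i => ‖v i‖)
    (fun i _ => norm_nonneg _) hi) (norm_nonneg _)

theorem tame_toLp {u : ι → Space n → ℂ} (hu : ∀ i, Tame (u i)) :
    Tame fun x => (WithLp.toLp 2 fun i => u i x : EuclideanSpace ℂ ι) := by
  have h1 : Tame (∑ i, fun x => ‖u i x‖) := Tame.sum _ fun i _ =>
    (hu i).mono (c := 1) (hu i).1.norm fun x => by rw [norm_norm, one_mul]
  refine h1.mono (c := 1) ?_ fun x => ?_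
  · have : StronglyMeasurable fun x i => u i x :=
      (measurable_pi_lambda _ fun i => (hu i).1.measurable).stronglyMeasurable
    exact (PiLp.continuous_toLp 2 fun _ : ι => ℂ).comp_stronglyMeasurable this
  · rw [one_mul, Finset.sum_apply, Real.norm_of_nonneg (Finset.sum_nonneg fun i _ => norm_nonneg _)]
    exact norm_toLp_le_sum _

theorem tame_squareVec {κ : ι → Space n → ℂ} (hκ : ∀ i, IsKernel (κ i)) (m : ι → ℤ)
    {f : Space n → ℂ} (hf : Tame f) : Tame (squareVec κ m f) :=
  tame_toLp fun i => (hκ i).reflect.tame_cv (tame_cv_psi hf _)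

theorem integral_mul_sum {f g : ι → Space n → ℂ} (hf : ∀ i, Tame (f i)) (hg : ∀ i, Tame (g i)) :
    ∫ x, ∑ i, f i x * g i x = ∑ i, ∫ x, f i x * g i x := by
  refine integral_finsetSum _ fun i _ => ?_
  obtain ⟨M, hM⟩ := (hg i).2.1
  exact (hf i).integrable.mul_bdd (c := M) (hg i).1.aestronglyMeasurable (Eventually.of_forall hM)

/-- `dualOp` is the transpose of `squareVec`, the kernels `ψ` being even. -/
theorem integral_squareVec {κ : ι → Space n → ℂ} (hκ : ∀ i, IsKernel (κ i)) (m : ι → ℤ)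
    {f : Space n → ℂ} (hf : Tame f) {g : Space n → EuclideanSpace ℂ ι} (hg : Tame g) :
    ∫ x, ∑ i, squareVec κ m f x i * g x i = ∫ x, f x * dualOp κ m g x := by
  have h1 := integral_mul_sum (fun i => (hκ i).reflect.tame_cv (tame_cv_psi hf (m i)))
    (fun i => hg.coord i)
  have h2 := integral_mul_sum (fun _ : ι => hf) (fun i => tame_dualOp_term hκ m hg i)
  simp only [dualOp, Finset.sum_apply, Finset.mul_sum]
  refine h1.trans (Eq.trans ?_ h2.symm)
  refine Finset.sum_congr rfl fun i _ => ?_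
  rw [integral_cv_mul (hκ i).reflect (tame_cv_psi hf _) (hg.coord i)]
  simp only [neg_neg]
  rw [integral_cv_mul (tame_psi _).isKernel hf ((hκ i).tame_cv (hg.coord i))]
  simp only [psi_neg]
  refine integral_congr_ae (Eventually.of_forall fun x => ?_)
  exact congrArg (f x * ·) (cv_comm (tame_psi _).isKernel (hκ i) (hg.coord i) x)

/-- Duality: a strong type `(q', q')` bound for `dualOp` gives the strong type `(q, q)` bound for
the square function. -/
theorem lintegral_squareVec_le {κ : ι → Space n → ℂ} (hκ : ∀ i, IsKernel (κ i)) (m : ι → ℤ)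
    {q q' : ℝ} (hq2 : 2 < q) (hqq' : q.HolderConjugate q') {B : ℝ≥0∞}
    (hB : ∀ g : Space n → EuclideanSpace ℂ ι, Tame g →
      ∫⁻ x, ‖dualOp κ m g x‖ₑ ^ q' ≤ B * ∫⁻ x, ‖g x‖ₑ ^ q')
    {f : Space n → ℂ} (hf : Tame f) :
    ∫⁻ x, ‖squareVec κ m f x‖ₑ ^ q ≤ B ^ (q - 1) * ∫⁻ x, ‖f x‖ₑ ^ q := by
  have hq0 : 0 < q := by linarith
  have hq'0 : 0 < q' := hqq'.symm.pos
  set V := squareVec κ m f with hV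
  have hVt : Tame V := tame_squareVec hκ m hf
  obtain ⟨M, hM⟩ := hVt.2.1
  have hM0 : 0 ≤ M := (norm_nonneg _).trans (hM 0)
  set I := ∫⁻ x, ‖V x‖ₑ ^ q with hI
  have hItop : I ≠ ∞ := (hVt.lintegral_rpow_lt_top hq0).ne
  -- the test function extremal for the duality between `L^q` and `L^{q'}`
  set g : Space n → EuclideanSpace ℂ ι := fun x =>
    WithLp.toLp 2 fun i => ((‖V x‖ ^ (q - 2) : ℝ) : ℂ) * (starRingEnd ℂ) (V x i) with hg
  have hpow : StronglyMeasurable fun x => ((‖V x‖ ^ (q - 2) : ℝ) : ℂ) :=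
    Complex.continuous_ofReal.comp_stronglyMeasurable
      ((hVt.1.norm.measurable.pow_const (q - 2)).stronglyMeasurable)
  have hgt : Tame g := by
    refine tame_toLp fun i => (hVt.coord i).mono (c := M ^ (q - 2)) ?_ fun x => ?_
    · exact hpow.mul (Complex.continuous_conj.comp_stronglyMeasurable (hVt.coord i).1)
    · rw [norm_mul, Complex.norm_real, RCLike.norm_conj, Real.norm_of_nonneg (by positivity)]
      have : ‖V x‖ ^ (q - 2) ≤ M ^ (q - 2) :=
        Real.rpow_le_rpow (norm_nonneg _) (hM x) (by linarith)
      gcongr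
  have hpair : ∀ x, ∑ i, V x i * g x i = ((‖V x‖ ^ q : ℝ) : ℂ) := by
    intro x
    have e1 : ∀ i, V x i * g x i = ((‖V x‖ ^ (q - 2) * ‖V x i‖ ^ 2 : ℝ) : ℂ) := by
      intro i
      have : V x i * (starRingEnd ℂ) (V x i) = ((‖V x i‖ ^ 2 : ℝ) : ℂ) := by
        rw [Complex.mul_conj, Complex.normSq_eq_norm_sq]
      change V x i * (((‖V x‖ ^ (q - 2) : ℝ) : ℂ) * (starRingEnd ℂ) (V x i)) = _
      rw [mul_left_comm, this]
      push_cast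
      rfl
    simp only [e1]
    rw [← Complex.ofReal_sum, ← Finset.mul_sum, ← EuclideanSpace.norm_sq_eq]
    congr 1
    rw [← Real.rpow_natCast, ← Real.rpow_add_of_nonneg (norm_nonneg _) (by linarith) (by norm_num)]
    congr 1
    push_cast
    ring
  have hgn : ∀ x, ‖g x‖ₑ ^ q' ≤ ‖V x‖ₑ ^ q := by
    intro x
    have e1 : ‖g x‖ₑ ^ (2 : ℝ) = (‖V x‖ₑ ^ (q - 1)) ^ (2 : ℝ) := by
      rw [enorm_rpow_two_eq_sum]
      have e2 : ∀ i, ‖g x i‖ₑ ^ (2 : ℝ) = (‖V x‖ₑ ^ (q - 2)) ^ (2 : ℝ) * ‖V x i‖ₑ ^ (2 : ℝ) := by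
        intro i
        rw [← ENNReal.mul_rpow_of_nonneg _ _ two_pos.le]
        congr 1
        change ‖((‖V x‖ ^ (q - 2) : ℝ) : ℂ) * (starRingEnd ℂ) (V x i)‖ₑ = _
        rw [enorm_mul, ← ofReal_norm, ← ofReal_norm, Complex.norm_real, RCLike.norm_conj,
          Real.norm_of_nonneg (by positivity), ← ENNReal.ofReal_rpow_of_nonneg (norm_nonneg _)
          (by linarith), ofReal_norm, ofReal_norm]
      simp only [e2]
      rw [← Finset.mul_sum, ← enorm_rpow_two_eq_sum, ← ENNReal.mul_rpow_of_nonneg _ _ two_pos.le]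
      congr 1
      calc ‖V x‖ₑ ^ (q - 2) * ‖V x‖ₑ = ‖V x‖ₑ ^ (q - 2) * ‖V x‖ₑ ^ (1 : ℝ) := by
            rw [ENNReal.rpow_one]
        _ = _ := by
            rw [← ENNReal.rpow_add_of_nonneg _ _ (by linarith) one_pos.le]
            congr 1
            ring
    have e3 : ‖g x‖ₑ ≤ ‖V x‖ₑ ^ (q - 1) := (ENNReal.rpow_le_rpow_iff two_pos).1 e1.le
    calc ‖g x‖ₑ ^ q' ≤ (‖V x‖ₑ ^ (q - 1)) ^ q' := by gcongr
      _ = _ := by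
          rw [← ENNReal.rpow_mul, hqq'.sub_one_mul_conj]
  have hVq : Integrable fun x => ‖V x‖ ^ q := by
    refine ⟨(hVt.1.norm.measurable.pow_const q).aestronglyMeasurable, ?_⟩
    refine lt_of_le_of_lt (le_of_eq (lintegral_congr fun x => ?_)) hItop.lt_top
    rw [← ofReal_norm, Real.norm_of_nonneg (by positivity),
      ← ENNReal.ofReal_rpow_of_nonneg (norm_nonneg _) hq0.le, ofReal_norm]
  have hkey : I ≤ (∫⁻ x, ‖f x‖ₑ ^ q) ^ (1 / q) * (B * I) ^ (1 / q') := by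
    have e1 : I = ‖∫ x, ∑ i, V x i * g x i‖ₑ := by
      simp only [hpair]
      rw [integral_complex_ofReal, ← ofReal_norm, Complex.norm_real,
        Real.norm_of_nonneg (integral_nonneg fun x => by positivity),
        ofReal_integral_eq_lintegral_ofReal hVq (Eventually.of_forall fun x => by positivity)]
      refine lintegral_congr fun x => ?_
      rw [← ENNReal.ofReal_rpow_of_nonneg (norm_nonneg _) hq0.le, ofReal_norm]
    refine e1.le.trans ?_
    rw [integral_squareVec hκ m hf hgt]
    calc ‖∫ x, f x * dualOp κ m g x‖ₑ ≤ ∫⁻ x, ‖f x‖ₑ * ‖dualOp κ m g x‖ₑ := by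
          refine (enorm_integral_le_lintegral_enorm _).trans (le_of_eq ?_)
          simp only [enorm_mul]
      _ ≤ (∫⁻ x, ‖f x‖ₑ ^ q) ^ (1 / q) * (∫⁻ x, ‖dualOp κ m g x‖ₑ ^ q') ^ (1 / q') :=
          ENNReal.lintegral_mul_le_Lp_mul_Lq volume hqq' hf.1.measurable.enorm.aemeasurable
            (tame_dualOp hκ m hgt).1.measurable.enorm.aemeasurable
      _ ≤ _ := by
          gcongr
          exact (hB g hgt).trans (mul_le_mul_right (lintegral_mono hgn) _)
  rcases eq_or_ne I 0 with hI0 | hI0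
  · rw [hI0]; exact zero_le
  have hc0 : I ^ (1 / q') ≠ 0 := by
    rw [ne_eq, ENNReal.rpow_eq_zero_iff]
    rintro (⟨h, -⟩ | ⟨h, -⟩)
    · exact hI0 h
    · exact hItop h
  have hct : I ^ (1 / q') ≠ ∞ := ENNReal.rpow_ne_top_of_nonneg (by positivity) hItop
  have hsplit : I = I ^ (1 / q) * I ^ (1 / q') := by
    rw [← ENNReal.rpow_add_of_nonneg _ _ (by positivity) (by positivity), one_div, one_div,
      hqq'.inv_add_inv_eq_one, ENNReal.rpow_one]
  have h1 : I ^ (1 / q) ≤ (∫⁻ x, ‖f x‖ₑ ^ q) ^ (1 / q) * B ^ (1 / q') := by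
    rw [ENNReal.mul_rpow_of_nonneg _ _ (by positivity), ← mul_assoc] at hkey
    nth_rewrite 1 [hsplit] at hkey
    exact (ENNReal.mul_le_mul_iff_left hc0 hct).1 hkey
  calc I = (I ^ (1 / q)) ^ q := by
        rw [← ENNReal.rpow_mul, one_div_mul_cancel hq0.ne', ENNReal.rpow_one]
    _ ≤ ((∫⁻ x, ‖f x‖ₑ ^ q) ^ (1 / q) * B ^ (1 / q')) ^ q := by gcongr
    _ = B ^ (q - 1) * ∫⁻ x, ‖f x‖ₑ ^ q := by
        rw [ENNReal.mul_rpow_of_nonneg _ _ hq0.le, ← ENNReal.rpow_mul, ← ENNReal.rpow_mul,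
          one_div_mul_cancel hq0.ne', ENNReal.rpow_one, mul_comm]
        congr 2
        rw [one_div, inv_mul_eq_div, hqq'.div_conj_eq_sub_one]

/-- For the kernels of the cells, the square function collects the increments over the grid, with
the factor `L` that makes up for the Cauchy-Schwarz inequality in `variationSq_le_liminf_grid`. -/
theorem enorm_squareVec_cell_sq (hK : KernelBounds K A β) (k : ℤ) (J : Finset ℤ) (L : ℕ)
    {f : Space n → ℂ} (hf : Tame f) (x : Space n) :
    ‖squareVec (cellKernel K J L) (fun i => (i.1 : ℤ) - k) f x‖ₑ ^ 2 =
      ∑ j : J, (L : ℝ≥0∞) * ∑ l ∈ Finset.range L,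
        ‖localized K k j f (gridPoint j L (l + 1)) x - localized K k j f (gridPoint j L l) x‖ₑ ^ 2 := by
  rw [← ENNReal.rpow_two, enorm_rpow_two_eq_sum, Fintype.sum_prod_type]
  refine Finset.sum_congr rfl fun j _ => ?_
  rw [Finset.mul_sum, ← Fin.sum_univ_eq_sum_range fun l => (L : ℝ≥0∞) *
    ‖localized K k j f (gridPoint j L (l + 1)) x - localized K k j f (gridPoint j L l) x‖ₑ ^ 2]
  refine Finset.sum_congr rfl fun l _ => ?_
  have h2 : (0 : ℝ) < 2 ^ (j : ℤ) := by positivity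
  have h3 : (2 : ℝ) ^ (j : ℤ) ≤ gridPoint j L l := by
    unfold gridPoint
    exact le_mul_of_one_le_right h2.le (le_add_of_nonneg_right (by positivity))
  have e1 : cv (fun y => cellKernel K J L (j, l) (-y)) (cv (psi ((j : ℤ) - k)) f) x =
      (Real.sqrt L : ℂ) * (localized K k j f (gridPoint j L (l + 1)) x -
        localized K k j f (gridPoint j L l) x) := by
    rw [localized, localized, cv_annulus_sub hK (tame_cv_psi hf _) h2 h3
      (gridPoint_mono _ _ (Nat.le_succ _))]
    simp only [cv, cellKernel, neg_neg, mul_assoc]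
    rw [integral_const_mul]
  change ‖cv (fun y => cellKernel K J L (j, l) (-y)) (cv (psi ((j : ℤ) - k)) f) x‖ₑ ^ (2 : ℝ) = _
  rw [e1, enorm_mul, ENNReal.rpow_two, mul_pow]
  congr 1
  rw [← ofReal_norm, Complex.norm_real, Real.norm_of_nonneg (Real.sqrt_nonneg _),
    ← ENNReal.ofReal_pow (Real.sqrt_nonneg _), Real.sq_sqrt (Nat.cast_nonneg L),
    ENNReal.ofReal_natCast]

/-- Strong type estimates above the exponent `2`. -/
theorem exists_lintegral_localizedVariation_le (hn : 1 ≤ n) (hK : KernelBounds K A β) (hβ : 0 < β)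
    {q : ℝ} (hq : 2 < q) : ∃ C : ℝ≥0∞, C ≠ ∞ ∧ ∀ (k : ℤ) (f : Space n → ℂ), Tame f →
      ∫⁻ x, localizedVariation K k f x ^ q ≤
        C * ENNReal.ofReal (wt k) ^ (q - 1) * ∫⁻ x, ‖f x‖ₑ ^ q := by
  have hq1 : 1 < q := by linarith
  have hq0 : 0 < q := by linarith
  set q' := q.conjExponent with hq'
  have hqq' : q.HolderConjugate q' := Real.HolderConjugate.conjExponent hq1
  have hq'2 : q' < 2 := by
    rw [hq', Real.conjExponent, div_lt_iff₀ (by linarith)]; linarith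
  obtain ⟨C, hC, hdual⟩ := exists_lintegral_dualOp_le hn hK hβ hqq'.symm.lt hq'2
  refine ⟨C ^ (q - 1), ENNReal.rpow_ne_top_of_nonneg (by linarith) hC, fun k f hf => ?_⟩
  set R := C ^ (q - 1) * ENNReal.ofReal (wt k) ^ (q - 1) * ∫⁻ x, ‖f x‖ₑ ^ q with hR
  have hvec : ∀ (J : Finset ℤ) (L : ℕ), 1 ≤ L →
      ∫⁻ x, ‖squareVec (cellKernel K J L) (fun i => (i.1 : ℤ) - k) f x‖ₑ ^ q ≤ R := by
    intro J L hL
    refine (lintegral_squareVec_le (isKernel_cellKernel hK J L) _ hq hqq' (hdual k J L hL)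
      hf).trans (le_of_eq ?_)
    rw [ENNReal.mul_rpow_of_nonneg _ _ (by linarith)]
  have hJ : ∀ J : Finset ℤ, ∫⁻ x, (∑ j ∈ J, variationSq (fun t => localized K k j f t x) j) ^
      (q / 2) ≤ R := by
    intro J
    have hpt : ∀ x, (∑ j ∈ J, variationSq (fun t => localized K k j f t x) j) ^ (q / 2) ≤
        liminf (fun L : ℕ =>
          ‖squareVec (cellKernel K J L) (fun i => (i.1 : ℤ) - k) f x‖ₑ ^ q) atTop := by
      intro x
      have h1 : ∑ j ∈ J, variationSq (fun t => localized K k j f t x) j ≤ liminf (fun L : ℕ =>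
          ‖squareVec (cellKernel K J L) (fun i => (i.1 : ℤ) - k) f x‖ₑ ^ 2) atTop := by
        simp only [enorm_squareVec_cell_sq hK k J _ hf]
        rw [← Finset.sum_coe_sort J fun j => variationSq (fun t => localized K k j f t x) j]
        simp only [← tsum_fintype (L := SummationFilter.unconditional _)]
        refine le_trans (ENNReal.tsum_le_tsum fun j => ?_) (tsum_liminf_le _)
        exact variationSq_le_liminf_grid
          (continuousOn_cv_annulus hK (tame_cv_psi hf _) (by positivity) x)
      refine (ENNReal.rpow_le_rpow h1 (by positivity)).trans (le_of_eq ?_)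
      rw [rpow_liminf (by positivity)]
      congr 1
      ext L
      rw [← ENNReal.rpow_two, ← ENNReal.rpow_mul]
      congr 1
      ring
    refine (lintegral_mono hpt).trans ((lintegral_liminf_le fun L =>
      (tame_squareVec (isKernel_cellKernel hK J L) _ hf).1.enorm.pow_const q).trans ?_)
    refine liminf_le_of_le ?_ fun b hb => ?_
    · isBoundedDefault
    · obtain ⟨L, hL, hL1⟩ := (hb.and (eventually_ge_atTop 1)).exists
      exact hL.trans (hvec J L hL1)
  have hpt : ∀ x, localizedVariation K k f x ^ q ≤ liminf (fun J : Finset ℤ =>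
      (∑ j ∈ J, variationSq (fun t => localized K k j f t x) j) ^ (q / 2)) atTop := by
    intro x
    have h1 : Tendsto (fun J : Finset ℤ => ∑ j ∈ J, variationSq (fun t => localized K k j f t x) j)
        atTop (𝓝 (localizedSq K k f x)) := ENNReal.summable.hasSum
    rw [← rpow_liminf (by positivity), h1.liminf_eq, localizedVariation, ← ENNReal.rpow_mul]
    refine le_of_eq ?_
    congr 1
    ring
  refine (lintegral_mono hpt).trans ((lintegral_liminf_le fun J =>
    (Finset.measurable_sum _ fun j _ =>
      measurable_variationSq_cv hK (tame_cv_psi hf _) j).pow_const _).trans ?_)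
  refine liminf_le_of_le ?_ fun b hb => ?_
  · isBoundedDefault
  · obtain ⟨J, hJb⟩ := hb.exists
    exact hJb.trans (hJ J)

end Duality

/-! ### Interpolation and summation over the frequencies -/

section Interpolation

open Filter Topology

variable {n : ℕ} {K : Space n → ℂ} {A β : ℝ}

theorem ofReal_wt_rpow_mul_le (k : ℤ) {e₁ e₂ e : ℝ} (h : e₁ + e₂ ≤ e) :
    ENNReal.ofReal (wt k ^ e₁) * ENNReal.ofReal (wt k ^ e₂) ≤ ENNReal.ofReal (wt k ^ e) := by
  rw [← ENNReal.ofReal_mul (Real.rpow_nonneg (wt_pos k).le _), ← Real.rpow_add (wt_pos k)]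
  exact ENNReal.ofReal_le_ofReal (Real.rpow_le_rpow_of_exponent_le (one_le_wt k) h)

/-- Marcinkiewicz interpolation for `localizedVariation`, the free parameter being a power of
`1 + |k|`. -/
theorem lintegral_localizedVariation_interpolation (hK : KernelBounds K A β) (k : ℤ)
    {p₀ p p₁ e₀ e₁ s e : ℝ} (hp₀ : 0 < p₀) (hp₀p : p₀ < p) (hpp₁ : p < p₁) {C₀ C₁ : ℝ≥0∞}
    (hC₀ : C₀ ≠ ∞) (hC₁ : C₁ ≠ ∞)
    (h₀ : ∀ f : Space n → ℂ, Tame f → ∀ t : ℝ, 0 < t →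
      ENNReal.ofReal (t ^ p₀) * volume {x | ENNReal.ofReal t < localizedVariation K k f x} ≤
        C₀ * ENNReal.ofReal (wt k ^ e₀) * ∫⁻ x, ‖f x‖ₑ ^ p₀)
    (h₁ : ∀ f : Space n → ℂ, Tame f → ∀ t : ℝ, 0 < t →
      ENNReal.ofReal (t ^ p₁) * volume {x | ENNReal.ofReal t < localizedVariation K k f x} ≤
        C₁ * ENNReal.ofReal (wt k ^ e₁) * ∫⁻ x, ‖f x‖ₑ ^ p₁)
    (he₀ : e₀ + s * (p₀ - p) ≤ e) (he₁ : e₁ + s * (p₁ - p) ≤ e)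
    {f : Space n → ℂ} (hf : Tame f) :
    ∫⁻ x, localizedVariation K k f x ^ p ≤
      (ENNReal.ofReal (p * 2 ^ p₀ / (p - p₀)) * C₀ + ENNReal.ofReal (p * 2 ^ p₁ / (p₁ - p)) * C₁) *
        ENNReal.ofReal (wt k ^ e) * ∫⁻ x, ‖f x‖ₑ ^ p := by
  have hw := wt_pos k
  refine (marcinkiewicz (fun f hf => measurable_localizedVariation hK k hf)
    (fun f g hf hg => localizedVariation_add_le hK k hf hg) hp₀ hp₀p hpp₁
    (ENNReal.mul_ne_top hC₀ ENNReal.ofReal_ne_top) (ENNReal.mul_ne_top hC₁ ENNReal.ofReal_ne_top)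
    h₀ h₁ (a := wt k ^ s) (Real.rpow_pos_of_pos hw s) hf).trans (mul_le_mul_left ?_ _)
  rw [← Real.rpow_mul hw.le, ← Real.rpow_mul hw.le, add_mul]
  refine add_le_add ?_ ?_
  · calc _ = ENNReal.ofReal (p * 2 ^ p₀ / (p - p₀)) * C₀ *
          (ENNReal.ofReal (wt k ^ e₀) * ENNReal.ofReal (wt k ^ (s * (p₀ - p)))) := by ring
      _ ≤ _ := mul_le_mul_right (ofReal_wt_rpow_mul_le k he₀) _
  · calc _ = ENNReal.ofReal (p * 2 ^ p₁ / (p₁ - p)) * C₁ *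
          (ENNReal.ofReal (wt k ^ e₁) * ENNReal.ofReal (wt k ^ (s * (p₁ - p)))) := by ring
      _ ≤ _ := mul_le_mul_right (ofReal_wt_rpow_mul_le k he₁) _

/-- In the stated range of exponents the interpolated bounds are summable over the frequencies. -/
theorem exists_lintegral_localizedVariation_decay (hn : 1 ≤ n) (hK : KernelBounds K A β)
    (hβ : 2 < β) {p : ℝ} (hp_lower : (2 + β) / β < p) (hp_upper : p < (2 + β) / 2) :
    ∃ C : ℝ≥0∞, C ≠ ∞ ∧ ∃ η : ℝ, 0 < η ∧ ∀ (k : ℤ) (f : Space n → ℂ), Tame f →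
      ∫⁻ x, localizedVariation K k f x ^ p ≤
        C * ENNReal.ofReal (wt k ^ (-(p * (1 + η)))) * ∫⁻ x, ‖f x‖ₑ ^ p := by
  have hβ0 : 0 < β := by linarith
  have hlow : 2 + β < p * β := (div_lt_iff₀ hβ0).1 hp_lower
  have hup : p * 2 < 2 + β := (lt_div_iff₀ two_pos).1 hp_upper
  have hp1 : 1 < p := by
    by_contra h
    push Not at h
    nlinarith
  obtain ⟨C₂, hC₂, h₂⟩ := exists_lintegral_localizedVariation_sq_le hn hK hβ0
  have h₂w : ∀ (k : ℤ) (f : Space n → ℂ), Tame f → ∀ t : ℝ, 0 < t →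
      ENNReal.ofReal (t ^ (2 : ℝ)) * volume {x | ENNReal.ofReal t < localizedVariation K k f x} ≤
        C₂ * ENNReal.ofReal (wt k ^ (-β)) * ∫⁻ x, ‖f x‖ₑ ^ (2 : ℝ) := fun k f hf t ht =>
    (rpow_mul_measure_le (measurable_localizedVariation hK k hf) two_pos ht).trans (h₂ k f hf)
  rcases lt_trichotomy p 2 with hp2 | rfl | hp2
  · obtain ⟨C₁, hC₁, h₁⟩ := exists_weak_type_localizedVariation hn hK hβ0
    refine ⟨ENNReal.ofReal (p * 2 ^ (1 : ℝ) / (p - 1)) * C₁ +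
      ENNReal.ofReal (p * 2 ^ (2 : ℝ) / (2 - p)) * C₂, ENNReal.add_ne_top.2
      ⟨ENNReal.mul_ne_top ENNReal.ofReal_ne_top hC₁, ENNReal.mul_ne_top ENNReal.ofReal_ne_top hC₂⟩,
      (β * (p - 1) - 2) / p, div_pos (by nlinarith) (by linarith), fun k f hf => ?_⟩
    -- The free parameter is `(1 + |k|) ^ (1 + β)`, for which both interpolated terms are
    -- `(1 + |k|) ^ (-(p + β (p - 1) - 2))`; this beats `(1 + |k|) ^ (-p)` when `p > (2 + β) / β`.
    have hη : p * (1 + (β * (p - 1) - 2) / p) = p + β * (p - 1) - 2 := by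
      have : p ≠ 0 := by linarith
      field_simp
      ring
    rw [hη]
    refine lintegral_localizedVariation_interpolation hK k (e₀ := 1) (e₁ := -β)
      (s := (p + β * (p - 1) - 1) / (p - 1)) one_pos hp1 hp2 hC₁ hC₂ (fun f hf t ht => ?_) (h₂w k)
      ?_ ?_ hf
    · simpa only [Real.rpow_one, ENNReal.rpow_one] using h₁ k f hf t ht
    · refine le_of_eq ?_
      have : p - 1 ≠ 0 := by linarith
      field_simp
      ring
    · have hp1' : 0 < p - 1 := by linarith
      have e : (p + β * (p - 1) - 1) / (p - 1) = 1 + β := by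
        field_simp
        ring
      rw [e]
      nlinarith
  · refine ⟨C₂, hC₂, (β - 2) / 2, by linarith, fun k f hf => ?_⟩
    have e : -(2 * (1 + (β - 2) / 2)) = -β := by ring
    rw [e]
    exact h₂ k f hf
  -- Interpolation with an exponent `q` so large that the factor `(1 + |k|) ^ (q - 1)` costs less
  -- than the room `δ` left by `p < (2 + β) / 2`.
  · set δ := (β + 2 - 2 * p) / (2 * p - 2) with hδ
    have hδ0 : 0 < δ := div_pos (by linarith) (by linarith)
    have hδ' : δ * (2 * p - 2) = β + 2 - 2 * p := div_mul_cancel₀ _ (by linarith)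
    set q := p + 2 * p * (1 + δ) / δ with hq
    have hqδ : (q - p) * δ = 2 * p * (1 + δ) := by
      rw [hq, add_sub_cancel_left, div_mul_cancel₀ _ hδ0.ne']
    have hpq : p < q := by
      rw [hq]
      have : 0 < 2 * p * (1 + δ) / δ := by positivity
      linarith
    obtain ⟨C₁, hC₁, h₁⟩ := exists_lintegral_localizedVariation_le hn hK hβ0 (hp2.trans hpq)
    refine ⟨ENNReal.ofReal (p * 2 ^ (2 : ℝ) / (p - 2)) * C₂ +
      ENNReal.ofReal (p * 2 ^ q / (q - p)) * C₁, ENNReal.add_ne_top.2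
      ⟨ENNReal.mul_ne_top ENNReal.ofReal_ne_top hC₂, ENNReal.mul_ne_top ENNReal.ofReal_ne_top hC₁⟩,
      δ, hδ0, fun k f hf => ?_⟩
    refine lintegral_localizedVariation_interpolation hK k (e₀ := -β) (e₁ := q - 1)
      (s := -(1 + δ)) two_pos hp2 hpq hC₂ hC₁ (h₂w k) (fun f hf t ht => ?_) ?_ ?_ hf
    · rw [← ENNReal.ofReal_rpow_of_pos (wt_pos k)]
      exact (rpow_mul_measure_le (measurable_localizedVariation hK k hf) (by linarith) ht).trans
        (h₁ k f hf)
    · nlinarith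
    · nlinarith

/-- The short variation of the truncated integrals, in terms of the annular pieces. -/
def annularVariation (K f : Space n → ℂ) (x : Space n) : ℝ≥0∞ :=
  (∑' j : ℤ, dyadicVariation (fun t => cv (annulus K (2 ^ j) t) f x) j ^ 2) ^ (1 / 2 : ℝ)

theorem sum_sq_rpow_half_le {ι κ : Type*} (s : Finset κ) (u : κ → ι → ℝ≥0∞) :
    (∑' i, (∑ k ∈ s, u k i) ^ 2) ^ (1 / 2 : ℝ) ≤ ∑ k ∈ s, (∑' i, u k i ^ 2) ^ (1 / 2 : ℝ) := by
  classical
  induction s using Finset.induction_on with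
  | empty => simp
  | insert k s hk ih =>
    simp only [Finset.sum_insert hk]
    exact (tsum_sq_rpow_half_add_le _ _).trans (add_le_add le_rfl ih)

/-- The Littlewood–Paley type decomposition `f = ∑ k, ψ_{j - k} * f`, used separately at every
scale `j`. -/
theorem annularVariation_le_liminf (hn : 1 ≤ n) (hK : KernelBounds K A β) {f : Space n → ℂ}
    (hf : Tame f) (x : Space n) : annularVariation K f x ≤
      liminf (fun m : ℕ => ∑ k ∈ Finset.Ico (-m : ℤ) m, localizedVariation K k f x) atTop := by
  obtain ⟨M, hM⟩ := hf.2.1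
  have hj : ∀ j : ℤ, dyadicVariation (fun t => cv (annulus K (2 ^ j) t) f x) j ≤
      liminf (fun m : ℕ => ∑ k ∈ Finset.Ico (-m : ℤ) m,
        dyadicVariation (fun t => localized K k j f t x) j) atTop := by
    intro j
    set F : ℕ → Space n → ℂ := fun m => ∑ k ∈ Finset.Ico (-m : ℤ) m, cv (psi (j - k)) f with hF
    have hFt : ∀ m, Tame (F m) := fun m => Tame.sum _ fun k _ => tame_cv_psi hf _
    have hFeq : ∀ m y, F m y = cv (phi (j - m + 1)) f y - cv (phi (j + m + 1)) f y := by
      intro m y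
      rw [← cv_sub_left (tame_phi _).isKernel (tame_phi _).isKernel hf, ← sum_psi]
      simp only [hF, Finset.sum_apply, cv, Finset.sum_mul]
      rw [integral_finsetSum _ fun k _ => (tame_psi _).isKernel.integrable_mul hf y]
    have hFlim : ∀ᵐ y, Tendsto (fun m => F m y) atTop (𝓝 (f y)) := by
      filter_upwards [ae_tendsto_cv_phi hf (j + 1)] with y hy
      have h2 := hy.sub (tendsto_cv_phi_zero hn hf (j + 1) y)
      rw [sub_zero] at h2
      refine h2.congr fun m => ?_
      rw [hFeq, sub_add_eq_add_sub, add_right_comm]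
    have hFb : ∀ m y, ‖F m y‖ ≤ 2 * M := by
      intro m y
      rw [hFeq, two_mul]
      exact (norm_sub_le _ _).trans (add_le_add (norm_cv_phi_le hM _ _) (norm_cv_phi_le hM _ _))
    refine (dyadicVariation_le_liminf (A := fun m t => cv (annulus K (2 ^ j) t) (F m) x)
      fun t _ => tendsto_cv (hK.isKernel (by positivity) t) (fun m => (hFt m).1) hFb hFlim x).trans
      (liminf_le_liminf (Eventually.of_forall fun m => ?_))
    refine le_trans (le_of_eq ?_) (dyadicVariation_sum_le _ _ j)
    congr 1
    ext t
    exact cv_sum (hK.isKernel (by positivity) t) _ (fun k _ => tame_cv_psi hf _) x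
  unfold annularVariation
  have hsq : ∀ u : ℕ → ℝ≥0∞, (liminf u atTop) ^ 2 = liminf (fun m => u m ^ 2) atTop := fun u => by
    simp only [← ENNReal.rpow_two]
    exact rpow_liminf two_pos
  calc (∑' j : ℤ, dyadicVariation (fun t => cv (annulus K (2 ^ j) t) f x) j ^ 2) ^ (1 / 2 : ℝ)
      ≤ (∑' j : ℤ, liminf (fun m : ℕ => (∑ k ∈ Finset.Ico (-m : ℤ) m,
          dyadicVariation (fun t => localized K k j f t x) j) ^ 2) atTop) ^ (1 / 2 : ℝ) := by
        refine ENNReal.rpow_le_rpow (ENNReal.tsum_le_tsum fun j => ?_) (by norm_num)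
        rw [← hsq]
        gcongr
        exact hj j
    _ ≤ (liminf (fun m : ℕ => ∑' j : ℤ, (∑ k ∈ Finset.Ico (-m : ℤ) m,
          dyadicVariation (fun t => localized K k j f t x) j) ^ 2) atTop) ^ (1 / 2 : ℝ) :=
        ENNReal.rpow_le_rpow (tsum_liminf_le _) (by norm_num)
    _ = liminf (fun m : ℕ => (∑' j : ℤ, (∑ k ∈ Finset.Ico (-m : ℤ) m,
          dyadicVariation (fun t => localized K k j f t x) j) ^ 2) ^ (1 / 2 : ℝ)) atTop :=
        rpow_liminf one_half_pos
    _ ≤ _ := by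
        refine liminf_le_liminf (Eventually.of_forall fun m => ?_)
        simp only [localizedVariation_eq]
        exact sum_sq_rpow_half_le _ _

theorem lintegral_sum_rpow_le {ι : Type*} (s : Finset ι) {u : ι → Space n → ℝ≥0∞}
    (hu : ∀ i, Measurable (u i)) {p : ℝ} (hp : 1 ≤ p) :
    (∫⁻ x, (∑ i ∈ s, u i x) ^ p) ^ (1 / p) ≤ ∑ i ∈ s, (∫⁻ x, u i x ^ p) ^ (1 / p) := by
  classical
  have hp0 : 0 < p := by linarith
  induction s using Finset.induction_on with
  | empty => simp [hp0]
  | insert i s hi ih =>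
    simp only [Finset.sum_insert hi]
    refine (ENNReal.lintegral_Lp_add_le (hu i).aemeasurable
      (Finset.measurable_sum s fun j _ => hu j).aemeasurable hp).trans (add_le_add le_rfl ?_)
    simpa using ih

theorem tsum_wt_rpow_ne_top {η : ℝ} (hη : 0 < η) :
    ∑' k : ℤ, ENNReal.ofReal (wt k ^ (-(1 + η))) ≠ ∞ := by
  refine Summable.tsum_ofReal_ne_top ?_
  rw [summable_int_iff_summable_nat_and_neg]
  have h : Summable fun m : ℕ => wt (m : ℤ) ^ (-(1 + η)) := by
    have h1 := (summable_nat_add_iff 1).2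
      (Real.summable_nat_rpow (p := -(1 + η)).2 (by linarith))
    refine h1.congr fun m => ?_
    rw [wt]
    push_cast
    rw [abs_of_nonneg (Nat.cast_nonneg m), add_comm]
  refine ⟨h, h.congr fun m => ?_⟩
  simp only [wt, Int.cast_neg, abs_neg]

/-- The estimate for bounded functions of bounded support. -/
theorem exists_lintegral_annularVariation_le (hn : 1 ≤ n) (hK : KernelBounds K A β)
    (hβ : 2 < β) {p : ℝ} (hp_lower : (2 + β) / β < p) (hp_upper : p < (2 + β) / 2) :
    ∃ C : ℝ≥0∞, C ≠ ∞ ∧ ∀ f : Space n → ℂ, Tame f →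
      ∫⁻ x, annularVariation K f x ^ p ≤ C * ∫⁻ x, ‖f x‖ₑ ^ p := by
  obtain ⟨C, hC, η, hη, hdec⟩ := exists_lintegral_localizedVariation_decay hn hK hβ hp_lower hp_upper
  have hβ0 : 0 < β := by linarith
  have hp1 : 1 < p := lt_trans ((one_lt_div hβ0).2 (by linarith)) hp_lower
  have hp0 : 0 < p := by linarith
  set Z := ∑' k : ℤ, ENNReal.ofReal (wt k ^ (-(1 + η))) with hZ
  have hZt : Z ≠ ∞ := tsum_wt_rpow_ne_top hη
  refine ⟨C * Z ^ p, ENNReal.mul_ne_top hC (ENNReal.rpow_ne_top_of_nonneg hp0.le hZt),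
    fun f hf => ?_⟩
  set N := ∫⁻ x, ‖f x‖ₑ ^ p with hN
  have hm : ∀ k, Measurable (localizedVariation K k f) := fun k =>
    measurable_localizedVariation hK k hf
  have hfin : ∀ s : Finset ℤ, ∫⁻ x, (∑ k ∈ s, localizedVariation K k f x) ^ p ≤ C * Z ^ p * N := by
    intro s
    have h1 : (∫⁻ x, (∑ k ∈ s, localizedVariation K k f x) ^ p) ^ (1 / p) ≤
        (C * N) ^ (1 / p) * Z := by
      refine (lintegral_sum_rpow_le s hm hp1.le).trans ?_
      calc ∑ k ∈ s, (∫⁻ x, localizedVariation K k f x ^ p) ^ (1 / p)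
          ≤ ∑ k ∈ s, (C * N) ^ (1 / p) * ENNReal.ofReal (wt k ^ (-(1 + η))) := by
            refine Finset.sum_le_sum fun k _ => ?_
            have e : ENNReal.ofReal (wt k ^ (-(1 + η))) =
                ENNReal.ofReal (wt k ^ (-(p * (1 + η)))) ^ (1 / p) := by
              rw [ENNReal.ofReal_rpow_of_nonneg (Real.rpow_nonneg (wt_pos k).le _) (by positivity),
                ← Real.rpow_mul (wt_pos k).le]
              congr 2
              field_simp
            rw [e, ← ENNReal.mul_rpow_of_nonneg _ _ (by positivity)]
            refine ENNReal.rpow_le_rpow ((hdec k f hf).trans (le_of_eq (by ring))) (by positivity)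
        _ = (C * N) ^ (1 / p) * ∑ k ∈ s, ENNReal.ofReal (wt k ^ (-(1 + η))) := by
            rw [Finset.mul_sum]
        _ ≤ _ := by
            gcongr
            exact ENNReal.sum_le_tsum s
    calc ∫⁻ x, (∑ k ∈ s, localizedVariation K k f x) ^ p
        = ((∫⁻ x, (∑ k ∈ s, localizedVariation K k f x) ^ p) ^ (1 / p)) ^ p := by
          rw [← ENNReal.rpow_mul, one_div_mul_cancel hp0.ne', ENNReal.rpow_one]
      _ ≤ ((C * N) ^ (1 / p) * Z) ^ p := by gcongr
      _ = _ := by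
          rw [ENNReal.mul_rpow_of_nonneg _ _ hp0.le, ← ENNReal.rpow_mul,
            one_div_mul_cancel hp0.ne', ENNReal.rpow_one]
          ring
  have hpt : ∀ x, annularVariation K f x ^ p ≤ liminf (fun m : ℕ =>
      (∑ k ∈ Finset.Ico (-m : ℤ) m, localizedVariation K k f x) ^ p) atTop := fun x => by
    rw [← rpow_liminf hp0]
    exact ENNReal.rpow_le_rpow (annularVariation_le_liminf hn hK hf x) hp0.le
  refine (lintegral_mono hpt).trans ((lintegral_liminf_le fun m =>
    (Finset.measurable_sum _ fun k _ => hm k).pow_const p).trans ?_)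
  refine liminf_le_of_le ?_ fun b hb => ?_
  · isBoundedDefault
  · obtain ⟨m, hmb⟩ := hb.exists
    exact hmb.trans (hfin _)

end Interpolation

/-! ### From tame functions to `Lᵖ` -/

section General

open Filter Topology

variable {n : ℕ} {Ω : USphere n → ℂ} {f : Space n → ℂ}

theorem measurableSet_lt_norm (ε : ℝ) : MeasurableSet {y : Space n | ε < ‖y‖} :=
  measurableSet_lt measurable_const measurable_norm

theorem annulus_mul_eq (K : Space n → ℂ) (f : Space n → ℂ) (a t : ℝ) (x : Space n) :
    (fun y => annulus K a t y * f (x - y)) =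
      {y | a < ‖y‖ ∧ ‖y‖ ≤ t}.indicator fun y => K y * f (x - y) := by
  ext y
  by_cases hy : y ∈ {y : Space n | a < ‖y‖ ∧ ‖y‖ ≤ t}
  · simp only [annulus, Set.indicator_of_mem hy]
  · simp only [annulus, Set.indicator_of_notMem hy, zero_mul]

theorem truncated_eq_sub_cv {a t : ℝ} {x : Space n} (hat : a ≤ t)
    (h : IntegrableOn (fun y => roughKernel Ω y * f (x - y)) {y : Space n | a < ‖y‖}) :
    truncated Ω f t x = truncated Ω f a x - cv (annulus (roughKernel Ω) a t) f x := by
  have hsub : {y : Space n | a < ‖y‖ ∧ ‖y‖ ≤ t} ⊆ {y : Space n | a < ‖y‖} := fun y hy => hy.1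
  have hsub' : {y : Space n | t < ‖y‖} ⊆ {y : Space n | a < ‖y‖} := fun y hy =>
    lt_of_le_of_lt hat hy
  have hunion : {y : Space n | a < ‖y‖} =
      {y | t < ‖y‖} ∪ {y | a < ‖y‖ ∧ ‖y‖ ≤ t} := by
    ext y
    simp only [Set.mem_union, Set.mem_ofPred_eq]
    constructor
    · intro hy
      rcases lt_or_ge t ‖y‖ with h1 | h1
      · exact Or.inl h1
      · exact Or.inr ⟨hy, h1⟩
    · rintro (hy | hy)
      · exact hat.trans_lt hy
      · exact hy.1
  have hdisj : Disjoint {y : Space n | t < ‖y‖} {y | a < ‖y‖ ∧ ‖y‖ ≤ t} :=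
    Set.disjoint_left.2 fun y (h1 : t < ‖y‖) h2 => absurd h2.2 (not_le.2 h1)
  rw [eq_sub_iff_add_eq, cv, annulus_mul_eq, integral_indicator (measurableSet_annulus a t),
    truncated, truncated, hunion, setIntegral_union hdisj (measurableSet_annulus a t)
      (h.mono_set hsub') (h.mono_set hsub)]

/-- The restriction of `f` to the part of the ball of radius `m` where `|f| ≤ m`. -/
def tameTruncation (f : Space n → ℂ) (m : ℕ) : Space n → ℂ :=
  {x | ‖x‖ ≤ m ∧ ‖f x‖ ≤ m}.indicator f

theorem tame_tameTruncation (hf : Measurable f) (m : ℕ) : Tame (tameTruncation f m) := by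
  refine ⟨(hf.indicator ((measurableSet_le measurable_norm measurable_const).inter
    (measurableSet_le hf.norm measurable_const))).stronglyMeasurable, ⟨m, fun x => ?_⟩, m,
    fun x hx => Set.indicator_of_notMem (fun h => absurd h.1 (not_le.2 hx)) _⟩
  by_cases h : x ∈ {x : Space n | ‖x‖ ≤ m ∧ ‖f x‖ ≤ m}
  · rw [tameTruncation, Set.indicator_of_mem h]
    exact h.2
  · rw [tameTruncation, Set.indicator_of_notMem h, norm_zero]
    exact Nat.cast_nonneg m

theorem norm_tameTruncation_le (f : Space n → ℂ) (m : ℕ) (x : Space n) :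
    ‖tameTruncation f m x‖ ≤ ‖f x‖ := norm_indicator_le_norm_self _ _

theorem tendsto_tameTruncation (f : Space n → ℂ) (x : Space n) :
    Tendsto (fun m => tameTruncation f m x) atTop (𝓝 (f x)) := by
  obtain ⟨m₀, hm₀⟩ := exists_nat_ge (max ‖x‖ ‖f x‖)
  refine tendsto_const_nhds.congr' ((eventually_ge_atTop m₀).mono fun m hm => ?_)
  have h : max ‖x‖ ‖f x‖ ≤ m := hm₀.trans (by exact_mod_cast hm)
  exact (Set.indicator_of_mem (s := {x : Space n | ‖x‖ ≤ m ∧ ‖f x‖ ≤ m})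
    ⟨(le_max_left _ _).trans h, (le_max_right _ _).trans h⟩ f).symm

theorem tendsto_cv_annulus_tameTruncation (hΩ : Measurable Ω) (hf : Measurable f) {a : ℝ}
    {x : Space n}
    (h : IntegrableOn (fun y => roughKernel Ω y * f (x - y)) {y : Space n | a < ‖y‖}) (t : ℝ) :
    Tendsto (fun m => cv (annulus (roughKernel Ω) a t) (tameTruncation f m) x) atTop
      (𝓝 (cv (annulus (roughKernel Ω) a t) f x)) := by
  have hK := measurable_roughKernel hΩ
  have hm : ∀ {g : Space n → ℂ}, Measurable g → AEStronglyMeasurable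
      (fun y => annulus (roughKernel Ω) a t y * g (x - y)) := fun hg =>
    ((hK.indicator (measurableSet_annulus a t)).mul
      (hg.comp (measurable_const.sub measurable_id))).aestronglyMeasurable
  have hint : Integrable fun y => annulus (roughKernel Ω) a t y * f (x - y) := by
    rw [annulus_mul_eq, integrable_indicator_iff (measurableSet_annulus a t)]
    exact h.mono_set fun y hy => hy.1
  refine tendsto_integral_of_dominated_convergence _
    (fun m => hm (tame_tameTruncation hf m).1.measurable) hint.norm
    (fun m => Eventually.of_forall fun y => ?_) (Eventually.of_forall fun y => ?_)
  · rw [norm_mul, norm_mul]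
    gcongr
    exact norm_tameTruncation_le f m _
  · exact (tendsto_tameTruncation f _).const_mul _

/-- The short variation is lower semicontinuous along the tame truncations. -/
theorem shortVariation_truncated_le_liminf (hΩ : Measurable Ω) (hf : Measurable f) {x : Space n}
    (h : ∀ ε : ℝ, 0 < ε →
      IntegrableOn (fun y => roughKernel Ω y * f (x - y)) {y : Space n | ε < ‖y‖}) :
    shortVariation (truncated Ω f) x ≤
      liminf (fun m => annularVariation (roughKernel Ω) (tameTruncation f m) x) atTop := by
  have hj : ∀ j : ℤ, variationSq (fun t => truncated Ω f t x) j ≤ liminf (fun m => variationSq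
      (fun t => cv (annulus (roughKernel Ω) (2 ^ j) t) (tameTruncation f m) x) j) atTop := by
    intro j
    have h2 : (0 : ℝ) < 2 ^ j := by positivity
    refine le_trans (variationSq_mono fun s hs t ht _ => ?_)
      (variationSq_le_liminf fun t _ => tendsto_cv_annulus_tameTruncation hΩ hf (h _ h2) t)
    rw [truncated_eq_sub_cv hs.1 (h _ h2), truncated_eq_sub_cv ht.1 (h _ h2), sub_sub_sub_cancel_left,
      ← neg_sub, enorm_neg]
  unfold shortVariation annularVariation
  simp only [dyadicVariation_sq]
  rw [← rpow_liminf one_half_pos]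
  exact ENNReal.rpow_le_rpow ((ENNReal.tsum_le_tsum hj).trans (tsum_liminf_le _)) (by norm_num)

theorem measurable_annularVariation {K h : Space n → ℂ} {A β : ℝ} (hK : KernelBounds K A β)
    (hh : Tame h) : Measurable (annularVariation K h) := by
  unfold annularVariation
  simp only [dyadicVariation_sq]
  exact (Measurable.tsum fun j => measurable_variationSq_cv hK hh j).pow_const _

/-- The estimate for Borel representatives of `Ω` and `f`, by Fatou's lemma from the tame case. -/
theorem exists_lintegral_shortVariation_le (hn : 1 ≤ n) {α : ℝ} (hα : 1 < α) (hΩm : Measurable Ω)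
    (hΩ_int : Integrable Ω (surf n)) (hΩ_mean : ∫ θ, Ω θ ∂(surf n) = 0)
    (hΩ : Ω ∈ grafakosStefanov n α) {p : ℝ} (hp_lower : (3 + α) / (1 + α) < p)
    (hp_upper : p < (3 + α) / 2) : ∃ C : ℝ≥0∞, C ≠ ∞ ∧ ∀ f : Space n → ℂ, Measurable f →
      (∀ᵐ x : Space n, ∀ ε : ℝ, 0 < ε →
        IntegrableOn (fun y => roughKernel Ω y * f (x - y)) {y : Space n | ε < ‖y‖}) →
      ∫⁻ x, shortVariation (truncated Ω f) x ^ p ≤ C * ∫⁻ x, ‖f x‖ₑ ^ p := by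
  obtain ⟨A, hK⟩ := exists_kernelBounds hn hα hΩm hΩ_int hΩ_mean hΩ
  obtain ⟨C, hC, hbound⟩ := exists_lintegral_annularVariation_le hn hK (by linarith) (p := p)
    (by rwa [← add_assoc, show (2 : ℝ) + 1 = 3 by norm_num])
    (by rwa [← add_assoc, show (2 : ℝ) + 1 = 3 by norm_num])
  have hp0 : 0 < p := lt_trans (by positivity) hp_lower
  refine ⟨C, hC, fun f hf hgood => ?_⟩
  calc ∫⁻ x, shortVariation (truncated Ω f) x ^ p
      ≤ ∫⁻ x, liminf (fun m => annularVariation (roughKernel Ω) (tameTruncation f m) x ^ p)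
          atTop := by
        refine lintegral_mono_ae (hgood.mono fun x hx => ?_)
        rw [← rpow_liminf hp0]
        exact ENNReal.rpow_le_rpow (shortVariation_truncated_le_liminf hΩm hf hx) hp0.le
    _ ≤ liminf (fun m => ∫⁻ x, annularVariation (roughKernel Ω) (tameTruncation f m) x ^ p)
          atTop := lintegral_liminf_le fun m =>
        (measurable_annularVariation hK (tame_tameTruncation hf m)).pow_const p
    _ ≤ C * ∫⁻ x, ‖f x‖ₑ ^ p := by
        refine liminf_le_of_le (by isBoundedDefault) fun b hb => ?_
        obtain ⟨m, hm⟩ := hb.exists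
        refine hm.trans ((hbound _ (tame_tameTruncation hf m)).trans ?_)
        gcongr with x
        exact enorm_le_iff_norm_le.2 (norm_tameTruncation_le f m x)

/-! ### Measurability of the short variation -/

theorem measurable_truncated (hΩ : Measurable Ω) (hf : Measurable f) (t : ℝ) :
    Measurable (truncated Ω f t) := by
  have h : StronglyMeasurable fun z : Space n × Space n => roughKernel Ω z.2 * f (z.1 - z.2) :=
    (((measurable_roughKernel hΩ).comp measurable_snd).mul
      (hf.comp (measurable_fst.sub measurable_snd))).stronglyMeasurable
  exact (h.integral_prod_right' (ν := volume.restrict {y : Space n | t < ‖y‖})).measurable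

/-- Spheres are null sets, so the truncated integrals depend continuously on the truncation. -/
theorem continuousOn_truncated {a : ℝ} (ha : 0 < a) {x : Space n}
    (h : IntegrableOn (fun y => roughKernel Ω y * f (x - y)) {y : Space n | a < ‖y‖}) :
    ContinuousOn (fun t => truncated Ω f t x) (Set.Ici a) := by
  intro t₀ ht₀
  have hind : ∀ t, truncated Ω f t x =
      ∫ y, {y : Space n | t < ‖y‖}.indicator (fun y => roughKernel Ω y * f (x - y)) y := fun t =>
    (integral_indicator (measurableSet_lt_norm t)).symm
  simp only [hind]
  have hsub : ∀ t ∈ Set.Ici a, {y : Space n | t < ‖y‖} ⊆ {y : Space n | a < ‖y‖} :=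
    fun t ht y (hy : t < ‖y‖) => lt_of_le_of_lt (Set.mem_Ici.1 ht) hy
  refine continuousWithinAt_of_dominated (bound := fun y =>
    ‖{y : Space n | a < ‖y‖}.indicator (fun y => roughKernel Ω y * f (x - y)) y‖) ?_ ?_ ?_ ?_
  · filter_upwards [self_mem_nhdsWithin] with t ht
    exact ((h.mono_set (hsub t ht)).integrable_indicator
      (measurableSet_lt_norm t)).aestronglyMeasurable
  · filter_upwards [self_mem_nhdsWithin] with t ht
    exact Eventually.of_forall fun y => norm_indicator_le_of_subset (hsub t ht) _ y
  · exact (h.integrable_indicator (measurableSet_lt_norm a)).norm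
  · have h0 : (volume : Measure (Space n)) (Metric.sphere 0 t₀) = 0 :=
      Measure.addHaar_sphere_of_ne_zero _ _ (ha.trans_le ht₀).ne'
    filter_upwards [measure_eq_zero_iff_ae_notMem.1 h0] with y hy
    have hy : ‖y‖ ≠ t₀ := by simpa using hy
    refine ContinuousAt.continuousWithinAt ?_
    rcases lt_or_gt_of_ne hy with hlt | hgt
    · refine (continuousAt_const (x := t₀) (y := (0 : ℂ))).congr ?_
      filter_upwards [lt_mem_nhds hlt] with t ht
      exact (Set.indicator_of_notMem (s := {y : Space n | t < ‖y‖})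
        (fun h' : t < ‖y‖ => lt_asymm h' ht) (fun y => roughKernel Ω y * f (x - y))).symm
    · refine (continuousAt_const (x := t₀) (y := roughKernel Ω y * f (x - y))).congr ?_
      filter_upwards [gt_mem_nhds hgt] with t ht
      exact (Set.indicator_of_mem (s := {y : Space n | t < ‖y‖}) ht
        (fun y => roughKernel Ω y * f (x - y))).symm

/-- The family is modified on the null set where some truncated integral diverges; it is then
continuous in the truncation at every point. -/
theorem aemeasurable_shortVariation (hΩ : Measurable Ω) (hf : Measurable f)
    (hgood : ∀ᵐ x : Space n, ∀ ε : ℝ, 0 < ε →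
      IntegrableOn (fun y => roughKernel Ω y * f (x - y)) {y : Space n | ε < ‖y‖}) :
    AEMeasurable (shortVariation (truncated Ω f)) := by
  obtain ⟨N, hN, hNm, hN0⟩ := exists_measurable_superset_of_null (ae_iff.1 hgood)
  have hx : ∀ x ∈ Nᶜ, ∀ ε : ℝ, 0 < ε →
      IntegrableOn (fun y => roughKernel Ω y * f (x - y)) {y : Space n | ε < ‖y‖} :=
    fun x hx => not_not.1 fun h => hx (hN h)
  refine ⟨shortVariation fun t => Nᶜ.indicator (truncated Ω f t), ?_, ?_⟩
  · have : Measurable fun x => ∑' j : ℤ, variationSq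
        (fun t => Nᶜ.indicator (truncated Ω f t) x) j := by
      refine .tsum fun j => measurable_variationSq
        (fun t _ => (measurable_truncated hΩ hf t).indicator hNm.compl) fun x => ?_
      by_cases hxN : x ∈ Nᶜ
      · simp only [Set.indicator_of_mem hxN]
        exact (continuousOn_truncated (by positivity) (hx x hxN _ (by positivity))).mono
          Set.Icc_subset_Ici_self
      · simp only [Set.indicator_of_notMem hxN]
        exact continuousOn_const
    unfold shortVariation
    simp only [dyadicVariation_sq]
    exact this.pow_const _
  · filter_upwards [measure_eq_zero_iff_ae_notMem.1 hN0] with x hxN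
    simp only [shortVariation, Set.indicator_of_mem (Set.mem_compl hxN)]

/-! ### Independence of the representatives -/

theorem ae_eq_roughKernel_mul (hn : 1 ≤ n) {Ω' : USphere n → ℂ} {f' : Space n → ℂ}
    (hΩ : Ω =ᵐ[surf n] Ω') (hf : f =ᵐ[volume] f') (x : Space n) :
    (fun y => roughKernel Ω y * f (x - y)) =ᵐ[volume] fun y => roughKernel Ω' y * f' (x - y) :=
  (roughKernel_ae_eq hn hΩ).mul
    ((Measure.measurePreserving_sub_left volume x).quasiMeasurePreserving.ae_eq_comp hf)

theorem truncated_congr_ae (hn : 1 ≤ n) {Ω' : USphere n → ℂ} {f' : Space n → ℂ}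
    (hΩ : Ω =ᵐ[surf n] Ω') (hf : f =ᵐ[volume] f') : truncated Ω f = truncated Ω' f' := by
  ext ε x
  exact integral_congr_ae (ae_restrict_of_ae (ae_eq_roughKernel_mul hn hΩ hf x))

theorem grafakosStefanov_congr_ae {α : ℝ} {Ω' : USphere n → ℂ} (h : Ω =ᵐ[surf n] Ω')
    (hΩ : Ω ∈ grafakosStefanov n α) : Ω' ∈ grafakosStefanov n α := by
  refine lt_of_eq_of_lt (iSup_congr fun ξ => lintegral_congr_ae ?_) hΩ
  filter_upwards [h] with θ hθ
  rw [hθ]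

end General

end

end RoughVariation

theorem proposition3p2 (n : ℕ) (hn : 1 ≤ n) (α : ℝ) (hα : 1 < α)
    (Ω : RoughVariation.USphere n → ℂ)
    (hΩ_int : Integrable Ω (RoughVariation.surf n))
    (hΩ_mean : ∫ θ, Ω θ ∂(RoughVariation.surf n) = 0)
    (hΩ : Ω ∈ RoughVariation.grafakosStefanov n α)
    (p : ℝ) (hp_lower : (3 + α) / (1 + α) < p) (hp_upper : p < (3 + α) / 2) :
    ∃ C : ℝ≥0, ∀ f : RoughVariation.Space n → ℂ, MemLp f (ENNReal.ofReal p) volume →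
      (∀ᵐ x : RoughVariation.Space n, ∀ ε : ℝ, 0 < ε →
        IntegrableOn (fun y => RoughVariation.roughKernel Ω y * f (x - y))
          {y : RoughVariation.Space n | ε < ‖y‖} volume) ∧
      AEMeasurable (RoughVariation.shortVariation (RoughVariation.truncated Ω f)) volume ∧
      eLpNorm (RoughVariation.shortVariation (RoughVariation.truncated Ω f))
          (ENNReal.ofReal p) volume
        ≤ C * eLpNorm f (ENNReal.ofReal p) volume := by
  have hp1 : 1 < p := lt_trans ((one_lt_div (by linarith)).2 (by linarith)) hp_lower
  have hp0 : 0 < p := by linarith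
  have hp0' : ENNReal.ofReal p ≠ 0 := (ENNReal.ofReal_pos.2 hp0).ne'
  -- Replace `Ω` by a Borel representative.
  obtain ⟨Ω₀, hΩ₀, hΩeq⟩ := hΩ_int.1.aemeasurable
  obtain ⟨C, hC, hbound⟩ := RoughVariation.exists_lintegral_shortVariation_le hn hα hΩ₀
    (hΩ_int.congr hΩeq) ((integral_congr_ae hΩeq).symm.trans hΩ_mean)
    (RoughVariation.grafakosStefanov_congr_ae hΩeq hΩ) hp_lower hp_upper
  refine ⟨(C ^ (1 / p)).toNNReal, fun f hf => ?_⟩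
  obtain ⟨f₀, hf₀, hfeq⟩ := hf.1.aemeasurable
  have hfin : ∫⁻ x, ‖f₀ x‖ₑ ^ p < ∞ := by
    have h := lintegral_rpow_enorm_lt_top_of_eLpNorm_lt_top hp0' ENNReal.ofReal_ne_top
      (hf.ae_eq hfeq).2
    rwa [ENNReal.toReal_ofReal hp0.le] at h
  have hgood := RoughVariation.ae_integrableOn_truncated hn hΩ₀ (hΩ_int.congr hΩeq) hp1 hf₀ hfin
  rw [RoughVariation.truncated_congr_ae hn hΩeq hfeq, eLpNorm_congr_ae hfeq]
  refine ⟨hgood.mono fun x hx ε hε => (hx ε hε).congr_fun_ae (ae_restrict_of_ae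
    (RoughVariation.ae_eq_roughKernel_mul hn hΩeq hfeq x).symm),
    RoughVariation.aemeasurable_shortVariation hΩ₀ hf₀ hgood, ?_⟩
  rw [eLpNorm_eq_lintegral_rpow_enorm_toReal hp0' ENNReal.ofReal_ne_top,
    eLpNorm_eq_lintegral_rpow_enorm_toReal hp0' ENNReal.ofReal_ne_top, ENNReal.toReal_ofReal hp0.le,
    ENNReal.coe_toNNReal (ENNReal.rpow_ne_top_of_nonneg (by positivity) hC),
    ← ENNReal.mul_rpow_of_nonneg _ _ (by positivity)]
  simp only [enorm_eq_self]
  exact ENNReal.rpow_le_rpow (hbound f₀ hf₀ hgood) (by positivity)
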